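/- Let $p$ be a prime and $1\le k\le n$. Let $S(n)=\mathbb Z/p\otimes_{K(n)_*}K(n)_*K(n)\otimes_{K(n)_*}\mathbb Z/p=\mathbb Z/p[t_1,t_2,\dots]/(t_s^{p^n}-t_s)$ ($v_n\mapsto 1$) be the Morava stabilizer algebra, with the Hopf algebra structure induced from $BP_*BP$ (Hazewinkel generators), and let $S(n,k)=S(n)/(t_s: s<k)=\mathbb Z/p[t_k,t_{k+1},\dots]/(t_s^{p^n}-t_s)$, with internal degrees $|t_s|=2(p^s-1)$ taken modulo $2(p^n-1)$. Put $M(t_s^{p^j})=2s-1$ for $k\le s\le n+k-1$ and $M(t_s^{p^j})=\max\{2s-1,\ pM(t_{s-n}^{p^{j+n-1}})+1\}$ for $s\ge n+k$. If $e_s$ has $p$-adic digits $e_{s,0},e_{s,1},\dots$, put $M(\prod_s t_s^{e_s})=\sum_{s,i}e_{s,i}M(t_s^{p^i})$. On the cobar complex of $S(n,k)$, with $\bar S$ the augmentation ideal, $C^s=\bar S^{\otimes s}$ and $$d[\alpha_1|\cdots|\alpha_s]=\sum_i(-1)^i[\alpha_1|\cdots|\Delta(\alpha_i)-\alpha_i\otimes1-1\otimes\alpha_i|\cdots|\alpha_s],$$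 put $M[\alpha_1|\cdots|\alpha_s]=\sum_i M(\alpha_i)$ for monomials $\alpha_i\neq 1$. Let $F^M$ be the span of these elements of filtration $\le M$. The May spectral sequence $E_r^{s,t,M}$, $d_r:E_r^{s,t,M}\to E_r^{s+1,t,M-r}$, is the spectral sequence of this filtered complex: $E_r^{s,t,M}=Z_r^{s,t,M}/(Z_{r-1}^{s,t,M-1}+dZ_{r-1}^{s-1,t,M+r-1})$ with $Z_r^{s,t,M}=\{x\in F^MC^{s,t}: dx\in F^{M-r}\}$. For $i\ge k$ and $j\in\mathbb Z/n$ let $h_{i,j}\in E_1^{1,\,2(p^i-1)p^j,\,M(t_i)}$ be the class of $[t_i^{p^j}]$ and $b_{i,j}\in E_1^{2,\,2(p^i-1)p^{j+1},\,pM(t_i)}$ the class of $\sum_{0<m<p}\frac1p\binom pm[t_i^{mp^j}|t_i^{(p-m)p^j}]$ (so $b_{i,j}=h_{i,j}^2$ if $p=2$). Let $$s_0=\max\left\{\left\lfloor\frac{2pn+p-2}{2(p-1)}\right\rfloor,\ n+k-1\right\}.$$ **Theorem.** 1. In the May $E_1$-term the first differentials are $$d_1(h_{i,j})=-\sum_{k\le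 r\le i-k}h_{r,j}h_{i-r,r+j}\quad(k\le i\le s_0),\qquad d_1(b_{i,j})=0\quad(k\le i\le s_0-n),$$ except that for $p=2$ and $i=2n$ there is an extra term: $$d_1(h_{2n,j})=-\sum_{k\le r\le 2n-k}h_{r,j}h_{2n-r,r+j}+h_{n,j+n-1}^2 .$$ 2. If $p$ is odd, let $\widetilde E_1=E[h_{i,j}\mid k\le i\le s_0,\ j\in\mathbb Z/n]\otimes P[b_{i,j}\mid k\le i\le s_0-n,\ j\in\mathbb Z/n]$. If $p=2$, then $s_0=2n$, and let $\widetilde E_1=E[h_{i,j}\mid n<i\le 2n,\ j\in\mathbb Z/n]\otimes P[h_{i,j}\mid k\le i\le n,\ j\in\mathbb Z/n]$. Here $E[\ ]$ and $P[\ ]$ denote exterior and polynomial algebras over $\mathbb Z/p$, and the generators have the tridegrees given above. Then there is a differential $d_1$ on $\widetilde E_1$ of tridegree $(1,0,-1)$, with $d_1(xy)=d_1(x)y+(-1)^{s}x\,d_1(y)$ for $x$ of cohomological degree $s$, whose values on the generators are given by the formulas in 1; and $$E_2^{s,t,M}\;\cong\;H^{s,t,M}(\widetilde E_1,d_1)\qquad\text{for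 all } s,t,M.$$ The isomorphism is induced by a surjective homomorphism $E_1\to\widetilde E_1$ of trigraded differential algebras which sends each of the classes $h_{i,j},b_{i,j}$ $(i\ge k)$ to the element of $\widetilde E_1$ of the same name. Here an element whose index is outside the range of the generators of $\widetilde E_1$ is read as $0$, and $b_{i,j}$ is read as $h_{i,j}^2$ in $\widetilde E_1$ if $p=2$. -/

import Mathlib

open scoped TensorProduct

noncomputable section

namespace MaySS

/-! ### The coproduct polynomials of `BP_*BP`, specialised to `v_n = 1`, `v_i = 0` for `i ≠ n` -/

/-- The variable `t_a ⊗ 1` (with `t_0 = 1`). -/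
def xVar (a : ℕ) : MvPolynomial (ℕ ⊕ ℕ) ℤ := if a = 0 then 1 else MvPolynomial.X (Sum.inl a)

/-- The variable `1 ⊗ t_a` (with `t_0 = 1`). -/
def yVar (a : ℕ) : MvPolynomial (ℕ ⊕ ℕ) ℤ := if a = 0 then 1 else MvPolynomial.X (Sum.inr a)

/-- Division of an integral polynomial by `p`, coefficient by coefficient.  It is only applied to
polynomials all of whose coefficients are divisible by `p`. -/
def divP (p : ℕ) (f : MvPolynomial (ℕ ⊕ ℕ) ℤ) : MvPolynomial (ℕ ⊕ ℕ) ℤ :=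
  ∑ m ∈ f.support, MvPolynomial.monomial m (f.coeff m / (p : ℤ))

/-- `∑_{a+b=s} t_a^{p^e} ⊗ t_b^{p^{a+e}}`. -/
def diagSum (p s e : ℕ) : MvPolynomial (ℕ ⊕ ℕ) ℤ :=
  ∑ a ∈ Finset.range (s + 1), xVar a ^ p ^ e * yVar (s - a) ^ p ^ (a + e)

/-- The integral polynomials `b_{s,m}`, defined inductively by
`p b_{s,m} = Δ(t_s)^{p^{m+1}} - ∑_{a+b=s} t_a^{p^{m+1}} ⊗ t_b^{p^{a+m+1}} + b_{s-n,m+n}`, where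
`Δ(t_s) = ∑_{a+b=s} t_a ⊗ t_b^{p^a} - b_{s-n,n-1}`; terms with `s < n` are zero. (`n ≥ 1`.) -/
def bPoly (p n : ℕ) (s m : ℕ) : MvPolynomial (ℕ ⊕ ℕ) ℤ :=
  divP p
    ((diagSum p s 0 - (if _h : 0 < n ∧ n ≤ s then bPoly p n (s - n) (n - 1) else 0)) ^ p ^ (m + 1)
      - diagSum p s (m + 1)
      + (if _h : 0 < n ∧ n ≤ s then bPoly p n (s - n) (m + n) else 0))
termination_by s
decreasing_by all_goals omega

/-- The coproduct polynomial `Δ(t_s) = ∑_{a+b=s} t_a ⊗ t_b^{p^a} - b_{s-n,n-1}`. -/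
def deltaPoly (p n s : ℕ) : MvPolynomial (ℕ ⊕ ℕ) ℤ :=
  diagSum p s 0 - (if 0 < n ∧ n ≤ s then bPoly p n (s - n) (n - 1) else 0)

/-! ### The Hopf algebra `S(n,k)` -/

/-- The relations `t_s^{p^n} = t_s`, `s ≥ k`. -/
def relIdeal (p n k : ℕ) : Ideal (MvPolynomial {s : ℕ // k ≤ s} (ZMod p)) :=
  Ideal.span (Set.range fun s => MvPolynomial.X s ^ p ^ n - MvPolynomial.X s)

/-- `S(n,k) = Z/p[t_k, t_{k+1}, …]/(t_s^{p^n} - t_s)`. -/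
def S (p n k : ℕ) : Type := MvPolynomial {s : ℕ // k ≤ s} (ZMod p) ⧸ relIdeal p n k

instance instCommRingS (p n k : ℕ) : CommRing (S p n k) :=
  inferInstanceAs (CommRing (MvPolynomial {s : ℕ // k ≤ s} (ZMod p) ⧸ relIdeal p n k))

instance instAlgebraS (p n k : ℕ) : Algebra (ZMod p) (S p n k) :=
  inferInstanceAs (Algebra (ZMod p) (MvPolynomial {s : ℕ // k ≤ s} (ZMod p) ⧸ relIdeal p n k))

/-- The quotient map from the polynomial algebra onto `S(n,k)`. -/
def toS (p n k : ℕ) : MvPolynomial {s : ℕ // k ≤ s} (ZMod p) →ₐ[ZMod p] S p n k :=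
  Ideal.Quotient.mkₐ (ZMod p) (relIdeal p n k)

/-- The element `t_s` of `S(n,k) = S(n)/(t_j : 0 < j < k)`, with `t_0 = 1`. -/
def t (p n k s : ℕ) : S p n k :=
  if s = 0 then 1 else if h : k ≤ s then toS p n k (MvPolynomial.X ⟨s, h⟩) else 0

/-- `S(n,k) ⊗ S(n,k)`. -/
abbrev SS (p n k : ℕ) : Type := S p n k ⊗[ZMod p] S p n k

/-- The value of the coproduct on `t_s`. -/
def deltaT (p n k s : ℕ) : SS p n k :=
  MvPolynomial.aeval
    (Sum.elim (fun a => t p n k a ⊗ₜ[ZMod p] (1 : S p n k))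
      (fun a => (1 : S p n k) ⊗ₜ[ZMod p] t p n k a))
    (deltaPoly p n s)

lemma add_pow_pp (p n : ℕ) [Fact p.Prime] {R : Type*} [CommRing R] [Algebra (ZMod p) R]
    (x y : R) : (x + y) ^ p ^ n = x ^ p ^ n + y ^ p ^ n := by
  have hp : (p : R) = 0 := by
    have h : algebraMap (ZMod p) R (p : ZMod p) = 0 := by simp
    simpa only [map_natCast] using h
  obtain ⟨r, hr⟩ := exists_add_pow_prime_pow_eq (Fact.out : p.Prime) x y n
  rw [hr, hp]; ring

lemma S_pow (p n k : ℕ) [Fact p.Prime] (z : S p n k) : z ^ p ^ n = z := by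
  obtain ⟨f, rfl⟩ := Ideal.Quotient.mkₐ_surjective (ZMod p) (relIdeal p n k) z
  change toS p n k f ^ p ^ n = toS p n k f
  induction f using MvPolynomial.induction_on with
  | C a => rw [← map_pow, ← map_pow, ZMod.pow_card_pow]
  | add f g hf hg => rw [map_add, add_pow_pp, hf, hg]
  | mul_X f s hf =>
    rw [map_mul, mul_pow, hf]
    congr 1
    rw [← map_pow]
    exact Ideal.Quotient.eq.2 (Ideal.subset_span ⟨s, rfl⟩)

lemma SS_pow (p n k : ℕ) [Fact p.Prime] (z : SS p n k) : z ^ p ^ n = z := by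
  induction z using TensorProduct.induction_on with
  | zero => exact zero_pow (pow_ne_zero _ (Fact.out : p.Prime).ne_zero)
  | tmul x y => rw [Algebra.TensorProduct.tmul_pow, S_pow, S_pow]
  | add x y hx hy => rw [add_pow_pp p n x y, hx, hy]

/-- An algebra map out of `S(n,k)` is given by values of the `t_s`, `s ≥ k`, that satisfy the
relations. -/
def liftS (p n k : ℕ) {R : Type} [CommRing R] [Algebra (ZMod p) R] (g : {s : ℕ // k ≤ s} → R)
    (hg : ∀ s, g s ^ p ^ n = g s) : S p n k →ₐ[ZMod p] R :=
  Ideal.Quotient.liftₐ (relIdeal p n k) (MvPolynomial.aeval g) (by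
    intro f hf
    have hle : relIdeal p n k ≤ RingHom.ker (MvPolynomial.aeval (R := ZMod p) g) := by
      refine Ideal.span_le.2 ?_
      rintro _ ⟨s, rfl⟩
      change MvPolynomial.aeval g _ = 0
      rw [map_sub, map_pow, MvPolynomial.aeval_X, hg, sub_self]
    exact hle hf)

/-- The coproduct `Δ : S(n,k) → S(n,k) ⊗ S(n,k)`. -/
def comul (p n k : ℕ) [Fact p.Prime] : S p n k →ₐ[ZMod p] SS p n k :=
  liftS p n k (fun s => deltaT p n k s) (fun _ => SS_pow p n k _)

/-- The augmentation `ε : S(n,k) → Z/p`, `ε(t_s) = 0`. -/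
def counit (p n k : ℕ) [Fact p.Prime] : S p n k →ₐ[ZMod p] ZMod p :=
  liftS p n k (fun _ => 0) (fun _ => zero_pow (pow_ne_zero _ (Fact.out : p.Prime).ne_zero))

/-- The augmentation ideal. -/
abbrev Sbar (p n k : ℕ) [Fact p.Prime] : Type := LinearMap.ker (counit p n k).toLinearMap

/-- The projection `x ↦ x - ε(x)` onto the augmentation ideal. -/
def pr (p n k : ℕ) [Fact p.Prime] : S p n k →ₗ[ZMod p] Sbar p n k where
  toFun x := ⟨x - algebraMap (ZMod p) (S p n k) (counit p n k x), by simp [LinearMap.mem_ker]⟩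
  map_add' x y := by
    apply Subtype.ext
    simp only [map_add, Submodule.coe_add]
    ring
  map_smul' c x := by
    apply Subtype.ext
    simp [Algebra.smul_def, mul_sub]

lemma pr_coe (p n k : ℕ) [Fact p.Prime] (x : Sbar p n k) : pr p n k x = x := by
  apply Subtype.ext
  have hx : counit p n k (x : S p n k) = 0 := x.2
  simp [pr, hx]

/-! ### The cobar complex -/

/-- The cobar construction `⨁_s Sbar^{⊗ s}`; the bar `|` is the product. -/
abbrev Cobar (p n k : ℕ) [Fact p.Prime] : Type := TensorAlgebra (ZMod p) (Sbar p n k)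

/-- The element `[x]`, for `x` in the augmentation ideal (`[x - ε(x)]` in general). -/
def br (p n k : ℕ) [Fact p.Prime] : S p n k →ₗ[ZMod p] Cobar p n k :=
  TensorAlgebra.ι (ZMod p) ∘ₗ pr p n k

/-- `[α] ↦ [Δ(α) - α ⊗ 1 - 1 ⊗ α]`, the reduced coproduct being the projection of `Δ(α)` to the
tensor square of the augmentation ideal. -/
def redComul (p n k : ℕ) [Fact p.Prime] : Sbar p n k →ₗ[ZMod p] Cobar p n k :=
  (LinearMap.mul' (ZMod p) (Cobar p n k) ∘ₗ TensorProduct.map (br p n k) (br p n k)) ∘ₗ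
    (comul p n k).toLinearMap ∘ₗ Submodule.subtype _

/-- The algebra map `x ↦ (±x, d x; 0, x)` that encodes the cobar differential. -/
def cobarHom (p n k : ℕ) [Fact p.Prime] :
    Cobar p n k →ₐ[ZMod p] Matrix (Fin 2) (Fin 2) (Cobar p n k) :=
  TensorAlgebra.lift (ZMod p)
    { toFun := fun a => !![-TensorAlgebra.ι (ZMod p) a, -redComul p n k a;
                           0, TensorAlgebra.ι (ZMod p) a]
      map_add' := by
        intro a b
        ext i j
        fin_cases i <;> fin_cases j <;> simp [add_comm]
      map_smul' := by
        intro c a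
        ext i j
        fin_cases i <;> fin_cases j <;> simp }

/-- The cobar differential:
`d[α_1|…|α_s] = ∑_i (-1)^i [α_1|…|Δ(α_i) - α_i ⊗ 1 - 1 ⊗ α_i|…|α_s]`
(see `cobarD_one`, `cobarD_ι`, `cobarD_ι_mul`). -/
def cobarD (p n k : ℕ) [Fact p.Prime] : Cobar p n k →ₗ[ZMod p] Cobar p n k where
  toFun x := cobarHom p n k x 0 1
  map_add' x y := by simp
  map_smul' c x := by simp

lemma cobarD_one (p n k : ℕ) [Fact p.Prime] : cobarD p n k 1 = 0 := by
  simp [cobarD]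

lemma cobarD_ι (p n k : ℕ) [Fact p.Prime] (a : Sbar p n k) :
    cobarD p n k (TensorAlgebra.ι (ZMod p) a) = -redComul p n k a := by
  simp [cobarD, cobarHom]

lemma cobarHom_one_one (p n k : ℕ) [Fact p.Prime] (x : Cobar p n k) :
    cobarHom p n k x 1 0 = 0 ∧ cobarHom p n k x 1 1 = x := by
  induction x using TensorAlgebra.induction with
  | algebraMap r => simp [Matrix.algebraMap_matrix_apply]
  | ι a => simp [cobarHom]
  | mul a b ha hb => simp [Matrix.mul_apply, Fin.sum_univ_two, ha, hb]
  | add a b ha hb => simp [ha, hb]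

lemma cobarD_ι_mul (p n k : ℕ) [Fact p.Prime] (a : Sbar p n k) (x : Cobar p n k) :
    cobarD p n k (TensorAlgebra.ι (ZMod p) a * x) =
      -redComul p n k a * x - TensorAlgebra.ι (ZMod p) a * cobarD p n k x := by
  have h : cobarHom p n k (TensorAlgebra.ι (ZMod p) a) =
      !![-TensorAlgebra.ι (ZMod p) a, -redComul p n k a; 0, TensorAlgebra.ι (ZMod p) a] := by
    simp [cobarHom]
  change cobarHom p n k _ 0 1 = _ - _ * cobarHom p n k x 0 1
  rw [map_mul, h, Matrix.mul_apply, Fin.sum_univ_two, (cobarHom_one_one p n k x).2]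
  simp [sub_eq_add_neg, add_comm]

/-! ### The May filtration -/

/-- `M(t_s^{p^j})` (it does not depend on `j`), for `s ≥ k`: it is `2s-1` for `s ≤ n+k-1` and
`max {2s-1, p M(t_{s-n}) + 1}` for `s ≥ n+k`. (`n ≥ 1`.) -/
def mayM (p n k : ℕ) (s : ℕ) : ℕ :=
  if _h : 0 < n ∧ n + k ≤ s then max (2 * s - 1) (p * mayM p n k (s - n) + 1) else 2 * s - 1
termination_by s
decreasing_by omega

/-- Internal degrees live in `Z/2(p^n-1)`, because `v_n` is sent to `1`. -/
abbrev Deg (p n : ℕ) : Type := ZMod (2 * (p ^ n - 1))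

/-- Exponents of the monomials in `t_k, t_{k+1}, …`. -/
abbrev Expo (k : ℕ) : Type := {s : ℕ // k ≤ s} →₀ ℕ

/-- The May filtration of the monomial `∏ t_s^{e_s}`: the sum over `s` of
`(∑ of the p-adic digits of e_s) * M(t_s)`. -/
def monoM (p n k : ℕ) (e : Expo k) : ℕ :=
  e.sum fun s c => (Nat.digits p c).sum * mayM p n k s

/-- The internal degree of the monomial `∏ t_s^{e_s}`, where `|t_s| = 2(p^s-1)`. -/
def monoDeg (p n k : ℕ) (e : Expo k) : Deg p n :=
  e.sum fun s c => ((c * (2 * (p ^ (s : ℕ) - 1)) : ℕ) : Deg p n)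

/-- `[∏ t_s^{e_s}]` in the cobar complex. -/
def brMono (p n k : ℕ) [Fact p.Prime] (e : Expo k) : Cobar p n k :=
  br p n k (toS p n k (MvPolynomial.monomial e 1))

/-- The part of May filtration `≤ M` of the cobar complex in cohomological degree `s` and internal
degree `u`: spanned by the `[α_1|…|α_s]`, `α_i ≠ 1` monomials, with `∑ M(α_i) ≤ M`. -/
def FC (p n k : ℕ) [Fact p.Prime] (s : ℤ) (u : Deg p n) (M : ℤ) :
    Submodule (ZMod p) (Cobar p n k) :=
  Submodule.span (ZMod p) {x | ∃ L : List (Expo k), (∀ e ∈ L, e ≠ 0) ∧ (L.length : ℤ) = s ∧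
    (L.map (monoDeg p n k)).sum = u ∧ (((L.map (monoM p n k)).sum : ℕ) : ℤ) ≤ M ∧
    x = (L.map (brMono p n k)).prod}

/-! ### The May spectral sequence: the spectral sequence of the filtered cobar complex -/

/-- `Z_r^{s,u,M} = {x ∈ F^M C^{s,u} | d x ∈ F^{M-r} C^{s+1,u}}`. -/
def Z (p n k : ℕ) [Fact p.Prime] (r s : ℤ) (u : Deg p n) (M : ℤ) :
    Submodule (ZMod p) (Cobar p n k) :=
  FC p n k s u M ⊓ (FC p n k (s + 1) u (M - r)).comap (cobarD p n k)

/-- `B_r^{s,u,M} = Z_{r-1}^{s,u,M-1} + d Z_{r-1}^{s-1,u,M+r-1}`. -/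
def B (p n k : ℕ) [Fact p.Prime] (r s : ℤ) (u : Deg p n) (M : ℤ) :
    Submodule (ZMod p) (Cobar p n k) :=
  Z p n k (r - 1) s u (M - 1) ⊔ (Z p n k (r - 1) (s - 1) u (M + r - 1)).map (cobarD p n k)

/-- The May `E_r`-term `E_r^{s,u,M} = Z_r^{s,u,M} / B_r^{s,u,M}`. -/
abbrev E (p n k : ℕ) [Fact p.Prime] (r s : ℤ) (u : Deg p n) (M : ℤ) : Type :=
  ↥(Z p n k r s u M) ⧸ (B p n k r s u M).comap (Z p n k r s u M).subtype

/-- The class in `E_r^{s,u,M}` of an element of `Z_r^{s,u,M}`. -/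
def cls (p n k : ℕ) [Fact p.Prime] (r s : ℤ) (u : Deg p n) (M : ℤ) :
    ↥(Z p n k r s u M) →ₗ[ZMod p] E p n k r s u M :=
  Submodule.mkQ _

/-- The graph of the May differential `d_r : E_r^{s,u,M} → E_r^{s+1,u,M-r}`, which sends the class
of `x` to the class of `d x`. -/
def IsMayDiff (p n k : ℕ) [Fact p.Prime] (r s : ℤ) (u : Deg p n) (M : ℤ)
    (ξ : E p n k r s u M) (η : E p n k r (s + 1) u (M - r)) : Prop :=
  ∃ (x : Cobar p n k) (hx : x ∈ Z p n k r s u M)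
    (hdx : cobarD p n k x ∈ Z p n k r (s + 1) u (M - r)),
    cls p n k r s u M ⟨x, hx⟩ = ξ ∧ cls p n k r (s + 1) u (M - r) ⟨cobarD p n k x, hdx⟩ = η

/-- The cobar representative `[t_i^{p^j}]` of `h_{i,j}`. -/
def hCob (p n k : ℕ) [Fact p.Prime] (i : ℕ) (j : ZMod n) : Cobar p n k :=
  br p n k (t p n k i ^ p ^ j.val)

/-- The cobar representative `∑_{0<m<p} (1/p) binom(p,m) [t_i^{m p^j} | t_i^{(p-m) p^j}]` of
`b_{i,j}`. -/
def bCob (p n k : ℕ) [Fact p.Prime] (i : ℕ) (j : ZMod n) : Cobar p n k :=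
  ∑ m ∈ Finset.Ioo 0 p, ((p.choose m / p : ℕ) : ZMod p) •
    (br p n k (t p n k i ^ (m * p ^ j.val)) * br p n k (t p n k i ^ ((p - m) * p ^ j.val)))

/-- The internal degree of `h_{i,j}`. -/
def hDeg (p n : ℕ) (i : ℕ) (j : ZMod n) : Deg p n := ((2 * (p ^ i - 1) * p ^ j.val : ℕ) : Deg p n)

/-- The internal degree of `b_{i,j}`. -/
def bDeg (p n : ℕ) (i : ℕ) (j : ZMod n) : Deg p n :=
  ((2 * (p ^ i - 1) * p ^ (j.val + 1) : ℕ) : Deg p n)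

/-! ### The reduced complex -/

/-- `s_0 = max {[(2pn+p-2)/(2(p-1))], n+k-1}`. -/
def s0 (p n k : ℕ) : ℕ := max ((2 * p * n + p - 2) / (2 * (p - 1))) (n + k - 1)

/-- The index set `{(i,j) | a ≤ i ≤ b, j ∈ Z/n}`. -/
abbrev Idx (n a b : ℕ) : Type := {i : ℕ // a ≤ i ∧ i ≤ b} × ZMod n

/-- `E[x_{i,j} | a ≤ i ≤ b, j ∈ Z/n] ⊗ P[y_{i,j} | a' ≤ i ≤ b', j ∈ Z/n]` over `Z/p`. -/
abbrev EP (p n a b a' b' : ℕ) : Type :=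
  ExteriorAlgebra (ZMod p) (Idx n a b →₀ ZMod p) ⊗[ZMod p] MvPolynomial (Idx n a' b') (ZMod p)

/-- The exterior generator `x_{i,j}` (zero when `i` is out of range). -/
def extGen (p n a b a' b' : ℕ) (i : ℕ) (j : ZMod n) : EP p n a b a' b' :=
  if hi : a ≤ i ∧ i ≤ b then
    ExteriorAlgebra.ι (ZMod p) (Finsupp.single (⟨i, hi⟩, j) (1 : ZMod p)) ⊗ₜ[ZMod p] 1
  else 0

/-- The polynomial generator `y_{i,j}` (zero when `i` is out of range). -/
def polyGen (p n a b a' b' : ℕ) (i : ℕ) (j : ZMod n) : EP p n a b a' b' :=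
  if hi : a' ≤ i ∧ i ≤ b' then 1 ⊗ₜ[ZMod p] MvPolynomial.X (⟨i, hi⟩, j) else 0

/-- The reduced `E_1`-term at odd primes:
`E[h_{i,j} | k ≤ i ≤ s_0] ⊗ P[b_{i,j} | k ≤ i ≤ s_0 - n]`. -/
abbrev RedOdd (p n k : ℕ) : Type := EP p n k (s0 p n k) k (s0 p n k - n)

/-- `h_{i,j}` in the reduced `E_1`-term at odd primes. -/
def hOdd (p n k : ℕ) (i : ℕ) (j : ZMod n) : RedOdd p n k := extGen _ _ _ _ _ _ i j

/-- `b_{i,j}` in the reduced `E_1`-term at odd primes. -/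
def bOdd (p n k : ℕ) (i : ℕ) (j : ZMod n) : RedOdd p n k := polyGen _ _ _ _ _ _ i j

/-- The reduced `E_1`-term at the prime 2:
`E[h_{i,j} | n < i ≤ 2n] ⊗ P[h_{i,j} | k ≤ i ≤ n]`. -/
abbrev RedTwo (n k : ℕ) : Type := EP 2 n (n + 1) (2 * n) k n

/-- `h_{i,j}` in the reduced `E_1`-term at the prime 2. -/
def hTwo (n k : ℕ) (i : ℕ) (j : ZMod n) : RedTwo n k :=
  if i ≤ n then polyGen _ _ _ _ _ _ i j else extGen _ _ _ _ _ _ i j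

/-- `b_{i,j} = h_{i,j}^2` in the reduced `E_1`-term at the prime 2. -/
def bTwo (n k : ℕ) (i : ℕ) (j : ZMod n) : RedTwo n k := hTwo n k i j ^ 2

/-- The value of `d_1(h_{i,j})`: it is `-∑_{k ≤ r ≤ i-k} h_{r,j} h_{i-r,r+j}`, with the extra
summand `h_{n,j+n-1}^2` when `p = 2` and `i = 2n`. -/
def d1h (p n k : ℕ) {A : Type} [Ring A] (h : ℕ → ZMod n → A) (i : ℕ) (j : ZMod n) : A :=
  -(∑ r ∈ Finset.Icc k (i - k), h r j * h (i - r) ((r : ZMod n) + j)) +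
    (if p = 2 ∧ i = 2 * n then h n (j + ((n - 1 : ℕ) : ZMod n)) ^ 2 else 0)

section Reduced

variable (p n k : ℕ) {A : Type} [Ring A] [Algebra (ZMod p) A] (h b : ℕ → ZMod n → A)

/-- The tridegree (cohomological degree, internal degree, May filtration) of a generator:
`inl (i,j)` stands for `h_{i,j}` and `inr (i,j)` for `b_{i,j}`. -/
def genDeg : (ℕ × ZMod n) ⊕ (ℕ × ZMod n) → ℤ × Deg p n × ℤ
  | Sum.inl (i, j) => (1, hDeg p n i j, (mayM p n k i : ℤ))
  | Sum.inr (i, j) => (2, bDeg p n i j, (p : ℤ) * (mayM p n k i : ℤ))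

/-- The homogeneous part of tridegree `(s,u,M)`: spanned by the products of generators of total
tridegree `(s,u,M)`. -/
def homog (s : ℤ) (u : Deg p n) (M : ℤ) : Submodule (ZMod p) A :=
  Submodule.span (ZMod p) {x | ∃ L : List ((ℕ × ZMod n) ⊕ (ℕ × ZMod n)),
    (L.map (genDeg p n k)).sum = (s, u, M) ∧
    x = (L.map (Sum.elim (fun q => h q.1 q.2) (fun q => b q.1 q.2))).prod}

/-- `d` is the first May differential of the reduced complex: a differential of tridegree
`(1,0,-1)` that satisfies the Leibniz rule and has the prescribed values on the generators. -/
structure IsReducedD (d : A →ₗ[ZMod p] A) : Prop where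
  degree : ∀ s u M, ∀ x ∈ homog p n k h b s u M, d x ∈ homog p n k h b (s + 1) u (M - 1)
  leibniz : ∀ s u M, ∀ x ∈ homog p n k h b s u M, ∀ y : A,
    d (x * y) = d x * y + Int.negOnePow s • (x * d y)
  on_h : ∀ i, k ≤ i → i ≤ s0 p n k → ∀ j, d (h i j) = d1h p n k h i j
  on_b : ∀ i, k ≤ i → i ≤ s0 p n k - n → ∀ j, d (b i j) = 0
  sq : ∀ x, d (d x) = 0

/-- Cocycles of tridegree `(s,u,M)` of the reduced complex. -/
def redCocycles (d : A →ₗ[ZMod p] A) (s : ℤ) (u : Deg p n) (M : ℤ) : Submodule (ZMod p) A :=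
  homog p n k h b s u M ⊓ LinearMap.ker d

/-- The cohomology of the reduced complex in tridegree `(s,u,M)`. -/
abbrev redH (d : A →ₗ[ZMod p] A) (s : ℤ) (u : Deg p n) (M : ℤ) : Type :=
  ↥(redCocycles p n k h b d s u M) ⧸
    ((homog p n k h b (s - 1) u (M + 1)).map d).comap (redCocycles p n k h b d s u M).subtype

variable [Fact p.Prime]

/-- `π : E_1 → A` is a surjection of trigraded differential algebras which sends `h_{i,j}` to
`h_{i,j}` and `b_{i,j}` to `b_{i,j}` (to zero, when the target has no such generator). -/
structure IsReduction (d : A →ₗ[ZMod p] A)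
    (π : ∀ (s : ℤ) (u : Deg p n) (M : ℤ), E p n k 1 s u M →ₗ[ZMod p] A) : Prop where
  range : ∀ s u M, LinearMap.range (π s u M) = homog p n k h b s u M
  map_one : ∃ h1 : (1 : Cobar p n k) ∈ Z p n k 1 0 0 0, π 0 0 0 (cls p n k 1 0 0 0 ⟨1, h1⟩) = 1
  map_mul : ∀ s u M s' u' M' (x : Z p n k 1 s u M) (y : Z p n k 1 s' u' M'),
    ∃ hxy : (x : Cobar p n k) * (y : Cobar p n k) ∈ Z p n k 1 (s + s') (u + u') (M + M'),
      π (s + s') (u + u') (M + M') (cls p n k 1 _ _ _ ⟨_, hxy⟩) =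
        π s u M (cls p n k 1 s u M x) * π s' u' M' (cls p n k 1 s' u' M' y)
  map_h : ∀ i, k ≤ i → ∀ j, ∃ hx : hCob p n k i j ∈ Z p n k 1 1 (hDeg p n i j) (mayM p n k i : ℤ),
    π 1 (hDeg p n i j) (mayM p n k i : ℤ) (cls p n k 1 _ _ _ ⟨_, hx⟩) = h i j
  map_b : ∀ i, k ≤ i → ∀ j,
    ∃ hx : bCob p n k i j ∈ Z p n k 1 2 (bDeg p n i j) ((p : ℤ) * (mayM p n k i : ℤ)),
      π 2 (bDeg p n i j) ((p : ℤ) * (mayM p n k i : ℤ)) (cls p n k 1 _ _ _ ⟨_, hx⟩) = b i j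
  map_d : ∀ s u M, ∀ ξ : E p n k 1 s u M, ∃ η : E p n k 1 (s + 1) u (M - 1),
    IsMayDiff p n k 1 s u M ξ η ∧ π (s + 1) u (M - 1) η = d (π s u M ξ)

/-- The May `E_2`-term is isomorphic to the cohomology of the complex `A` with generators `h`, `b`
and with the first May differential, by the map induced by a reduction `E_1 → A`. -/
def ComputesE2 : Prop :=
  ∃ d : A →ₗ[ZMod p] A, IsReducedD p n k h b d ∧
    ∃ π : ∀ (s : ℤ) (u : Deg p n) (M : ℤ), E p n k 1 s u M →ₗ[ZMod p] A,
      IsReduction p n k h b d π ∧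
      ∃ Φ : ∀ (s : ℤ) (u : Deg p n) (M : ℤ),
          E p n k 2 s u M ≃ₗ[ZMod p] redH p n k h b d s u M,
        ∀ s u M (x : Cobar p n k) (hx : x ∈ Z p n k 2 s u M),
          ∃ (hx' : x ∈ Z p n k 1 s u M)
            (hc : π s u M (cls p n k 1 s u M ⟨x, hx'⟩) ∈ redCocycles p n k h b d s u M),
            Φ s u M (cls p n k 2 s u M ⟨x, hx⟩) = Submodule.Quotient.mk ⟨_, hc⟩

end Reduced

/-- `d_1[x] = [y]` in the May `E_1`-term, for `x` in tridegree `(s,u,M)`. -/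
def D1Eq (p n k : ℕ) [Fact p.Prime] (s : ℤ) (u : Deg p n) (M : ℤ) (x y : Cobar p n k) : Prop :=
  ∃ (hx : x ∈ Z p n k 1 s u M) (hy : y ∈ Z p n k 1 (s + 1) u (M - 1)),
    IsMayDiff p n k 1 s u M (cls p n k 1 s u M ⟨x, hx⟩) (cls p n k 1 (s + 1) u (M - 1) ⟨y, hy⟩)

end MaySS

end

/-!
The basis `∏ t_{i,j}^{q_{i,j}} / ∏ q_{i,j}!`, `0 ≤ q_{i,j} < p`, of `S(n,k)`, where
`t_{i,j} = t_i^{p^j}`, makes the cobar complex the free algebra on the nonzero exponents `q`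
(`theta`). The coproduct of `S(n,k)` is coassociative since its polynomials are so modulo `p`, which
is checked on ghost components over the Witt vectors (`dl_coassoc`), and the integral polynomials
`b_{s,m}` have filtration `p M(t_s)` (`kill_bPoly_mem`). Hence the differential preserves the May
filtration; its leading part `d0` is the cobar differential of the truncated divided power coalgebra
on the primitive elements `t_{i,j}`, and its next part `d1`, which lowers the filtration by one, is
known on the elements `[t_{i,j}]` (`delc_one_single`): there the products `h_r h_{i-r}` come from the
diagonal part of the coproduct and the class `b_{i-n}` comes from the polynomials `b_{s,m}`.

The cohomology of `d0` is `E[h_{i,j}] ⊗ P[b_{i,j}]`, the Fock space `Fk`. No minimal resolution is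
chosen for this. Instead the cobar construction acts on the Fock space, `t_{i,j}` by multiplication
by `h_{i,j}` and `t_{i,j}^{p-1}` by `b_{i,j}` times the contraction with `h_{i,j}`; the action on
`1` kills coboundaries, it is onto because of the cocycles `[t_{i,j}]` and `b_{i,j}`, and its kernel
on cocycles consists of coboundaries (`d0_exact`) because the Koszul complex with coefficients in
the Fock space is contractible one generator at a time (`kD_exact`). This treats all primes alike:
for `p = 2` the two operators belong to the same `t_{i,j}`, their sum up to sign has the square
`b_{i,j}`, and `h_{i,j}^2 = b_{i,j}` comes out by itself.

Any algebra on which the cobar construction acts receives a map `piA` from this cohomology, and the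
reduced complexes are such algebras (`Target`, with the instances `oddTarget` and `twoTarget`). For
`i > s_0` the recursion of `M` gives `M(t_i) = p M(t_{i-n}) + 1`, so that `d_1(h_{i,j})` contains
`b_{i-n,j+n-1}` with coefficient one; this is its only term of highest weight for the weight `2i - 1`
of `h_i` and `b_{i-n}`. Each of the generators `h_{i,j}` and `b_{i-n,j+n-1}` with `i > s_0` occurs in
exactly one of these pairs, and contracting the pairs shows that the kernel of the reduction is
acyclic for `d_1` (`Target.acyclic`). For `i ≤ s_0` no such term is present, except if `p = 2` and
`i = 2n` (`extra_iff`), which is the extra term of the formula. A chase along the filtration, with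
the exactness of `d0` and the acyclicity of the kernel, identifies `E_2` with the cohomology of the
reduced complex (`Target.computesE2`).
-/

set_option linter.unusedSectionVars false

noncomputable section

namespace MaySS

/-! ### Fock spaces: an exterior algebra tensored with a polynomial algebra -/

section

section Fock

variable (R : Type) [CommRing R] (X Y : Type)

/-- The algebra `E[h_x | x ∈ X] ⊗ P[b_y | y ∈ Y]`.  It is a definition of its own, so that all its
algebraic structure is found through one ring structure. -/
def Fock : Type := ExteriorAlgebra R (X →₀ R) ⊗[R] MvPolynomial Y R

instance : Ring (Fock R X Y) :=
  inferInstanceAs (Ring (ExteriorAlgebra R (X →₀ R) ⊗[R] MvPolynomial Y R))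

instance : Algebra R (Fock R X Y) :=
  inferInstanceAs (Algebra R (ExteriorAlgebra R (X →₀ R) ⊗[R] MvPolynomial Y R))

variable {X Y}

variable {R} in
/-- The element `u ⊗ v`. -/
def tm (u : ExteriorAlgebra R (X →₀ R)) (v : MvPolynomial Y R) : Fock R X Y := u ⊗ₜ v

variable {R} in
/-- The exterior generator, as an element of the exterior algebra. -/
abbrev ex (x : X) : ExteriorAlgebra R (X →₀ R) := ExteriorAlgebra.ι R (Finsupp.single x 1)

/-- The exterior generator `h_x`. -/
def hgen (x : X) : Fock R X Y := tm (ex x) 1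

/-- The polynomial generator `b_y`. -/
def bgen (y : Y) : Fock R X Y := tm 1 (MvPolynomial.X y)

/-- The operator `f ⊗ g`. -/
def tmap (f : Module.End R (ExteriorAlgebra R (X →₀ R))) (g : Module.End R (MvPolynomial Y R)) :
    Module.End R (Fock R X Y) := (TensorProduct.map f g : _ ⊗[R] _ →ₗ[R] _ ⊗[R] _)

/-- Multiplication by `h_x`. -/
def hop (x : X) : Module.End R (Fock R X Y) := tmap R (LinearMap.mulLeft R (ex x)) 1

/-- Contraction with the dual of `h_x`. -/
def dop (x : X) : Module.End R (Fock R X Y) :=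
  tmap R (CliffordAlgebra.contractLeft (Q := (0 : QuadraticForm R (X →₀ R))) (Finsupp.lapply x)) 1

/-- Multiplication by `b_y`. -/
def bop (y : Y) : Module.End R (Fock R X Y) := tmap R 1 (LinearMap.mulLeft R (MvPolynomial.X y))

open Classical in
/-- Division of a polynomial by the variable `y`; monomials without `y` are sent to zero. -/
def divX (y : Y) : MvPolynomial Y R →ₗ[R] MvPolynomial Y R :=
  (MvPolynomial.basisMonomials Y R).constr R
    fun c => if c y = 0 then 0 else MvPolynomial.monomial (c - Finsupp.single y 1) 1

/-- Division by `b_y`; monomials without `b_y` are sent to zero. -/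
def binv (y : Y) : Module.End R (Fock R X Y) := tmap R 1 (divX R y)

/-- The product of the exterior generators in the list `L` and the polynomial generators with
multiplicities `c`. -/
def mon (L : List X) (c : Y →₀ ℕ) : Fock R X Y :=
  tm (L.map ex).prod (MvPolynomial.monomial c 1)

variable {R}

lemma tm_add (u : ExteriorAlgebra R (X →₀ R)) (v w : MvPolynomial Y R) :
    tm u (v + w) = tm u v + tm u w := TensorProduct.tmul_add _ _ _

lemma add_tm (u u' : ExteriorAlgebra R (X →₀ R)) (v : MvPolynomial Y R) :
    tm (u + u') v = tm u v + tm u' v := TensorProduct.add_tmul _ _ _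

lemma neg_tm (u : ExteriorAlgebra R (X →₀ R)) (v : MvPolynomial Y R) :
    tm (-u) v = -tm u v := TensorProduct.neg_tmul _ _

lemma zero_tm (v : MvPolynomial Y R) : tm (0 : ExteriorAlgebra R (X →₀ R)) v = 0 :=
  TensorProduct.zero_tmul _ _

lemma tm_zero (u : ExteriorAlgebra R (X →₀ R)) : tm u (0 : MvPolynomial Y R) = 0 :=
  TensorProduct.tmul_zero _ _

lemma smul_tm (r : R) (u : ExteriorAlgebra R (X →₀ R)) (v : MvPolynomial Y R) :
    tm (r • u) v = r • tm u v := (TensorProduct.smul_tmul' _ _ _).symm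

lemma tm_smul (r : R) (u : ExteriorAlgebra R (X →₀ R)) (v : MvPolynomial Y R) :
    tm u (r • v) = r • tm u v := TensorProduct.tmul_smul _ _ _

lemma tm_mul_tm (u u' : ExteriorAlgebra R (X →₀ R)) (v v' : MvPolynomial Y R) :
    tm u v * tm u' v' = tm (u * u') (v * v') := Algebra.TensorProduct.tmul_mul_tmul _ _ _ _

lemma one_eq_tm : (1 : Fock R X Y) = tm 1 1 := rfl

lemma tmap_tm (f : Module.End R (ExteriorAlgebra R (X →₀ R))) (g : Module.End R (MvPolynomial Y R))
    (u : ExteriorAlgebra R (X →₀ R)) (v : MvPolynomial Y R) :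
    tmap R f g (tm u v) = tm (f u) (g v) := TensorProduct.map_tmul _ _ _ _

lemma fock_induction {P : Fock R X Y → Prop} (h0 : P 0) (ht : ∀ u v, P (tm u v))
    (ha : ∀ a b, P a → P b → P (a + b)) (a : Fock R X Y) : P a :=
  TensorProduct.induction_on (motive := P) a h0 ht ha

lemma end_ext {f g : Module.End R (Fock R X Y)} (h : ∀ u v, f (tm u v) = g (tm u v)) : f = g := by
  refine LinearMap.ext fun a => ?_
  induction a using fock_induction with
  | h0 => rw [map_zero, map_zero]
  | ht u v => exact h u v
  | ha a b ha hb => rw [map_add, map_add, ha, hb]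

lemma tmap_commute_left (f : Module.End R (ExteriorAlgebra R (X →₀ R)))
    (g : Module.End R (MvPolynomial Y R)) : Commute (tmap R f 1) (tmap R 1 g) :=
  end_ext fun u v => by simp [tmap_tm]

lemma tmap_one_commute {f g : Module.End R (MvPolynomial Y R)} (h : f ∘ₗ g = g ∘ₗ f) :
    Commute (tmap R (X := X) 1 f) (tmap R 1 g) :=
  end_ext fun u v => by
    have := LinearMap.congr_fun h v
    simp only [LinearMap.comp_apply] at this
    simp [tmap_tm, this]

lemma divX_monomial (y : Y) (c : Y →₀ ℕ) :
    divX R y (MvPolynomial.monomial c 1) =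
      if c y = 0 then 0 else MvPolynomial.monomial (c - Finsupp.single y 1) 1 := by
  classical
  have := (MvPolynomial.basisMonomials Y R).constr_basis R
    (fun c => if c y = 0 then 0 else MvPolynomial.monomial (c - Finsupp.single y 1) (1 : R)) c
  rw [MvPolynomial.coe_basisMonomials] at this
  rw [divX]
  convert this

lemma poly_hom_ext {N : Type*} [AddCommMonoid N] [Module R N] {f g : MvPolynomial Y R →ₗ[R] N}
    (h : ∀ c, f (MvPolynomial.monomial c 1) = g (MvPolynomial.monomial c 1)) : f = g := by
  refine (MvPolynomial.basisMonomials Y R).ext fun c => ?_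
  simpa using h c

lemma X_mul_monomial (y : Y) (c : Y →₀ ℕ) :
    (MvPolynomial.X y : MvPolynomial Y R) * MvPolynomial.monomial c 1 =
      MvPolynomial.monomial (c + Finsupp.single y 1) 1 := by
  rw [MvPolynomial.X, MvPolynomial.monomial_mul, one_mul, add_comm]

lemma divX_X (y : Y) : divX R y ∘ₗ LinearMap.mulLeft R (MvPolynomial.X y) = LinearMap.id := by
  refine poly_hom_ext fun c => ?_
  simp [X_mul_monomial, divX_monomial]

lemma divX_X_of_ne {y z : Y} (h : y ≠ z) :
    divX R y ∘ₗ LinearMap.mulLeft R (MvPolynomial.X z) =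
      LinearMap.mulLeft R (MvPolynomial.X z) ∘ₗ divX R y := by
  classical
  refine poly_hom_ext fun c => ?_
  simp only [LinearMap.comp_apply, LinearMap.mulLeft_apply, X_mul_monomial, divX_monomial,
    Finsupp.add_apply, Finsupp.single_apply, if_neg h.symm, add_zero]
  split_ifs with h0
  · simp only [mul_zero]
  · rw [X_mul_monomial]
    refine congrArg (fun m => MvPolynomial.monomial m (1 : R)) ?_
    ext w
    simp only [Finsupp.coe_tsub, Finsupp.coe_add, Pi.sub_apply, Pi.add_apply, Finsupp.single_apply]
    by_cases hy : y = w
    · subst hy; simp [h.symm]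
    · simp [hy]

lemma hop_hop_self (x : X) : hop R (Y := Y) x * hop R x = 0 :=
  end_ext fun u v => by
    simp only [hop, Module.End.mul_apply, tmap_tm, LinearMap.mulLeft_apply]
    rw [← mul_assoc, ExteriorAlgebra.ι_sq_zero, zero_mul, zero_tm]; rfl

lemma hop_hop (x x' : X) : hop R (Y := Y) x * hop R x' = -(hop R x' * hop R x) :=
  end_ext fun u v => by
    simp only [hop, Module.End.mul_apply, tmap_tm, LinearMap.mulLeft_apply, LinearMap.neg_apply]
    rw [← neg_tm, ← mul_assoc, ← mul_assoc, ← neg_mul,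
      eq_neg_of_add_eq_zero_left (ExteriorAlgebra.ι_add_mul_swap (R := R) _ _)]

lemma dop_dop_self (x : X) : dop R (Y := Y) x * dop R x = 0 :=
  end_ext fun u v => by
    simp only [dop, Module.End.mul_apply, tmap_tm]
    rw [CliffordAlgebra.contractLeft_contractLeft, zero_tm]; rfl

lemma dop_dop (x x' : X) : dop R (Y := Y) x * dop R x' = -(dop R x' * dop R x) :=
  end_ext fun u v => by
    simp only [dop, Module.End.mul_apply, tmap_tm, LinearMap.neg_apply]
    rw [CliffordAlgebra.contractLeft_comm, neg_tm]

lemma dop_hop [DecidableEq X] (x x' : X) : dop R (Y := Y) x * hop R x' + hop R x' * dop R x =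
    if x = x' then 1 else 0 :=
  end_ext fun u v => by
    have := CliffordAlgebra.contractLeft_ι_mul (Q := (0 : QuadraticForm R (X →₀ R)))
      (Finsupp.lapply x) (Finsupp.single x' 1) u
    simp only [dop, hop, LinearMap.add_apply, Module.End.mul_apply, tmap_tm,
      LinearMap.mulLeft_apply]
    rw [show (ex x' : ExteriorAlgebra R (X →₀ R)) * u =
      CliffordAlgebra.ι 0 (Finsupp.single x' 1) * u from rfl, this, ← add_tm]
    split_ifs with h
    · subst h; simp
    · simp [Ne.symm h, zero_tm]

lemma dop_hop_self (x : X) : dop R (Y := Y) x * hop R x = 1 - hop R x * dop R x := by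
  classical
  have := dop_hop (R := R) (Y := Y) x x
  rw [if_pos rfl] at this
  exact eq_sub_of_add_eq this

lemma dop_hop_of_ne {x x' : X} (h : x ≠ x') :
    dop R (Y := Y) x * hop R x' = -(hop R x' * dop R x) := by
  classical
  have := dop_hop (R := R) (Y := Y) x x'
  rw [if_neg h] at this
  exact eq_neg_of_add_eq_zero_left this

lemma hop_bop (x : X) (y : Y) : Commute (hop R x) (bop R y) := tmap_commute_left _ _
lemma hop_binv (x : X) (y : Y) : Commute (hop R x) (binv R y) := tmap_commute_left _ _
lemma dop_bop (x : X) (y : Y) : Commute (dop R x) (bop R y) := tmap_commute_left _ _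
lemma dop_binv (x : X) (y : Y) : Commute (dop R x) (binv R y) := tmap_commute_left _ _

lemma bop_bop (y z : Y) : Commute (bop R (X := X) y) (bop R z) := by
  refine tmap_one_commute ?_
  rw [← LinearMap.mulLeft_mul, ← LinearMap.mulLeft_mul, mul_comm]

lemma binv_bop_self (y : Y) : binv R (X := X) y * bop R y = 1 :=
  end_ext fun u v => by
    have := LinearMap.congr_fun (divX_X (R := R) y) v
    simp only [LinearMap.comp_apply] at this
    simp only [binv, bop, Module.End.mul_apply, tmap_tm, this]; rfl

lemma binv_bop_of_ne {y z : Y} (h : y ≠ z) : Commute (binv R (X := X) y) (bop R z) :=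
  tmap_one_commute (divX_X_of_ne h)

lemma hop_apply (x : X) (a : Fock R X Y) : hop R x a = hgen R x * a := by
  induction a using fock_induction with
  | h0 => simp
  | ht u v => simp [hop, hgen, tmap_tm, tm_mul_tm]
  | ha a b ha hb => rw [map_add, mul_add, ha, hb]

lemma bop_apply (y : Y) (a : Fock R X Y) : bop R y a = bgen R y * a := by
  induction a using fock_induction with
  | h0 => simp
  | ht u v => simp [bop, bgen, tmap_tm, tm_mul_tm]
  | ha a b ha hb => rw [map_add, mul_add, ha, hb]

@[simp] lemma hop_mon (x : X) (L : List X) (c : Y →₀ ℕ) : hop R x (mon R L c) = mon R (x :: L) c := by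
  simp [hop, mon, tmap_tm]

@[simp] lemma bop_mon (y : Y) (L : List X) (c : Y →₀ ℕ) :
    bop R y (mon R L c) = mon R L (c + Finsupp.single y 1) := by
  simp [bop, mon, tmap_tm, X_mul_monomial]

lemma binv_mon (y : Y) (L : List X) (c : Y →₀ ℕ) :
    binv R y (mon R L c) = if c y = 0 then 0 else mon R L (c - Finsupp.single y 1) := by
  simp only [binv, mon, tmap_tm, divX_monomial]
  split_ifs
  · exact tm_zero _
  · rfl

@[simp] lemma dop_mon_nil (x : X) (c : Y →₀ ℕ) : dop R x (mon R [] c) = 0 := by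
  simp only [dop, mon, tmap_tm, List.map_nil, List.prod_nil]
  rw [show (1 : ExteriorAlgebra R (X →₀ R)) = (1 : CliffordAlgebra 0) from rfl,
    CliffordAlgebra.contractLeft_one, zero_tm]

lemma dop_mon_cons [DecidableEq X] (x x' : X) (L : List X) (c : Y →₀ ℕ) :
    dop R x (mon R (x' :: L) c) =
      (if x = x' then mon R L c else 0) - hop R x' (dop R x (mon R L c)) := by
  have := LinearMap.congr_fun (dop_hop (R := R) (Y := Y) x x') (mon R L c)
  simp only [LinearMap.add_apply, Module.End.mul_apply, hop_mon] at this
  rw [eq_sub_iff_add_eq, this]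
  split_ifs <;> simp

lemma dop_mon_of_not_mem (x : X) (L : List X) (c : Y →₀ ℕ) (hx : x ∉ L) :
    dop R x (mon R L c) = 0 := by
  classical
  induction L with
  | nil => simp
  | cons x' L ih =>
    rw [List.mem_cons, not_or] at hx
    rw [dop_mon_cons, if_neg hx.1, ih hx.2]; simp

lemma hop_mon_of_mem (x : X) (L : List X) (c : Y →₀ ℕ) (hx : x ∈ L) : hop R x (mon R L c) = 0 := by
  induction L with
  | nil => simp at hx
  | cons x' L ih =>
    rw [← hop_mon, ← Module.End.mul_apply]
    rcases List.mem_cons.1 hx with rfl | hx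
    · rw [hop_hop_self]; rfl
    · rw [hop_hop, LinearMap.neg_apply, Module.End.mul_apply, ih hx]; simp

lemma mon_of_not_nodup (L : List X) (c : Y →₀ ℕ) (hL : ¬ L.Nodup) : mon R L c = 0 := by
  induction L with
  | nil => simp at hL
  | cons x L ih =>
    rw [← hop_mon]
    by_cases hx : x ∈ L
    · exact hop_mon_of_mem x L c hx
    · rw [ih (fun h => hL (List.nodup_cons.2 ⟨hx, h⟩)), map_zero]

lemma one_eq_mon : (1 : Fock R X Y) = mon R [] 0 := by
  simp [mon, one_eq_tm]

lemma span_mon : Submodule.span R {a | ∃ (L : List X) (c : Y →₀ ℕ), a = mon R L c} = ⊤ := by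
  rw [eq_top_iff]
  rintro a -
  induction a using fock_induction with
  | h0 => exact zero_mem _
  | ha a b ha hb => exact add_mem ha hb
  | ht u v =>
    have hu : u ∈ Submodule.span R
        {u | ∃ L : List X, u = (L.map ex).prod} := by
      induction u using ExteriorAlgebra.induction with
      | algebraMap r =>
        rw [Algebra.algebraMap_eq_smul_one]
        exact Submodule.smul_mem _ _ (Submodule.subset_span ⟨[], by simp⟩)
      | ι m =>
        induction m using Finsupp.induction_linear with
        | zero => simp
        | add f g hf hg => rw [map_add]; exact add_mem hf hg
        | single x r =>
          rw [← mul_one r, ← smul_eq_mul, ← Finsupp.smul_single, map_smul]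
          exact Submodule.smul_mem _ _ (Submodule.subset_span ⟨[x], by simp⟩)
      | mul a b ha hb =>
        refine Submodule.span_induction₂ (p := fun a b _ _ => a * b ∈ _) ?_ ?_ ?_ ?_ ?_ ?_ ?_ ha hb
        · rintro _ _ ⟨L, rfl⟩ ⟨L', rfl⟩
          exact Submodule.subset_span ⟨L ++ L', by simp⟩
        · intros; simp
        · intros; simp
        · intro _ _ _ _ _ _ h1 h2; rw [add_mul]; exact add_mem h1 h2
        · intro _ _ _ _ _ _ h1 h2; rw [mul_add]; exact add_mem h1 h2
        · intro _ _ _ _ _ h; rw [smul_mul_assoc]; exact Submodule.smul_mem _ _ h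
        · intro _ _ _ _ _ h; rw [mul_smul_comm]; exact Submodule.smul_mem _ _ h
      | add a b ha hb => exact add_mem ha hb
    induction v using MvPolynomial.induction_on' with
    | add p q hp hq => rw [tm_add]; exact add_mem hp hq
    | monomial c r =>
      rw [← mul_one r, ← smul_eq_mul, ← MvPolynomial.smul_monomial, tm_smul]
      refine Submodule.smul_mem _ _ ?_
      induction hu using Submodule.span_induction with
      | mem x h => obtain ⟨L, rfl⟩ := h; exact Submodule.subset_span ⟨L, c, rfl⟩
      | zero => rw [zero_tm]; exact zero_mem _
      | add x y _ _ hx hy => rw [add_tm]; exact add_mem hx hy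
      | smul a x _ hx => rw [smul_tm]; exact Submodule.smul_mem _ _ hx

lemma fock_hom_ext {N : Type*} [AddCommGroup N] [Module R N] {f g : Fock R X Y →ₗ[R] N}
    (h : ∀ L c, L.Nodup → f (mon R L c) = g (mon R L c)) : f = g := by
  refine LinearMap.ext_on span_mon ?_
  rintro _ ⟨L, c, rfl⟩
  by_cases hL : L.Nodup
  · exact h L c hL
  · rw [mon_of_not_nodup L c hL, map_zero, map_zero]

/-! ### Gradings of Fock spaces -/

/-- Degrees of the generators `h_x` and `b_y`. -/
structure GenWt (X Y G : Type) where
  /-- the degree of `h_x` -/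
  h : X → G
  /-- the degree of `b_y` -/
  b : Y → G

/-- The degree of the monomial `mon L c`. -/
def GenWt.deg {G : Type} [AddCommGroup G] (D : GenWt X Y G) (L : List X) (c : Y →₀ ℕ) : G :=
  (L.map D.h).sum + c.sum fun y m => m • D.b y

variable (R) in
/-- The span of the monomials of degree `γ` and weight at most `w`. -/
def gspan {G : Type} [AddCommGroup G] (D : GenWt X Y G) (W : GenWt X Y ℤ) (γ : G) (w : ℤ) :
    Submodule R (Fock R X Y) :=
  Submodule.span R {a | ∃ L c, D.deg L c = γ ∧ W.deg L c ≤ w ∧ a = mon R L c}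

section Graded

variable {G : Type} [AddCommGroup G] {D : GenWt X Y G} {W : GenWt X Y ℤ}

lemma GenWt.deg_cons (D : GenWt X Y G) (x : X) (L : List X) (c : Y →₀ ℕ) :
    D.deg (x :: L) c = D.h x + D.deg L c := by
  simp [GenWt.deg, add_assoc]

lemma GenWt.deg_add (D : GenWt X Y G) (y : Y) (L : List X) (c : Y →₀ ℕ) :
    D.deg L (c + Finsupp.single y 1) = D.deg L c + D.b y := by
  classical
  rw [GenWt.deg, Finsupp.sum_add_index' (by simp) (by intros; rw [add_smul]),
    Finsupp.sum_single_index (by simp), one_smul, ← add_assoc, GenWt.deg]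

lemma GenWt.deg_sub (D : GenWt X Y G) (y : Y) (L : List X) (c : Y →₀ ℕ) (h : c y ≠ 0) :
    D.deg L (c - Finsupp.single y 1) = D.deg L c - D.b y := by
  rw [eq_sub_iff_add_eq, ← GenWt.deg_add]
  congr 1
  exact tsub_add_cancel_of_le (Finsupp.single_le_iff.2 (Nat.one_le_iff_ne_zero.2 h))

lemma mon_mem_gspan {L : List X} {c : Y →₀ ℕ} {γ : G} {w : ℤ} (h : D.deg L c = γ)
    (h' : W.deg L c ≤ w) : mon R L c ∈ gspan R D W γ w :=
  Submodule.subset_span ⟨L, c, h, h', rfl⟩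

/-- An operator maps `gspan` to a submodule as soon as it does so on monomials without repeated
factors. -/
lemma gspan_induction {N : Type*} [AddCommGroup N] [Module R N] {γ : G} {w : ℤ}
    {f : Fock R X Y →ₗ[R] N} {P : Submodule R N}
    (h : ∀ L c, L.Nodup → D.deg L c = γ → W.deg L c ≤ w → f (mon R L c) ∈ P)
    {a : Fock R X Y} (ha : a ∈ gspan R D W γ w) : f a ∈ P := by
  rw [← Submodule.mem_comap]
  refine Submodule.span_le.2 ?_ ha
  rintro _ ⟨L, c, h1, h2, rfl⟩
  by_cases hL : L.Nodup
  · exact h L c hL h1 h2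
  · rw [mon_of_not_nodup L c hL]; exact zero_mem _

lemma gspan_mono {γ : G} {w w' : ℤ} (h : w ≤ w') : gspan R D W γ w ≤ gspan R D W γ w' := by
  refine Submodule.span_mono ?_
  rintro _ ⟨L, c, h1, h2, rfl⟩
  exact ⟨L, c, h1, h2.trans h, rfl⟩

lemma hop_gspan {γ : G} {w : ℤ} (x : X) {a : Fock R X Y} (ha : a ∈ gspan R D W γ w) :
    hop R x a ∈ gspan R D W (γ + D.h x) (w + W.h x) := by
  refine gspan_induction (fun L c _ h1 h2 => ?_) ha
  rw [hop_mon]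
  refine mon_mem_gspan ?_ ?_
  · rw [GenWt.deg_cons, h1, add_comm]
  · rw [GenWt.deg_cons, add_comm]; gcongr

lemma bop_gspan {γ : G} {w : ℤ} (y : Y) {a : Fock R X Y} (ha : a ∈ gspan R D W γ w) :
    bop R y a ∈ gspan R D W (γ + D.b y) (w + W.b y) := by
  refine gspan_induction (fun L c _ h1 h2 => ?_) ha
  rw [bop_mon]
  refine mon_mem_gspan ?_ ?_
  · rw [GenWt.deg_add, h1]
  · rw [GenWt.deg_add]; gcongr

lemma binv_gspan {γ : G} {w : ℤ} (y : Y) {a : Fock R X Y} (ha : a ∈ gspan R D W γ w) :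
    binv R y a ∈ gspan R D W (γ - D.b y) (w - W.b y) := by
  refine gspan_induction (fun L c _ h1 h2 => ?_) ha
  rw [binv_mon]
  split_ifs with h
  · exact zero_mem _
  · refine mon_mem_gspan ?_ ?_
    · rw [GenWt.deg_sub _ _ _ _ h, h1]
    · rw [GenWt.deg_sub _ _ _ _ h]; gcongr

lemma dop_mon_gspan (x : X) (L : List X) (c : Y →₀ ℕ) :
    dop R x (mon R L c) ∈ gspan R D W (D.deg L c - D.h x) (W.deg L c - W.h x) := by
  classical
  induction L with
  | nil => simp
  | cons x' L ih =>
    rw [dop_mon_cons]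
    refine sub_mem ?_ ?_
    · split_ifs with h
      · subst h
        refine mon_mem_gspan ?_ ?_
        · rw [GenWt.deg_cons]; abel
        · rw [GenWt.deg_cons]; apply le_of_eq; abel
      · exact zero_mem _
    · have := hop_gspan x' ih
      rw [GenWt.deg_cons, GenWt.deg_cons]
      rwa [show D.h x' + D.deg L c - D.h x = D.deg L c - D.h x + D.h x' by abel,
        show W.h x' + W.deg L c - W.h x = W.deg L c - W.h x + W.h x' by abel]

lemma dop_gspan {γ : G} {w : ℤ} (x : X) {a : Fock R X Y} (ha : a ∈ gspan R D W γ w) :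
    dop R x a ∈ gspan R D W (γ - D.h x) (w - W.h x) := by
  refine gspan_induction (fun L c _ h1 h2 => ?_) ha
  rw [← h1]
  exact gspan_mono (by gcongr) (dop_mon_gspan x L c)

end Graded

/-! ### The projections onto the part without a given pair of generators -/

variable (R) in
/-- The projection onto the span of the monomials that involve neither `h_x` nor `b_y`. -/
def eop (x : X) (y : Y) : Module.End R (Fock R X Y) :=
  (1 - bop R y * binv R y) * (dop R x * hop R x)

open Classical in
lemma eop_mon (x : X) (y : Y) (L : List X) (c : Y →₀ ℕ) :
    eop R x y (mon R L c) = if x ∈ L ∨ c y ≠ 0 then 0 else mon R L c := by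
  rw [eop, Module.End.mul_apply, Module.End.mul_apply]
  by_cases hx : x ∈ L
  · rw [hop_mon_of_mem x L c hx]; simp [hx]
  · have : dop R x (hop R x (mon R L c)) = mon R L c := by
      rw [← Module.End.mul_apply, dop_hop_self, LinearMap.sub_apply, Module.End.mul_apply,
        dop_mon_of_not_mem x L c hx]; simp
    rw [this, LinearMap.sub_apply, Module.End.mul_apply, binv_mon]
    by_cases hc : c y = 0
    · simp [hx, hc]
    · simp only [hc, if_false, bop_mon, hx, false_or, ne_eq, not_false_eq_true, if_true]
      rw [tsub_add_cancel_of_le (Finsupp.single_le_iff.2 (Nat.one_le_iff_ne_zero.2 hc))]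
      simp

end Fock

end

/-! ### Antiderivations and gradings of free algebras -/

section

section Words

variable {R X : Type} [CommRing R]

/-- The word with the letters in `l`. -/
def word (R : Type) [CommRing R] (l : List X) : FreeAlgebra R X := (l.map (FreeAlgebra.ι R)).prod

@[simp] lemma word_nil : word R ([] : List X) = 1 := rfl
@[simp] lemma word_cons (a : X) (l : List X) : word R (a :: l) = FreeAlgebra.ι R a * word R l := by
  simp [word]
lemma word_append (l l' : List X) : word R (l ++ l') = word R l * word R l' := by simp [word]
lemma word_singleton (a : X) : word R [a] = FreeAlgebra.ι R a := by simp

variable (R X) in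
/-- The words form a basis of the free algebra. -/
def wbasis : Module.Basis (List X) R (FreeAlgebra R X) := FreeAlgebra.basisFreeMonoid R X

lemma wbasis_apply (l : List X) : wbasis R X l = word R l := by
  have h : ∀ l : FreeMonoid X, FreeAlgebra.equivMonoidAlgebraFreeMonoid (word R l.toList) =
      MonoidAlgebra.single l (1 : R) := by
    intro l
    induction l using FreeMonoid.inductionOn' with
    | one => rw [FreeMonoid.toList_one, word_nil, map_one]; rfl
    | of_mul a l ih =>
      rw [FreeMonoid.toList_of_mul, word_cons, map_mul, ih]
      simp [FreeAlgebra.equivMonoidAlgebraFreeMonoid, MonoidAlgebra.single_mul_single]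
  apply FreeAlgebra.equivMonoidAlgebraFreeMonoid.injective
  refine Eq.trans ?_ (h (FreeMonoid.ofList l)).symm
  change FreeAlgebra.equivMonoidAlgebraFreeMonoid (FreeAlgebra.equivMonoidAlgebraFreeMonoid.symm
    ((MonoidAlgebra.coeffLinearEquiv R).symm (Finsupp.basisSingleOne (R := R)
      (FreeMonoid.ofList l)))) = _
  rw [AlgEquiv.apply_symm_apply, Finsupp.coe_basisSingleOne]
  rfl

lemma word_hom_ext {N : Type*} [AddCommMonoid N] [Module R N] {f g : FreeAlgebra R X →ₗ[R] N}
    (h : ∀ l, f (word R l) = g (word R l)) : f = g :=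
  (wbasis R X).ext fun l => by rw [wbasis_apply]; exact h l

/-- The linear map with given values on the words. -/
def wlift {N : Type*} [AddCommMonoid N] [Module R N] (f : List X → N) : FreeAlgebra R X →ₗ[R] N :=
  (wbasis R X).constr R f

@[simp] lemma wlift_word {N : Type*} [AddCommMonoid N] [Module R N] (f : List X → N) (l : List X) :
    wlift (R := R) f (word R l) = f l := by
  rw [← wbasis_apply, wlift, Module.Basis.constr_basis]

/-- The values on words of the antiderivation that extends `δ`. -/
def derWord (δ : X → FreeAlgebra R X) : List X → FreeAlgebra R X
  | [] => 0
  | a :: l => δ a * word R l - FreeAlgebra.ι R a * derWord δ l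

/-- The antiderivation that extends `δ`: `d (a w) = δ a w - a d w` for letters `a`. -/
def der (δ : X → FreeAlgebra R X) : FreeAlgebra R X →ₗ[R] FreeAlgebra R X := wlift (derWord δ)

@[simp] lemma der_one (δ : X → FreeAlgebra R X) : der δ 1 = 0 := by
  rw [← word_nil, der, wlift_word]; rfl

lemma der_ι_mul (δ : X → FreeAlgebra R X) (a : X) (x : FreeAlgebra R X) :
    der δ (FreeAlgebra.ι R a * x) = δ a * x - FreeAlgebra.ι R a * der δ x := by
  have : der δ ∘ₗ LinearMap.mulLeft R (FreeAlgebra.ι R a) =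
      LinearMap.mulLeft R (δ a) - LinearMap.mulLeft R (FreeAlgebra.ι R a) ∘ₗ der δ := by
    refine word_hom_ext fun l => ?_
    simp only [LinearMap.comp_apply, LinearMap.mulLeft_apply, LinearMap.sub_apply]
    rw [← word_cons, der, wlift_word, wlift_word]; rfl
  exact LinearMap.congr_fun this x

@[simp] lemma der_ι (δ : X → FreeAlgebra R X) (a : X) : der δ (FreeAlgebra.ι R a) = δ a := by
  have := der_ι_mul δ a 1
  simpa using this

lemma der_word_mul (δ : X → FreeAlgebra R X) (l : List X) (x : FreeAlgebra R X) :
    der δ (word R l * x) = der δ (word R l) * x + (-1) ^ l.length * (word R l * der δ x) := by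
  induction l with
  | nil => simp
  | cons a l ih =>
    rw [word_cons, mul_assoc, der_ι_mul, der_ι_mul, ih, List.length_cons, pow_succ]
    have h : (-1 : FreeAlgebra R X) ^ l.length * FreeAlgebra.ι R a =
        FreeAlgebra.ι R a * (-1) ^ l.length := ((Commute.neg_one_left _).pow_left _).eq
    simp only [mul_add, sub_mul, mul_assoc, mul_neg, neg_mul, mul_one]
    rw [← mul_assoc ((-1 : FreeAlgebra R X) ^ l.length) (FreeAlgebra.ι R a), h]
    simp only [mul_assoc]
    abel

lemma der_add (δ δ' : X → FreeAlgebra R X) : der (δ + δ') = der δ + der δ' := by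
  refine word_hom_ext fun l => ?_
  induction l with
  | nil => simp
  | cons a l ih =>
    simp only [word_cons, der_ι_mul, LinearMap.add_apply, Pi.add_apply, add_mul] at ih ⊢
    rw [ih, mul_add]; abel

/-- The span of the words that satisfy `P`. -/
def wspan (R : Type) [CommRing R] (P : List X → Prop) : Submodule R (FreeAlgebra R X) :=
  Submodule.span R {x | ∃ l, P l ∧ x = word R l}

lemma word_mem_wspan {P : List X → Prop} {l : List X} (h : P l) : word R l ∈ wspan R P :=
  Submodule.subset_span ⟨l, h, rfl⟩

lemma wspan_le {P : List X → Prop} {N : Submodule R (FreeAlgebra R X)}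
    (h : ∀ l, P l → word R l ∈ N) : wspan R P ≤ N := by
  refine Submodule.span_le.2 ?_
  rintro _ ⟨l, hl, rfl⟩
  exact h l hl

lemma wspan_mono {P Q : List X → Prop} (h : ∀ l, P l → Q l) : wspan R P ≤ wspan R Q :=
  wspan_le fun l hl => word_mem_wspan (h l hl)

lemma wspan_map {N : Type*} [AddCommGroup N] [Module R N] {P : List X → Prop} {S : Submodule R N}
    {f : FreeAlgebra R X →ₗ[R] N} (h : ∀ l, P l → f (word R l) ∈ S) {x : FreeAlgebra R X}
    (hx : x ∈ wspan R P) : f x ∈ S :=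
  (wspan_le (N := S.comap f) h) hx

lemma wspan_mul {P Q T : List X → Prop} (h : ∀ l l', P l → Q l' → T (l ++ l'))
    {x y : FreeAlgebra R X} (hx : x ∈ wspan R P) (hy : y ∈ wspan R Q) : x * y ∈ wspan R T := by
  have : ∀ l, P l → word R l * y ∈ wspan R T := fun l hl =>
    wspan_map (f := LinearMap.mulLeft R (word R l)) (fun l' hl' => by
      rw [LinearMap.mulLeft_apply, ← word_append]; exact word_mem_wspan (h l l' hl hl')) hy
  exact wspan_map (f := LinearMap.mulRight R y) this hx

open Classical in
/-- The projection onto the span of the words that satisfy `P`. -/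
def wproj (P : List X → Prop) : FreeAlgebra R X →ₗ[R] FreeAlgebra R X :=
  wlift fun l => if P l then word R l else 0

lemma wproj_word_pos {P : List X → Prop} {l : List X} (h : P l) :
    wproj P (word R l) = word R l := by rw [wproj, wlift_word, if_pos h]

lemma wproj_word_neg {P : List X → Prop} {l : List X} (h : ¬ P l) :
    wproj P (word R l) = 0 := by rw [wproj, wlift_word, if_neg h]

lemma wproj_mem (P : List X → Prop) (x : FreeAlgebra R X) : wproj P x ∈ wspan R P := by
  have : x ∈ wspan R (fun _ : List X => True) := by
    have h := (wbasis R X).span_eq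
    have h2 : x ∈ Submodule.span R (Set.range (wbasis R X)) := h ▸ Submodule.mem_top
    refine Submodule.span_mono ?_ h2
    rintro _ ⟨l, rfl⟩
    exact ⟨l, trivial, wbasis_apply l⟩
  refine wspan_map (fun l _ => ?_) this
  by_cases h : P l
  · rw [wproj_word_pos h]; exact word_mem_wspan h
  · rw [wproj_word_neg h]; exact zero_mem _

lemma mem_wspan_true (x : FreeAlgebra R X) : x ∈ wspan R (fun _ : List X => True) := by
  have : wproj (fun _ : List X => True) = (LinearMap.id : FreeAlgebra R X →ₗ[R] _) :=
    word_hom_ext fun l => wproj_word_pos trivial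
  have h2 := wproj_mem (fun _ : List X => True) x
  rwa [this] at h2

lemma wproj_of_mem {P : List X → Prop} {x : FreeAlgebra R X} (hx : x ∈ wspan R P) :
    wproj P x = x := by
  have : x ∈ LinearMap.eqLocus (wproj P) LinearMap.id :=
    wspan_le (N := LinearMap.eqLocus (wproj P) LinearMap.id) (fun l hl => wproj_word_pos hl) hx
  exact this

lemma wproj_of_disjoint {P Q : List X → Prop} (h : ∀ l, P l → ¬ Q l) {x : FreeAlgebra R X}
    (hx : x ∈ wspan R P) : wproj Q x = 0 := by
  have : wproj Q x ∈ (⊥ : Submodule R (FreeAlgebra R X)) :=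
    wspan_map (fun l hl => by rw [wproj_word_neg (h l hl)]; exact zero_mem _) hx
  simpa using this

/-- An operator that maps words of degree `γ` to elements of degree `φ γ` commutes with the
projections onto the homogeneous parts. -/
lemma wproj_comm {G : Type} {deg : List X → G} {φ : G → G} (hφ : Function.Injective φ)
    {f : FreeAlgebra R X →ₗ[R] FreeAlgebra R X}
    (hf : ∀ l, f (word R l) ∈ wspan R fun l' => deg l' = φ (deg l)) (γ : G) (x : FreeAlgebra R X) :
    wproj (fun l => deg l = φ γ) (f x) = f (wproj (fun l => deg l = γ) x) := by
  suffices wproj (fun l => deg l = φ γ) ∘ₗ f = f ∘ₗ wproj (fun l => deg l = γ) from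
    LinearMap.congr_fun this x
  refine word_hom_ext fun l => ?_
  rw [LinearMap.comp_apply, LinearMap.comp_apply]
  by_cases h : deg l = γ
  · rw [wproj_word_pos (P := fun l => deg l = γ) h]
    exact wproj_of_mem (h ▸ hf l)
  · rw [wproj_word_neg (P := fun l => deg l = γ) h, map_zero]
    exact wproj_of_disjoint (fun l' h1 h2 => h (hφ (h1.symm.trans h2))) (hf l)

/-- The map `a w ↦ single a w` that cuts off the first letter. -/
def uncap : FreeAlgebra R X →ₗ[R] (X →₀ FreeAlgebra R X) :=
  wlift fun l => match l with
    | [] => 0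
    | a :: l => Finsupp.single a (word R l)

lemma uncap_one : uncap (1 : FreeAlgebra R X) = 0 := by
  rw [← word_nil, uncap, wlift_word]

lemma uncap_ι_mul (a : X) (x : FreeAlgebra R X) :
    uncap (FreeAlgebra.ι R a * x) = Finsupp.single a x := by
  have : uncap ∘ₗ LinearMap.mulLeft R (FreeAlgebra.ι R a) = Finsupp.lsingle a := by
    refine word_hom_ext fun l => ?_
    simp only [LinearMap.comp_apply, LinearMap.mulLeft_apply]
    rw [← word_cons, uncap, wlift_word]; rfl
  exact LinearMap.congr_fun this x

lemma eq_sum_uncap {x : FreeAlgebra R X} (hx : x ∈ wspan R fun l : List X => l ≠ []) :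
    x = (uncap x).sum fun a y => FreeAlgebra.ι R a * y := by
  let f : (X →₀ FreeAlgebra R X) →ₗ[R] FreeAlgebra R X :=
    Finsupp.lsum R fun a => LinearMap.mulLeft R (FreeAlgebra.ι R a)
  have hf : ∀ u, f u = u.sum fun a y => FreeAlgebra.ι R a * y := fun u => rfl
  rw [← hf]
  have : x ∈ LinearMap.eqLocus LinearMap.id (f ∘ₗ uncap) := by
    refine wspan_le (fun l hl => ?_) hx
    cases l with
    | nil => exact absurd rfl hl
    | cons a l =>
      rw [LinearMap.mem_eqLocus, LinearMap.comp_apply, word_cons, uncap_ι_mul, hf,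
        Finsupp.sum_single_index (by simp)]; rfl
  exact this

end Words

end

section

section DerLemmas

variable {R X : Type} [CommRing R]

lemma der_mul_of_length (δ : X → FreeAlgebra R X) {s : ℕ} {x : FreeAlgebra R X}
    (hx : x ∈ wspan R fun l : List X => l.length = s) (y : FreeAlgebra R X) :
    der δ (x * y) = der δ x * y + (-1) ^ s * (x * der δ y) := by
  have : x ∈ LinearMap.eqLocus (der δ ∘ₗ LinearMap.mulRight R y)
      (LinearMap.mulRight R y ∘ₗ der δ +
        LinearMap.mulLeft R ((-1 : FreeAlgebra R X) ^ s) ∘ₗ LinearMap.mulRight R (der δ y)) := by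
    refine wspan_le (fun l hl => ?_) hx
    rw [LinearMap.mem_eqLocus]
    simp only [LinearMap.comp_apply, LinearMap.add_apply, LinearMap.mulRight_apply,
      LinearMap.mulLeft_apply]
    rw [der_word_mul, hl]
  exact this

end DerLemmas

/-! ### Words in truncated divided powers -/

section Letters

variable {p : ℕ} {I : Type}

/-- All exponents are smaller than `p`. -/
def Trunc (p : ℕ) (q : I →₀ ℕ) : Prop := ∀ i, q i < p

variable (p I) in
/-- The letters are the nonzero truncated exponents `q`; the letter `q` stands for the divided
power `∏ t_i^{q_i} / q_i!`. -/
abbrev Letter : Type := {q : I →₀ ℕ // q ≠ 0 ∧ Trunc p q}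

variable (p I) in
/-- The cobar construction of the truncated divided power coalgebra on primitive generators. -/
abbrev Om : Type := FreeAlgebra (ZMod p) (Letter p I)

open Classical in
variable (p) in
/-- The letter `q`; it is zero if `q` is zero or not truncated. -/
def lt (q : I →₀ ℕ) : Om p I :=
  if h : q ≠ 0 ∧ Trunc p q then FreeAlgebra.ι (ZMod p) ⟨q, h⟩ else 0

lemma lt_letter (a : Letter p I) : lt p a.1 = FreeAlgebra.ι (ZMod p) a := by
  rw [lt, dif_pos a.2]

@[simp] lemma lt_zero : lt p (0 : I →₀ ℕ) = 0 := by simp [lt]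

lemma lt_of_not {q : I →₀ ℕ} (h : ¬ Trunc p q) : lt p q = 0 := by
  rw [lt, dif_neg fun h' => h h'.2]

lemma Trunc.mono {q q' : I →₀ ℕ} (h : Trunc p q) (h' : q' ≤ q) : Trunc p q' :=
  fun i => (h' i).trans_lt (h i)

lemma trunc_single [Fact p.Prime] {i : I} {m : ℕ} : Trunc p (Finsupp.single i m) ↔ m < p := by
  classical
  constructor
  · intro h; simpa using h i
  · intro h j
    rw [Finsupp.single_apply]
    split_ifs
    · exact h
    · exact (Fact.out : p.Prime).pos

variable [DecidableEq I]

/-- The value of the differential on the letter `a`. -/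
def del0 (a : Letter p I) : Om p I :=
  -∑ fg ∈ Finset.HasAntidiagonal.antidiagonal a.1, lt p fg.1 * lt p fg.2

variable (p I) in
/-- The differential of the cobar construction. -/
def d0 : Om p I →ₗ[ZMod p] Om p I := der del0

lemma d0_lt {q : I →₀ ℕ} (h : Trunc p q) :
    d0 p I (lt p q) = -∑ fg ∈ Finset.HasAntidiagonal.antidiagonal q, lt p fg.1 * lt p fg.2 := by
  by_cases h0 : q = 0
  · subst h0; simp
  · have := lt_letter (p := p) (I := I) ⟨q, h0, h⟩
    simp only at this
    rw [this, d0, der_ι]; rfl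

lemma d0_lt_mul (q : I →₀ ℕ) (x : Om p I) :
    d0 p I (lt p q * x) = d0 p I (lt p q) * x - lt p q * d0 p I x := by
  by_cases h : q ≠ 0 ∧ Trunc p q
  · rw [lt, dif_pos h, d0, der_ι_mul, der_ι]
  · rw [lt, dif_neg h]; simp

lemma lt_mul_mem (q q' : I →₀ ℕ) :
    lt p q * lt p q' ∈ wspan (ZMod p) fun l : List (Letter p I) => l.length = 2 := by
  rw [lt, lt]
  split_ifs with h h'
  · rw [← word_singleton, ← word_singleton, ← word_append]
    exact word_mem_wspan rfl
  all_goals simp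

lemma del0_mem (a : Letter p I) :
    del0 a ∈ wspan (ZMod p) fun l : List (Letter p I) => l.length = 2 :=
  neg_mem (sum_mem fun _ _ => lt_mul_mem _ _)

lemma d0_del0 (a : Letter p I) : d0 p I (del0 a) = 0 := by
  -- associativity of the square of the generating series of all letters
  let F : MvPowerSeries I (Om p I) := fun q => lt p q
  have hF : ∀ q, MvPowerSeries.coeff q F = lt p q := fun q => rfl
  have h1 : ∀ q, Trunc p q → d0 p I (lt p q) = -MvPowerSeries.coeff q (F * F) := by
    intro q hq
    rw [d0_lt hq, MvPowerSeries.coeff_mul]; rfl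
  have h2 : d0 p I (del0 a) = MvPowerSeries.coeff a.1 ((F * F) * F) -
      MvPowerSeries.coeff a.1 (F * (F * F)) := by
    rw [MvPowerSeries.coeff_mul, MvPowerSeries.coeff_mul, ← Finset.sum_sub_distrib, del0, map_neg,
      map_sum, ← Finset.sum_neg_distrib]
    refine Finset.sum_congr rfl fun fg hfg => ?_
    rw [Finset.HasAntidiagonal.mem_antidiagonal] at hfg
    rw [d0_lt_mul, h1 _ (a.2.2.mono (hfg ▸ le_self_add)), h1 _ (a.2.2.mono (hfg ▸ le_add_self)),
      hF, hF]
    simp only [neg_mul, mul_neg]; abel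
  rw [h2, mul_assoc, sub_self]

lemma d0_d0 [Fact p.Prime] (x : Om p I) : d0 p I (d0 p I x) = 0 := by
  suffices d0 p I ∘ₗ d0 p I = 0 from LinearMap.congr_fun this x
  refine word_hom_ext fun l => ?_
  induction l with
  | nil => simp [d0]
  | cons a l ih =>
    simp only [LinearMap.comp_apply, LinearMap.zero_apply] at ih ⊢
    rw [word_cons, d0, der_ι_mul, map_sub, der_mul_of_length _ (del0_mem a), der_ι_mul]
    change d0 p I (del0 a) * _ + _ - (_ - _ * d0 p I (d0 p I _)) = 0
    rw [d0_del0, ih]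
    simp

variable (p) in
/-- The cocycle `-∑ [t_i^m/m! | t_i^{p-m}/(p-m)!]` that represents the polynomial generator `b_i`.
It is `∑ (1/p) binom(p,m) [t_i^m | t_i^{p-m}]`, as `(p-1)! = -1` in `Z/p`. -/
def bw (i : I) : Om p I :=
  -∑ m ∈ Finset.Ioo 0 p, lt p (Finsupp.single i m) * lt p (Finsupp.single i (p - m))

lemma bw_eq [Fact p.Prime] (i : I) : bw p i = -∑ m ∈ Finset.HasAntidiagonal.antidiagonal p,
    lt p (Finsupp.single i m.1) * lt p (Finsupp.single i m.2) := by
  rw [bw, Finset.Nat.sum_antidiagonal_eq_sum_range_succ_mk]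
  congr 1
  refine Finset.sum_subset (fun m hm => ?_) fun m hm hm' => ?_
  · rw [Finset.mem_Ioo] at hm; rw [Finset.mem_range]; omega
  · rw [Finset.mem_range] at hm
    rw [Finset.mem_Ioo] at hm'
    have : m = 0 ∨ m = p := by omega
    rcases this with rfl | rfl <;> simp

/-- Formally `b_i` is the coboundary of the missing divided power `t_i^p/p!`, so that it is a cocycle
for the same reason for which `d0` is a differential. -/
lemma d0_bw [Fact p.Prime] (i : I) : d0 p I (bw p i) = 0 := by
  let F : PowerSeries (Om p I) := PowerSeries.mk fun m => lt p (Finsupp.single i m)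
  have hF : ∀ m, PowerSeries.coeff m F = lt p (Finsupp.single i m) :=
    fun m => PowerSeries.coeff_mk _ _
  have h1 : ∀ m, m < p → d0 p I (lt p (Finsupp.single i m)) = -PowerSeries.coeff m (F * F) := by
    intro m hm
    rw [d0_lt (trunc_single.2 hm), PowerSeries.coeff_mul, Finsupp.antidiagonal_single,
      Finset.sum_map]
    simp [hF]
  have h2 : d0 p I (bw p i) = PowerSeries.coeff p ((F * F) * F) -
      PowerSeries.coeff p (F * (F * F)) := by
    rw [PowerSeries.coeff_mul, PowerSeries.coeff_mul, ← Finset.sum_sub_distrib, bw_eq, map_neg,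
      map_sum, ← Finset.sum_neg_distrib]
    refine Finset.sum_congr rfl fun fg hfg => ?_
    rw [Finset.HasAntidiagonal.mem_antidiagonal] at hfg
    rw [d0_lt_mul, hF, hF]
    have hp := (Fact.out : p.Prime).pos
    have hlt : lt p (Finsupp.single i p) = 0 := lt_of_not fun h => (trunc_single.1 h).false
    rcases Nat.eq_zero_or_pos fg.1 with h | h
    · rw [h, show fg.2 = p by omega, hlt, Finsupp.single_zero, lt_zero]; simp
    · rcases Nat.eq_zero_or_pos fg.2 with h' | h'
      · rw [h', show fg.1 = p by omega, hlt, Finsupp.single_zero, lt_zero]; simp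
      · rw [h1 _ (by omega), h1 _ (by omega)]
        simp only [neg_mul, mul_neg]; abel
  rw [h2, mul_assoc, sub_self]

end Letters

end

/-! ### Representations of the cobar construction by anticommuting operators -/

section

section Rep

variable {p : ℕ} [Fact p.Prime] {I : Type} [DecidableEq I] {B : Type} [Ring B] [Algebra (ZMod p) B]

variable (p I B) in
/-- Families of elements `H_i`, `C_i` that anticommute for different indices.  They define a
representation of the cobar construction that sends `t_i` to `H_i` and `t_i^{p-1}` to `C_i` (to
`H_i - C_i` if `p = 2`, the truncated divided power `t_i^{p-1}/(p-1)!` being `-t_i^{p-1}`). -/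
structure AntiOps where
  /-- the image of `t_i` -/
  H : I → B
  /-- the image of `t_i^{p-1}` -/
  C : I → B
  HH : ∀ {i j}, i ≠ j → H i * H j = -(H j * H i)
  CC : ∀ {i j}, i ≠ j → C i * C j = -(C j * C i)
  HC : ∀ {i j}, i ≠ j → H i * C j = -(C j * H i)
  sq : p ≠ 2 → ∀ i, H i * H i = 0

variable (Q : AntiOps p I B)

namespace AntiOps

lemma CH {i j : I} (h : i ≠ j) : Q.C i * Q.H j = -(Q.H j * Q.C i) := by
  rw [Q.HC h.symm, neg_neg]

/-- The image of the divided power `t_i^m / m!`. -/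
def op (i : I) (m : ℕ) : B := (if m = 1 then Q.H i else 0) - (if m = p - 1 then Q.C i else 0)

/-- The image of a letter. -/
def tau (q : I →₀ ℕ) : B :=
  ∑ i ∈ q.support, ((if q = Finsupp.single i 1 then Q.H i else 0) -
    (if q = Finsupp.single i (p - 1) then Q.C i else 0))

lemma pred_pos : 1 ≤ p - 1 := by have := (Fact.out : p.Prime).two_le; omega

lemma tau_eq_sum {q : I →₀ ℕ} {T : Finset I} (h : q.support ⊆ T) :
    Q.tau q = ∑ i ∈ T, ((if q = Finsupp.single i 1 then Q.H i else 0) -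
      (if q = Finsupp.single i (p - 1) then Q.C i else 0)) := by
  refine Finset.sum_subset h fun i _ hi => ?_
  rw [Finsupp.notMem_support_iff] at hi
  have h1 := pred_pos (p := p)
  rw [if_neg, if_neg, sub_zero]
  · rintro rfl; simp at hi; omega
  · rintro rfl; simp at hi

@[simp] lemma tau_zero : Q.tau 0 = 0 := by simp [tau]

lemma tau_single (i : I) {m : ℕ} (hm : m ≠ 0) : Q.tau (Finsupp.single i m) = Q.op i m := by
  rw [tau, Finsupp.support_single _ hm, Finset.sum_singleton, op]
  congr 1
  · simp only [(Finsupp.single_injective i).eq_iff]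
  · simp only [(Finsupp.single_injective i).eq_iff]

lemma tau_cases (q : I →₀ ℕ) : Q.tau q = 0 ∨ ∃ i m, m ≠ 0 ∧ q = Finsupp.single i m := by
  by_contra! h
  refine h.1 (Finset.sum_eq_zero fun i _ => ?_)
  have h1 := pred_pos (p := p)
  rw [if_neg (h.2 i 1 one_ne_zero), if_neg (h.2 i (p - 1) (by omega)), sub_zero]

lemma op_anti {i j : I} (h : i ≠ j) (m m' : ℕ) : Q.op i m * Q.op j m' = -(Q.op j m' * Q.op i m) := by
  simp only [op]
  split_ifs <;>
    simp only [sub_mul, mul_sub, Q.HH h, Q.CC h, Q.HC h, Q.CH h, zero_mul, mul_zero, sub_zero,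
      zero_sub, neg_zero, neg_neg, neg_mul, mul_neg] <;> abel

lemma op_self (i : I) {m m' : ℕ} (hm : m ≠ 0) (hm' : m' ≠ 0) (h : m + m' < p) :
    Q.op i m * Q.op i m' = 0 := by
  simp only [op]
  rw [if_neg (show ¬ m = p - 1 by omega), if_neg (show ¬ m' = p - 1 by omega), sub_zero, sub_zero]
  split_ifs
  · exact Q.sq (by omega) i
  all_goals simp

lemma tau_anti {f g : I →₀ ℕ} (h : Trunc p (f + g)) :
    Q.tau f * Q.tau g = -(Q.tau g * Q.tau f) := by
  rcases Q.tau_cases f with hf | ⟨i, m, hm, rfl⟩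
  · simp [hf]
  rcases Q.tau_cases g with hg | ⟨j, m', hm', rfl⟩
  · simp [hg]
  rw [Q.tau_single i hm, Q.tau_single j hm']
  by_cases hij : i = j
  · subst hij
    have := h i
    simp only [Finsupp.add_apply, Finsupp.single_eq_same] at this
    rw [Q.op_self i hm hm' this, Q.op_self i hm' hm (by omega), neg_zero]
  · exact Q.op_anti hij _ _

lemma tau_sq {f : I →₀ ℕ} (h : Trunc p (f + f)) : Q.tau f * Q.tau f = 0 := by
  rcases Q.tau_cases f with hf | ⟨i, m, hm, rfl⟩
  · simp [hf]
  rw [Q.tau_single i hm]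
  have := h i
  simp only [Finsupp.add_apply, Finsupp.single_eq_same] at this
  exact Q.op_self i hm hm this

/-- The family `tau` is a twisting cochain: the products `τ_f τ_g` and `τ_g τ_f` cancel. -/
lemma sum_tau_tau {q : I →₀ ℕ} (h : Trunc p q) :
    ∑ fg ∈ Finset.HasAntidiagonal.antidiagonal q, Q.tau fg.1 * Q.tau fg.2 = 0 := by
  refine Finset.sum_involution (fun fg _ => fg.swap) ?_ ?_ ?_ ?_
  · intro fg hfg
    rw [Finset.HasAntidiagonal.mem_antidiagonal] at hfg
    rw [Q.tau_anti (hfg ▸ h)]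
    exact neg_add_cancel _
  · intro fg hfg h0 heq
    rw [Finset.HasAntidiagonal.mem_antidiagonal] at hfg
    have : fg.1 = fg.2 := (congrArg Prod.fst heq).symm
    refine h0 ?_
    rw [this] at hfg ⊢
    exact Q.tau_sq (hfg ▸ h)
  · intro fg hfg
    rw [Finset.HasAntidiagonal.mem_antidiagonal] at hfg ⊢
    rw [Prod.fst_swap, Prod.snd_swap, add_comm, hfg]
  · intro fg _; exact Prod.swap_swap fg

/-- The representation of the cobar construction. -/
def rho : Om p I →ₐ[ZMod p] B := FreeAlgebra.lift (ZMod p) fun a => Q.tau a.1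

lemma rho_ι (a : Letter p I) : Q.rho (FreeAlgebra.ι (ZMod p) a) = Q.tau a.1 := by simp [rho]

lemma rho_lt {q : I →₀ ℕ} (h : Trunc p q) : Q.rho (lt p q) = Q.tau q := by
  by_cases h0 : q = 0
  · subst h0; simp
  · rw [lt, dif_pos ⟨h0, h⟩, rho_ι]

lemma rho_d0 (x : Om p I) : Q.rho (d0 p I x) = 0 := by
  suffices Q.rho.toLinearMap ∘ₗ d0 p I = 0 from LinearMap.congr_fun this x
  refine word_hom_ext fun l => ?_
  induction l with
  | nil => simp [d0]
  | cons a l ih =>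
    simp only [LinearMap.comp_apply, LinearMap.zero_apply, AlgHom.toLinearMap_apply] at ih ⊢
    have h1 : Q.rho (del0 a) = 0 := by
      rw [del0, map_neg, map_sum, neg_eq_zero, ← Q.sum_tau_tau a.2.2]
      refine Finset.sum_congr rfl fun fg hfg => ?_
      rw [Finset.HasAntidiagonal.mem_antidiagonal] at hfg
      rw [map_mul, Q.rho_lt (a.2.2.mono (hfg ▸ le_self_add)),
        Q.rho_lt (a.2.2.mono (hfg ▸ le_add_self))]
    rw [word_cons, d0, der_ι_mul, map_sub, map_mul, map_mul, h1]
    rw [d0] at ih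
    rw [ih]; simp

lemma rho_bw (i : I) : Q.rho (bw p i) =
    if p = 2 then -((Q.H i - Q.C i) * (Q.H i - Q.C i)) else Q.H i * Q.C i + Q.C i * Q.H i := by
  have hp := (Fact.out : p.Prime).two_le
  have h1 : ∀ m, 0 < m → m < p → Q.rho (lt p (Finsupp.single i m)) = Q.op i m := by
    intro m h0 h1
    rw [Q.rho_lt (trunc_single.2 h1), Q.tau_single i h0.ne']
  have h2 : Q.rho (bw p i) = -∑ m ∈ Finset.Ioo 0 p, Q.op i m * Q.op i (p - m) := by
    rw [bw, map_neg, map_sum]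
    congr 1
    refine Finset.sum_congr rfl fun m hm => ?_
    rw [Finset.mem_Ioo] at hm
    rw [map_mul, h1 _ hm.1 hm.2, h1 _ (by omega) (by omega)]
  rw [h2]
  split_ifs with h
  · subst h
    rw [show Finset.Ioo 0 2 = {1} by rfl, Finset.sum_singleton]
    simp [op]
  · rw [← Finset.sum_subset (s₁ := {1, p - 1}), Finset.sum_pair (by omega)]
    · have e1 : p - (p - 1) = 1 := by omega
      simp only [op, e1, if_true, if_neg (show ¬ 1 = p - 1 by omega),
        if_neg (show ¬ p - 1 = 1 by omega)]
      simp [add_comm]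
    · intro m hm
      rw [Finset.mem_insert, Finset.mem_singleton] at hm
      rw [Finset.mem_Ioo]; omega
    · intro m hm hm'
      rw [Finset.mem_Ioo] at hm
      rw [Finset.mem_insert, Finset.mem_singleton] at hm'
      simp only [op]
      rw [if_neg (show ¬ m = 1 by omega), if_neg (show ¬ m = p - 1 by omega)]; simp

end AntiOps

end Rep

section Generic

variable {B : Type*} [Ring B]

lemma mul_mul_anticomm {b b' c c' : B} (h : c * c' = -(c' * c)) (hb : Commute b b')
    (h1 : Commute b c') (h2 : Commute b' c) : (b * c) * (b' * c') = -((b' * c') * (b * c)) := by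
  rw [mul_assoc, ← mul_assoc c, ← h2.eq, mul_assoc b', h, mul_neg, mul_neg, ← mul_assoc, hb.eq,
    mul_assoc, ← mul_assoc b, h1.eq, mul_assoc, mul_assoc]

lemma mul_mul_anticomm' {a b c : B} (h : c * a = -(a * c)) (hb : Commute a b) :
    a * (b * c) = -((b * c) * a) := by
  rw [mul_assoc, h, mul_neg, neg_neg, ← mul_assoc, hb.eq, mul_assoc]

lemma mul_mul_sq {b c : B} (h : c * c = 0) (h1 : Commute c b) : (b * c) * (b * c) = 0 := by
  rw [mul_assoc, ← mul_assoc c, h1.eq, mul_assoc b, h, mul_zero, mul_zero]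

lemma add_of_anticomm {a b c : B} (h : c * a = 1 - a * c) (h1 : Commute a b) :
    a * (b * c) + b * c * a = b := by
  rw [mul_assoc b, h, mul_sub, ← mul_assoc, ← mul_assoc, h1.eq]; simp

lemma neg_sub_sq {a b c : B} (h : c * a = 1 - a * c) (h1 : Commute a b) (ha : a * a = 0)
    (hc : c * c = 0) (h2 : Commute c b) : -((a - b * c) * (a - b * c)) = b := by
  have e := add_of_anticomm h h1
  have e2 := mul_mul_sq hc h2
  rw [sub_mul, mul_sub, mul_sub, ha, e2]
  calc _ = a * (b * c) + b * c * a := by abel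
    _ = b := e

end Generic

/-! ### The Fock representation -/

section FockRep

variable (p : ℕ) [Fact p.Prime] (I : Type) [DecidableEq I]

/-- The Fock space that is the cohomology of the cobar construction. -/
abbrev Fk : Type := Fock (ZMod p) I I

/-- The Fock representation: `t_i` acts as multiplication by `h_i` and `t_i^{p-1}` as `b_i` times
the contraction with `h_i`. -/
def fockOps : AntiOps p I (Module.End (ZMod p) (Fk p I)) where
  H i := hop _ i
  C i := bop _ i * dop _ i
  HH _ := hop_hop _ _
  CC {i j} _ := mul_mul_anticomm (dop_dop i j) (bop_bop i j) (dop_bop j i).symm (dop_bop i j).symm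
  HC {i j} h := mul_mul_anticomm' (dop_hop_of_ne h.symm) (hop_bop i j)
  sq _ i := hop_hop_self i

/-- The map from the cobar construction to the Fock space: the action on the vacuum vector. -/
def vac : Om p I →ₗ[ZMod p] Fk p I :=
  LinearMap.applyₗ (1 : Fk p I) ∘ₗ (fockOps p I).rho.toLinearMap

variable {p I}

lemma vac_apply (x : Om p I) : vac p I x = (fockOps p I).rho x 1 := rfl

lemma vac_mul (x y : Om p I) : vac p I (x * y) = (fockOps p I).rho x (vac p I y) := by
  simp [vac_apply]

lemma vac_one : vac p I 1 = 1 := by simp [vac_apply]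

lemma vac_d0 (x : Om p I) : vac p I (d0 p I x) = 0 := by
  rw [vac_apply, AntiOps.rho_d0]; rfl

lemma fock_rho_bw (i : I) : (fockOps p I).rho (bw p i) = bop _ i := by
  rw [AntiOps.rho_bw]
  split_ifs
  · exact neg_sub_sq (dop_hop_self i) (hop_bop i i) (hop_hop_self i) (dop_dop_self i) (dop_bop i i)
  · exact add_of_anticomm (dop_hop_self i) (hop_bop i i)

lemma vac_bw_mul (i : I) (x : Om p I) : vac p I (bw p i * x) = bop _ i (vac p I x) := by
  rw [vac_mul, fock_rho_bw]

end FockRep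

end

/-! ### Degrees of words -/

section

section Degrees

variable {p : ℕ} [Fact p.Prime] {I : Type} [DecidableEq I] {G : Type} [AddCommGroup G]

/-- Degrees of words: every letter contributes `ℓ`, and every `t_i` in it contributes `e i`. -/
structure WordWt (I G : Type) where
  /-- the contribution of the bar -/
  ℓ : G
  /-- the degree of `t_i` -/
  e : I → G

/-- The degree of a letter. -/
def WordWt.ldeg (D : WordWt I G) (q : I →₀ ℕ) : G := D.ℓ + q.sum fun i m => m • D.e i

/-- The degree of a word. -/
def WordWt.wdeg (D : WordWt I G) (l : List (Letter p I)) : G := (l.map fun a => D.ldeg a.1).sum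

variable (p) in
/-- The degrees of the generators of the Fock space that correspond to degrees of words. -/
def WordWt.gen (D : WordWt I G) : GenWt I I G where
  h i := D.ℓ + D.e i
  b i := 2 • D.ℓ + p • D.e i

variable (p) in
/-- The part of degree `γ` of the Fock space. -/
def fspan (D : WordWt I G) (γ : G) : Submodule (ZMod p) (Fk p I) :=
  gspan (ZMod p) (D.gen p) ⟨0, 0⟩ γ 0

lemma zero_deg {X Y G : Type} [AddCommGroup G] (L : List X) (c : Y →₀ ℕ) :
    (⟨0, 0⟩ : GenWt X Y G).deg L c = 0 := by
  simp [GenWt.deg, Pi.zero_def]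

variable (D : WordWt I G)

lemma hop_fspan {γ : G} (i : I) {a : Fk p I} (ha : a ∈ fspan p D γ) :
    hop _ i a ∈ fspan p D (γ + (D.ℓ + D.e i)) :=
  gspan_mono (by simp) (hop_gspan i ha)

lemma bop_fspan {γ : G} (i : I) {a : Fk p I} (ha : a ∈ fspan p D γ) :
    bop _ i a ∈ fspan p D (γ + (2 • D.ℓ + p • D.e i)) :=
  gspan_mono (by simp) (bop_gspan i ha)

lemma dop_fspan {γ : G} (i : I) {a : Fk p I} (ha : a ∈ fspan p D γ) :
    dop _ i a ∈ fspan p D (γ - (D.ℓ + D.e i)) :=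
  gspan_mono (by simp) (dop_gspan i ha)

lemma WordWt.ldeg_single (i : I) (m : ℕ) :
    D.ldeg (Finsupp.single i m) = D.ℓ + m • D.e i := by
  rw [ldeg, Finsupp.sum_single_index (by simp)]

lemma op_fspan {γ : G} (i : I) (m : ℕ) {a : Fk p I} (ha : a ∈ fspan p D γ) :
    (fockOps p I).op i m a ∈ fspan p D (γ + (D.ℓ + m • D.e i)) := by
  rw [AntiOps.op, LinearMap.sub_apply]
  refine sub_mem ?_ ?_
  · split_ifs with h
    · subst h; rw [one_smul]; exact hop_fspan D i ha
    · exact zero_mem _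
  · split_ifs with h
    · subst h
      have := bop_fspan D i (dop_fspan D i ha)
      have e : γ - (D.ℓ + D.e i) + (2 • D.ℓ + p • D.e i) = γ + (D.ℓ + (p - 1) • D.e i) := by
        conv_lhs => rw [← Nat.sub_add_cancel (Fact.out : p.Prime).one_le, add_smul]
        rw [two_smul, one_smul]; abel
      rw [e] at this
      exact this
    · exact zero_mem _

lemma tau_fspan {γ : G} (q : I →₀ ℕ) {a : Fk p I} (ha : a ∈ fspan p D γ) :
    (fockOps p I).tau q a ∈ fspan p D (γ + D.ldeg q) := by
  rcases (fockOps p I).tau_cases q with h | ⟨i, m, hm, rfl⟩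
  · rw [h]; exact zero_mem _
  · rw [AntiOps.tau_single _ _ hm, D.ldeg_single]; exact op_fspan D i m ha

lemma vac_ι_mul (a : Letter p I) (x : Om p I) :
    vac p I (FreeAlgebra.ι _ a * x) = (fockOps p I).tau a.1 (vac p I x) := by
  rw [vac_mul, AntiOps.rho_ι]

lemma vac_lt_mul {q : I →₀ ℕ} (hq : Trunc p q) (x : Om p I) :
    vac p I (lt p q * x) = (fockOps p I).tau q (vac p I x) := by
  rw [vac_mul, AntiOps.rho_lt _ hq]

lemma vac_word_mem (l : List (Letter p I)) : vac p I (word _ l) ∈ fspan p D (D.wdeg l) := by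
  induction l with
  | nil =>
    rw [word_nil, vac_one, one_eq_mon]
    exact mon_mem_gspan (by simp [GenWt.deg, WordWt.wdeg]) (by simp [zero_deg])
  | cons a l ih =>
    rw [word_cons, vac_ι_mul]
    have := tau_fspan D a.1 ih
    rwa [add_comm] at this

lemma vac_mem {γ : G} {x : Om p I} (hx : x ∈ wspan _ fun l => D.wdeg l = γ) :
    vac p I x ∈ fspan p D γ :=
  wspan_map (fun l hl => hl ▸ vac_word_mem D l) hx

lemma WordWt.wdeg_append (l l' : List (Letter p I)) : D.wdeg (l ++ l') = D.wdeg l + D.wdeg l' := by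
  simp [wdeg]

lemma WordWt.wdeg_cons (a : Letter p I) (l : List (Letter p I)) :
    D.wdeg (a :: l) = D.ldeg a.1 + D.wdeg l := by
  simp [wdeg]

lemma mul_mem_wdeg {γ γ' : G} {x y : Om p I} (hx : x ∈ wspan _ fun l => D.wdeg l = γ)
    (hy : y ∈ wspan _ fun l => D.wdeg l = γ') : x * y ∈ wspan _ fun l => D.wdeg l = γ + γ' :=
  wspan_mul (fun l l' h h' => by rw [D.wdeg_append, h, h']) hx hy

lemma lt_mem_wdeg (q : I →₀ ℕ) : lt p q ∈ wspan _ fun l => D.wdeg l = D.ldeg q := by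
  rw [lt]
  split_ifs with h
  · rw [← word_singleton]; exact word_mem_wspan (by simp [WordWt.wdeg])
  · exact zero_mem _

lemma one_mem_wdeg : (1 : Om p I) ∈ wspan _ fun l => D.wdeg l = 0 := by
  rw [← word_nil]; exact word_mem_wspan (by simp [WordWt.wdeg])

lemma WordWt.ldeg_add (q q' : I →₀ ℕ) : D.ldeg q + D.ldeg q' = D.ℓ + D.ldeg (q + q') := by
  simp only [ldeg]
  rw [Finsupp.sum_add_index' (by simp) (by intros; rw [add_smul])]; abel

lemma bw_mem_wdeg (i : I) : bw p i ∈ wspan _ fun l => D.wdeg l = (D.gen p).b i := by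
  refine neg_mem (sum_mem fun m hm => ?_)
  rw [Finset.mem_Ioo] at hm
  have := mul_mem_wdeg D (lt_mem_wdeg D (p := p) (Finsupp.single i m))
    (lt_mem_wdeg D (Finsupp.single i (p - m)))
  rwa [D.ldeg_add, ← Finsupp.single_add, D.ldeg_single, Nat.add_sub_cancel' hm.2.le, ← add_assoc,
    ← two_smul ℕ D.ℓ] at this

lemma d0_word_mem (l : List (Letter p I)) :
    d0 p I (word _ l) ∈ wspan _ fun l' => D.wdeg l' = D.ℓ + D.wdeg l := by
  induction l with
  | nil => simp [d0]
  | cons a l ih =>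
    rw [word_cons, d0, der_ι_mul]
    refine sub_mem ?_ ?_
    · have h1 : del0 a ∈ wspan (ZMod p) fun l' => D.wdeg l' = D.ℓ + D.ldeg a.1 := by
        refine neg_mem (sum_mem fun fg hfg => ?_)
        rw [Finset.HasAntidiagonal.mem_antidiagonal] at hfg
        rw [← hfg, ← D.ldeg_add]
        exact mul_mem_wdeg D (lt_mem_wdeg D _) (lt_mem_wdeg D _)
      have := mul_mem_wdeg D h1 (word_mem_wspan (P := fun l' => D.wdeg l' = D.wdeg l) rfl)
      rwa [D.wdeg_cons, ← add_assoc]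
    · have := mul_mem_wdeg D (lt_mem_wdeg D a.1) ih
      rw [lt_letter] at this
      rw [D.wdeg_cons]
      rwa [add_left_comm] at this

lemma d0_mem {γ : G} {x : Om p I} (hx : x ∈ wspan _ fun l => D.wdeg l = γ) :
    d0 p I x ∈ wspan _ fun l => D.wdeg l = D.ℓ + γ :=
  wspan_map (fun l hl => hl ▸ d0_word_mem D l) hx

lemma d0_bw_mul (i : I) (x : Om p I) : d0 p I (bw p i * x) = bw p i * d0 p I x := by
  have h : bw p i ∈ wspan (ZMod p) fun l : List (Letter p I) => l.length = 2 :=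
    neg_mem (sum_mem fun _ _ => lt_mul_mem _ _)
  have := d0_bw (p := p) i
  rw [d0] at this ⊢
  rw [der_mul_of_length _ h, this]; simp

/-- Every element of the Fock space is the image of a cocycle of the same degree: the monomials are
the images of products of the cocycles `[t_i]` and `b_i`. -/
lemma exists_vac_eq {γ : G} {a : Fk p I} (ha : a ∈ fspan p D γ) :
    ∃ z ∈ wspan (ZMod p) fun l : List (Letter p I) => D.wdeg l = γ, d0 p I z = 0 ∧
      vac p I z = a := by
  let N : Submodule (ZMod p) (Om p I) := (wspan (ZMod p) fun l => D.wdeg l = γ) ⊓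
    LinearMap.ker (d0 p I)
  suffices h : fspan p D γ ≤ N.map (vac p I) by
    obtain ⟨z, hz, rfl⟩ := h ha
    exact ⟨z, hz.1, hz.2, rfl⟩
  refine Submodule.span_le.2 ?_
  rintro _ ⟨L, c, rfl, -, rfl⟩
  suffices ∃ z ∈ wspan (ZMod p) fun l : List (Letter p I) => D.wdeg l = (D.gen p).deg L c,
      d0 p I z = 0 ∧ vac p I z = mon (ZMod p) L c by
    obtain ⟨z, h1, h2, h3⟩ := this
    exact ⟨z, ⟨h1, h2⟩, h3⟩
  clear ha N
  induction hn : c.sum (fun _ m => m) generalizing c with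
  | zero =>
    have hc : c = 0 := by
      ext y
      rw [Finsupp.sum, Finset.sum_eq_zero_iff] at hn
      by_contra hy
      exact hy (hn y (Finsupp.mem_support_iff.2 hy))
    subst hc
    induction L with
    | nil =>
      refine ⟨1, ?_, by simp [d0], by rw [vac_one, one_eq_mon]⟩
      rw [show (D.gen p).deg [] 0 = 0 by simp [GenWt.deg]]
      exact one_mem_wdeg D
    | cons i L ih =>
      obtain ⟨z, h1, h2, h3⟩ := ih
      by_cases hi : i ∈ L
      · exact ⟨0, zero_mem _, map_zero _, by rw [map_zero, ← hop_mon, hop_mon_of_mem i L _ hi]⟩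
      have hp := (Fact.out : p.Prime).one_lt
      refine ⟨lt p (Finsupp.single i 1) * z, ?_, ?_, ?_⟩
      · have := mul_mem_wdeg D (lt_mem_wdeg D (Finsupp.single i 1)) h1
        rw [D.ldeg_single, one_smul] at this
        rw [GenWt.deg_cons]; exact this
      · rw [d0_lt_mul, h2, d0_lt (trunc_single.2 hp), Finsupp.antidiagonal_single, Finset.sum_map]
        simp [Finset.Nat.antidiagonal_succ]
      · rw [vac_lt_mul (trunc_single.2 hp), h3, AntiOps.tau_single _ _ one_ne_zero, AntiOps.op,
          if_pos rfl, LinearMap.sub_apply]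
        have : (if 1 = p - 1 then (fockOps p I).C i else 0) (mon _ L 0) = 0 := by
          split_ifs
          · change bop _ i (dop _ i (mon _ L 0)) = 0
            rw [dop_mon_of_not_mem i L _ hi, map_zero]
          · rfl
        rw [this, sub_zero]
        exact hop_mon _ _ _
  | succ n ih =>
    obtain ⟨y, hy⟩ : ∃ y, c y ≠ 0 := by
      by_contra! h
      rw [show c = 0 from Finsupp.ext h] at hn
      simp at hn
    have hc : c - Finsupp.single y 1 + Finsupp.single y 1 = c :=
      tsub_add_cancel_of_le (Finsupp.single_le_iff.2 (Nat.one_le_iff_ne_zero.2 hy))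
    have hs : (c - Finsupp.single y 1).sum (fun _ m => m) = n := by
      have : (c - Finsupp.single y 1 + Finsupp.single y 1).sum (fun _ m => m) = n + 1 := by
        rw [hc, hn]
      rw [Finsupp.sum_add_index' (by simp) (by simp), Finsupp.sum_single_index rfl] at this
      omega
    obtain ⟨z, h1, h2, h3⟩ := ih _ hs
    refine ⟨bw p y * z, ?_, by rw [d0_bw_mul, h2, mul_zero], by rw [vac_bw_mul, h3, bop_mon, hc]⟩
    have := mul_mem_wdeg D (bw_mem_wdeg D y) h1
    rwa [add_comm, ← GenWt.deg_add, hc] at this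

end Degrees

end

/-! ### The Koszul complex of the truncated divided power coalgebra -/

section

section Koszul

variable {p : ℕ} [Fact p.Prime] {I : Type} [DecidableEq I]

variable (p I) in
/-- The Koszul complex: the tensor product of the divided power coalgebra and the Fock space. -/
abbrev Kz : Type := (I →₀ ℕ) →₀ Fk p I

/-- The operator that changes the exponent `r` of `t_i` to `m r` if `P r` holds, and applies `B`. -/
def shift (i : I) (P : ℕ → Prop) [DecidablePred P] (m : ℕ → ℕ)
    (B : Module.End (ZMod p) (Fk p I)) : Module.End (ZMod p) (Kz p I) :=
  Finsupp.lsum (ZMod p) fun q =>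
    if P (q i) then Finsupp.lsingle (q.update i (m (q i))) ∘ₗ B else 0

lemma shift_single (i : I) (P : ℕ → Prop) [DecidablePred P] (m : ℕ → ℕ)
    (B : Module.End (ZMod p) (Fk p I)) (q : I →₀ ℕ) (a : Fk p I) :
    shift i P m B (Finsupp.single q a) =
      if P (q i) then Finsupp.single (q.update i (m (q i))) (B a) else 0 := by
  rw [shift, Finsupp.lsum_single]
  split_ifs <;> rfl

lemma shift_shift {i j : I} (h : i ≠ j) {P P' : ℕ → Prop} [DecidablePred P] [DecidablePred P']
    {m m' : ℕ → ℕ} {B B' : Module.End (ZMod p) (Fk p I)} (hB : B * B' = -(B' * B)) (x : Kz p I) :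
    shift i P m B (shift j P' m' B' x) = -shift j P' m' B' (shift i P m B x) := by
  induction x using Finsupp.induction_linear with
  | zero => simp
  | add x y hx hy => simp only [map_add, hx, hy, neg_add]
  | single q a =>
    have e1 : ∀ r, (q.update j r) i = q i := fun r => by
      rw [Finsupp.update_apply, if_neg h]
    have e2 : ∀ r, (q.update i r) j = q j := fun r => by
      rw [Finsupp.update_apply, if_neg h.symm]
    have e3 : B (B' a) = -B' (B a) := LinearMap.congr_fun hB a
    rw [shift_single, shift_single]
    by_cases h1 : P (q i)
    · by_cases h2 : P' (q j)
      · rw [if_pos h1, if_pos h2, shift_single, shift_single, e1, e2, if_pos h1, if_pos h2, e3,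
          Finsupp.update_comm _ h, Finsupp.single_neg]
      · rw [if_pos h1, if_neg h2, shift_single, e2, if_neg h2]; simp
    · by_cases h2 : P' (q j)
      · rw [if_neg h1, if_pos h2, shift_single, e1, if_neg h1]; simp
      · rw [if_neg h1, if_neg h2]; simp

/-- The part of the Koszul differential that belongs to the generator `t_j`. -/
def kd (j : I) : Module.End (ZMod p) (Kz p I) :=
  shift j (1 ≤ ·) (· - 1) (hop _ j) - shift j (· = p - 1) (fun _ => 0) (bop _ j * dop _ j)

/-- The contraction of the part of the Koszul complex that belongs to the generator `t_i`. -/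
def kσ (i : I) : Module.End (ZMod p) (Kz p I) :=
  shift i (· < p - 1) (· + 1) (dop _ i) - shift i (· = 0) (fun _ => p - 1) (binv _ i * hop _ i)

/-- The projection onto the part without `t_i`, `h_i`, `b_i`. -/
def ke (i : I) : Module.End (ZMod p) (Kz p I) := shift i (· = 0) (fun _ => 0) (eop _ i i)

lemma anticomm_symm {B : Type*} [Ring B] {a b : B} (h : a * b = -(b * a)) : b * a = -(a * b) := by
  rw [h, neg_neg]

lemma kd_kσ_of_ne {i j : I} (h : j ≠ i) (x : Kz p I) : kd j (kσ i x) = -kσ i (kd j x) := by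
  have h1 := shift_shift (p := p) h (P := (1 ≤ ·)) (P' := (· < p - 1)) (m := (· - 1))
    (m' := (· + 1)) (anticomm_symm (dop_hop_of_ne h.symm)) x
  have h2 := shift_shift (p := p) h (P := (1 ≤ ·)) (P' := (· = 0)) (m := (· - 1))
    (m' := fun _ => p - 1) (mul_mul_anticomm' (hop_hop i j) (hop_binv j i)) x
  have h3 := shift_shift (p := p) h (P := (· = p - 1)) (P' := (· < p - 1)) (m := fun _ => 0)
    (m' := (· + 1)) (anticomm_symm (mul_mul_anticomm' (dop_dop j i) (dop_bop i j))) x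
  have h4 := shift_shift (p := p) h (P := (· = p - 1)) (P' := (· = 0)) (m := fun _ => 0)
    (m' := fun _ => p - 1) (mul_mul_anticomm (dop_hop_of_ne h) (binv_bop_of_ne h.symm).symm
      (hop_bop i j).symm (dop_binv j i).symm) x
  simp only [kd, kσ, LinearMap.sub_apply, map_sub]
  rw [h1, h2, h3, h4]; abel

lemma fock_rel {B : Type*} [Ring B] {h d b v : B} (hh : h * h = 0)
    (dd : d * d = 0) (vb : v * b = 1) (hb : Commute h b) (hv : Commute h v) (db : Commute d b)
    (dv : Commute d v) :
    h * (v * h) = 0 ∧ (b * d) * d = 0 ∧ (b * d) * (v * h) = b * v * (d * h) ∧ v * h * h = 0 ∧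
      (d * (b * d)) = 0 ∧ (v * h) * (b * d) = h * d := by
  refine ⟨?_, ?_, ?_, ?_, ?_, ?_⟩
  · rw [← mul_assoc, hv.eq, mul_assoc, hh, mul_zero]
  · rw [mul_assoc, dd, mul_zero]
  · rw [mul_assoc, ← mul_assoc d, dv.eq, mul_assoc, mul_assoc]
  · rw [mul_assoc, hh, mul_zero]
  · rw [← mul_assoc, db.eq, mul_assoc, dd, mul_zero]
  · rw [mul_assoc, ← mul_assoc h, hb.eq, mul_assoc, ← mul_assoc, vb, one_mul]

/-- The Koszul complex of a single generator is contractible. -/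
lemma kd_kσ_self (i : I) {q : I →₀ ℕ} (hq : Trunc p q) (a : Fk p I) :
    kd i (kσ i (Finsupp.single q a)) + kσ i (kd i (Finsupp.single q a)) =
      Finsupp.single q a - ke i (Finsupp.single q a) := by
  obtain ⟨r1, r2, r3, r4, r5, r6⟩ := fock_rel (hop_hop_self (R := ZMod p) (Y := I) i)
    (dop_dop_self i) (binv_bop_self i) (hop_bop i i) (hop_binv i i) (dop_bop i i)
    (dop_binv i i)
  have hp := (Fact.out : p.Prime).two_le
  have hqi := hq i
  have s1 : ∀ a, hop (ZMod p) (Y := I) i (binv _ i (hop _ i a)) = 0 := LinearMap.congr_fun r1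
  have s2 : ∀ a, bop (ZMod p) i (dop _ i (dop (Y := I) _ i a)) = 0 := LinearMap.congr_fun r2
  have s3 : ∀ a, bop (ZMod p) i (dop (Y := I) _ i (binv _ i (hop _ i a))) =
    bop _ i (binv _ i (dop _ i (hop _ i a))) := LinearMap.congr_fun r3
  have s4 : ∀ a, binv (ZMod p) (Y := I) i (hop _ i (hop _ i a)) = 0 := LinearMap.congr_fun r4
  have s5 : ∀ a, dop (ZMod p) i (bop (Y := I) _ i (dop _ i a)) = 0 := LinearMap.congr_fun r5
  have s6 : ∀ a, binv (ZMod p) i (hop (Y := I) _ i (bop _ i (dop _ i a))) =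
    hop _ i (dop _ i a) := LinearMap.congr_fun r6
  have s7 : ∀ a, dop (ZMod p) i (hop (Y := I) _ i a) + hop _ i (dop _ i a) = a := fun a => by
    have := LinearMap.congr_fun (dop_hop_self (R := ZMod p) (Y := I) i) a
    rw [LinearMap.sub_apply] at this
    exact add_eq_of_eq_sub this
  have s8 : ∀ a, eop (ZMod p) i i a = dop (ZMod p) i (hop (Y := I) _ i a) -
    bop _ i (binv _ i (dop _ i (hop _ i a))) := fun a => rfl
  have u0 : ∀ r, q i = r → q.update i r = q := fun r hr => by rw [← hr, Finsupp.update_self]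
  have up : ∀ r, (q.update i r) i = r := fun r => by rw [Finsupp.update_apply, if_pos rfl]
  simp only [kd, kσ, ke, LinearMap.sub_apply, map_sub, shift_single, apply_ite, map_zero, up,
    Finsupp.update_idem, Module.End.mul_apply, s1, s2, s3, s4, s5, s6, s8, Finsupp.single_zero]
  rcases Nat.eq_zero_or_pos (q i) with h0 | h0
  · have c1 : 0 < p - 1 := by omega
    have c2 : ¬ (0 = p - 1) := by omega
    have c3 : 1 ≤ p - 1 := by omega
    simp only [h0, c1, c2, c3, if_true, if_false, zero_add, le_refl, Nat.sub_self, u0 0 h0,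
      sub_zero, ite_self]
    conv_rhs => arg 1; rw [← s7 a]
    rw [Finsupp.single_add, Finsupp.single_sub]; abel
  · have c0 : ¬ (q i = 0) := by omega
    have c1 : 1 ≤ q i := h0
    have c2 : q i - 1 < p - 1 := by omega
    have c3 : q i - 1 + 1 = q i := by omega
    have c5 : 0 < p - 1 := by omega
    by_cases h1 : q i = p - 1
    · have c4 : ¬ q i < p - 1 := by omega
      have u1 : q.update i (p - 1) = q := u0 _ h1
      simp only [c0, c1, c2, c3, c4, c5, if_true, if_false, Finsupp.update_self, ite_self, sub_zero,
        zero_sub, zero_add, u0 _ h1, if_pos h1, sub_neg_eq_add]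
      rw [← Finsupp.single_add, s7]
    · have c4 : q i < p - 1 := by omega
      simp only [c0, c1, c2, c3, c4, if_true, if_false, Finsupp.update_self, ite_self, sub_zero,
        zero_sub, h1, sub_neg_eq_add, Nat.le_add_left, Nat.add_sub_cancel]
      rw [← Finsupp.single_add, add_comm, s7]

/-- The differential of the Koszul complex. -/
def kD : Module.End (ZMod p) (Kz p I) :=
  Finsupp.lsum (ZMod p) fun q => ∑ fg ∈ Finset.HasAntidiagonal.antidiagonal q,
    Finsupp.lsingle fg.1 ∘ₗ (fockOps p I).tau fg.2

lemma kD_single (q : I →₀ ℕ) (a : Fk p I) : kD (Finsupp.single q a) =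
    ∑ fg ∈ Finset.HasAntidiagonal.antidiagonal q,
      Finsupp.single fg.1 ((fockOps p I).tau fg.2 a) := by
  rw [kD, Finsupp.lsum_single, LinearMap.sum_apply]; rfl

lemma sum_antidiagonal_assoc {N : Type*} [AddCommMonoid N] (q : I →₀ ℕ)
    (F : (I →₀ ℕ) → (I →₀ ℕ) → (I →₀ ℕ) → N) :
    ∑ x ∈ Finset.HasAntidiagonal.antidiagonal q, ∑ y ∈ Finset.HasAntidiagonal.antidiagonal x.1,
      F y.1 y.2 x.2 = ∑ x ∈ Finset.HasAntidiagonal.antidiagonal q,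
        ∑ y ∈ Finset.HasAntidiagonal.antidiagonal x.2, F x.1 y.1 y.2 := by
  rw [Finset.sum_sigma', Finset.sum_sigma']
  refine Finset.sum_nbij' (fun z => ⟨(z.2.1, z.2.2 + z.1.2), (z.2.2, z.1.2)⟩)
    (fun z => ⟨(z.1.1 + z.2.1, z.2.2), (z.1.1, z.2.1)⟩) ?_ ?_ ?_ ?_ ?_
  · rintro ⟨⟨a, b⟩, ⟨c, d⟩⟩ h
    simp only [Finset.mem_sigma, Finset.HasAntidiagonal.mem_antidiagonal] at h ⊢
    exact ⟨by rw [← add_assoc, h.2, h.1], trivial⟩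
  · rintro ⟨⟨a, b⟩, ⟨c, d⟩⟩ h
    simp only [Finset.mem_sigma, Finset.HasAntidiagonal.mem_antidiagonal] at h ⊢
    exact ⟨by rw [add_assoc, h.2, h.1], trivial⟩
  · rintro ⟨⟨a, b⟩, ⟨c, d⟩⟩ h
    simp only [Finset.mem_sigma, Finset.HasAntidiagonal.mem_antidiagonal] at h ⊢
    rw [h.2]
  · rintro ⟨⟨a, b⟩, ⟨c, d⟩⟩ h
    simp only [Finset.mem_sigma, Finset.HasAntidiagonal.mem_antidiagonal] at h ⊢
    rw [h.2]
  · rintro ⟨⟨a, b⟩, ⟨c, d⟩⟩ h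
    rfl

lemma kD_kD_single {q : I →₀ ℕ} (hq : Trunc p q) (a : Fk p I) :
    kD (kD (Finsupp.single q a)) = 0 := by
  simp only [kD_single, map_sum]
  rw [sum_antidiagonal_assoc q fun f g h =>
    Finsupp.single f ((fockOps p I).tau g ((fockOps p I).tau h a))]
  refine Finset.sum_eq_zero fun x hx => ?_
  rw [Finset.HasAntidiagonal.mem_antidiagonal] at hx
  have := LinearMap.congr_fun ((fockOps p I).sum_tau_tau (hq.mono (hx ▸ le_add_self))) a
  rw [LinearMap.sum_apply] at this
  simp only [Module.End.mul_apply] at this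
  rw [← Finsupp.single_finsetSum, this]
  simp

lemma sum_antidiagonal_single {N : Type*} [AddCommMonoid N] (q : I →₀ ℕ) (j : I) (m : ℕ)
    (F : (I →₀ ℕ) → N) :
    ∑ x ∈ Finset.HasAntidiagonal.antidiagonal q, (if x.2 = Finsupp.single j m then F x.1 else 0) =
      if m ≤ q j then F (q.update j (q j - m)) else 0 := by
  classical
  have e : (Finset.HasAntidiagonal.antidiagonal q).filter (fun x => x.2 = Finsupp.single j m) =
      if Finsupp.single j m ≤ q then {(q - Finsupp.single j m, Finsupp.single j m)} else ∅ := by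
    convert Finset.HasAntidiagonal.filter_snd_eq_antidiagonal q (Finsupp.single j m)
  rw [← Finset.sum_filter, e]
  by_cases h : m ≤ q j
  · rw [if_pos h, if_pos, Finset.sum_singleton]
    · congr 1
      ext i
      rw [Finsupp.update_apply, Finsupp.tsub_apply, Finsupp.single_apply]
      split_ifs with h1 h2 h2
      · rw [h2]
      · exact absurd h1.symm h2
      · exact absurd h2.symm h1
      · simp
    · intro i
      rw [Finsupp.single_apply]
      split_ifs with h1
      · rw [← h1]; exact h
      · exact Nat.zero_le _
  · rw [if_neg h, if_neg, Finset.sum_empty]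
    intro h'
    exact h (by simpa using h' j)

lemma kD_eq_sum {T : Finset I} {q : I →₀ ℕ} (hq : Trunc p q) (hT : q.support ⊆ T) (a : Fk p I) :
    kD (Finsupp.single q a) = ∑ j ∈ T, kd j (Finsupp.single q a) := by
  rw [kD_single]
  have : ∀ x ∈ Finset.HasAntidiagonal.antidiagonal q,
      Finsupp.single x.1 ((fockOps p I).tau x.2 a) = ∑ j ∈ T,
        ((if x.2 = Finsupp.single j 1 then Finsupp.single x.1 (hop _ j a) else 0) -
        (if x.2 = Finsupp.single j (p - 1) then Finsupp.single x.1 (bop _ j (dop _ j a)) else 0)) := by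
    intro x hx
    rw [Finset.HasAntidiagonal.mem_antidiagonal] at hx
    rw [(fockOps p I).tau_eq_sum ((Finsupp.support_mono (hx ▸ le_add_self)).trans hT),
      LinearMap.sum_apply, Finsupp.single_finsetSum]
    refine Finset.sum_congr rfl fun j _ => ?_
    rw [LinearMap.sub_apply, Finsupp.single_sub]
    congr 1 <;> split_ifs <;> first | rfl | exact Finsupp.single_zero _
  rw [Finset.sum_congr rfl this, Finset.sum_comm]
  refine Finset.sum_congr rfl fun j _ => ?_
  rw [Finset.sum_sub_distrib, sum_antidiagonal_single q j 1 fun f => Finsupp.single f (hop _ j a),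
    sum_antidiagonal_single q j (p - 1) fun f => Finsupp.single f (bop _ j (dop _ j a)), kd,
    LinearMap.sub_apply, shift_single, shift_single]
  congr 1
  have := hq j
  by_cases h : q j = p - 1
  · rw [if_pos h.ge, if_pos h, h, Nat.sub_self]; rfl
  · rw [if_neg (by omega), if_neg h]

/-- The weights of the generators whose index is not in `T`. -/
def outWt (T : Finset I) : GenWt I I ℤ where
  h i := if i ∈ T then 0 else 1
  b i := if i ∈ T then 0 else 1

/-- Cohomological degrees of words: the number of letters. -/
def lenWt (I : Type) : WordWt I ℤ := ⟨1, 0⟩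

/-- The part of cohomological degree `m` of the Koszul complex on the generators in `T`. -/
def kspan (m : ℤ) (T : Finset I) : Submodule (ZMod p) (Kz p I) :=
  Submodule.span _ {x | ∃ q a, Trunc p q ∧ q.support ⊆ T ∧
    a ∈ gspan (ZMod p) ((lenWt I).gen p) (outWt T) m 0 ∧ x = Finsupp.single q a}

lemma gspan_outWt_mono {T T' : Finset I} (h : T ⊆ T') {m : ℤ} :
    gspan (ZMod p) ((lenWt I).gen p) (outWt T) m 0 ≤
      gspan (ZMod p) ((lenWt I).gen p) (outWt T') m 0 := by
  refine Submodule.span_mono ?_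
  rintro _ ⟨L, c, h1, h2, rfl⟩
  refine ⟨L, c, h1, le_trans ?_ h2, rfl⟩
  have h3 : ∀ i, (if i ∈ T' then (0 : ℤ) else 1) ≤ if i ∈ T then 0 else 1 := by
    intro i
    by_cases hi : i ∈ T
    · rw [if_pos hi, if_pos (h hi)]
    · rw [if_neg hi]; split_ifs <;> simp
  exact add_le_add (List.sum_le_sum fun i _ => h3 i)
    (Finset.sum_le_sum fun i _ => nsmul_le_nsmul_right (h3 i) _)

lemma kspan_mono {T T' : Finset I} (h : T ⊆ T') {m : ℤ} :
    kspan (p := p) m T ≤ kspan m T' := by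
  refine Submodule.span_mono ?_
  rintro _ ⟨q, a, h1, h2, h3, rfl⟩
  exact ⟨q, a, h1, h2.trans h, gspan_outWt_mono h h3, rfl⟩

lemma kspan_map {N : Type*} [AddCommGroup N] [Module (ZMod p) N] {m : ℤ} {T : Finset I}
    {f : Kz p I →ₗ[ZMod p] N} {P : Submodule (ZMod p) N}
    (h : ∀ q a, Trunc p q → q.support ⊆ T →
      a ∈ gspan (ZMod p) ((lenWt I).gen p) (outWt T) m 0 → f (Finsupp.single q a) ∈ P)
    {x : Kz p I} (hx : x ∈ kspan m T) : f x ∈ P := by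
  rw [← Submodule.mem_comap]
  refine Submodule.span_le.2 ?_ hx
  rintro _ ⟨q, a, h1, h2, h3, rfl⟩
  exact h q a h1 h2 h3

lemma kspan_ext {N : Type*} [AddCommGroup N] [Module (ZMod p) N] {m : ℤ} {T : Finset I}
    {f g : Kz p I →ₗ[ZMod p] N} (h : ∀ q a, Trunc p q → q.support ⊆ T →
      f (Finsupp.single q a) = g (Finsupp.single q a)) {x : Kz p I} (hx : x ∈ kspan m T) :
    f x = g x := by
  have := kspan_map (P := ⊥) (f := f - g) (fun q a h1 h2 _ => by
    rw [LinearMap.sub_apply, h q a h1 h2, sub_self]; exact zero_mem _) hx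
  rw [Submodule.mem_bot, LinearMap.sub_apply] at this
  exact sub_eq_zero.1 this

lemma shift_mem {i : I} {T : Finset I} {P : ℕ → Prop} [DecidablePred P] {m : ℕ → ℕ}
    {B : Module.End (ZMod p) (Fk p I)} {s s' : ℤ} (hi : i ∈ T) (hm : ∀ r, r < p → P r → m r < p)
    (hB : ∀ a, a ∈ gspan (ZMod p) ((lenWt I).gen p) (outWt T) s 0 →
      B a ∈ gspan (ZMod p) ((lenWt I).gen p) (outWt T) s' 0) {x : Kz p I} (hx : x ∈ kspan s T) :
    shift i P m B x ∈ kspan s' T := by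
  refine kspan_map (fun q a h1 h2 h3 => ?_) hx
  rw [shift_single]
  split_ifs with h
  · refine Submodule.subset_span ⟨_, _, ?_, ?_, hB a h3, rfl⟩
    · intro j
      rw [Finsupp.update_apply]
      split_ifs with hj
      · exact hm _ (h1 i) h
      · exact h1 j
    · exact (Finsupp.support_update_subset _ _).trans (Finset.insert_subset hi h2)
  · exact zero_mem _

lemma kσ_mem {i : I} {T : Finset I} (hi : i ∈ T) {m : ℤ} {x : Kz p I} (hx : x ∈ kspan m T) :
    kσ i x ∈ kspan (m - 1) T := by
  have hp := (Fact.out : p.Prime).two_le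
  have w0 : (outWt T).h i = 0 := if_pos hi
  have w1 : (outWt T).b i = 0 := if_pos hi
  have g0 : ((lenWt I).gen p).h i = 1 := by simp [lenWt, WordWt.gen]
  have g1 : ((lenWt I).gen p).b i = 2 := by simp [lenWt, WordWt.gen]
  refine sub_mem (shift_mem hi (fun r _ _ => by omega) (fun a ha => ?_) hx)
    (shift_mem hi (fun r _ _ => by omega) (fun a ha => ?_) hx)
  · have := dop_gspan i ha
    rwa [w0, g0, sub_zero] at this
  · have := binv_gspan i (hop_gspan i ha)
    rw [w0, g0, w1, g1, add_zero, sub_zero] at this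
    convert this using 1
    ring_nf
    rfl

lemma ke_mem {i : I} {T : Finset I} {m : ℤ} {x : Kz p I}
    (hx : x ∈ kspan m (insert i T)) : ke i x ∈ kspan m T := by
  refine kspan_map (fun q a h1 h2 h3 => ?_) hx
  rw [ke, shift_single]
  split_ifs with h
  · refine Submodule.subset_span ⟨q, _, h1, ?_, ?_, by rw [← h, Finsupp.update_self]⟩
    · intro j hj
      rcases Finset.mem_insert.1 (h2 hj) with rfl | hj'
      · exact absurd h (Finsupp.mem_support_iff.1 hj)
      · exact hj'
    · refine gspan_induction (fun L c _ e1 e2 => ?_) h3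
      rw [eop_mon]
      split_ifs with h'
      · exact zero_mem _
      · push Not at h'
        refine mon_mem_gspan e1 (le_trans (le_of_eq ?_) e2)
        rw [GenWt.deg, GenWt.deg]
        congr 1
        · refine congrArg List.sum (List.map_congr_left fun j hj => ?_)
          have : j ≠ i := fun hji => h'.1 (hji ▸ hj)
          simp [outWt, this]
        · refine Finset.sum_congr rfl fun j hj => ?_
          have : j ≠ i := fun hji => Finsupp.mem_support_iff.1 hj (hji ▸ h'.2)
          simp [outWt, this]
  · exact zero_mem _

/-- The homotopy of the generator `t_i` contracts the Koszul complex onto the part without this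
generator, since it anticommutes with the differentials of the other generators. -/
lemma kD_kσ {i : I} {T : Finset I} (hi : i ∈ T) {m : ℤ} {x : Kz p I} (hx : x ∈ kspan m T) :
    kD (kσ i x) + kσ i (kD x) = x - ke i x := by
  have hD : ∀ {m} {x : Kz p I}, x ∈ kspan m T → kD x = (∑ j ∈ T, kd j) x := fun hx =>
    kspan_ext (fun q a h1 h2 => by rw [kD_eq_sum h1 h2, LinearMap.sum_apply]) hx
  rw [hD (kσ_mem hi hx), hD hx, LinearMap.sum_apply, LinearMap.sum_apply, map_sum,
    ← Finset.sum_add_distrib, ← Finset.add_sum_erase _ _ hi, Finset.sum_eq_zero, add_zero]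
  · refine kspan_ext (f := kd i ∘ₗ kσ i + kσ i ∘ₗ kd i) (g := LinearMap.id - ke i)
      (fun q a h1 h2 => ?_) hx
    exact kd_kσ_self i h1 a
  · intro j hj
    rw [kd_kσ_of_ne (Finset.ne_of_mem_erase hj), neg_add_cancel]

lemma kspan_empty {m : ℤ} {x : Kz p I} (hx : x ∈ kspan m (∅ : Finset I)) (h0 : x 0 = 0) : x = 0 := by
  have : x = Finsupp.single 0 (x 0) :=
    kspan_ext (f := LinearMap.id) (g := Finsupp.lsingle 0 ∘ₗ Finsupp.lapply 0)
      (fun q a _ h2 => by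
        rw [Finset.subset_empty, Finsupp.support_eq_empty] at h2
        subst h2; simp) hx
  rw [this, h0, Finsupp.single_zero]

lemma kD_kD {m : ℤ} {T : Finset I} {x : Kz p I} (hx : x ∈ kspan m T) : kD (kD x) = 0 :=
  kspan_ext (f := kD ∘ₗ kD) (g := 0) (fun _ a h1 _ => kD_kD_single h1 a) hx

/-- The Koszul complex is acyclic, except for its elements of exponent zero: the homotopies remove
the generators one at a time. -/
lemma kD_exact (T : Finset I) {m : ℤ} {x : Kz p I} (hx : x ∈ kspan m T) (h0 : x 0 = 0)
    (hd : kD x = 0) : ∃ y ∈ kspan (p := p) (m - 1) T, kD y = x := by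
  induction T using Finset.induction_on generalizing x with
  | empty => exact ⟨0, zero_mem _, by rw [map_zero, kspan_empty hx h0]⟩
  | insert i T _ ih =>
    have hi := Finset.mem_insert_self i T
    have h1 := kD_kσ hi hx
    rw [hd, map_zero, add_zero] at h1
    have h2 : ke i x = x - kD (kσ i x) := by rw [h1]; abel
    have h3 : (ke i x) 0 = 0 := by
      suffices Finsupp.lapply (R := ZMod p) 0 ∘ₗ ke i =
          eop (ZMod p) (X := I) (Y := I) i i ∘ₗ Finsupp.lapply 0 by
        have h4 := LinearMap.congr_fun this x
        simp only [LinearMap.comp_apply, Finsupp.lapply_apply, h0, map_zero] at h4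
        exact h4
      refine Finsupp.lhom_ext fun q a => ?_
      simp only [LinearMap.comp_apply, ke, shift_single, Finsupp.lapply_apply]
      by_cases hq : q = 0
      · subst hq; simp
      · have e0 : ∀ b : Fk p I, Finsupp.single q b 0 = 0 := fun b =>
          Finsupp.single_eq_of_ne (Ne.symm hq)
        rw [e0]
        refine Eq.trans ?_ (map_zero _).symm
        split_ifs with h
        · rw [← h, Finsupp.update_self, e0]
        · rfl
    obtain ⟨y, hy, hy'⟩ := ih (ke_mem hx) h3 (by
      rw [h2, map_sub, hd, kD_kD (kσ_mem hi hx), sub_zero])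
    refine ⟨y + kσ i x, add_mem ?_ (kσ_mem hi hx), by rw [map_add, hy', h2]; abel⟩
    exact kspan_mono (Finset.subset_insert i T) hy

end Koszul

end

/-! ### The cohomology of the cobar construction -/

section

instance {R X Y : Type} [CommRing R] [Nontrivial R] : Nontrivial (Fock R X Y) := by
  let f : ExteriorAlgebra R (X →₀ R) ⊗[R] MvPolynomial Y R →ₐ[R] R :=
    Algebra.TensorProduct.lift ExteriorAlgebra.algebraMapInv (MvPolynomial.aeval fun _ => 0)
      fun _ _ => mul_comm _ _
  refine ⟨(1 : ExteriorAlgebra R (X →₀ R) ⊗[R] MvPolynomial Y R), (0 : _ ⊗[R] _), fun h => ?_⟩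
  have := congrArg f h
  rw [map_one, map_zero] at this
  exact one_ne_zero this

section Exact

variable {p : ℕ} [Fact p.Prime] {I : Type} [DecidableEq I]

variable (p I) in
/-- The chain map from the cobar construction to the Koszul complex that cuts off the first letter
and maps the rest to the Fock space. -/
def fockUncap : Om p I →ₗ[ZMod p] Kz p I :=
  Finsupp.lmapDomain (Fk p I) (ZMod p) Subtype.val ∘ₗ
    (Finsupp.mapRange.linearMap (vac p I) : (Letter p I →₀ Om p I) →ₗ[ZMod p] _) ∘ₗ uncap

lemma fockUncap_apply (x : Om p I) (a : Letter p I) : fockUncap p I x a.1 = vac p I (uncap x a) := by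
  simp only [fockUncap, LinearMap.comp_apply, Finsupp.lmapDomain_apply]
  rw [Finsupp.mapDomain_apply Subtype.val_injective]; rfl

lemma fockUncap_apply_of_not (x : Om p I) {q : I →₀ ℕ} (hq : ¬ (q ≠ 0 ∧ Trunc p q)) :
    fockUncap p I x q = 0 := by
  simp only [fockUncap, LinearMap.comp_apply, Finsupp.lmapDomain_apply]
  exact Finsupp.mapDomain_of_notMem_range _ _ (by simpa using hq)

lemma fockUncap_ι_mul (a : Letter p I) (x : Om p I) :
    fockUncap p I (FreeAlgebra.ι _ a * x) = Finsupp.single a.1 (vac p I x) := by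
  simp only [fockUncap, LinearMap.comp_apply, Finsupp.lmapDomain_apply, uncap_ι_mul]
  simp

lemma fockUncap_lt_mul {q : I →₀ ℕ} (hq : Trunc p q) (x : Om p I) :
    fockUncap p I (lt p q * x) =
      Finsupp.single q (vac p I x) - (if q = 0 then Finsupp.single 0 (vac p I x) else 0) := by
  by_cases h0 : q = 0
  · subst h0; simp
  · rw [if_neg h0, sub_zero, lt, dif_pos ⟨h0, hq⟩, fockUncap_ι_mul]

lemma fockUncap_d0 {x : Om p I} (hx : x ∈ wspan _ fun l : List (Letter p I) => l ≠ []) :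
    fockUncap p I (d0 p I x) = Finsupp.single 0 (vac p I x) - kD (fockUncap p I x) := by
  have : x ∈ LinearMap.eqLocus (fockUncap p I ∘ₗ d0 p I)
      (Finsupp.lsingle 0 ∘ₗ vac p I - kD ∘ₗ fockUncap p I) := by
    refine wspan_le (fun l hl => ?_) hx
    cases l with
    | nil => exact absurd rfl hl
    | cons a l =>
      rw [LinearMap.mem_eqLocus, LinearMap.sub_apply, LinearMap.comp_apply, LinearMap.comp_apply,
        LinearMap.comp_apply, word_cons, ← lt_letter, d0_lt_mul, d0_lt a.2.2, neg_mul,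
        Finset.sum_mul, map_sub, map_neg, map_sum, lt_letter, fockUncap_ι_mul, fockUncap_ι_mul,
        vac_d0, Finsupp.single_zero, sub_zero, kD_single, Finsupp.lsingle_apply, vac_ι_mul]
      have : ∀ fg ∈ Finset.HasAntidiagonal.antidiagonal a.1,
          fockUncap p I (lt p fg.1 * lt p fg.2 * word _ l) =
            Finsupp.single fg.1 ((fockOps p I).tau fg.2 (vac p I (word _ l))) -
            if fg = (0, a.1) then Finsupp.single 0 ((fockOps p I).tau a.1 (vac p I (word _ l)))
            else 0 := by
        intro fg hfg
        rw [Finset.HasAntidiagonal.mem_antidiagonal] at hfg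
        rw [mul_assoc, fockUncap_lt_mul (a.2.2.mono (hfg ▸ le_self_add)),
          vac_lt_mul (a.2.2.mono (hfg ▸ le_add_self))]
        congr 1
        by_cases h : fg.1 = 0
        · have h2 : fg.2 = a.1 := by rw [← hfg, h, zero_add]
          rw [if_pos h, if_pos (Prod.ext h h2), h2]
        · rw [if_neg h, if_neg fun h' => h (by rw [h'])]
      rw [Finset.sum_congr rfl this, Finset.sum_sub_distrib, Finset.sum_ite_eq', if_pos]
      · abel
      · rw [Finset.HasAntidiagonal.mem_antidiagonal, zero_add]
  exact this

lemma uncap_lt_mul (q : I →₀ ℕ) (x : Om p I) (f : Letter p I) :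
    uncap (lt p q * x) f = if q = f.1 then x else 0 := by
  classical
  rw [lt]
  split_ifs with h h1 h1
  · rw [uncap_ι_mul]; subst h1; rw [Finsupp.single_eq_same]
  · rw [uncap_ι_mul, Finsupp.single_eq_of_ne]
    rintro rfl; exact h1 rfl
  · exact absurd (h1 ▸ f.2) h
  · simp

/-- The leading terms of a differential. -/
lemma uncap_d0 {x : Om p I} (hx : x ∈ wspan _ fun l : List (Letter p I) => l ≠ []) {N : ℕ}
    (hN : ∀ a, uncap x a ≠ 0 → a.1.degree ≤ N) (f : Letter p I) (hf : N ≤ f.1.degree) :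
    uncap (d0 p I x) f = -d0 p I (uncap x f) := by
  classical
  conv_lhs => rw [eq_sum_uncap hx]
  rw [Finsupp.sum, map_sum, map_sum, Finsupp.finsetSum_apply]
  have : ∀ a ∈ (uncap x).support, uncap (d0 p I (FreeAlgebra.ι _ a * uncap x a)) f =
      if a = f then -d0 p I (uncap x f) else 0 := by
    intro a ha
    have haN := hN a (Finsupp.mem_support_iff.1 ha)
    rw [← lt_letter, d0_lt_mul, d0_lt a.2.2, neg_mul, Finset.sum_mul, map_sub, map_neg, map_sum,
      Finsupp.sub_apply, Finsupp.neg_apply, Finsupp.finsetSum_apply, Finset.sum_eq_zero, neg_zero,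
      zero_sub, uncap_lt_mul]
    · by_cases h : a = f
      · rw [if_pos h, if_pos (congrArg _ h), h]
      · rw [if_neg h, if_neg fun h' => h (Subtype.ext h'), neg_zero]
    · intro fg hfg
      rw [Finset.HasAntidiagonal.mem_antidiagonal] at hfg
      rw [mul_assoc, uncap_lt_mul]
      split_ifs with h
      · have h2 : fg.2 = 0 := by
          rw [← Finsupp.degree_eq_zero_iff]
          have := congrArg Finsupp.degree hfg
          rw [map_add, h] at this
          omega
        rw [h2]; simp
      · rfl
  rw [Finset.sum_congr rfl this, Finset.sum_ite_eq']
  split_ifs with h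
  · rfl
  · rw [Finsupp.notMem_support_iff.1 h, map_zero, neg_zero]

lemma lenWt_ldeg (q : I →₀ ℕ) : (lenWt I).ldeg q = 1 := by
  simp [lenWt, WordWt.ldeg]

lemma lenWt_wdeg (l : List (Letter p I)) : (lenWt I).wdeg l = l.length := by
  induction l with
  | nil => rfl
  | cons a l ih => rw [WordWt.wdeg_cons, ih, lenWt_ldeg, List.length_cons]; push_cast; ring

/-- Elements of cohomological degree `s` of the cobar construction. -/
abbrev lspan (p : ℕ) (I : Type) (s : ℤ) : Submodule (ZMod p) (Om p I) :=
  wspan (ZMod p) fun l : List (Letter p I) => (lenWt I).wdeg l = s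

lemma ne_nil_of_lspan {s : ℕ} {x : Om p I} (hx : x ∈ lspan p I (s + 1 : ℕ)) :
    x ∈ wspan (ZMod p) fun l : List (Letter p I) => l ≠ [] := by
  refine wspan_mono (fun l hl => ?_) hx
  rintro rfl
  rw [lenWt_wdeg, List.length_nil] at hl
  omega

lemma uncap_mem {s : ℤ} {x : Om p I} (hx : x ∈ lspan p I s) (a : Letter p I) :
    uncap x a ∈ lspan p I (s - 1) := by
  classical
  refine wspan_map (f := Finsupp.lapply a ∘ₗ uncap) (fun l hl => ?_) hx
  cases l with
  | nil => rw [word_nil, LinearMap.comp_apply, uncap_one]; exact zero_mem _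
  | cons b l =>
    rw [LinearMap.comp_apply, word_cons, uncap_ι_mul, Finsupp.lapply_apply, Finsupp.single_apply]
    split_ifs
    · refine word_mem_wspan ?_
      rw [← hl, WordWt.wdeg_cons, lenWt_ldeg]; ring
    · exact zero_mem _

lemma d0_project {G : Type} [AddCommGroup G] (D : WordWt I G) {γ : G} (y : Om p I)
    (h : d0 p I y ∈ wspan _ fun l => D.wdeg l = γ) :
    ∃ y' ∈ wspan (ZMod p) fun l : List (Letter p I) => D.wdeg l = γ - D.ℓ,
      d0 p I y' = d0 p I y := by
  refine ⟨wproj (fun l => D.wdeg l = γ - D.ℓ) y, wproj_mem _ _, ?_⟩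
  rw [← wproj_comm (deg := fun l : List (Letter p I) => D.wdeg l) (φ := fun g => D.ℓ + g)
    (add_right_injective _) (d0_word_mem D)]
  rw [add_sub_cancel]
  exact wproj_of_mem h

lemma exists_gspan {m : ℤ} {a : Fk p I} (ha : a ∈ fspan p (lenWt I) m) :
    ∃ T : Finset I, a ∈ gspan (ZMod p) ((lenWt I).gen p) (outWt T) m 0 := by
  induction ha using Submodule.span_induction with
  | mem x h =>
    obtain ⟨L, c, h1, -, rfl⟩ := h
    refine ⟨L.toFinset ∪ c.support, mon_mem_gspan h1 (le_of_eq ?_)⟩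
    rw [GenWt.deg, List.sum_eq_zero, Finsupp.sum, Finset.sum_eq_zero, add_zero]
    · intro i hi
      rw [outWt]
      simp only [if_pos (Finset.mem_union_right _ hi), smul_zero]
    · intro r hr
      obtain ⟨i, hi, rfl⟩ := List.mem_map.1 hr
      exact if_pos (Finset.mem_union_left _ (List.mem_toFinset.2 hi))
  | zero => exact ⟨∅, zero_mem _⟩
  | add x y _ _ hx hy =>
    obtain ⟨T, hT⟩ := hx
    obtain ⟨T', hT'⟩ := hy
    exact ⟨T ∪ T', add_mem (gspan_outWt_mono Finset.subset_union_left hT)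
      (gspan_outWt_mono Finset.subset_union_right hT')⟩
  | smul r x _ hx =>
    obtain ⟨T, hT⟩ := hx
    exact ⟨T, Submodule.smul_mem _ _ hT⟩

lemma exists_kspan {m : ℤ} {v : Kz p I} (h1 : ∀ q ∈ v.support, Trunc p q)
    (h2 : ∀ q, v q ∈ fspan p (lenWt I) m) : ∃ T : Finset I, v ∈ kspan m T := by
  choose T hT using fun q => exists_gspan (h2 q)
  refine ⟨v.support.biUnion fun q => T q ∪ q.support, ?_⟩
  have hv := Finsupp.sum_single v
  suffices v.sum Finsupp.single ∈ kspan _ _ by rwa [hv] at this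
  clear hv
  refine sum_mem fun q hq => Submodule.subset_span ⟨q, v q, h1 q hq, ?_, ?_, rfl⟩
  · exact Finset.subset_union_right.trans
      (Finset.subset_biUnion_of_mem (fun q => T q ∪ q.support) hq)
  · exact gspan_outWt_mono (Finset.subset_union_left.trans
      (Finset.subset_biUnion_of_mem (fun q => T q ∪ q.support) hq)) (hT q)

lemma kspan_apply {m : ℤ} {T : Finset I} {v : Kz p I} (hv : v ∈ kspan m T) (q : I →₀ ℕ) :
    v q ∈ fspan p (lenWt I) m := by
  refine kspan_map (f := Finsupp.lapply q) (fun q' a _ _ h3 => ?_) hv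
  rw [Finsupp.lapply_apply, Finsupp.single_apply]
  split_ifs
  · refine Submodule.span_mono ?_ h3
    rintro _ ⟨L, c, h1, -, rfl⟩
    exact ⟨L, c, h1, (zero_deg L c).le, rfl⟩
  · exact zero_mem _

lemma kspan_trunc {m : ℤ} {T : Finset I} {v : Kz p I} (hv : v ∈ kspan m T) {q : I →₀ ℕ}
    (hq : v q ≠ 0) : Trunc p q := by
  by_contra h
  refine hq ?_
  refine kspan_ext (f := Finsupp.lapply q) (g := 0) (fun q' a h1 _ => ?_) hv
  rw [Finsupp.lapply_apply, Finsupp.single_eq_of_ne]; rfl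
  rintro rfl; exact h h1

/-- A cocycle can be changed by a coboundary so that its coefficients have vanishing image in the
Fock space. -/
lemma exists_add_d0 {s : ℕ} {x : Om p I} (hx : x ∈ lspan p I (s + 1 : ℕ)) (hd : d0 p I x = 0)
    (hv : vac p I x = 0) : ∃ y ∈ lspan p I s, ∀ a, vac p I (uncap (x + d0 p I y) a) = 0 := by
  have h1 := fockUncap_d0 (ne_nil_of_lspan hx)
  rw [hd, hv, map_zero, Finsupp.single_zero, zero_sub, eq_comm, neg_eq_zero] at h1
  have h2 : ∃ T : Finset I, fockUncap p I x ∈ kspan (s : ℤ) T := by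
    refine exists_kspan (fun q hq => ?_) fun q => ?_
    · by_contra h
      exact Finsupp.mem_support_iff.1 hq (fockUncap_apply_of_not x fun h' => h h'.2)
    · by_cases h : q ≠ 0 ∧ Trunc p q
      · rw [show q = (⟨q, h⟩ : Letter p I).1 from rfl, fockUncap_apply]
        have := vac_mem _ (uncap_mem hx ⟨q, h⟩)
        convert this using 2
        push_cast; ring
      · rw [fockUncap_apply_of_not x h]; exact zero_mem _
  obtain ⟨T, hT⟩ := h2
  -- the coefficients form a cycle of the Koszul complex, which is a boundary; its primitive lifts to
  -- the cobar construction, as every element of the Fock space is represented by a cocycle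
  obtain ⟨κ, hκ, hκ'⟩ := kD_exact T hT (fockUncap_apply_of_not x fun h => h.1 rfl) h1
  choose g hg1 hg2 hg3 using fun q => exists_vac_eq (lenWt I) (kspan_apply hκ q)
  let y : Om p I := κ.sum fun q _ => lt p q * g q
  have hy : y ∈ lspan p I s := sum_mem fun q _ => by
    have := mul_mem_wdeg _ (lt_mem_wdeg (lenWt I) q) (hg1 q)
    rwa [lenWt_ldeg, add_sub_cancel] at this
  have hy' : y ∈ wspan (ZMod p) fun l : List (Letter p I) => l ≠ [] := by
    refine sum_mem fun q _ => ?_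
    change lt p q * g q ∈ _
    rw [lt]
    split_ifs with h
    · rw [← word_singleton]
      refine wspan_mul (P := fun l => l = [⟨q, h⟩]) (Q := fun _ => True) (fun l l' h _ => ?_)
        (word_mem_wspan rfl) (mem_wspan_true _)
      rw [h]; simp
    · simp
  have hFy : fockUncap p I y = κ - Finsupp.single 0 (κ 0) := by
    have : ∀ q ∈ κ.support, fockUncap p I (lt p q * g q) = Finsupp.single q (κ q) -
        if q = 0 then Finsupp.single 0 (κ 0) else 0 := by
      intro q hq
      rw [fockUncap_lt_mul (kspan_trunc hκ (Finsupp.mem_support_iff.1 hq)), hg3]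
      congr 1
      split_ifs with h
      · rw [h]
      · rfl
    rw [show y = ∑ q ∈ κ.support, lt p q * g q from rfl, map_sum, Finset.sum_congr rfl this,
      Finset.sum_sub_distrib, Finset.sum_ite_eq']
    congr 1
    · exact Finsupp.sum_single κ
    · split_ifs with h
      · rfl
      · rw [Finsupp.notMem_support_iff.1 h, Finsupp.single_zero]
  refine ⟨y, hy, fun a => ?_⟩
  rw [← fockUncap_apply, map_add, fockUncap_d0 hy', hFy, map_sub, hκ', kD_single,
    Finsupp.antidiagonal_zero, Finset.sum_singleton, AntiOps.tau_zero]
  simp only [LinearMap.zero_apply, Finsupp.single_zero, sub_zero, add_sub_cancel]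
  exact Finsupp.single_eq_of_ne a.2.1

/-- The cohomology of the cobar construction injects into the Fock space. -/
theorem d0_exact_of_length (s : ℕ) {x : Om p I} (hx : x ∈ lspan p I s) (hd : d0 p I x = 0)
    (hv : vac p I x = 0) : ∃ y ∈ lspan p I (s - 1 : ℤ), d0 p I y = x := by
  suffices ∃ y, d0 p I y = x by
    obtain ⟨y, rfl⟩ := this
    exact d0_project (lenWt I) y hx
  induction s generalizing x with
  | zero =>
    refine ⟨0, ?_⟩
    have h1 : x ∈ Submodule.span (ZMod p) {(1 : Om p I)} := by
      refine wspan_le (fun l hl => ?_) hx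
      rw [lenWt_wdeg] at hl
      obtain rfl : l = [] := List.length_eq_zero_iff.1 (by exact_mod_cast hl)
      exact Submodule.mem_span_singleton_self _
    obtain ⟨c, rfl⟩ := Submodule.mem_span_singleton.1 h1
    rw [map_smul, vac_one, smul_eq_zero] at hv
    rcases hv with hc | h
    · rw [hc]; simp
    · exact absurd h one_ne_zero
  | succ s ihs =>
    -- make the images in the Fock space of all coefficients vanish, and then kill the coefficients
    -- of the first letters, by induction on the maximal degree of these letters
    obtain ⟨y, hy, hxy⟩ := exists_add_d0 hx hd hv
    suffices ∃ y', d0 p I y' = x + d0 p I y by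
      obtain ⟨y', hy'⟩ := this
      exact ⟨y' - y, by rw [map_sub, hy']; abel⟩
    have hmem : ∀ {y}, y ∈ lspan p I s → d0 p I y ∈ lspan p I (s + 1 : ℕ) := fun hy => by
      have := d0_mem (lenWt I) hy
      rwa [show (lenWt I).ℓ + (s : ℤ) = (s + 1 : ℕ) by simp [lenWt, add_comm]] at this
    have hx' : x + d0 p I y ∈ lspan p I (s + 1 : ℕ) := add_mem hx (hmem hy)
    have hd' : d0 p I (x + d0 p I y) = 0 := by rw [map_add, hd, d0_d0, add_zero]
    generalize x + d0 p I y = z at hxy hx' hd'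
    obtain ⟨N, hN⟩ : ∃ N, ∀ a, uncap z a ≠ 0 → a.1.degree ≤ N :=
      ⟨(uncap z).support.sup fun a => a.1.degree, fun a ha =>
        Finset.le_sup (f := fun a : Letter p I => a.1.degree) (Finsupp.mem_support_iff.2 ha)⟩
    clear hx hd hv hy x y
    induction N generalizing z with
    | zero =>
      refine ⟨0, ?_⟩
      have : uncap z = 0 := by
        ext a
        by_contra h
        exact a.2.1 ((Finsupp.degree_eq_zero_iff _).1 (Nat.le_zero.1 (hN a h)))
      rw [eq_sum_uncap (ne_nil_of_lspan hx'), this]; simp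
    | succ N ihN =>
      -- the coefficients of the letters of maximal degree are cocycles, hence coboundaries; the
      -- primitives can be chosen with image zero in the Fock space, so that the correction does not
      -- destroy what has been achieved for the other coefficients
      have h1 : ∀ a : Letter p I, ∃ v ∈ lspan p I (s - 1 : ℤ), vac p I v = 0 ∧
          (N + 1 ≤ a.1.degree → d0 p I v = uncap z a) := by
        intro a
        by_cases ha : N + 1 ≤ a.1.degree
        · have hm := uncap_mem hx' a
          rw [show ((s + 1 : ℕ) : ℤ) - 1 = s by push_cast; ring] at hm
          have hd2 : d0 p I (uncap z a) = 0 := by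
            have := uncap_d0 (ne_nil_of_lspan hx') hN a ha
            rw [hd', map_zero, Finsupp.zero_apply, eq_comm, neg_eq_zero] at this
            exact this
          obtain ⟨u, hu⟩ := ihs hm hd2 (hxy a)
          obtain ⟨u', hu', hu2⟩ := d0_project (lenWt I) u (hu ▸ hm)
          obtain ⟨g, hg1, hg2, hg3⟩ := exists_vac_eq (lenWt I) (vac_mem _ hu')
          exact ⟨u' - g, sub_mem hu' hg1, by rw [map_sub, hg3, sub_self], fun _ => by
            rw [map_sub, hg2, hu2, hu, sub_zero]⟩
        · exact ⟨0, zero_mem _, map_zero _, fun h => absurd h ha⟩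
      choose v hv1 hv2 hv3 using h1
      let A := (uncap z).support.filter fun a => N + 1 ≤ a.1.degree
      let y : Om p I := ∑ a ∈ A, FreeAlgebra.ι _ a * v a
      have hy : y ∈ lspan p I s := sum_mem fun a _ => by
        have := mul_mem_wdeg _ (lt_mem_wdeg (lenWt I) a.1) (hv1 a)
        rwa [lenWt_ldeg, add_sub_cancel, lt_letter] at this
      have hy0 : y ∈ wspan (ZMod p) fun l : List (Letter p I) => l ≠ [] := by
        refine sum_mem fun a _ => ?_
        rw [← word_singleton]
        refine wspan_mul (P := fun l => l = [a]) (Q := fun _ => True) (fun l l' h _ => ?_)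
          (word_mem_wspan rfl) (mem_wspan_true _)
        rw [h]; simp
      have hFy : fockUncap p I y = 0 := by
        rw [map_sum]
        refine Finset.sum_eq_zero fun a _ => ?_
        rw [fockUncap_ι_mul, hv2, Finsupp.single_zero]
      have huy : ∀ f, uncap y f = if f ∈ A then v f else 0 := by
        classical
        intro f
        rw [map_sum, Finsupp.finsetSum_apply]
        simp only [uncap_ι_mul, Finsupp.single_apply]
        exact Finset.sum_ite_eq' _ _ _
      have hA : ∀ f, uncap y f ≠ 0 → f.1.degree ≤ N + 1 := by
        intro f hf
        rw [huy] at hf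
        split_ifs at hf with h
        · exact hN f (Finsupp.mem_support_iff.1 (Finset.mem_filter.1 h).1)
        · exact absurd rfl hf
      obtain ⟨y', hy'⟩ := ihN (z + d0 p I y) (fun a => by
          rw [map_add, Finsupp.add_apply, map_add, hxy, zero_add, ← fockUncap_apply,
            fockUncap_d0 hy0, hFy, map_zero, sub_zero]
          exact Finsupp.single_eq_of_ne a.2.1) (add_mem hx' (hmem hy))
        (by rw [map_add, hd', d0_d0, add_zero]) (fun f hf => by
          by_contra h
          push Not at h
          refine hf ?_
          rw [map_add, Finsupp.add_apply, uncap_d0 hy0 hA f h, huy]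
          by_cases hz : uncap z f = 0
          · rw [if_neg fun h' => Finsupp.mem_support_iff.1 (Finset.mem_filter.1 h').1 hz, hz]
            simp
          · rw [if_pos (Finset.mem_filter.2 ⟨Finsupp.mem_support_iff.2 hz, h⟩), hv3 f h,
              add_neg_cancel])
      exact ⟨y' - y, by rw [map_sub, hy']; abel⟩

end Exact

end

/-! ### Integrality of the coproduct polynomials -/

section

section Polys

/-- Integral polynomials in the variables `t_a ⊗ 1` and `1 ⊗ t_a`. -/
abbrev ZPoly : Type := MvPolynomial (ℕ ⊕ ℕ) ℤ

lemma coeff_divP (p : ℕ) (f : ZPoly) (e : ℕ ⊕ ℕ →₀ ℕ) :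
    (divP p f).coeff e = f.coeff e / (p : ℤ) := by
  classical
  rw [divP, MvPolynomial.coeff_sum]
  simp only [MvPolynomial.coeff_monomial]
  rw [Finset.sum_ite_eq']
  split_ifs with h
  · rfl
  · rw [MvPolynomial.notMem_support_iff.1 h, Int.zero_ediv]

lemma coeff_natCast_mul {σ : Type} (p : ℕ) (f : MvPolynomial σ ℤ) (e : σ →₀ ℕ) :
    ((p : MvPolynomial σ ℤ) * f).coeff e = p * f.coeff e := by
  rw [← map_natCast MvPolynomial.C, MvPolynomial.coeff_C_mul]

lemma mul_divP {p : ℕ} {f : ZPoly} (h : (p : ZPoly) ∣ f) : (p : ZPoly) * divP p f = f := by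
  obtain ⟨g, rfl⟩ := h
  ext e
  rw [coeff_natCast_mul, coeff_divP, coeff_natCast_mul]
  rcases Nat.eq_zero_or_pos p with h | h
  · simp [h]
  · rw [Int.mul_ediv_cancel_left _ (by exact_mod_cast h.ne')]

variable (p n : ℕ)

/-- The polynomial `b_{s-n,m}`, zero for `s < n`. -/
def bPrev (s m : ℕ) : ZPoly := if 0 < n ∧ n ≤ s then bPoly p n (s - n) m else 0

lemma deltaPoly_eq (s : ℕ) : deltaPoly p n s = diagSum p s 0 - bPrev p n s (n - 1) := rfl

/-- The polynomial `p b_{s,m}`. -/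
def bNum (s m : ℕ) : ZPoly :=
  deltaPoly p n s ^ p ^ (m + 1) - diagSum p s (m + 1) + bPrev p n s (m + n)

lemma bPoly_eq (s m : ℕ) : bPoly p n s m = divP p (bNum p n s m) := by
  rw [bPoly]; rfl

variable {p n}

lemma expand_xVar (a : ℕ) : MvPolynomial.expand p (xVar a) = xVar a ^ p := by
  rw [xVar]; split_ifs <;> simp

lemma expand_yVar (a : ℕ) : MvPolynomial.expand p (yVar a) = yVar a ^ p := by
  rw [yVar]; split_ifs <;> simp

lemma expand_diagSum (s e : ℕ) : MvPolynomial.expand p (diagSum p s e) = diagSum p s (e + 1) := by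
  rw [diagSum, map_sum, diagSum]
  refine Finset.sum_congr rfl fun a _ => ?_
  rw [map_mul, map_pow, map_pow, expand_xVar, expand_yVar, ← pow_mul, ← pow_mul, ← pow_succ',
    ← pow_succ', add_assoc]

lemma expand_dvd {q : ℕ} {f : ZPoly} (h : (q : ZPoly) ∣ f) :
    (q : ZPoly) ∣ MvPolynomial.expand p f := by
  obtain ⟨g, rfl⟩ := h
  rw [map_mul, map_natCast]
  exact dvd_mul_right _ _

variable [Fact p.Prime]

lemma dvd_expand_sub (f : ZPoly) : (p : ZPoly) ∣ MvPolynomial.expand p f - f ^ p := by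
  have h := MvPolynomial.C_dvd_iff_zmod p (MvPolynomial.expand p f - f ^ p)
  rw [map_natCast] at h
  rw [h, map_sub, map_pow, MvPolynomial.map_expand, MvPolynomial.expand_zmod, sub_self]

lemma dvd_iterate_expand_sub (f : ZPoly) (j : ℕ) :
    (p : ZPoly) ∣ (MvPolynomial.expand p)^[j] f - f ^ p ^ j := by
  induction j with
  | zero => simp
  | succ j ih =>
    rw [Function.iterate_succ_apply']
    have h1 := dvd_expand_sub (p := p) ((MvPolynomial.expand p)^[j] f)
    have h2 : (p : ZPoly) ∣ ((MvPolynomial.expand p)^[j] f) ^ p - (f ^ p ^ j) ^ p :=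
      ih.trans (sub_dvd_pow_sub_pow _ _ _)
    rw [← pow_mul, ← pow_succ] at h2
    have := dvd_add h1 h2
    rwa [sub_add_sub_cancel] at this

/-- The polynomial that defines `p b_{s,m}` is divisible by `p`, and `b_{s,m+1}` is congruent modulo
`p^{m+1}` to the polynomial that arises from `b_{s,m}` by replacing the variables by their `p`-th
powers.  The first fact for `s` follows from the second one for `s - n`, as the `p`-th power of a
polynomial is congruent to this substitution modulo `p`. -/
lemma bPoly_congr (hn : 0 < n) (s : ℕ) : ∀ m, (p : ZPoly) ∣ bNum p n s m ∧
    (p : ZPoly) ^ (m + 1) ∣ MvPolynomial.expand p (bPoly p n s m) - bPoly p n s (m + 1) := by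
  induction s using Nat.strong_induction_on with
  | _ s ih =>
  have hprev : ∀ m, (p : ZPoly) ^ (m + 1) ∣
      MvPolynomial.expand p (bPrev p n s m) - bPrev p n s (m + 1) := by
    intro m
    rw [bPrev, bPrev]
    split_ifs with h
    · exact (ih (s - n) (by omega) m).2
    · simp
  have hprev' : ∀ m j, (p : ZPoly) ∣
      (MvPolynomial.expand p)^[j] (bPrev p n s m) - bPrev p n s (m + j) := by
    intro m j
    induction j with
    | zero => simp
    | succ j ihj =>
      rw [Function.iterate_succ_apply']
      have h1 := expand_dvd (p := p) ihj
      rw [map_sub] at h1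
      have h2 := (dvd_pow_self (p : ZPoly) (Nat.succ_ne_zero _)).trans (hprev (m + j))
      have := dvd_add h1 h2
      rwa [sub_add_sub_cancel] at this
  have hdiag : ∀ j, (MvPolynomial.expand p)^[j] (diagSum p s 0) = diagSum p s j := by
    intro j
    induction j with
    | zero => rfl
    | succ j ihj => rw [Function.iterate_succ_apply', ihj, expand_diagSum]
  have hA : ∀ m, (p : ZPoly) ∣ bNum p n s m := by
    intro m
    have h1 := dvd_iterate_expand_sub (p := p) (deltaPoly p n s) (m + 1)
    have h2 := hprev' (n - 1) (m + 1)
    have e : (MvPolynomial.expand p)^[m + 1] (deltaPoly p n s) =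
        diagSum p s (m + 1) - (MvPolynomial.expand p)^[m + 1] (bPrev p n s (n - 1)) := by
      rw [deltaPoly_eq, ← hdiag (m + 1)]
      exact iterate_map_sub (MvPolynomial.expand p : ZPoly →ₐ[ℤ] ZPoly) _ _ _
    rw [e] at h1
    rw [show n - 1 + (m + 1) = m + n by omega] at h2
    have := dvd_add h1 h2
    rw [← dvd_neg] at this
    rw [bNum]
    convert this using 1
    ring
  intro m
  refine ⟨hA m, ?_⟩
  have hp : (p : ZPoly) ≠ 0 := by exact_mod_cast (Fact.out : p.Prime).ne_zero
  rw [← mul_dvd_mul_iff_left hp, mul_sub]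
  have e1 : (p : ZPoly) * MvPolynomial.expand p (bPoly p n s m) =
      MvPolynomial.expand p (bNum p n s m) := by
    conv_rhs => rw [← mul_divP (hA m), map_mul, map_natCast, ← bPoly_eq]
  rw [e1, bPoly_eq, mul_divP (hA _), bNum, bNum, map_add, map_sub, map_pow, expand_diagSum,
    ← pow_succ']
  have h1 := dvd_sub_pow_of_dvd_sub (dvd_expand_sub (p := p) (deltaPoly p n s)) (m + 1)
  rw [← pow_mul, ← pow_succ'] at h1
  have h2 := (pow_dvd_pow (p : ZPoly) (show m + 1 + 1 ≤ m + n + 1 by omega)).trans (hprev (m + n))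
  have := dvd_add h1 h2
  convert this using 1
  rw [show m + n + 1 = m + 1 + n by omega]
  ring

/-- The defining equation of `b_{s,m}`. -/
lemma mul_bPoly (hn : 0 < n) (s m : ℕ) : (p : ZPoly) * bPoly p n s m =
    deltaPoly p n s ^ p ^ (m + 1) - diagSum p s (m + 1) + bPrev p n s (m + n) := by
  rw [bPoly_eq, mul_divP (bPoly_congr hn s m).1, bNum]

lemma bPrev_of_le (hn : 0 < n) {s : ℕ} (h : n ≤ s) (m : ℕ) :
    bPrev p n s m = bPoly p n (s - n) m := if_pos ⟨hn, h⟩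

lemma bPrev_of_lt {s : ℕ} (h : s < n) (m : ℕ) : bPrev p n s m = 0 := if_neg (by omega)

/-- The telescoping sum: the ghost components of the `Δ(t_s)` are the sums of those of the `t_s`,
up to a multiple of `p` if `e > 0`. -/
lemma ghost_deltaPoly (hn : 0 < n) (N c e : ℕ) (hN : c < n * (N + 1)) :
    ∑ i ∈ Finset.range (N + 1), (p : ZPoly) ^ (N - i) * (if n * i ≤ c then
      deltaPoly p n (c - n * i) ^ p ^ (e + n * i) - diagSum p (c - n * i) (e + n * i) else 0) =
    if e = 0 then 0 else (p : ZPoly) ^ (N + 1) * bPoly p n c (e - 1) := by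
  have key : ∀ i, n * i ≤ c → e + n * i ≠ 0 →
      deltaPoly p n (c - n * i) ^ p ^ (e + n * i) - diagSum p (c - n * i) (e + n * i) =
      p * bPoly p n (c - n * i) (e + n * i - 1) -
        if n * (i + 1) ≤ c then bPoly p n (c - n * (i + 1)) (e + n * (i + 1) - 1) else 0 := by
    intro i hi he
    obtain ⟨m, hm⟩ : ∃ m, e + n * i = m + 1 := ⟨e + n * i - 1, by omega⟩
    rw [mul_bPoly hn, hm, Nat.add_sub_cancel, bPrev]
    have e3 : n * (i + 1) = n * i + n := by ring
    by_cases h : n * (i + 1) ≤ c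
    · rw [if_pos h, if_pos ⟨hn, by omega⟩, show c - n * i - n = c - n * (i + 1) by omega,
        show e + n * (i + 1) - 1 = m + n by omega]; ring
    · rw [if_neg h, if_neg (by omega)]; ring
  -- the partial sums
  have part : ∀ j, j ≤ N → ∑ i ∈ Finset.range (j + 1), (p : ZPoly) ^ (N - i) *
      (if n * i ≤ c then deltaPoly p n (c - n * i) ^ p ^ (e + n * i) -
        diagSum p (c - n * i) (e + n * i) else 0) =
      (if e = 0 then 0 else (p : ZPoly) ^ (N + 1) * bPoly p n c (e - 1)) - (p : ZPoly) ^ (N - j) *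
        if n * (j + 1) ≤ c then bPoly p n (c - n * (j + 1)) (e + n * (j + 1) - 1) else 0 := by
    intro j
    induction j with
    | zero =>
      intro _
      rw [Finset.sum_range_one, mul_zero, if_pos (Nat.zero_le _)]
      by_cases he : e = 0
      · subst he
        rw [if_pos rfl, deltaPoly_eq, bPrev]
        simp only [add_zero, pow_zero, pow_one, Nat.sub_zero, zero_add, mul_one]
        by_cases h : n ≤ c
        · rw [if_pos ⟨hn, h⟩, if_pos h]; ring
        · rw [if_neg (by omega), if_neg h]; ring
      · have := key 0 (by simp) (by omega)
        rw [mul_zero] at this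
        rw [this, if_neg he]
        simp only [Nat.sub_zero, add_zero, zero_add, mul_one]
        rw [pow_succ]; ring
    | succ j ihj =>
      intro hj
      rw [Finset.sum_range_succ, ihj (by omega)]
      by_cases h : n * (j + 1) ≤ c
      · have hpos : 0 < n * (j + 1) := by positivity
        rw [if_pos h, if_pos h, key (j + 1) h (by omega), show N - j = N - (j + 1) + 1 by omega,
          pow_succ]
        ring
      · rw [if_neg h, if_neg h, if_neg (show ¬ n * (j + 1 + 1) ≤ c from fun h' =>
          h (le_trans (Nat.mul_le_mul_left n (Nat.le_succ _)) h'))]; ring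
  rw [part N le_rfl, if_neg (show ¬ n * (N + 1) ≤ c by omega)]; simp

end Polys

end

/-! ### Coassociativity of the coproduct polynomials -/

section

section Coassoc

variable {p n : ℕ} [Fact p.Prime] {R : Type} [CommRing R]

/-- The value of a coproduct polynomial. -/
abbrev ev (x y : ℕ → R) : ZPoly →ₐ[ℤ] R := MvPolynomial.aeval (Sum.elim x y)

lemma ev_xVar {x y : ℕ → R} (hx : x 0 = 1) (a : ℕ) : ev x y (xVar a) = x a := by
  rw [xVar]
  split_ifs with h
  · rw [map_one, h, hx]
  · simp

lemma ev_yVar {x y : ℕ → R} (hy : y 0 = 1) (a : ℕ) : ev x y (yVar a) = y a := by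
  rw [yVar]
  split_ifs with h
  · rw [map_one, h, hy]
  · simp

lemma ev_diagSum {x y : ℕ → R} (hx : x 0 = 1) (hy : y 0 = 1) (s e : ℕ) : ev x y (diagSum p s e) =
    ∑ a ∈ Finset.range (s + 1), x a ^ p ^ e * y (s - a) ^ p ^ (a + e) := by
  rw [diagSum, map_sum]
  simp only [map_mul, map_pow, ev_xVar hx, ev_yVar hy]

lemma deltaPoly_zero (hn : 0 < n) : deltaPoly p n 0 = 1 := by
  rw [deltaPoly, if_neg (by omega)]; simp [diagSum, xVar, yVar]

lemma sum_range_ite (S m c : ℕ) (hc : c < S) (F : ℕ → R) :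
    ∑ a ∈ Finset.range S, (if a + m = c then F a else 0) = if m ≤ c then F (c - m) else 0 := by
  by_cases h : m ≤ c
  · rw [if_pos h, Finset.sum_eq_single (c - m), if_pos (by omega)]
    · intro a _ ha; rw [if_neg (by omega)]
    · intro ha; exact absurd (Finset.mem_range.2 (by omega)) ha
  · rw [if_neg h]
    exact Finset.sum_eq_zero fun a _ => if_neg (by omega)

lemma sum_range_range_ite (S m c : ℕ) (hc : c < S) (F : ℕ → ℕ → R) :
    ∑ a ∈ Finset.range S, ∑ b ∈ Finset.range S, (if a + b + m = c then F a b else 0) =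
      if m ≤ c then ∑ a ∈ Finset.range (c - m + 1), F a (c - m - a) else 0 := by
  have h1 : ∀ a, ∑ b ∈ Finset.range S, (if a + b + m = c then F a b else 0) =
      if a + m ≤ c then F a (c - m - a) else 0 := by
    intro a
    have := sum_range_ite S (a + m) c hc (F a)
    rw [show c - m - a = c - (a + m) by omega, ← this]
    refine Finset.sum_congr rfl fun b _ => ?_
    rw [show b + (a + m) = a + b + m by ring]
  simp only [h1]
  split_ifs with h
  · rw [← Finset.sum_subset (s₁ := Finset.range (c - m + 1))]
    · refine Finset.sum_congr rfl fun a ha => ?_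
      rw [Finset.mem_range] at ha
      rw [if_pos (by omega)]
    · intro a ha; rw [Finset.mem_range] at ha ⊢; omega
    · intro a _ ha
      rw [Finset.mem_range] at ha
      rw [if_neg (by omega)]
  · exact Finset.sum_eq_zero fun a _ => if_neg (by omega)

/-- The telescoping sum of the coproduct polynomials, evaluated in a ring. -/
lemma ghost_ev (hn : 0 < n) {S N c e : ℕ} (hc : c < S) (hN : c < n * (N + 1)) {x y : ℕ → R}
    (hx : x 0 = 1) (hy : y 0 = 1) :
    ∑ i ∈ Finset.range (N + 1), (p : R) ^ (N - i) * ∑ a ∈ Finset.range S,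
      (if a + n * i = c then ev x y (deltaPoly p n a) ^ p ^ (e + n * i) else 0) =
    ∑ i ∈ Finset.range (N + 1), (p : R) ^ (N - i) * ∑ a ∈ Finset.range S, ∑ b ∈ Finset.range S,
      (if a + b + n * i = c then x a ^ p ^ (e + n * i) * y b ^ p ^ (a + (e + n * i)) else 0) +
    if e = 0 then 0 else (p : R) ^ (N + 1) * ev x y (bPoly p n c (e - 1)) := by
  have h := congrArg (ev x y) (ghost_deltaPoly (p := p) hn N c e hN)
  rw [map_sum, apply_ite (ev x y), map_zero, map_mul, map_pow, map_natCast] at h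
  rw [← h, ← Finset.sum_add_distrib]
  refine Finset.sum_congr rfl fun i _ => ?_
  rw [map_mul, map_pow, map_natCast, ← mul_add, sum_range_ite S _ c hc fun a =>
    ev x y (deltaPoly p n a) ^ p ^ (e + n * i), sum_range_range_ite S _ c hc fun a b =>
    x a ^ p ^ (e + n * i) * y b ^ p ^ (a + (e + n * i)), apply_ite (ev x y), map_zero]
  congr 1
  split_ifs with h1
  · rw [map_sub, map_pow, ev_diagSum hx hy]; ring
  · simp

variable (p n) in
/-- The values of the coproduct polynomials. -/
def dl (x y : ℕ → R) (s : ℕ) : R := ev x y (deltaPoly p n s)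

lemma dl_zero (hn : 0 < n) (x y : ℕ → R) : dl p n x y 0 = 1 := by
  rw [dl, deltaPoly_zero hn, map_one]

/-- The ghost components of the two iterated coproducts agree up to multiples of `p^{N+1}`. -/
lemma ghost_coassoc (hn : 0 < n) (s : ℕ) {x y z : ℕ → R} (hx : x 0 = 1) (hy : y 0 = 1)
    (hz : z 0 = 1) (hxp : ∀ a, x a ^ p ^ n = x a) :
    (p : R) ^ (s + 1) ∣ ∑ i ∈ Finset.range (s + 1), (p : R) ^ (s - i) * ∑ a ∈ Finset.range (s + 1),
      (if a + n * i = s then dl p n (dl p n x y) z a ^ p ^ (n * i) -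
        dl p n x (dl p n y z) a ^ p ^ (n * i) else 0) := by
  have hxi : ∀ a i, x a ^ p ^ (n * i) = x a := by
    intro a i
    induction i with
    | zero => simp
    | succ i ih => rw [mul_add, mul_one, pow_add, pow_mul, ih, hxp]
  have hs : s < s + 1 := Nat.lt_succ_self s
  have hN : ∀ c, c ≤ s → c < n * (s + 1) := fun c hc =>
    lt_of_lt_of_le (Nat.lt_succ_of_le hc) (Nat.le_mul_of_pos_left _ hn)
  -- the ghost components of both sides are the same sum over `x_a y_b z_c`, up to a multiple of
  -- `p^{s+1}` for the second one, where the components of the inner coproduct of positive exponent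
  -- contribute a remainder
  let F : ℕ → ℕ → ℕ → ℕ → R := fun i a b c => if a + b + c + n * i = s then
    (p : R) ^ (s - i) * (x a * y b ^ p ^ (a + n * i) * z c ^ p ^ (a + b + n * i)) else 0
  have hP : ∑ i ∈ Finset.range (s + 1), (p : R) ^ (s - i) * ∑ a ∈ Finset.range (s + 1),
      (if a + n * i = s then dl p n (dl p n x y) z a ^ p ^ (n * i) else 0) =
      ∑ i ∈ Finset.range (s + 1), ∑ a ∈ Finset.range (s + 1), ∑ b ∈ Finset.range (s + 1),
        ∑ c ∈ Finset.range (s + 1), F i a b c := by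
    have h1 := ghost_ev (p := p) (e := 0) hn hs (hN s le_rfl) (dl_zero (p := p) hn x y) hz
    simp only [zero_add, if_true, add_zero] at h1
    refine h1.trans ?_
    have h2 : ∀ c ∈ Finset.range (s + 1),
        ∑ i ∈ Finset.range (s + 1), ∑ a ∈ Finset.range (s + 1), (p : R) ^ (s - i) *
          (if a + c + n * i = s then dl p n x y a ^ p ^ (n * i) * z c ^ p ^ (a + n * i) else 0) =
        ∑ i ∈ Finset.range (s + 1), ∑ a ∈ Finset.range (s + 1), ∑ b ∈ Finset.range (s + 1),
          F i a b c := by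
      intro c hc
      rw [Finset.mem_range] at hc
      have h3 := ghost_ev (p := p) (e := 0) (S := s + 1) hn (show s - c < s + 1 by omega)
        (hN (s - c) (by omega)) hx hy
      simp only [zero_add, if_true, add_zero] at h3
      have h4 := congrArg (fun r => r * z c ^ p ^ (s - c)) h3
      simp only [Finset.sum_mul, Finset.mul_sum] at h4
      refine Eq.trans ?_ (h4.trans ?_)
      · refine Finset.sum_congr rfl fun i _ => Finset.sum_congr rfl fun a _ => ?_
        rw [mul_assoc]
        congr 1
        by_cases h : a + c + n * i = s
        · rw [if_pos h, if_pos (by omega), show s - c = a + n * i by omega]; rfl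
        · rw [if_neg h, if_neg (by omega), zero_mul]
      · refine Finset.sum_congr rfl fun i _ => Finset.sum_congr rfl fun a _ =>
          Finset.sum_congr rfl fun b _ => ?_
        simp only [F]
        by_cases h : a + b + c + n * i = s
        · rw [if_pos h, if_pos (by omega), show s - c = a + b + n * i by omega, hxi]; ring
        · rw [if_neg h, if_neg (by omega), mul_zero, zero_mul]
    have h5 := Finset.sum_congr rfl h2
    rw [Finset.sum_comm] at h5
    simp only [Finset.mul_sum]
    refine Eq.trans (Finset.sum_congr rfl fun i _ => Finset.sum_comm) (h5.trans ?_)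
    rw [Finset.sum_comm]
    refine Finset.sum_congr rfl fun i _ => ?_
    rw [Finset.sum_comm]
    exact Finset.sum_congr rfl fun a _ => Finset.sum_comm
  have hQ : ∃ r, ∑ i ∈ Finset.range (s + 1), (p : R) ^ (s - i) * ∑ a ∈ Finset.range (s + 1),
      (if a + n * i = s then dl p n x (dl p n y z) a ^ p ^ (n * i) else 0) =
      ∑ i ∈ Finset.range (s + 1), ∑ a ∈ Finset.range (s + 1), ∑ b ∈ Finset.range (s + 1),
        ∑ c ∈ Finset.range (s + 1), F i a b c + (p : R) ^ (s + 1) * r := by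
    have h1 := ghost_ev (p := p) (e := 0) hn hs (hN s le_rfl) hx (dl_zero (p := p) hn y z)
    simp only [zero_add, if_true, add_zero] at h1
    have h2 : ∀ a ∈ Finset.range (s + 1), ∃ r,
        ∑ i ∈ Finset.range (s + 1), ∑ b ∈ Finset.range (s + 1), (p : R) ^ (s - i) *
          (if a + b + n * i = s then x a ^ p ^ (n * i) * dl p n y z b ^ p ^ (a + n * i) else 0) =
        ∑ i ∈ Finset.range (s + 1), ∑ b ∈ Finset.range (s + 1), ∑ c ∈ Finset.range (s + 1),
          F i a b c + (p : R) ^ (s + 1) * r := by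
      intro a ha
      rw [Finset.mem_range] at ha
      have h3 := ghost_ev (p := p) (e := a) (S := s + 1) hn (show s - a < s + 1 by omega)
        (hN (s - a) (by omega)) hy hz
      have h4 := congrArg (fun r => x a * r) h3
      refine ⟨x a * if a = 0 then 0 else ev y z (bPoly p n (s - a) (a - 1)), ?_⟩
      simp only [mul_add, Finset.mul_sum] at h4
      refine Eq.trans ?_ (h4.trans ?_)
      · refine Finset.sum_congr rfl fun i _ => Finset.sum_congr rfl fun b _ => ?_
        rw [mul_left_comm]
        congr 1
        by_cases h : a + b + n * i = s
        · rw [if_pos h, if_pos (by omega), hxi]; rfl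
        · rw [if_neg h, if_neg (by omega), mul_zero]
      · congr 1
        · refine Finset.sum_congr rfl fun i _ => Finset.sum_congr rfl fun b _ =>
            Finset.sum_congr rfl fun c _ => ?_
          simp only [F]
          by_cases h : a + b + c + n * i = s
          · rw [if_pos h, if_pos (by omega), show b + (a + n * i) = a + b + n * i by ring]; ring
          · rw [if_neg h, if_neg (by omega), mul_zero, mul_zero]
        · split_ifs <;> ring
    choose! r hr using h2
    refine ⟨∑ a ∈ Finset.range (s + 1), r a, h1.trans ?_⟩
    have h5 := Finset.sum_congr rfl hr
    rw [Finset.sum_comm, Finset.sum_add_distrib, ← Finset.mul_sum] at h5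
    simp only [Finset.mul_sum] at h5 ⊢
    refine h5.trans ?_
    rw [Finset.sum_comm]
  obtain ⟨r, hr⟩ := hQ
  refine ⟨-r, ?_⟩
  have e1 : ∀ i a, (if a + n * i = s then dl p n (dl p n x y) z a ^ p ^ (n * i) -
        dl p n x (dl p n y z) a ^ p ^ (n * i) else 0) =
      (if a + n * i = s then dl p n (dl p n x y) z a ^ p ^ (n * i) else 0) -
      (if a + n * i = s then dl p n x (dl p n y z) a ^ p ^ (n * i) else 0) := by
    intro i a; split_ifs <;> simp
  simp only [e1, Finset.sum_sub_distrib, mul_sub]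
  rw [hP, hr]; ring

/-- The coproduct polynomials are coassociative modulo `p`: in the congruence of the ghost components
the summands for smaller `s` vanish modulo `p^{s+1}` by induction, and `p^s` can be cancelled. -/
lemma coassoc_of_torsionFree (hn : 0 < n) (hR : ∀ r s : R, (p : R) * r = p * s → r = s)
    {x y z : ℕ → R} (hx : x 0 = 1) (hy : y 0 = 1) (hz : z 0 = 1) (hxp : ∀ a, x a ^ p ^ n = x a)
    (s : ℕ) : (p : R) ∣ dl p n (dl p n x y) z s - dl p n x (dl p n y z) s := by
  induction s using Nat.strong_induction_on with
  | _ s ih =>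
  have h := ghost_coassoc (p := p) hn s hx hy hz hxp
  rw [Finset.sum_range_succ'] at h
  have h1 : (p : R) ^ (s + 1) ∣ ∑ i ∈ Finset.range s, (p : R) ^ (s - (i + 1)) *
      ∑ a ∈ Finset.range (s + 1), (if a + n * (i + 1) = s then
        dl p n (dl p n x y) z a ^ p ^ (n * (i + 1)) -
        dl p n x (dl p n y z) a ^ p ^ (n * (i + 1)) else 0) := by
    refine Finset.dvd_sum fun i hi => ?_
    rw [Finset.mem_range] at hi
    rw [Finset.mul_sum]
    refine Finset.dvd_sum fun a _ => ?_
    split_ifs with ha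
    · have hpos : 0 < n * (i + 1) := by positivity
      have h2 := dvd_sub_pow_of_dvd_sub (ih a (by omega)) (n * (i + 1))
      have h3 : i + 1 ≤ n * (i + 1) := Nat.le_mul_of_pos_left _ hn
      refine (pow_dvd_pow _ (show s + 1 ≤ s - (i + 1) + (n * (i + 1) + 1) by omega)).trans ?_
      rw [pow_add]
      exact mul_dvd_mul_left _ h2
    · simp
  rw [dvd_add_right h1, sum_range_ite (s + 1) (n * 0) s (by omega) fun a =>
    dl p n (dl p n x y) z a ^ p ^ (n * 0) - dl p n x (dl p n y z) a ^ p ^ (n * 0)] at h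
  simp only [mul_zero, Nat.sub_zero, Nat.zero_le, if_true, pow_zero, pow_one] at h
  obtain ⟨r, hr⟩ := h
  refine ⟨r, ?_⟩
  have hcancel : ∀ m (r s : R), (p : R) ^ m * r = (p : R) ^ m * s → r = s := by
    intro m
    induction m with
    | zero => intro r s; simp
    | succ m ihm =>
      intro r s h
      rw [pow_succ', mul_assoc, mul_assoc] at h
      exact ihm _ _ (hR _ _ h)
  refine hcancel s _ _ ?_
  rw [hr]; ring

/-- The coproduct polynomials are coassociative over rings of characteristic `p` with
`z^{p^n} = z`. -/
theorem dl_coassoc (hn : 0 < n) [CharP R p] (hR : ∀ r : R, r ^ p ^ n = r)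
    {x y z : ℕ → R} (hx : x 0 = 1) (hy : y 0 = 1) (hz : z 0 = 1) (s : ℕ) :
    dl p n (dl p n x y) z s = dl p n x (dl p n y z) s := by
  -- the Teichmüller lifts to the Witt vectors satisfy the same relations, and there is no torsion
  have hW : ∀ r s : WittVector p R, (p : WittVector p R) * r = p * s → r = s := by
    have h0 : ∀ r : WittVector p R, (p : WittVector p R) * r = 0 → r = 0 := by
      intro r hr
      ext i
      have h1 := WittVector.mul_charP_coeff_succ r i
      rw [mul_comm, hr, WittVector.zero_coeff] at h1
      rw [WittVector.zero_coeff, ← hR (r.coeff i)]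
      obtain ⟨m, rfl⟩ : ∃ m, n = m + 1 := ⟨n - 1, by omega⟩
      rw [pow_succ', pow_mul, ← h1]
      exact zero_pow (pow_ne_zero _ (Fact.out : p.Prime).ne_zero)
    intro r s h
    rw [← sub_eq_zero]
    exact h0 _ (by rw [mul_sub, h, sub_self])
  let T : (ℕ → R) → ℕ → WittVector p R := fun x a => WittVector.teichmuller p (x a)
  have hT : ∀ {x : ℕ → R}, x 0 = 1 → T x 0 = 1 := fun {x} hx => by simp only [T]; rw [hx, map_one]
  have h := coassoc_of_torsionFree (p := p) hn hW (hT hx) (hT hy) (hT hz)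
    (fun a => by simp only [T]; rw [← map_pow, hR]) s
  let κ : WittVector p R →+* R := WittVector.constantCoeff
  have hκ : ∀ (x y : ℕ → WittVector p R) s, κ (dl p n x y s) =
      dl p n (fun a => κ (x a)) (fun a => κ (y a)) s := by
    intro x y s
    rw [dl, dl]
    change (κ.toIntAlgHom.comp (ev x y)) _ = _
    congr 1
    refine MvPolynomial.algHom_ext fun a => ?_
    cases a <;> simp
  have hκT : ∀ x : ℕ → R, (fun a => κ (T x a)) = x := fun x => funext fun a => rfl
  obtain ⟨r, hr⟩ := h
  have h1 := congrArg κ hr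
  rw [map_sub, map_mul, map_natCast, CharP.cast_eq_zero, zero_mul, sub_eq_zero, hκ, hκ, hκT] at h1
  have h2 : ∀ x y : ℕ → R, (fun a => κ (dl p n (T x) (T y) a)) = dl p n x y := by
    intro x y
    funext a
    rw [hκ, hκT, hκT]
  rw [h2, h2, hκT] at h1
  exact h1

end Coassoc

end

/-! ### Sums of digits -/

section

section Digits

variable {p : ℕ} [Fact p.Prime]

lemma digits_sum_eq (p : ℕ) [Fact p.Prime] (c : ℕ) :
    (Nat.digits p c).sum = c % p + (Nat.digits p (c / p)).sum := by
  rcases Nat.eq_zero_or_pos c with rfl | h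
  · simp
  · rw [Nat.digits_def' (Fact.out : p.Prime).one_lt h, List.sum_cons]

lemma digits_sum_add_le (p : ℕ) [Fact p.Prime] (a b : ℕ) :
    (Nat.digits p (a + b)).sum ≤ (Nat.digits p a).sum + (Nat.digits p b).sum := by
  induction h : a + b using Nat.strong_induction_on generalizing a b with
  | _ N ih =>
  subst h
  have hp := (Fact.out : p.Prime).two_le
  have hsmall : ∀ c, c < p → (Nat.digits p c).sum = c := fun c hc => by
    rw [digits_sum_eq, Nat.mod_eq_of_lt hc, Nat.div_eq_of_lt hc]; simp
  rcases Nat.eq_zero_or_pos (a + b) with h0 | h0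
  · rw [h0]; simp
  have hlt : ∀ c, 0 < c → c / p < c := fun c hc => Nat.div_lt_self hc hp
  rw [digits_sum_eq p (a + b), digits_sum_eq p a, digits_sum_eq p b]
  have e1 := Nat.add_mod a b p
  have e2 := Nat.add_div (a := a) (b := b) (by omega : 0 < p)
  have h1 := ih (a / p + b / p) (by
    have := Nat.div_le_self a p
    have := Nat.div_le_self b p
    rcases Nat.eq_zero_or_pos a with h | h
    · have := hlt b (by omega); omega
    · have := hlt a h; omega) (a / p) (b / p) rfl
  by_cases hc : p ≤ a % p + b % p
  · rw [if_pos hc] at e2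
    have h2 : (Nat.digits p (a / p + b / p + 1)).sum ≤ (Nat.digits p (a / p + b / p)).sum + 1 := by
      have h3 : a / p + b / p + 1 < a + b := by
        have := Nat.div_add_mod a p
        have := Nat.div_add_mod b p
        have : 2 * (a / p) ≤ p * (a / p) := Nat.mul_le_mul_right _ hp
        have : 2 * (b / p) ≤ p * (b / p) := Nat.mul_le_mul_right _ hp
        have := Nat.mod_lt a (by omega : 0 < p)
        have := Nat.mod_lt b (by omega : 0 < p)
        omega
      have := ih _ h3 (a / p + b / p) 1 rfl
      rwa [hsmall 1 (by omega)] at this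
    have e3 : (a % p + b % p) % p = a % p + b % p - p := by
      rw [Nat.mod_eq_sub_mod hc, Nat.mod_eq_of_lt]
      have := Nat.mod_lt a (by omega : 0 < p)
      have := Nat.mod_lt b (by omega : 0 < p)
      omega
    rw [e1, e2, e3]
    omega
  · rw [if_neg hc, add_zero] at e2
    rw [e1, e2, Nat.mod_eq_of_lt (by omega)]
    omega

lemma digits_sum_mul_self (p : ℕ) [Fact p.Prime] (c : ℕ) :
    (Nat.digits p (p * c)).sum = (Nat.digits p c).sum := by
  have hp := (Fact.out : p.Prime).pos
  rw [digits_sum_eq, Nat.mul_mod_right, Nat.mul_div_cancel_left _ hp, zero_add]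

lemma digits_sum_mul_pow_le (p : ℕ) [Fact p.Prime] (m j : ℕ) :
    (Nat.digits p (m * p ^ j)).sum ≤ m := by
  induction j with
  | zero =>
    rw [pow_zero, mul_one]
    induction m with
    | zero => simp
    | succ m ih =>
      have h1 : (Nat.digits p 1).sum = 1 := by
        rw [digits_sum_eq, Nat.mod_eq_of_lt (Fact.out : p.Prime).one_lt,
          Nat.div_eq_of_lt (Fact.out : p.Prime).one_lt]; simp
      have := digits_sum_add_le p m 1
      omega
  | succ j ih => rwa [pow_succ', mul_left_comm, digits_sum_mul_self]

lemma sum_digits_lt (n : ℕ) (f : ℕ → ℕ) (hf : ∀ j, f j < p) :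
    ∑ j ∈ Finset.range n, f j * p ^ j < p ^ n := by
  induction n with
  | zero => simp
  | succ n ih =>
    rw [Finset.sum_range_succ, pow_succ]
    have h1 : f n + 1 ≤ p := hf n
    have h2 := Nat.mul_le_mul_right (p ^ n) h1
    rw [add_mul, one_mul, mul_comm p] at h2
    omega

lemma sum_digits_inj (n : ℕ) (f g : ℕ → ℕ) (hf : ∀ j, f j < p) (hg : ∀ j, g j < p)
    (h : ∑ j ∈ Finset.range n, f j * p ^ j = ∑ j ∈ Finset.range n, g j * p ^ j) :
    ∀ j < n, f j = g j := by
  have hp := (Fact.out : p.Prime).pos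
  induction n generalizing f g with
  | zero => intro j hj; omega
  | succ n ih =>
    have e : ∀ f : ℕ → ℕ, ∑ j ∈ Finset.range (n + 1), f j * p ^ j =
        f 0 + p * ∑ j ∈ Finset.range n, f (j + 1) * p ^ j := by
      intro f
      rw [Finset.sum_range_succ', pow_zero, mul_one, add_comm, Finset.mul_sum]
      congr 1
      exact Finset.sum_congr rfl fun j _ => by rw [pow_succ]; ring
    rw [e, e] at h
    have h0 : f 0 = g 0 := by
      have := congrArg (· % p) h
      simpa [Nat.add_mul_mod_self_left, Nat.mod_eq_of_lt (hf 0), Nat.mod_eq_of_lt (hg 0)] using this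
    rw [h0] at h
    have h1 := Nat.eq_of_mul_eq_mul_left hp (Nat.add_left_cancel h)
    intro j hj
    cases j with
    | zero => exact h0
    | succ j => exact ih _ _ (fun j => hf _) (fun j => hg _) h1 j (by omega)

end Digits

/-! ### Monomials in `S(n,k)` -/

section SMonomials

/-- The index set of the elements `t_{i,j} = t_i^{p^j}`. -/
abbrev Ix (n k : ℕ) : Type := {s : ℕ // k ≤ s} × ZMod n

variable (p : ℕ) {n k : ℕ} [Fact p.Prime] [NeZero n]

/-- The element `t_i^{p^j}`. -/
def tt (l : Ix n k) : S p n k := toS p n k (MvPolynomial.X l.1) ^ p ^ l.2.val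

/-- The index of the `p`-th power. -/
def Ix.succ (l : Ix n k) : Ix n k := (l.1, l.2 + 1)

lemma pow_val_add_one (x : S p n k) (j : ZMod n) : x ^ p ^ (j + 1).val = (x ^ p ^ j.val) ^ p := by
  rw [← pow_mul, ← pow_succ]
  rcases Nat.lt_or_ge (j.val + 1) n with h | h
  · have : 1 < n := by omega
    have : Fact (1 < n) := ⟨this⟩
    rw [ZMod.val_add_of_lt (by rw [ZMod.val_one]; exact h), ZMod.val_one]
  · have h1 := ZMod.val_lt j
    have h2 : j.val + 1 = n := by omega
    have h3 : j + 1 = 0 := by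
      have := congrArg (Nat.cast (R := ZMod n)) h2
      rw [Nat.cast_add, ZMod.natCast_zmod_val, Nat.cast_one, ZMod.natCast_self] at this
      exact this
    rw [h3, h2, ZMod.val_zero, pow_zero, pow_one, S_pow]

lemma tt_succ (l : Ix n k) : tt p l.succ = tt p l ^ p := pow_val_add_one p _ _

/-- The monomial `∏ t_{i,j}^{q_{i,j}}`. -/
def tp (q : Ix n k →₀ ℕ) : S p n k := q.prod fun l m => tt p l ^ m

@[simp] lemma tp_zero : tp p (0 : Ix n k →₀ ℕ) = 1 := Finsupp.prod_zero_index

lemma tp_add (q q' : Ix n k →₀ ℕ) : tp p (q + q') = tp p q * tp p q' :=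
  Finsupp.prod_add_index' (by simp) (by intros; rw [pow_add])

lemma tp_single (l : Ix n k) (m : ℕ) : tp p (Finsupp.single l m) = tt p l ^ m :=
  Finsupp.prod_single_index (by simp)

/-- The degree of the monomial `q`. -/
def qdeg (q : Ix n k →₀ ℕ) : Deg p n := q.sum fun l m => m • hDeg p n l.1 l.2

/-- The weight of the monomial `q`. -/
def qwt (q : Ix n k →₀ ℕ) : ℕ := q.sum fun l m => m * mayM p n k l.1

@[simp] lemma qdeg_zero : qdeg p (0 : Ix n k →₀ ℕ) = 0 := Finsupp.sum_zero_index
@[simp] lemma qwt_zero : qwt p (0 : Ix n k →₀ ℕ) = 0 := Finsupp.sum_zero_index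

lemma qdeg_add (q q' : Ix n k →₀ ℕ) : qdeg p (q + q') = qdeg p q + qdeg p q' :=
  Finsupp.sum_add_index' (by simp) (by intros; rw [add_smul])

lemma qwt_add (q q' : Ix n k →₀ ℕ) : qwt p (q + q') = qwt p q + qwt p q' :=
  Finsupp.sum_add_index' (by simp) (by intros; rw [add_mul])

lemma qdeg_single (l : Ix n k) (m : ℕ) :
    qdeg p (Finsupp.single l m) = m • hDeg p n l.1 l.2 := Finsupp.sum_single_index (by simp)

lemma qwt_single (l : Ix n k) (m : ℕ) :
    qwt p (Finsupp.single l m) = m * mayM p n k l.1 := Finsupp.sum_single_index (by simp)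

lemma pow_periodic (c : ℕ) (s : ℕ) : ((2 * (p ^ s - 1) * (c * p ^ n) : ℕ) : Deg p n) =
    ((2 * (p ^ s - 1) * c : ℕ) : Deg p n) := by
  have hpn : 1 ≤ p ^ n := Nat.one_le_pow _ _ (Fact.out : p.Prime).pos
  have e : 2 * (p ^ s - 1) * (c * p ^ n) =
      2 * (p ^ s - 1) * c + (p ^ s - 1) * c * (2 * (p ^ n - 1)) := by
    obtain ⟨m, hm⟩ : ∃ m, p ^ n = m + 1 := ⟨p ^ n - 1, by omega⟩
    rw [hm, Nat.add_sub_cancel]; ring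
  rw [e, Nat.cast_add, Nat.cast_mul _ (2 * (p ^ n - 1)), ZMod.natCast_self, mul_zero, add_zero]

lemma hDeg_add_one (i : ℕ) (j : ZMod n) : hDeg p n i (j + 1) = p • hDeg p n i j := by
  rw [hDeg, hDeg, nsmul_eq_mul, ← Nat.cast_mul]
  rcases Nat.lt_or_ge (j.val + 1) n with h | h
  · have : 1 < n := by omega
    have : Fact (1 < n) := ⟨this⟩
    rw [ZMod.val_add_of_lt (by rw [ZMod.val_one]; exact h), ZMod.val_one, pow_succ]
    congr 1; ring
  · have h1 := ZMod.val_lt j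
    have h2 : j.val + 1 = n := by omega
    have h3 : j + 1 = 0 := by
      have := congrArg (Nat.cast (R := ZMod n)) h2
      rw [Nat.cast_add, ZMod.natCast_zmod_val, Nat.cast_one, ZMod.natCast_self] at this
      exact this
    rw [h3, ZMod.val_zero, pow_zero, ← pow_periodic p 1 i]
    have e : p ^ n = p ^ j.val * p := by rw [← pow_succ, h2]
    congr 1
    rw [e]; ring

lemma bDeg_eq (i : ℕ) (j : ZMod n) : bDeg p n i j = p • hDeg p n i j := by
  rw [bDeg, hDeg, nsmul_eq_mul, ← Nat.cast_mul, pow_succ]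
  congr 1; ring

lemma one_le_mayM {k : ℕ} {s : ℕ} (hs : 1 ≤ s) : 1 ≤ mayM p n k s := by
  rw [mayM]; split_ifs <;> omega

lemma exists_trunc [NeZero k] (q : Ix n k →₀ ℕ) : ∃ q', Trunc p q' ∧ tp p q' = tp p q ∧
    qdeg p q' = qdeg p q ∧ qwt p q' ≤ qwt p q ∧ (¬ Trunc p q → qwt p q' < qwt p q) := by
  have hp := (Fact.out : p.Prime).two_le
  induction h : q.degree using Nat.strong_induction_on generalizing q with
  | _ N ih =>
  subst h
  by_cases hq : Trunc p q
  · exact ⟨q, hq, rfl, rfl, le_rfl, fun h => absurd hq h⟩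
  rw [Trunc] at hq
  push Not at hq
  obtain ⟨l, hl⟩ := hq
  obtain ⟨r, rfl⟩ : ∃ r, q = r + Finsupp.single l p :=
    ⟨q - Finsupp.single l p, (tsub_add_cancel_of_le (Finsupp.single_le_iff.2 hl)).symm⟩
  have hdeg : (r + Finsupp.single l.succ 1).degree < (r + Finsupp.single l p).degree := by
    rw [map_add, map_add, Finsupp.degree_single, Finsupp.degree_single]; omega
  obtain ⟨q', h1, h2, h3, h4, -⟩ := ih _ hdeg _ rfl
  have h5 : qwt p (r + Finsupp.single l.succ 1) < qwt p (r + Finsupp.single l p) := by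
    rw [qwt_add, qwt_add, qwt_single, qwt_single]
    have h6 : 1 ≤ mayM p n k l.1 :=
      one_le_mayM p (le_trans (Nat.one_le_iff_ne_zero.2 (NeZero.ne k)) l.1.2)
    have : 2 * mayM p n k l.1 ≤ p * mayM p n k l.1 := Nat.mul_le_mul_right _ hp
    change _ + 1 * mayM p n k l.1 < _
    omega
  refine ⟨q', h1, ?_, ?_, h4.trans h5.le, fun _ => h4.trans_lt h5⟩
  · rw [h2, tp_add, tp_add, tp_single, tp_single, tt_succ, pow_one]
  · rw [h3, qdeg_add, qdeg_add, qdeg_single, qdeg_single]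
    change _ + 1 • hDeg p n l.1 (l.2 + 1) = _
    rw [hDeg_add_one, one_smul]

/-- The element `x` is a monomial of degree `g` and weight at most `w`. -/
def IsMono (x : S p n k) (g : Deg p n) (w : ℕ) : Prop :=
  ∃ q : Ix n k →₀ ℕ, tp p q = x ∧ qdeg p q = g ∧ qwt p q ≤ w

variable {p}

lemma IsMono.one : IsMono p (1 : S p n k) 0 0 := ⟨0, by simp, by simp, by simp⟩

lemma IsMono.mul {x y : S p n k} {g h : Deg p n} {v w : ℕ} (hx : IsMono p x g v)
    (hy : IsMono p y h w) : IsMono p (x * y) (g + h) (v + w) := by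
  obtain ⟨q, rfl, rfl, hq⟩ := hx
  obtain ⟨r, rfl, rfl, hr⟩ := hy
  exact ⟨q + r, tp_add p q r, qdeg_add p q r, by rw [qwt_add]; omega⟩

lemma IsMono.mono {x : S p n k} {g : Deg p n} {v w : ℕ} (hx : IsMono p x g v) (h : v ≤ w) :
    IsMono p x g w := by
  obtain ⟨q, rfl, rfl, hq⟩ := hx
  exact ⟨q, rfl, rfl, hq.trans h⟩

lemma IsMono.prod {ι : Type} {s : Finset ι} {x : ι → S p n k} {g : ι → Deg p n} {w : ι → ℕ}
    (h : ∀ i ∈ s, IsMono p (x i) (g i) (w i)) :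
    IsMono p (∏ i ∈ s, x i) (∑ i ∈ s, g i) (∑ i ∈ s, w i) := by
  classical
  induction s using Finset.induction_on with
  | empty => exact IsMono.one
  | insert i s hi ih =>
    rw [Finset.prod_insert hi, Finset.sum_insert hi, Finset.sum_insert hi]
    exact (h i (Finset.mem_insert_self _ _)).mul
      (ih fun j hj => h j (Finset.mem_insert_of_mem hj))

variable (p) in
lemma isMono_tt_pow (l : Ix n k) (c : ℕ) :
    IsMono p (tt p l ^ c) (c • hDeg p n l.1 l.2) ((Nat.digits p c).sum * mayM p n k l.1) := by
  have hp := (Fact.out : p.Prime).two_le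
  induction c using Nat.strong_induction_on generalizing l with
  | _ c ih =>
  rcases Nat.eq_zero_or_pos c with rfl | hc
  · simpa using IsMono.one
  have h1 := ih (c / p) (Nat.div_lt_self hc hp) l.succ
  rw [tt_succ, ← pow_mul, show hDeg p n (l.succ).1 (l.succ).2 = p • hDeg p n l.1 l.2 from
    hDeg_add_one p _ _, ← mul_smul] at h1
  have h2 : IsMono p (tt p l ^ (c % p)) ((c % p) • hDeg p n l.1 l.2)
      ((c % p) * mayM p n k l.1) :=
    ⟨Finsupp.single l (c % p), tp_single p _ _, qdeg_single p _ _, (qwt_single p _ _).le⟩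
  have h3 := h2.mul h1
  rwa [← pow_add, ← add_smul, Nat.mod_add_div, mul_comm (c / p) p, Nat.mod_add_div,
    show (l.succ).1 = l.1 from rfl, ← add_mul, ← digits_sum_eq] at h3

lemma toS_monomial (e : Expo k) : toS p n k (MvPolynomial.monomial e 1) =
    e.prod fun s c => tt p ((s, 0) : Ix n k) ^ c := by
  rw [MvPolynomial.monomial_eq, map_mul, Finsupp.prod, map_prod, MvPolynomial.C_1, map_one, one_mul,
    Finsupp.prod]
  refine Finset.prod_congr rfl fun s _ => ?_
  rw [map_pow, tt, ZMod.val_zero, pow_zero, pow_one]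

lemma isMono_toS (e : Expo k) :
    IsMono p (toS p n k (MvPolynomial.monomial e 1)) (monoDeg p n k e) (monoM p n k e) := by
  rw [toS_monomial]
  have := IsMono.prod (s := e.support) fun s _ => isMono_tt_pow p ((s, 0) : Ix n k) (e s)
  convert this using 1
  · rfl
  · refine Finset.sum_congr rfl fun s _ => ?_
    rw [hDeg, ZMod.val_zero, pow_zero, mul_one, nsmul_eq_mul, ← Nat.cast_mul]
  · rfl

variable (p) in
/-- The exponents of `∏ t_{i,j}^{q_{i,j}}` as a monomial in the `t_i`. -/
def enc (q : Ix n k →₀ ℕ) : Expo k := q.sum fun l m => Finsupp.single l.1 (m * p ^ l.2.val)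

lemma enc_add (q q' : Ix n k →₀ ℕ) : enc p (q + q') = enc p q + enc p q' :=
  Finsupp.sum_add_index' (by simp) (by intros; rw [add_mul, Finsupp.single_add])

lemma enc_single (l : Ix n k) (m : ℕ) :
    enc p (Finsupp.single l m) = Finsupp.single l.1 (m * p ^ l.2.val) :=
  Finsupp.sum_single_index (by simp)

lemma toS_enc (q : Ix n k →₀ ℕ) : toS p n k (MvPolynomial.monomial (enc p q) 1) = tp p q := by
  induction q using Finsupp.induction_linear with
  | zero => simp [enc]
  | add q q' h h' =>
    rw [enc_add, tp_add, ← h, ← h', ← map_mul, MvPolynomial.monomial_mul, one_mul]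
  | single l m =>
    rw [enc_single, tp_single, tt, ← pow_mul, ← map_pow, MvPolynomial.X_pow_eq_monomial,
      mul_comm]

lemma monoM_add_le (e e' : Expo k) : monoM p n k (e + e') ≤ monoM p n k e + monoM p n k e' := by
  classical
  rw [monoM, monoM, monoM, Finsupp.sum_of_support_subset _ Finsupp.support_add _ (by simp),
    Finsupp.sum_of_support_subset e (Finset.subset_union_left (s₂ := e'.support)) _ (by simp),
    Finsupp.sum_of_support_subset e' (Finset.subset_union_right (s₁ := e.support)) _ (by simp),
    ← Finset.sum_add_distrib]
  refine Finset.sum_le_sum fun s _ => ?_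
  rw [← add_mul]
  exact Nat.mul_le_mul_right _ (digits_sum_add_le p _ _)

lemma monoM_enc_le (q : Ix n k →₀ ℕ) : monoM p n k (enc p q) ≤ qwt p q := by
  induction q using Finsupp.induction_linear with
  | zero => simp [enc, monoM]
  | add q q' h h' =>
    rw [enc_add, qwt_add]
    exact (monoM_add_le _ _).trans (add_le_add h h')
  | single l m =>
    rw [enc_single, qwt_single, monoM, Finsupp.sum_single_index (by simp)]
    exact Nat.mul_le_mul_right _ (digits_sum_mul_pow_le p _ _)

lemma monoDeg_add (e e' : Expo k) : monoDeg p n k (e + e') = monoDeg p n k e + monoDeg p n k e' :=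
  Finsupp.sum_add_index' (by simp) (by intros; push_cast; ring)

lemma monoDeg_enc (q : Ix n k →₀ ℕ) : monoDeg p n k (enc p q) = qdeg p q := by
  induction q using Finsupp.induction_linear with
  | zero => simp [enc, monoDeg]
  | add q q' h h' => rw [enc_add, qdeg_add, monoDeg_add, h, h']
  | single l m =>
    rw [enc_single, qdeg_single, monoDeg, Finsupp.sum_single_index (by simp), hDeg, nsmul_eq_mul,
      ← Nat.cast_mul]
    congr 1; ring

end SMonomials

end

/-! ### The monomial basis of `S(n,k)` -/

section

section SBasis

variable {p n k : ℕ} [Fact p.Prime] [NeZero n]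

/-- The reduction of exponents according to `t^{p^n} = t`. -/
def redExp (p n c : ℕ) : ℕ := if c = 0 then 0 else (c - 1) % (p ^ n - 1) + 1

lemma redExp_zero : redExp p n 0 = 0 := if_pos rfl

lemma one_lt_pow_p (p n : ℕ) [Fact p.Prime] [NeZero n] : 1 < p ^ n :=
  Nat.one_lt_pow (NeZero.ne n) (Fact.out : p.Prime).one_lt

lemma redExp_add (c : ℕ) : redExp p n (c + p ^ n) = redExp p n (c + 1) := by
  have h := one_lt_pow_p p n
  rw [redExp, redExp, if_neg (by omega), if_neg (by omega), Nat.add_sub_assoc h.le,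
    Nat.add_mod_right, Nat.add_sub_cancel]

lemma redExp_of_lt {c : ℕ} (hc : c < p ^ n) : redExp p n c = c := by
  rw [redExp]
  split_ifs with h
  · exact h.symm
  · rw [Nat.mod_eq_of_lt (by omega)]; omega

variable (p n k) in
/-- The reduction of monomials according to the relations `t_s^{p^n} = t_s`. -/
def nform : MvPolynomial {s : ℕ // k ≤ s} (ZMod p) →ₗ[ZMod p] (Expo k →₀ ZMod p) :=
  (MvPolynomial.basisMonomials _ (ZMod p)).constr (ZMod p) fun e =>
    Finsupp.single (e.mapRange (redExp p n) redExp_zero) 1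

lemma nform_monomial (e : Expo k) : nform p n k (MvPolynomial.monomial e 1) =
    Finsupp.single (e.mapRange (redExp p n) redExp_zero) 1 := by
  have := (MvPolynomial.basisMonomials _ (ZMod p)).constr_basis (ZMod p)
    (fun e : Expo k => Finsupp.single (e.mapRange (redExp p n) redExp_zero) (1 : ZMod p)) e
  rwa [MvPolynomial.coe_basisMonomials] at this

lemma nform_relIdeal {f : MvPolynomial {s : ℕ // k ≤ s} (ZMod p)} (hf : f ∈ relIdeal p n k) :
    nform p n k f = 0 := by
  suffices ∀ g, nform p n k (g * f) = 0 by simpa using this 1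
  induction hf using Submodule.span_induction with
  | mem f hf =>
    obtain ⟨s, rfl⟩ := hf
    intro g
    suffices nform p n k ∘ₗ LinearMap.mulRight (ZMod p) (MvPolynomial.X s ^ p ^ n -
        MvPolynomial.X s) = 0 from LinearMap.congr_fun this g
    refine poly_hom_ext fun e => ?_
    rw [LinearMap.comp_apply, LinearMap.mulRight_apply, mul_sub, map_sub,
      MvPolynomial.X_pow_eq_monomial, MvPolynomial.X, MvPolynomial.monomial_mul,
      MvPolynomial.monomial_mul, mul_one, nform_monomial, nform_monomial, LinearMap.zero_apply,
      sub_eq_zero]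
    congr 1
    ext s'
    classical
    simp only [Finsupp.mapRange_apply, Finsupp.add_apply, Finsupp.single_apply]
    split_ifs
    · exact redExp_add _
    · rfl
  | zero => simp
  | add f f' _ _ h h' => intro g; rw [mul_add, map_add, h, h', add_zero]
  | smul a f _ h => intro g; rw [smul_eq_mul, ← mul_assoc]; exact h _

lemma enc_apply (q : Ix n k →₀ ℕ) (s : {s : ℕ // k ≤ s}) :
    enc p q s = ∑ j ∈ Finset.range n, q (s, (j : ZMod n)) * p ^ j := by
  classical
  induction q using Finsupp.induction_linear with
  | zero => simp [enc]
  | add q q' h h' =>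
    rw [enc_add, Finsupp.add_apply, h, h', ← Finset.sum_add_distrib]
    exact Finset.sum_congr rfl fun j _ => by rw [Finsupp.add_apply, add_mul]
  | single l m =>
    rw [enc_single, Finsupp.single_apply]
    split_ifs with h
    · rw [Finset.sum_eq_single l.2.val]
      · rw [ZMod.natCast_zmod_val, ← h]
        simp
      · intro j hj hne
        rw [Finsupp.single_apply, if_neg, zero_mul]
        intro h'
        refine hne ?_
        rw [h', ZMod.val_natCast_of_lt (Finset.mem_range.1 hj)]
      · intro h'
        exact absurd (Finset.mem_range.2 (ZMod.val_lt _)) h'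
    · refine (Finset.sum_eq_zero fun j _ => ?_).symm
      rw [Finsupp.single_apply, if_neg, zero_mul]
      intro h'
      exact h (congrArg Prod.fst h')

lemma enc_inj {q q' : Ix n k →₀ ℕ} (hq : Trunc p q) (hq' : Trunc p q') (h : enc p q = enc p q') :
    q = q' := by
  ext ⟨s, j⟩
  have h1 := DFunLike.congr_fun h s
  rw [enc_apply, enc_apply] at h1
  have := sum_digits_inj n (fun j => q (s, (j : ZMod n))) (fun j => q' (s, (j : ZMod n)))
    (fun _ => hq _) (fun _ => hq' _) h1 j.val (ZMod.val_lt j)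
  simpa using this

lemma nform_enc {q : Ix n k →₀ ℕ} (hq : Trunc p q) :
    nform p n k (MvPolynomial.monomial (enc p q) 1) = Finsupp.single (enc p q) 1 := by
  rw [nform_monomial]
  congr 1
  ext s
  rw [Finsupp.mapRange_apply]
  refine redExp_of_lt ?_
  rw [enc_apply]
  exact sum_digits_lt n (fun j => q (s, (j : ZMod n))) fun _ => hq _

variable (p n k) in
lemma linearIndependent_tp :
    LinearIndependent (ZMod p) fun q : {q : Ix n k →₀ ℕ // Trunc p q} => tp p q.1 := by
  rw [linearIndependent_iff]
  intro c hc
  have h1 : toS p n k (Finsupp.linearCombination (ZMod p)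
      (fun q : {q : Ix n k →₀ ℕ // Trunc p q} => MvPolynomial.monomial (enc p q.1) (1 : ZMod p)) c)
      = 0 := by
    rw [← hc, Finsupp.linearCombination_apply, Finsupp.linearCombination_apply, Finsupp.sum,
      map_sum]
    refine Finset.sum_congr rfl fun q _ => ?_
    rw [map_smul, toS_enc]
  have h2 := nform_relIdeal (Ideal.Quotient.eq_zero_iff_mem.1 h1)
  rw [Finsupp.linearCombination_apply, Finsupp.sum, map_sum] at h2
  have h3 : Finsupp.mapDomain (fun q : {q : Ix n k →₀ ℕ // Trunc p q} => enc p q.1) c = 0 := by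
    rw [← h2, Finsupp.mapDomain, Finsupp.sum]
    refine Finset.sum_congr rfl fun q _ => ?_
    rw [map_smul, nform_enc q.2, Finsupp.smul_single, smul_eq_mul, mul_one]
  have h4 : Function.Injective (fun q : {q : Ix n k →₀ ℕ // Trunc p q} => enc p q.1) :=
    fun q q' h => Subtype.ext (enc_inj q.2 q'.2 h)
  exact Finsupp.mapDomain_injective h4 (h3.trans Finsupp.mapDomain_zero.symm)

variable [NeZero k]

lemma mem_span_tp (x : S p n k) :
    x ∈ Submodule.span (ZMod p) {y | ∃ q : Ix n k →₀ ℕ, Trunc p q ∧ y = tp p q} := by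
  obtain ⟨f, rfl⟩ := Ideal.Quotient.mkₐ_surjective (ZMod p) (relIdeal p n k) x
  change toS p n k f ∈ _
  induction f using MvPolynomial.induction_on' with
  | monomial e c =>
    obtain ⟨q, h1, -, -⟩ := isMono_toS (p := p) (n := n) e
    obtain ⟨q', h2, h3, -⟩ := exists_trunc p q
    rw [← mul_one c, ← smul_eq_mul, ← MvPolynomial.smul_monomial, map_smul, ← h1, ← h3]
    exact Submodule.smul_mem _ _ (Submodule.subset_span ⟨q', h2, rfl⟩)
  | add f g hf hg => rw [map_add]; exact add_mem hf hg

lemma counit_tt (l : Ix n k) : counit p n k (tt p l) = 0 := by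
  rw [tt, map_pow]
  have : counit p n k (toS p n k (MvPolynomial.X l.1)) = 0 := by
    change MvPolynomial.aeval _ (MvPolynomial.X l.1) = _
    rw [MvPolynomial.aeval_X]
  rw [this]
  exact zero_pow (pow_ne_zero _ (Fact.out : p.Prime).ne_zero)

lemma counit_tp {q : Ix n k →₀ ℕ} (hq : q ≠ 0) : counit p n k (tp p q) = 0 := by
  obtain ⟨l, hl⟩ := Finsupp.ne_iff.1 hq
  rw [tp, Finsupp.prod, map_prod]
  refine Finset.prod_eq_zero (Finsupp.mem_support_iff.2 hl) ?_
  rw [map_pow, counit_tt, zero_pow hl]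

variable (p) in
/-- The product of the factorials of the exponents. -/
def qfact {I : Type} (q : I →₀ ℕ) : ZMod p := q.prod fun _ m => (m.factorial : ZMod p)

lemma factorial_ne_zero {m : ℕ} (h : m < p) : (m.factorial : ZMod p) ≠ 0 := by
  rw [Ne, ZMod.natCast_eq_zero_iff, (Fact.out : p.Prime).dvd_factorial]
  omega

lemma qfact_ne_zero {I : Type} {q : I →₀ ℕ} (h : Trunc p q) : qfact p q ≠ 0 :=
  Finset.prod_ne_zero_iff.2 fun l _ => factorial_ne_zero (h l)

/-- The class of the divided power `t^q / q!` in the augmentation ideal. -/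
def gam (a : Letter p (Ix n k)) : Sbar p n k := (qfact p a.1)⁻¹ • pr p n k (tp p a.1)

lemma coe_pr_tp {q : Ix n k →₀ ℕ} (hq : q ≠ 0) : (pr p n k (tp p q) : S p n k) = tp p q := by
  change tp p q - algebraMap (ZMod p) (S p n k) (counit p n k (tp p q)) = tp p q
  rw [counit_tp hq, map_zero, sub_zero]

lemma pr_one : pr p n k 1 = 0 := by
  apply Subtype.ext
  change 1 - algebraMap (ZMod p) (S p n k) (counit p n k 1) = 0
  rw [map_one, map_one, sub_self]

variable (p n k) in
/-- The basis of the augmentation ideal by divided powers. -/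
def gamBasis : Module.Basis (Letter p (Ix n k)) (ZMod p) (Sbar p n k) :=
  Module.Basis.mk (v := gam) (by
    have h1 : LinearIndependent (ZMod p) fun a : Letter p (Ix n k) => tp p a.1 :=
      (linearIndependent_tp p n k).comp (fun a : Letter p (Ix n k) => ⟨a.1, a.2.2⟩)
        fun a b h => Subtype.ext (by simpa using h)
    have h2 := h1.units_smul fun a => Units.mk0 (qfact p a.1)⁻¹ (inv_ne_zero (qfact_ne_zero a.2.2))
    refine LinearIndependent.of_comp (Submodule.subtype _) ?_
    convert h2 using 1
    funext a
    change (qfact p a.1)⁻¹ • (pr p n k (tp p a.1) : S p n k) = (qfact p a.1)⁻¹ • tp p a.1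
    rw [coe_pr_tp a.2.1]) (by
    rintro x -
    rw [← pr_coe p n k x]
    refine Submodule.span_induction (p := fun y _ => pr p n k y ∈ _) ?_ ?_ ?_ ?_
      (mem_span_tp (x : S p n k))
    · rintro _ ⟨q, hq, rfl⟩
      by_cases h0 : q = 0
      · rw [h0, tp_zero, pr_one]; exact zero_mem _
      · have : pr p n k (tp p q) = qfact p q • gam ⟨q, h0, hq⟩ := by
          rw [gam, smul_smul, mul_inv_cancel₀ (qfact_ne_zero hq), one_smul]
        rw [this]
        exact Submodule.smul_mem _ _ (Submodule.subset_span ⟨_, rfl⟩)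
    · rw [map_zero]; exact zero_mem _
    · intro y z _ _ hy hz; rw [map_add]; exact add_mem hy hz
    · intro c y _ hy; rw [map_smul]; exact Submodule.smul_mem _ _ hy)

variable (p n k) in
/-- The cobar complex is the free algebra on the divided powers. -/
def theta : Om p (Ix n k) ≃ₐ[ZMod p] Cobar p n k :=
  (TensorAlgebra.equivFreeAlgebra (gamBasis p n k)).symm

lemma theta_ι (a : Letter p (Ix n k)) :
    theta p n k (FreeAlgebra.ι _ a) = TensorAlgebra.ι (ZMod p) (gam a) := by
  rw [theta, TensorAlgebra.equivFreeAlgebra_symm_ι, gamBasis, Module.Basis.mk_apply]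

lemma br_tp {q : Ix n k →₀ ℕ} (hq : Trunc p q) :
    br p n k (tp p q) = qfact p q • theta p n k (lt p q) := by
  by_cases h0 : q = 0
  · rw [h0, tp_zero, lt_zero, map_zero, smul_zero, br, LinearMap.comp_apply, pr_one, map_zero]
  · rw [lt, dif_pos ⟨h0, hq⟩, theta_ι, gam, map_smul, smul_smul,
      mul_inv_cancel₀ (qfact_ne_zero hq), one_smul]; rfl

end SBasis

/-! ### The May filtration of words -/

section Filtration

variable {p n k : ℕ} [Fact p.Prime] [NeZero n]

variable (p n k) in
/-- The tridegree (cohomological degree, internal degree, May filtration) of words. -/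
def triWt : WordWt (Ix n k) (ℤ × Deg p n × ℤ) where
  ℓ := (1, 0, 0)
  e l := (0, hDeg p n l.1 l.2, mayM p n k l.1)

lemma triWt_ldeg (q : Ix n k →₀ ℕ) : (triWt p n k).ldeg q = (1, qdeg p q, (qwt p q : ℤ)) := by
  induction q using Finsupp.induction_linear with
  | zero => simp [WordWt.ldeg, triWt]
  | add q q' h h' =>
    have := (triWt p n k).ldeg_add q q'
    rw [h, h'] at this
    rw [← add_right_inj (triWt p n k).ℓ, ← this, qdeg_add, qwt_add]
    simp [triWt]
  | single l m =>
    rw [WordWt.ldeg_single, qdeg_single, qwt_single]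
    simp [triWt]

/-- The words of cohomological degree `s`, internal degree `u` and May filtration `≤ M`. -/
def FPred (p n k : ℕ) [Fact p.Prime] (s : ℤ) (u : Deg p n) (M : ℤ)
    (l : List (Letter p (Ix n k))) : Prop :=
  ((triWt p n k).wdeg l).1 = s ∧ ((triWt p n k).wdeg l).2.1 = u ∧ ((triWt p n k).wdeg l).2.2 ≤ M

variable (p n k) in
/-- The span of the words of cohomological degree `s`, internal degree `u` and May filtration
`≤ M`. -/
def FO (s : ℤ) (u : Deg p n) (M : ℤ) : Submodule (ZMod p) (Om p (Ix n k)) :=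
  wspan (ZMod p) (FPred p n k s u M)

lemma FO_mono {s : ℤ} {u : Deg p n} {M M' : ℤ} (h : M ≤ M') : FO p n k s u M ≤ FO p n k s u M' :=
  wspan_mono fun _ hl => ⟨hl.1, hl.2.1, hl.2.2.trans h⟩

lemma FO_mul {s s' : ℤ} {u u' : Deg p n} {M M' : ℤ} {x y : Om p (Ix n k)} (hx : x ∈ FO p n k s u M)
    (hy : y ∈ FO p n k s' u' M') : x * y ∈ FO p n k (s + s') (u + u') (M + M') :=
  wspan_mul (fun l l' h h' => by
    rw [FPred, WordWt.wdeg_append]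
    exact ⟨by rw [← h.1, ← h'.1]; rfl, by rw [← h.2.1, ← h'.2.1]; rfl, add_le_add h.2.2 h'.2.2⟩)
    hx hy

lemma one_mem_FO : (1 : Om p (Ix n k)) ∈ FO p n k 0 0 0 := by
  rw [← word_nil]; exact word_mem_wspan ⟨rfl, rfl, le_rfl⟩

lemma lt_mem_FO (q : Ix n k →₀ ℕ) : lt p q ∈ FO p n k 1 (qdeg p q) (qwt p q) := by
  refine wspan_mono (fun l hl => ?_) (lt_mem_wdeg (triWt p n k) q)
  rw [triWt_ldeg] at hl
  rw [FPred, hl]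
  exact ⟨rfl, rfl, le_rfl⟩

lemma mem_FO_of_wdeg {s : ℤ} {u : Deg p n} {M : ℤ} {x : Om p (Ix n k)}
    (hx : x ∈ wspan (ZMod p) fun l => (triWt p n k).wdeg l = (s, u, M)) : x ∈ FO p n k s u M :=
  wspan_mono (fun l hl => by rw [FPred, hl]; exact ⟨rfl, rfl, le_rfl⟩) hx

variable [NeZero k]

lemma br_mem {x : S p n k} {g : Deg p n} {w : ℕ} (hx : IsMono p x g w) :
    ∃ y ∈ FO p n k 1 g w, theta p n k y = br p n k x := by
  obtain ⟨q, rfl, rfl, hw⟩ := hx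
  obtain ⟨q', h1, h2, h3, h4, -⟩ := exists_trunc p q
  refine ⟨qfact p q' • lt p q', Submodule.smul_mem _ _ ?_, by rw [← h2, br_tp h1, map_smul]⟩
  rw [← h3]
  exact FO_mono (by exact_mod_cast h4.trans hw) (lt_mem_FO q')

lemma theta_word (l : List (Letter p (Ix n k))) : ∃ c : ZMod p, theta p n k (word _ l) =
    c • ((l.map fun a => enc p a.1).map (brMono p n k)).prod := by
  induction l with
  | nil => exact ⟨1, by simp⟩
  | cons a l ih =>
    obtain ⟨c, hc⟩ := ih
    refine ⟨(qfact p a.1)⁻¹ * c, ?_⟩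
    have : theta p n k (FreeAlgebra.ι _ a) = (qfact p a.1)⁻¹ • brMono p n k (enc p a.1) := by
      rw [brMono, toS_enc, br_tp a.2.2, smul_smul, inv_mul_cancel₀ (qfact_ne_zero a.2.2), one_smul,
        lt_letter]
    rw [word_cons, map_mul, hc, this, smul_mul_smul_comm]
    simp

lemma FC_eq (s : ℤ) (u : Deg p n) (M : ℤ) :
    FC p n k s u M = (FO p n k s u M).map (theta p n k).toLinearMap := by
  apply le_antisymm
  · refine Submodule.span_le.2 ?_
    rintro _ ⟨L, -, rfl, rfl, h3, rfl⟩
    suffices ∃ y ∈ FO p n k L.length (L.map (monoDeg p n k)).sum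
        (((L.map (monoM p n k)).sum : ℕ) : ℤ), theta p n k y = (L.map (brMono p n k)).prod by
      obtain ⟨y, hy, hy'⟩ := this
      exact ⟨y, FO_mono h3 hy, hy'⟩
    clear h3
    induction L with
    | nil => exact ⟨1, one_mem_FO, by simp⟩
    | cons e L ih =>
      obtain ⟨y, hy, hy'⟩ := ih
      obtain ⟨z, hz, hz'⟩ := br_mem (isMono_toS (p := p) (n := n) e)
      refine ⟨z * y, ?_, by rw [map_mul, hy', hz']; rfl⟩
      have := FO_mul hz hy
      simp only [List.map_cons, List.sum_cons, List.length_cons]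
      rw [Nat.cast_add, Nat.cast_succ, add_comm (L.length : ℤ)]
      exact this
  · rw [Submodule.map_le_iff_le_comap]
    refine wspan_le fun l hl => ?_
    obtain ⟨c, hc⟩ := theta_word l
    rw [Submodule.mem_comap]
    change theta p n k (word _ l) ∈ _
    rw [hc]
    refine Submodule.smul_mem _ _ (Submodule.subset_span ⟨_, ?_, ?_, ?_, ?_, rfl⟩)
    · intro e he
      obtain ⟨a, -, rfl⟩ := List.mem_map.1 he
      intro h
      refine a.2.1 (enc_inj a.2.2 (fun _ => (Fact.out : p.Prime).pos) ?_)
      rw [h]; simp [enc]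
    all_goals
      obtain ⟨h1, h2, h3⟩ := hl
      have hw : (triWt p n k).wdeg l = ((l.length : ℤ), (l.map fun a => qdeg p a.1).sum,
          (((l.map fun a => qwt p a.1).sum : ℕ) : ℤ)) := by
        clear h1 h2 h3 hc
        induction l with
        | nil => rfl
        | cons a l ih =>
          rw [WordWt.wdeg_cons, ih, triWt_ldeg]
          simp [add_comm]
      rw [hw] at h1 h2 h3
    · rw [List.length_map, ← h1]
    · rw [← h2, List.map_map]
      congr 1
      exact List.map_congr_left fun (a : Letter p (Ix n k)) _ => monoDeg_enc a.1
    · refine le_trans ?_ h3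
      have : ((l.map fun a => enc p a.1).map (monoM p n k)).sum ≤ (l.map fun a => qwt p a.1).sum := by
        clear h1 h2 h3 hw hc
        induction l with
        | nil => simp
        | cons a l ih =>
          simp only [List.map_cons, List.sum_cons]
          exact add_le_add (monoM_enc_le a.1) ih
      exact Nat.cast_le.2 this

end Filtration

end

/-! ### Weight estimates for the coproduct polynomials -/

section

section PolyWeight

variable (p n k : ℕ) [Fact p.Prime] [NeZero n]

lemma mayM_of_lt {s : ℕ} (h : s < n + k) : mayM p n k s = 2 * s - 1 := by
  rw [mayM, dif_neg (by omega)]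

lemma mayM_of_le {s : ℕ} (h : n + k ≤ s) :
    mayM p n k s = max (2 * s - 1) (p * mayM p n k (s - n) + 1) := by
  have := NeZero.pos n
  rw [mayM, dif_pos ⟨this, h⟩]

/-- The filtration `M` is superadditive. -/
lemma mayM_add_lt {a b : ℕ} (ha : 1 ≤ a) (hb : 1 ≤ b) :
    mayM p n k a + mayM p n k b + 1 ≤ mayM p n k (a + b) := by
  induction h : a + b using Nat.strong_induction_on generalizing a b with
  | _ N ih =>
  subst h
  have hn := NeZero.pos n
  have hp := (Fact.out : p.Prime).two_le
  -- the case where the second term of the maximum that defines `M(t_b)` is the larger one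
  have key : ∀ a b, 1 ≤ a → n + k ≤ b → (∀ m < a + b, ∀ {a b : ℕ}, 1 ≤ a → 1 ≤ b → a + b = m →
      mayM p n k a + mayM p n k b + 1 ≤ mayM p n k m) → 1 ≤ b - n →
      mayM p n k a + (p * mayM p n k (b - n) + 1) + 1 ≤ mayM p n k (a + b) := by
    intro a b ha hb ih hbn
    rw [mayM_of_le p n k (s := a + b) (by omega)]
    refine le_trans ?_ (le_max_right _ _)
    have h1 := ih (a + b - n) (by omega) ha hbn (by omega)
    have h2 := Nat.mul_le_mul_left p h1
    have h3 : 2 * mayM p n k a ≤ p * mayM p n k a := Nat.mul_le_mul_right _ hp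
    rw [mul_add, mul_add] at h2
    omega
  have lower : 2 * (a + b) - 1 ≤ mayM p n k (a + b) := by
    rw [mayM]; split_ifs <;> simp
  have cases : ∀ s, mayM p n k s = 2 * s - 1 ∨
      (n + k ≤ s ∧ mayM p n k s = p * mayM p n k (s - n) + 1 ∧ 1 ≤ s - n) := by
    intro s
    by_cases h : n + k ≤ s
    · rw [mayM_of_le p n k h]
      rcases Nat.eq_zero_or_pos (s - n) with h0 | h0
      · left
        rw [h0, mayM, dif_neg (by omega)]
        omega
      · rcases le_total (2 * s - 1) (p * mayM p n k (s - n) + 1) with h1 | h1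
        · exact Or.inr ⟨h, max_eq_right h1, h0⟩
        · exact Or.inl (max_eq_left h1)
    · exact Or.inl (mayM_of_lt p n k (by omega))
  rcases cases b with h1 | ⟨h1, h2, h3⟩
  · rcases cases a with h4 | ⟨h4, h5, h6⟩
    · omega
    · have := key b a hb h4 (by rw [add_comm]; exact ih) h6
      rw [add_comm a b, h5]; omega
  · have := key a b ha h1 ih h3
    omega

/-- The index of a variable. -/
def vIdx : ℕ ⊕ ℕ → ℕ := Sum.elim id id

/-- The degree of a monomial in the variables `t_a ⊗ 1` and `1 ⊗ t_a`. -/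
def pdeg (e : ℕ ⊕ ℕ →₀ ℕ) : Deg p n := e.sum fun v c => c • hDeg p n (vIdx v) 0

/-- The May filtration of a monomial in the variables `t_a ⊗ 1` and `1 ⊗ t_a`. -/
def pwt (e : ℕ ⊕ ℕ →₀ ℕ) : ℕ := e.sum fun v c => (Nat.digits p c).sum * mayM p n k (vIdx v)

lemma pdeg_add (e e' : ℕ ⊕ ℕ →₀ ℕ) : pdeg p n (e + e') = pdeg p n e + pdeg p n e' :=
  Finsupp.sum_add_index' (by simp) (by intros; rw [add_smul])

lemma pdeg_smul (m : ℕ) (e : ℕ ⊕ ℕ →₀ ℕ) : pdeg p n (m • e) = m • pdeg p n e := by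
  induction m with
  | zero => simp [pdeg]
  | succ m ih => rw [succ_nsmul, pdeg_add, ih, succ_nsmul]

lemma pwt_add_le (e e' : ℕ ⊕ ℕ →₀ ℕ) : pwt p n k (e + e') ≤ pwt p n k e + pwt p n k e' := by
  classical
  rw [pwt, pwt, pwt, Finsupp.sum_of_support_subset _ Finsupp.support_add _ (by simp),
    Finsupp.sum_of_support_subset e (Finset.subset_union_left (s₂ := e'.support)) _ (by simp),
    Finsupp.sum_of_support_subset e' (Finset.subset_union_right (s₁ := e.support)) _ (by simp),
    ← Finset.sum_add_distrib]
  refine Finset.sum_le_sum fun s _ => ?_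
  rw [← add_mul]
  exact Nat.mul_le_mul_right _ (digits_sum_add_le p _ _)

lemma pwt_smul_p (e : ℕ ⊕ ℕ →₀ ℕ) : pwt p n k (p • e) = pwt p n k e := by
  rw [pwt, Finsupp.sum_smul_index (by simp)]
  simp only [digits_sum_mul_self]
  rfl

/-- The integral polynomials that are homogeneous of degree `γ` and all of whose terms
`a X^e` satisfy `M(X^e) + c ≤ p^v M` for some `v` with `p^v ∣ a`. -/
def PH (γ : Deg p n) (c M : ℕ) : AddSubgroup ZPoly where
  carrier := {f | ∀ e, f.coeff e ≠ 0 →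
    pdeg p n e = γ ∧ ∃ v, (p : ℤ) ^ v ∣ f.coeff e ∧ pwt p n k e + c ≤ p ^ v * M}
  zero_mem' e h := absurd (MvPolynomial.coeff_zero e) h
  neg_mem' {f} hf e h := by
    rw [MvPolynomial.coeff_neg, neg_ne_zero] at h
    obtain ⟨h1, v, h2, h3⟩ := hf e h
    exact ⟨h1, v, by rw [MvPolynomial.coeff_neg]; exact (dvd_neg).2 h2, h3⟩
  add_mem' {f g} hf hg e h := by
    rw [MvPolynomial.coeff_add] at h ⊢
    by_cases h1 : f.coeff e = 0
    · rw [h1, zero_add] at h ⊢; exact hg e h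
    by_cases h2 : g.coeff e = 0
    · rw [h2, add_zero] at h ⊢; exact hf e h
    obtain ⟨h3, v, h4, h5⟩ := hf e h1
    obtain ⟨-, v', h6, h7⟩ := hg e h2
    refine ⟨h3, ?_⟩
    rcases le_total v v' with hv | hv
    · exact ⟨v, dvd_add h4 ((pow_dvd_pow _ hv).trans h6), h5⟩
    · exact ⟨v', dvd_add ((pow_dvd_pow _ hv).trans h4) h6, h7⟩

variable {p n k} {γ γ' : Deg p n} {c c' M M' : ℕ} {f g : ZPoly}

lemma PH_monomial {e : ℕ ⊕ ℕ →₀ ℕ} {a : ℤ} (v : ℕ) (h : (p : ℤ) ^ v ∣ a)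
    (hw : pwt p n k e + c ≤ p ^ v * M) :
    MvPolynomial.monomial e a ∈ PH p n k (pdeg p n e) c M := by
  classical
  intro e' he'
  rw [MvPolynomial.coeff_monomial] at he' ⊢
  split_ifs at he' ⊢ with h1
  · subst h1; exact ⟨rfl, v, h, hw⟩
  · exact absurd rfl he'

lemma PH_term (hf : f ∈ PH p n k γ c M) {e : ℕ ⊕ ℕ →₀ ℕ} (he : e ∈ f.support) :
    pdeg p n e = γ ∧ ∃ v, (p : ℤ) ^ v ∣ f.coeff e ∧ pwt p n k e + c ≤ p ^ v * M :=
  hf e (MvPolynomial.mem_support_iff.1 he)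

lemma PH_mono (hc : c' ≤ c) (hM : M ≤ M') (hf : f ∈ PH p n k γ c M) : f ∈ PH p n k γ c' M' := by
  intro e he
  obtain ⟨h1, v, h2, h3⟩ := hf e he
  exact ⟨h1, v, h2, le_trans (by omega) (h3.trans (Nat.mul_le_mul_left _ hM))⟩

lemma PH_shift (hM : M + c ≤ M') (hf : f ∈ PH p n k γ 0 M) : f ∈ PH p n k γ c M' := by
  intro e he
  obtain ⟨h1, v, h2, h3⟩ := hf e he
  refine ⟨h1, v, h2, ?_⟩
  have h4 : 1 ≤ p ^ v := Nat.one_le_pow _ _ (Fact.out : p.Prime).pos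
  have h5 := Nat.mul_le_mul_left (p ^ v) hM
  have h6 := Nat.mul_le_mul_right c h4
  rw [mul_add] at h5
  omega

lemma PH_mul (hf : f ∈ PH p n k γ c M) (hg : g ∈ PH p n k γ' c' M') :
    f * g ∈ PH p n k (γ + γ') (c + c') (M + M') := by
  rw [f.as_sum, g.as_sum, Finset.sum_mul_sum]
  refine sum_mem fun e he => sum_mem fun e' he' => ?_
  obtain ⟨rfl, v, h2, h3⟩ := PH_term hf he
  obtain ⟨rfl, v', h2', h3'⟩ := PH_term hg he'
  rw [MvPolynomial.monomial_mul, ← pdeg_add]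
  refine PH_monomial (v + v') (by rw [pow_add]; exact mul_dvd_mul h2 h2') ?_
  have h4 := pwt_add_le p n k e e'
  have hp := (Fact.out : p.Prime).pos
  have h5 : p ^ v * M ≤ p ^ (v + v') * M :=
    Nat.mul_le_mul_right _ (Nat.pow_le_pow_right hp (by omega))
  have h6 : p ^ v' * M' ≤ p ^ (v + v') * M' :=
    Nat.mul_le_mul_right _ (Nat.pow_le_pow_right hp (by omega))
  rw [mul_add]
  omega

lemma PH_one : (1 : ZPoly) ∈ PH p n k 0 0 0 := by
  have := PH_monomial (p := p) (n := n) (k := k) (e := 0) (a := 1) (c := 0) (M := 0) 0 (by simp)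
    (by simp [pwt])
  rwa [show pdeg p n 0 = 0 by simp [pdeg]] at this

lemma PH_pow (hf : f ∈ PH p n k γ c M) (m : ℕ) : f ^ m ∈ PH p n k (m • γ) (m * c) (m * M) := by
  induction m with
  | zero => simpa using PH_one
  | succ m ih => rw [pow_succ, succ_nsmul, add_mul, add_mul, one_mul, one_mul]; exact PH_mul ih hf

lemma PH_natCast_mul (m : ℕ) (hf : f ∈ PH p n k γ c M) : (m : ZPoly) * f ∈ PH p n k γ c M := by
  rw [← nsmul_eq_mul]; exact AddSubgroup.nsmul_mem _ hf m

lemma PH_p_mul (hf : f ∈ PH p n k γ c (p * M)) : (p : ZPoly) * f ∈ PH p n k γ c M := by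
  intro e he
  rw [coeff_natCast_mul] at he ⊢
  obtain ⟨h1, v, h2, h3⟩ := hf e (right_ne_zero_of_mul he)
  exact ⟨h1, v + 1, by rw [pow_succ']; exact mul_dvd_mul_left _ h2, by rwa [pow_succ, mul_assoc]⟩

lemma PH_of_p_mul (hf : (p : ZPoly) * f ∈ PH p n k γ c M) : f ∈ PH p n k γ c (p * M) := by
  have hp : (p : ℤ) ≠ 0 := by exact_mod_cast (Fact.out : p.Prime).ne_zero
  intro e he
  obtain ⟨h1, v, h2, h3⟩ := hf e (by rw [coeff_natCast_mul]; exact mul_ne_zero hp he)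
  rw [coeff_natCast_mul] at h2
  refine ⟨h1, ?_⟩
  cases v with
  | zero =>
    refine ⟨0, by simp, h3.trans (Nat.mul_le_mul_left _ ?_)⟩
    exact Nat.le_mul_of_pos_left _ (Fact.out : p.Prime).pos
  | succ v =>
    rw [pow_succ'] at h2
    exact ⟨v, (mul_dvd_mul_iff_left hp).1 h2, by rwa [pow_succ, mul_assoc] at h3⟩

variable (p) in
/-- The polynomial `((x+y)^p - x^p - y^p)/p`. -/
def wpoly {R : Type} [CommRing R] (x y : R) : R :=
  ∑ u ∈ Finset.Ioo 0 p, x ^ u * y ^ (p - u) * ((p.choose u / p : ℕ) : R)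

lemma add_pow_p {R : Type} [CommRing R] (x y : R) :
    (x + y) ^ p = x ^ p + y ^ p + p * wpoly p x y := by
  rw [add_pow_prime_eq (Fact.out : p.Prime) x y, mul_assoc (p : R), mul_assoc (p : R), wpoly,
    Finset.mul_sum]
  congr 2
  refine Finset.sum_congr rfl fun u hu => ?_
  rw [Finset.mem_Ioo] at hu
  obtain ⟨v, rfl⟩ : ∃ v, u = v + 1 := ⟨u - 1, by omega⟩
  obtain ⟨w, hw⟩ : ∃ w, p - (v + 1) = w + 1 := ⟨p - (v + 1) - 1, by omega⟩
  rw [hw, Nat.add_sub_cancel, Nat.add_sub_cancel, pow_succ, pow_succ]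
  ring

lemma map_wpoly {R R' : Type} [CommRing R] [CommRing R'] (φ : R →+* R') (x y : R) :
    φ (wpoly p x y) = wpoly p (φ x) (φ y) := by
  simp [wpoly]

lemma PH_wpoly (hf : f ∈ PH p n k γ 0 M) (hg : g ∈ PH p n k γ c M) :
    wpoly p f g ∈ PH p n k (p • γ) c (p * M) := by
  refine sum_mem fun u hu => ?_
  rw [Finset.mem_Ioo] at hu
  rw [mul_comm (f ^ u * g ^ (p - u))]
  refine PH_natCast_mul _ ?_
  have := PH_mul (PH_pow hf u) (PH_pow hg (p - u))
  rw [← add_smul, ← add_mul, Nat.add_sub_cancel' hu.2.le] at this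
  refine PH_mono ?_ le_rfl this
  have h1 : 1 ≤ p - u := by omega
  have := Nat.mul_le_mul_right c h1
  omega

/-- A `p`-th power does not raise the filtration: the cross terms gain a factor of `p`. -/
lemma PH_pow_p (hf : f ∈ PH p n k γ c M) : f ^ p ∈ PH p n k (p • γ) c M := by
  suffices f ∈ PH p n k γ c M ∧ f ^ p ∈ PH p n k (p • γ) c M from this.2
  have hs := f.support_sum_monomial_coeff
  have : ∀ T ⊆ f.support, ∑ e ∈ T, MvPolynomial.monomial e (f.coeff e) ∈ PH p n k γ c M ∧
      (∑ e ∈ T, MvPolynomial.monomial e (f.coeff e)) ^ p ∈ PH p n k (p • γ) c M := by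
    classical
    intro T
    induction T using Finset.induction_on with
    | empty =>
      intro _
      rw [Finset.sum_empty, zero_pow (Fact.out : p.Prime).ne_zero]
      exact ⟨zero_mem _, zero_mem _⟩
    | insert e T he ih =>
      intro hT
      obtain ⟨h1, h2⟩ := ih fun x hx => hT (Finset.mem_insert_of_mem hx)
      obtain ⟨rfl, v, h3, h4⟩ := PH_term hf (hT (Finset.mem_insert_self _ _))
      rw [Finset.sum_insert he, add_pow_p]
      have h5 := PH_monomial v h3 h4
      refine ⟨add_mem h5 h1, add_mem (add_mem ?_ h2) (PH_p_mul (PH_wpoly ?_ h1))⟩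
      · rw [MvPolynomial.monomial_pow, ← pdeg_smul]
        have hp := (Fact.out : p.Prime).pos
        refine PH_monomial v (h3.trans (dvd_pow_self _ hp.ne')) ?_
        rwa [pwt_smul_p]
      · exact PH_mono (Nat.zero_le _) le_rfl h5
  have h := this f.support subset_rfl
  rwa [hs] at h

lemma PH_pow_pow (hf : f ∈ PH p n k γ c M) (m : ℕ) : f ^ p ^ m ∈ PH p n k (p ^ m • γ) c M := by
  induction m with
  | zero => simpa using hf
  | succ m ih =>
    rw [pow_succ, pow_mul, mul_comm (p ^ m), mul_smul]
    exact PH_pow_p ih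

/-- The `p`-th power of `a + b`, up to `p²` and terms of lower weight. -/
lemma PH_expand {a b u r : ZPoly} (ha : a ∈ PH p n k γ 0 M) (hb : b ∈ PH p n k γ 0 M)
    (hr : r ∈ PH p n k γ 1 M) : ∃ u', ∃ r' ∈ PH p n k (p • γ) 1 M,
      (a + b + p * u + r) ^ p = a ^ p + b ^ p + p * (wpoly p a b + p * u') + r' := by
  have h1 : (p : ZPoly) ^ 2 ∣ (a + b + p * u + r) ^ p - (a + b + r) ^ p := by
    have := dvd_sub_pow_of_dvd_sub (R := ZPoly) (p := p) (a := a + b + p * u + r) (b := a + b + r)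
      ⟨u, by ring⟩ 1
    simpa using this
  obtain ⟨u', hu'⟩ := h1
  refine ⟨u', r ^ p + p * wpoly p (a + b) r,
    add_mem (PH_pow_p hr) (PH_p_mul (PH_wpoly (add_mem ha hb) hr)), ?_⟩
  rw [sub_eq_iff_eq_add.1 hu', add_pow_p (a + b) r, add_pow_p a b]
  ring

lemma PH_expand_pow {a b r : ZPoly} (ha : a ∈ PH p n k γ 0 M) (hb : b ∈ PH p n k γ 0 M)
    (hr : r ∈ PH p n k γ 1 M) (m : ℕ) : ∃ u, ∃ r' ∈ PH p n k (p ^ m • γ) 1 M,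
      (a + b + r) ^ p ^ m = a ^ p ^ m + b ^ p ^ m + p * u + r' := by
  induction m with
  | zero => exact ⟨0, r, by simpa using hr, by simp⟩
  | succ m ih =>
    obtain ⟨u, r', h1, h2⟩ := ih
    obtain ⟨u', r'', h3, h4⟩ := PH_expand (u := u) (PH_pow_pow ha m) (PH_pow_pow hb m) h1
    refine ⟨wpoly p (a ^ p ^ m) (b ^ p ^ m) + p * u', r'', ?_, ?_⟩
    · rwa [pow_succ', mul_smul]
    · rw [pow_succ, pow_mul, h2, h4, pow_mul, pow_mul]

variable (k) in
/-- Setting the variables `t_a ⊗ 1`, `1 ⊗ t_a` with `0 < a < k` to zero. -/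
def kill : ZPoly →ₐ[ℤ] ZPoly :=
  MvPolynomial.aeval fun v => if 0 < vIdx v ∧ vIdx v < k then 0 else MvPolynomial.X v

lemma kill_xVar {a : ℕ} (h : k ≤ a) (h0 : a ≠ 0) : kill k (xVar a) = xVar a := by
  rw [xVar, if_neg h0, kill, MvPolynomial.aeval_X]; exact if_neg fun h' => not_lt.2 h h'.2

lemma kill_yVar {a : ℕ} (h : k ≤ a) (h0 : a ≠ 0) : kill k (yVar a) = yVar a := by
  rw [yVar, if_neg h0, kill, MvPolynomial.aeval_X]; exact if_neg fun h' => not_lt.2 h h'.2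

lemma kill_xVar_of_lt {a : ℕ} (h : a < k) (h0 : a ≠ 0) : kill k (xVar a) = 0 := by
  rw [xVar, if_neg h0, kill, MvPolynomial.aeval_X]; exact if_pos ⟨Nat.pos_of_ne_zero h0, h⟩

lemma kill_yVar_of_lt {a : ℕ} (h : a < k) (h0 : a ≠ 0) : kill k (yVar a) = 0 := by
  rw [yVar, if_neg h0, kill, MvPolynomial.aeval_X]; exact if_pos ⟨Nat.pos_of_ne_zero h0, h⟩

variable (p k) in
/-- The sum `∑ t_a^{p^e} ⊗ t_b^{p^{a+e}}` over `a + b = s` with `a, b ≥ k`. -/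
def midSum (s e : ℕ) : ZPoly :=
  ∑ a ∈ Finset.Icc k (s - k), xVar a ^ p ^ e * yVar (s - a) ^ p ^ (a + e)

lemma p_pow_ne_zero (m : ℕ) : p ^ m ≠ 0 := pow_ne_zero _ (Fact.out : p.Prime).ne_zero

lemma kill_diagSum_of_lt {s : ℕ} (h : s < k) (h0 : s ≠ 0) (e : ℕ) :
    kill k (diagSum p s e) = 0 := by
  rw [diagSum, map_sum]
  refine Finset.sum_eq_zero fun a ha => ?_
  rw [Finset.mem_range] at ha
  rw [map_mul, map_pow, map_pow]
  by_cases ha0 : a = 0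
  · rw [kill_yVar_of_lt (by omega) (by omega), zero_pow (p_pow_ne_zero _), mul_zero]
  · rw [kill_xVar_of_lt (by omega) (by omega), zero_pow (p_pow_ne_zero _), zero_mul]

variable [NeZero k]

lemma kill_diagSum {s : ℕ} (h : k ≤ s) (e : ℕ) :
    kill k (diagSum p s e) = xVar s ^ p ^ e + yVar s ^ p ^ e + midSum p k s e := by
  have hk := NeZero.pos k
  rw [diagSum, map_sum, Finset.sum_range_succ, Finset.sum_range_eq_add_Ico _ (by omega)]
  have e1 : ∑ a ∈ Finset.Ico 1 s, kill k (xVar a ^ p ^ e * yVar (s - a) ^ p ^ (a + e)) =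
      midSum p k s e := by
    rw [midSum]
    symm
    have hsub : Finset.Icc k (s - k) ⊆ Finset.Ico 1 s := by
      intro a ha
      rw [Finset.mem_Icc] at ha
      rw [Finset.mem_Ico]; omega
    rw [← Finset.sum_subset hsub]
    · refine Finset.sum_congr rfl fun a ha => ?_
      rw [Finset.mem_Icc] at ha
      rw [map_mul, map_pow, map_pow, kill_xVar (by omega) (by omega),
        kill_yVar (by omega) (by omega)]
    · intro a ha ha'
      rw [Finset.mem_Icc] at ha'
      rw [Finset.mem_Ico] at ha
      rw [map_mul, map_pow, map_pow]
      by_cases h1 : a < k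
      · rw [kill_xVar_of_lt h1 (by omega), zero_pow (p_pow_ne_zero _), zero_mul]
      · rw [kill_yVar_of_lt (a := s - a) (by omega) (by omega), zero_pow (p_pow_ne_zero _),
          mul_zero]
  have hx : xVar 0 = 1 := if_pos rfl
  have hy : yVar 0 = 1 := if_pos rfl
  rw [e1, map_mul, map_pow, map_pow, map_mul, map_pow, map_pow, kill_xVar h (by omega), Nat.sub_zero,
    kill_yVar h (by omega), Nat.sub_self, hx, hy, map_one, one_pow, one_pow, one_mul, mul_one,
    zero_add]
  ring

variable (p n) in
lemma hDeg_zero_add (a b : ℕ) :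
    hDeg p n a 0 + p ^ a • hDeg p n b 0 = hDeg p n (a + b) 0 := by
  rw [hDeg, hDeg, hDeg, nsmul_eq_mul, ← Nat.cast_mul, ← Nat.cast_add, ZMod.val_zero, pow_zero]
  congr 1
  have h1 : 1 ≤ p ^ a := Nat.one_le_pow _ _ (Fact.out : p.Prime).pos
  have h2 : 1 ≤ p ^ b := Nat.one_le_pow _ _ (Fact.out : p.Prime).pos
  obtain ⟨u, hu⟩ := Nat.exists_eq_add_of_le h1
  obtain ⟨v, hv⟩ := Nat.exists_eq_add_of_le h2
  have h3 : p ^ (a + b) = 1 + (u + v + u * v) := by rw [pow_add, hu, hv]; ring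
  rw [h3, hu, hv]
  simp only [Nat.add_sub_cancel_left]
  ring

variable (p n) in
lemma hDeg_prev {s : ℕ} (h : n ≤ s) : p ^ n • hDeg p n (s - n) 0 = hDeg p n s 0 := by
  have h1 := hDeg_zero_add p n n (s - n)
  rw [Nat.add_sub_cancel' h] at h1
  rw [← h1]
  have : hDeg p n n 0 = 0 := by
    rw [hDeg, ZMod.val_zero, pow_zero, mul_one, ZMod.natCast_self]
  rw [this, zero_add]

lemma xVar_mem {a : ℕ} (ha : a ≠ 0) :
    xVar a ∈ PH p n k (hDeg p n a 0) 0 (mayM p n k a) := by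
  have := PH_monomial (p := p) (n := n) (k := k) (e := Finsupp.single (Sum.inl a) 1) (a := 1)
    (c := 0) (M := mayM p n k a) 0 (by simp) (by
      rw [pwt, Finsupp.sum_single_index (by simp), digits_sum_eq,
        Nat.mod_eq_of_lt (Fact.out : p.Prime).one_lt, Nat.div_eq_of_lt (Fact.out : p.Prime).one_lt]
      simp [vIdx])
  rw [pdeg, Finsupp.sum_single_index (by simp), one_smul] at this
  rw [xVar, if_neg ha]
  exact this

lemma yVar_mem {a : ℕ} (ha : a ≠ 0) :
    yVar a ∈ PH p n k (hDeg p n a 0) 0 (mayM p n k a) := by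
  have := PH_monomial (p := p) (n := n) (k := k) (e := Finsupp.single (Sum.inr a) 1) (a := 1)
    (c := 0) (M := mayM p n k a) 0 (by simp) (by
      rw [pwt, Finsupp.sum_single_index (by simp), digits_sum_eq,
        Nat.mod_eq_of_lt (Fact.out : p.Prime).one_lt, Nat.div_eq_of_lt (Fact.out : p.Prime).one_lt]
      simp [vIdx])
  rw [pdeg, Finsupp.sum_single_index (by simp), one_smul] at this
  rw [yVar, if_neg ha]
  exact this

lemma midSum_mem (s e : ℕ) :
    midSum p k s e ∈ PH p n k (p ^ e • hDeg p n s 0) 1 (mayM p n k s) := by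
  have hk := NeZero.pos k
  refine sum_mem fun a ha => ?_
  rw [Finset.mem_Icc] at ha
  have h1 := PH_mul (PH_pow_pow (xVar_mem (p := p) (n := n) (k := k) (a := a) (by omega)) e)
    (PH_pow_pow (yVar_mem (p := p) (n := n) (k := k) (a := s - a) (by omega)) (a + e))
  rw [add_comm a e, pow_add, mul_smul, ← smul_add, hDeg_zero_add, ← pow_add,
    Nat.add_sub_cancel' (by omega)] at h1
  rw [add_comm a e]
  have h2 := mayM_add_lt p n k (a := a) (b := s - a) (by omega) (by omega)
  rw [Nat.add_sub_cancel' (by omega)] at h2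
  exact PH_shift h2 h1

lemma kill_bPrev_of_lt {s : ℕ} (h : s < n) (m : ℕ) : kill k (bPrev p n s m) = 0 := by
  rw [bPrev_of_lt h, map_zero]

lemma kill_mul_bPoly (s m : ℕ) : (p : ZPoly) * kill k (bPoly p n s m) =
    kill k (deltaPoly p n s) ^ p ^ (m + 1) - kill k (diagSum p s (m + 1)) +
      kill k (bPrev p n s (m + n)) := by
  have := congrArg (kill k) (mul_bPoly (p := p) (NeZero.pos n) s m)
  simpa only [map_mul, map_natCast, map_add, map_sub, map_pow] using this

lemma kill_bPoly_of_lt (hkn : k ≤ n) {s : ℕ} (h : s < k) (m : ℕ) :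
    kill k (bPoly p n s m) = 0 := by
  have hp : (p : ZPoly) ≠ 0 := by exact_mod_cast (Fact.out : p.Prime).ne_zero
  refine (mul_eq_zero.1 (?_ : (p : ZPoly) * _ = 0)).resolve_left hp
  rw [kill_mul_bPoly, kill_bPrev_of_lt (by omega), deltaPoly_eq, map_sub,
    kill_bPrev_of_lt (by omega)]
  by_cases h0 : s = 0
  · subst h0
    simp [diagSum, xVar, yVar]
  · rw [kill_diagSum_of_lt h h0, kill_diagSum_of_lt h h0]
    simp [(Fact.out : p.Prime).ne_zero]

lemma kill_bPrev_of_lt_add (hkn : k ≤ n) {s : ℕ} (h : s < n + k) (m : ℕ) :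
    kill k (bPrev p n s m) = 0 := by
  by_cases h1 : s < n
  · exact kill_bPrev_of_lt h1 m
  · rw [bPrev_of_le (NeZero.pos n) (by omega), kill_bPoly_of_lt hkn (by omega)]

lemma mul_mayM_sub_lt {s : ℕ} (h : n + k ≤ s) : p * mayM p n k (s - n) + 1 ≤ mayM p n k s := by
  rw [mayM_of_le p n k h]; exact le_max_right _ _

variable (k) in
/-- The part of `Δ(t_s)` of filtration less than `M(t_s)`. -/
def deltaRest (p n s : ℕ) : ZPoly := midSum p k s 0 - kill k (bPrev p n s (n - 1))

lemma kill_deltaPoly {s : ℕ} (h : k ≤ s) :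
    kill k (deltaPoly p n s) = xVar s + yVar s + deltaRest k p n s := by
  rw [deltaPoly_eq, map_sub, kill_diagSum h, deltaRest, pow_zero, pow_one, pow_one]
  ring

lemma kill_bPrev_mem_of (hkn : k ≤ n) {s : ℕ} (m : ℕ)
    (ih : ∀ s' < s, k ≤ s' → ∀ m, kill k (bPoly p n s' m) ∈
      PH p n k (p ^ (m + 1) • hDeg p n s' 0) 0 (p * mayM p n k s')) (m' : ℕ) (hm : m + 1 = n + m') :
    kill k (bPrev p n s m) ∈ PH p n k (p ^ m' • hDeg p n s 0) 1 (mayM p n k s) := by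
  have hn := NeZero.pos n
  by_cases h : n + k ≤ s
  · rw [bPrev_of_le hn (by omega)]
    have h1 := ih (s - n) (by omega) (by omega) m
    rw [hm, add_comm n m', pow_add, mul_smul, hDeg_prev p n (by omega)] at h1
    exact PH_shift (mul_mayM_sub_lt h) h1
  · rw [kill_bPrev_of_lt_add hkn (by omega)]; exact zero_mem _

/-- The coproduct polynomials `b_{s,m}` have filtration `p M(t_s)`, by induction from their
definition: the recursion of `M` is made for the summand `b_{s-n,m+n}`. -/
lemma kill_bPoly_mem (hkn : k ≤ n) {s : ℕ} (h : k ≤ s) (m : ℕ) : kill k (bPoly p n s m) ∈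
    PH p n k (p ^ (m + 1) • hDeg p n s 0) 0 (p * mayM p n k s) := by
  have hk := NeZero.pos k
  have hn := NeZero.pos n
  induction s using Nat.strong_induction_on generalizing m with
  | _ s ih =>
  have hprev := fun m m' => kill_bPrev_mem_of (p := p) hkn (s := s) m
    (fun s' h1 h2 m => ih s' h1 h2 m) m'
  refine PH_of_p_mul ?_
  rw [kill_mul_bPoly, kill_diagSum h, kill_deltaPoly h]
  have hs : s ≠ 0 := by omega
  have hz : ∀ {γ : Deg p n} {f : ZPoly}, f ∈ PH p n k γ 1 (mayM p n k s) →
      f ∈ PH p n k γ 0 (mayM p n k s) := PH_mono (Nat.zero_le _) le_rfl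
  refine add_mem (sub_mem (PH_pow_pow (add_mem (add_mem (xVar_mem hs) (yVar_mem hs)) ?_) _)
    (add_mem (add_mem (PH_pow_pow (xVar_mem hs) _) (PH_pow_pow (yVar_mem hs) _))
      (hz (midSum_mem _ _)))) (hz (hprev _ _ (by omega)))
  refine hz (sub_mem ?_ ?_)
  · have := midSum_mem (p := p) (n := n) (k := k) s 0
    rwa [pow_zero, one_smul] at this
  · have := hprev (n - 1) 0 (by omega)
    rwa [pow_zero, one_smul] at this

lemma kill_bPrev_mem (hkn : k ≤ n) (s m m' : ℕ) (hm : m + 1 = n + m') :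
    kill k (bPrev p n s m) ∈ PH p n k (p ^ m' • hDeg p n s 0) 1 (mayM p n k s) :=
  kill_bPrev_mem_of hkn m (fun _ _ h m => kill_bPoly_mem hkn h m) m' hm

lemma deltaRest_mem (hkn : k ≤ n) (s : ℕ) :
    deltaRest k p n s ∈ PH p n k (hDeg p n s 0) 1 (mayM p n k s) := by
  have hn := NeZero.pos n
  refine sub_mem ?_ ?_
  · have := midSum_mem (p := p) (n := n) (k := k) s 0
    rwa [pow_zero, one_smul] at this
  · have := kill_bPrev_mem (p := p) hkn s (n - 1) 0 (by omega)
    rwa [pow_zero, one_smul] at this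

/-- The leading term of `b_{s,m}` modulo `p` is the polynomial `((x+y)^p - x^p - y^p)/p` at the
`p^m`-th powers of `x = t_s ⊗ 1` and `y = 1 ⊗ t_s`. -/
lemma kill_bPoly_eq (hkn : k ≤ n) {s : ℕ} (h : k ≤ s) (m : ℕ) :
    ∃ u, ∃ r ∈ PH p n k (p ^ (m + 1) • hDeg p n s 0) 1 (p * mayM p n k s),
      kill k (bPoly p n s m) = wpoly p (xVar s ^ p ^ m) (yVar s ^ p ^ m) + p * u + r := by
  have hk := NeZero.pos k
  have hs : s ≠ 0 := by omega
  have hx := xVar_mem (p := p) (n := n) (k := k) hs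
  have hy := yVar_mem (p := p) (n := n) (k := k) hs
  obtain ⟨u, r, hr, h1⟩ := PH_expand_pow hx hy (deltaRest_mem hkn s) m
  obtain ⟨u', r', hr', h2⟩ := PH_expand (u := u) (PH_pow_pow hx m) (PH_pow_pow hy m) hr
  refine ⟨u', _, PH_of_p_mul ?_, (add_sub_cancel _ (kill k (bPoly p n s m))).symm⟩
  have e : (p : ZPoly) * (kill k (bPoly p n s m) -
      (wpoly p (xVar s ^ p ^ m) (yVar s ^ p ^ m) + p * u')) =
      r' - midSum p k s (m + 1) + kill k (bPrev p n s (m + n)) := by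
    rw [mul_sub, kill_mul_bPoly, kill_diagSum h, kill_deltaPoly h, pow_succ p m, pow_mul, h1, h2,
      pow_mul, pow_mul]
    ring
  rw [e, pow_succ', mul_smul]
  refine add_mem (sub_mem hr' ?_) ?_
  · rw [← mul_smul, ← pow_succ']; exact midSum_mem _ _
  · rw [← mul_smul, ← pow_succ']; exact kill_bPrev_mem hkn _ _ _ (by omega)

end PolyWeight

end

/-! ### Weight estimates for the coproduct of `S(n,k)` -/

section

section ComulWeight

variable {p n k : ℕ} [Fact p.Prime] [NeZero n] [NeZero k]

variable (p n k) in
/-- The element `t_a^{p^j}`, with `t_0 = 1` and `t_a = 0` for `0 < a < k`. -/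
def tj (a : ℕ) (j : ZMod n) : S p n k := t p n k a ^ p ^ j.val

lemma tj_of_le {a : ℕ} (h : k ≤ a) (j : ZMod n) : tj p n k a j = tt p ((⟨a, h⟩, j) : Ix n k) := by
  have := NeZero.pos k
  rw [tj, t, if_neg (by omega), dif_pos h, tt]

lemma tj_zero (j : ZMod n) : tj p n k 0 j = 1 := by rw [tj, t, if_pos rfl, one_pow]

lemma tj_of_lt {a : ℕ} (h : a < k) (h0 : a ≠ 0) (j : ZMod n) : tj p n k a j = 0 := by
  rw [tj, t, if_neg h0, dif_neg (by omega), zero_pow (p_pow_ne_zero _)]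

lemma tj_pow (a : ℕ) (j : ZMod n) (c : ℕ) : tj p n k a j ^ p ^ c = tj p n k a (j + c) := by
  induction c with
  | zero => simp
  | succ c ih =>
    rw [pow_succ, pow_mul, ih, Nat.cast_succ, ← add_assoc, tj, tj]
    exact (pow_val_add_one p _ _).symm

lemma isMono_tj_pow (a : ℕ) (j : ZMod n) (c : ℕ) : tj p n k a j ^ c = 0 ∨
    IsMono p (tj p n k a j ^ c) (c • hDeg p n a j) ((Nat.digits p c).sum * mayM p n k a) := by
  by_cases h : k ≤ a
  · right
    rw [tj_of_le h]
    exact isMono_tt_pow p ((⟨a, h⟩, j) : Ix n k) c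
  by_cases h0 : a = 0
  · right
    subst h0
    rw [tj_zero, one_pow]
    have : hDeg p n 0 j = 0 := by simp [hDeg]
    rw [this, smul_zero]
    exact IsMono.one.mono (Nat.zero_le _)
  rw [tj_of_lt (by omega) h0]
  rcases Nat.eq_zero_or_pos c with rfl | hc
  · right
    simpa using IsMono.one
  · left; exact zero_pow hc.ne'

variable (p n k) in
/-- The span of the `x ⊗ y`, `x` and `y` monomials, of degree `γ` and filtration `≤ M`. -/
def SSF (γ : Deg p n) (M : ℤ) : Submodule (ZMod p) (SS p n k) :=
  Submodule.span (ZMod p) {z | ∃ (x y : S p n k) (g g' : Deg p n) (w w' : ℕ), IsMono p x g w ∧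
    IsMono p y g' w' ∧ g + g' = γ ∧ (w : ℤ) + w' ≤ M ∧ z = x ⊗ₜ y}

lemma SSF_mono {γ : Deg p n} {M M' : ℤ} (h : M ≤ M') : SSF p n k γ M ≤ SSF p n k γ M' := by
  refine Submodule.span_mono ?_
  rintro _ ⟨x, y, g, g', w, w', h1, h2, h3, h4, rfl⟩
  exact ⟨x, y, g, g', w, w', h1, h2, h3, h4.trans h, rfl⟩

lemma tmul_mem_SSF {x y : S p n k} {g g' : Deg p n} {w w' : ℕ} (hx : IsMono p x g w)
    (hy : IsMono p y g' w') : x ⊗ₜ y ∈ SSF p n k (g + g') (w + w') :=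
  Submodule.subset_span ⟨x, y, g, g', w, w', hx, hy, rfl, le_rfl, rfl⟩

lemma one_mem_SSF : (1 : SS p n k) ∈ SSF p n k 0 0 := by
  have := tmul_mem_SSF (IsMono.one (p := p) (n := n) (k := k)) IsMono.one
  rw [add_zero, Nat.cast_zero, add_zero] at this
  exact this

lemma SSF_mul {γ γ' : Deg p n} {M M' : ℤ} {z z' : SS p n k} (hz : z ∈ SSF p n k γ M)
    (hz' : z' ∈ SSF p n k γ' M') : z * z' ∈ SSF p n k (γ + γ') (M + M') := by
  have := Submodule.mul_mem_mul hz hz'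
  rw [SSF, SSF, Submodule.span_mul_span] at this
  refine (Submodule.span_le.2 ?_) this
  rintro _ ⟨_, ⟨x, y, g, g', w, w', h1, h2, rfl, h4, rfl⟩,
    _, ⟨x', y', u, u', v, v', h1', h2', rfl, h4', rfl⟩, rfl⟩
  refine Submodule.subset_span ⟨x * x', y * y', g + u, g' + u', w + v, w' + v', h1.mul h1',
    h2.mul h2', by abel, by push_cast; linarith, ?_⟩
  exact Algebra.TensorProduct.tmul_mul_tmul _ _ _ _

lemma SSF_pow {γ : Deg p n} {M : ℤ} {z : SS p n k} (hz : z ∈ SSF p n k γ M) (m : ℕ) :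
    z ^ m ∈ SSF p n k (m • γ) (m * M) := by
  induction m with
  | zero => simpa using one_mem_SSF
  | succ m ih =>
    rw [pow_succ, succ_nsmul, Nat.cast_succ, add_mul, one_mul]
    exact SSF_mul ih hz

lemma natCast_p_eq_zero {R : Type} [CommRing R] [Algebra (ZMod p) R] : (p : R) = 0 := by
  have h : algebraMap (ZMod p) R (p : ZMod p) = 0 := by simp
  simpa only [map_natCast] using h

variable (p n k) in
/-- The values `t_a^{p^j} ⊗ 1` of the variables. -/
def tX (j : ZMod n) (a : ℕ) : SS p n k := tj p n k a j ⊗ₜ 1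

variable (p n k) in
/-- The values `1 ⊗ t_a^{p^j}` of the variables. -/
def tY (j : ZMod n) (a : ℕ) : SS p n k := 1 ⊗ₜ tj p n k a j

lemma tX_pow (j : ZMod n) (a c : ℕ) : tX p n k j a ^ c = (tj p n k a j ^ c) ⊗ₜ 1 := by
  rw [tX, Algebra.TensorProduct.tmul_pow, one_pow]

lemma tY_pow (j : ZMod n) (a c : ℕ) : tY p n k j a ^ c = 1 ⊗ₜ (tj p n k a j ^ c) := by
  rw [tY, Algebra.TensorProduct.tmul_pow, one_pow]

lemma hDeg_eq (a : ℕ) (j : ZMod n) : hDeg p n a j = p ^ j.val • hDeg p n a 0 := by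
  rw [hDeg, hDeg, nsmul_eq_mul, ← Nat.cast_mul, ZMod.val_zero, pow_zero, mul_one]
  congr 1
  ring

lemma ev_term_mem (j : ZMod n) (v : ℕ ⊕ ℕ) (c : ℕ) :
    (Sum.elim (tX p n k j) (tY p n k j) v) ^ c ∈ SSF p n k (c • hDeg p n (vIdx v) j)
      (((Nat.digits p c).sum * mayM p n k (vIdx v) : ℕ) : ℤ) := by
  rcases v with a | a
  · change tX p n k j a ^ c ∈ SSF p n k (c • hDeg p n a j) _
    rw [tX_pow]
    rcases isMono_tj_pow (p := p) (k := k) a j c with h | h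
    · rw [h, TensorProduct.zero_tmul]; exact zero_mem _
    · have := tmul_mem_SSF h IsMono.one
      rwa [add_zero, Nat.cast_zero, add_zero] at this
  · change tY p n k j a ^ c ∈ SSF p n k (c • hDeg p n a j) _
    rw [tY_pow]
    rcases isMono_tj_pow (p := p) (k := k) a j c with h | h
    · rw [h, TensorProduct.tmul_zero]; exact zero_mem _
    · have := tmul_mem_SSF IsMono.one h
      rwa [zero_add, Nat.cast_zero, zero_add] at this

lemma ev_monomial_mem (j : ZMod n) (e : ℕ ⊕ ℕ →₀ ℕ) :
    (e.prod fun v c => (Sum.elim (tX p n k j) (tY p n k j) v) ^ c) ∈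
      SSF p n k (p ^ j.val • pdeg p n e) (pwt p n k e) := by
  classical
  rw [Finsupp.prod, pdeg, pwt, Finsupp.sum, Finsupp.sum, Finset.smul_sum]
  induction e.support using Finset.induction_on with
  | empty => simpa using one_mem_SSF
  | insert v T hv ih =>
    rw [Finset.prod_insert hv, Finset.sum_insert hv, Finset.sum_insert hv, Nat.cast_add]
    refine SSF_mul ?_ ih
    rw [smul_comm, ← hDeg_eq]
    exact ev_term_mem j v _

/-- The values of polynomials of degree `γ` and weight `M - c`. -/
lemma ev_mem {γ : Deg p n} {c M : ℕ} {f : ZPoly} (hf : f ∈ PH p n k γ c M) (j : ZMod n) :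
    ev (tX p n k j) (tY p n k j) f ∈ SSF p n k (p ^ j.val • γ) ((M : ℤ) - c) := by
  rw [f.as_sum, map_sum]
  refine sum_mem fun e he => ?_
  obtain ⟨rfl, v, h2, h3⟩ := PH_term hf he
  rw [MvPolynomial.aeval_monomial]
  cases v with
  | zero =>
    rw [pow_zero, one_mul] at h3
    rw [← Algebra.smul_def, ← Int.cast_smul_eq_zsmul (ZMod p)]
    exact Submodule.smul_mem _ _ (SSF_mono (by omega) (ev_monomial_mem j e))
  | succ v =>
    obtain ⟨b, hb⟩ := (dvd_pow_self (p : ℤ) (Nat.succ_ne_zero v)).trans h2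
    rw [hb, map_mul, map_natCast, natCast_p_eq_zero (p := p) (R := SS p n k), zero_mul, zero_mul]
    exact zero_mem _

lemma ev_kill (j : ZMod n) (f : ZPoly) :
    ev (tX p n k j) (tY p n k j) (kill k f) = ev (tX p n k j) (tY p n k j) f := by
  rw [kill, MvPolynomial.comp_aeval_apply]
  congr 2
  funext v
  split_ifs with h
  · rw [map_zero]
    rcases v with a | a
    · change 0 = tX p n k j a
      rw [tX, tj_of_lt (a := a) h.2 h.1.ne', TensorProduct.zero_tmul]
    · change 0 = tY p n k j a
      rw [tY, tj_of_lt (a := a) h.2 h.1.ne', TensorProduct.tmul_zero]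
  · rw [MvPolynomial.aeval_X]

lemma ev_pow (j : ZMod n) (f : ZPoly) :
    ev (tX p n k 0) (tY p n k 0) f ^ p ^ j.val = ev (tX p n k j) (tY p n k j) f := by
  let φ : SS p n k →+* SS p n k :=
    { toFun := fun x => x ^ p ^ j.val
      map_one' := one_pow _
      map_mul' := fun x y => mul_pow x y _
      map_zero' := zero_pow (p_pow_ne_zero _)
      map_add' := fun x y => add_pow_pp p _ x y }
  change φ.toIntAlgHom (ev (tX p n k 0) (tY p n k 0) f) = _
  rw [MvPolynomial.comp_aeval_apply]
  congr 2
  funext v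
  rcases v with a | a
  · change tX p n k 0 a ^ p ^ j.val = tX p n k j a
    rw [tX_pow, tj_pow, zero_add, ZMod.natCast_zmod_val, tX]
  · change tY p n k 0 a ^ p ^ j.val = tY p n k j a
    rw [tY_pow, tj_pow, zero_add, ZMod.natCast_zmod_val, tY]

lemma tj_val_zero (a : ℕ) : tj p n k a 0 = t p n k a := by
  rw [tj, ZMod.val_zero, pow_zero, pow_one]

lemma deltaT_eq (s : ℕ) : deltaT p n k s = ev (tX p n k 0) (tY p n k 0) (deltaPoly p n s) := by
  rw [deltaT]
  congr 2
  funext v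
  rcases v with a | a
  · change _ = tX p n k 0 a
    rw [tX, tj_val_zero]; rfl
  · change _ = tY p n k 0 a
    rw [tY, tj_val_zero]; rfl

lemma comul_toS_X (s : {s : ℕ // k ≤ s}) :
    comul p n k (toS p n k (MvPolynomial.X s)) = deltaT p n k s := by
  change MvPolynomial.aeval _ (MvPolynomial.X s) = _
  rw [MvPolynomial.aeval_X]

lemma comul_tt (l : Ix n k) : comul p n k (tt p l) =
    ev (tX p n k l.2) (tY p n k l.2) (kill k (deltaPoly p n l.1)) := by
  rw [tt, map_pow, comul_toS_X, deltaT_eq, ev_pow, ev_kill]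

variable (p n k) in
/-- The terms of next to highest filtration of the coproduct of `t_i^{p^j}` (and possibly some of
lower filtration). -/
def sub1 (i : ℕ) (j : ZMod n) : SS p n k :=
  ∑ a ∈ Finset.Icc k (i - k), tj p n k a j ⊗ₜ tj p n k (i - a) ((a : ZMod n) + j) -
    if n + k ≤ i then wpoly p (tX p n k (j + ((n - 1 : ℕ) : ZMod n)) (i - n))
      (tY p n k (j + ((n - 1 : ℕ) : ZMod n)) (i - n)) else 0

lemma ev_xVar_tX (j : ZMod n) (a : ℕ) :
    ev (tX p n k j) (tY p n k j) (xVar a) = tX p n k j a :=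
  ev_xVar (by rw [tX, tj_zero]; rfl) a

lemma ev_yVar_tY (j : ZMod n) (a : ℕ) :
    ev (tX p n k j) (tY p n k j) (yVar a) = tY p n k j a :=
  ev_yVar (by rw [tY, tj_zero]; rfl) a

lemma ev_midSum (i : ℕ) (j : ZMod n) : ev (tX p n k j) (tY p n k j) (midSum p k i 0) =
    ∑ a ∈ Finset.Icc k (i - k), tj p n k a j ⊗ₜ tj p n k (i - a) ((a : ZMod n) + j) := by
  rw [midSum, map_sum]
  refine Finset.sum_congr rfl fun a _ => ?_
  rw [map_mul, map_pow, map_pow, ev_xVar_tX, ev_yVar_tY, pow_zero, pow_one, add_zero, tY_pow,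
    tj_pow, tX, Algebra.TensorProduct.tmul_mul_tmul, one_mul, mul_one, add_comm j]

/-- The coproduct of `t_i^{p^j}` up to terms of filtration `M(t_i) - 2`. -/
lemma comul_tt_sub_mem (hkn : k ≤ n) (l : Ix n k) :
    comul p n k (tt p l) - (tX p n k l.2 l.1 + tY p n k l.2 l.1) - sub1 p n k l.1 l.2 ∈
      SSF p n k (hDeg p n l.1 l.2) ((mayM p n k l.1 : ℤ) - 2) := by
  have hn := NeZero.pos n
  obtain ⟨⟨i, hi⟩, j⟩ := l
  change comul p n k (tt p ((⟨i, hi⟩, j) : Ix n k)) - (tX p n k j i + tY p n k j i) -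
    sub1 p n k i j ∈ SSF p n k (hDeg p n i j) ((mayM p n k i : ℤ) - 2)
  rw [comul_tt, kill_deltaPoly hi, deltaRest]
  rw [map_add, map_sub, map_add]
  change ev (tX p n k j) (tY p n k j) (xVar i) + ev (tX p n k j) (tY p n k j) (yVar i) +
    (ev (tX p n k j) (tY p n k j) (midSum p k i 0) -
      ev (tX p n k j) (tY p n k j) (kill k (bPrev p n i (n - 1)))) - _ - _ ∈ _
  rw [ev_xVar_tX, ev_yVar_tY, ev_midSum, sub1]
  split_ifs with h
  · rw [bPrev_of_le hn (by omega)]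
    obtain ⟨u, r, hr, h1⟩ := kill_bPoly_eq (p := p) hkn (s := i - n) (by omega) (n - 1)
    have h2 := ev_mem hr j
    rw [Nat.sub_add_cancel hn, hDeg_prev p n (by omega), ← hDeg_eq] at h2
    have h3 : ev (tX p n k j) (tY p n k j) (kill k (bPoly p n (i - n) (n - 1))) =
        wpoly p (tX p n k (j + ((n - 1 : ℕ) : ZMod n)) (i - n))
          (tY p n k (j + ((n - 1 : ℕ) : ZMod n)) (i - n)) + ev (tX p n k j) (tY p n k j) r := by
      rw [h1, map_add, map_add, map_mul, map_natCast, natCast_p_eq_zero, zero_mul, add_zero]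
      congr 1
      have := map_wpoly (p := p) (ev (tX p n k j) (tY p n k j)).toRingHom
        (xVar (i - n) ^ p ^ (n - 1)) (yVar (i - n) ^ p ^ (n - 1))
      refine this.trans ?_
      congr 1
      · change ev (tX p n k j) (tY p n k j) _ = _
        rw [map_pow, ev_xVar_tX, tX_pow, tj_pow, tX]
      · change ev (tX p n k j) (tY p n k j) _ = _
        rw [map_pow, ev_yVar_tY, tY_pow, tj_pow, tY]
    rw [h3]
    have h4 := neg_mem (SSF_mono (p := p) (n := n) (k := k) (γ := hDeg p n i j)
      (M' := (mayM p n k i : ℤ) - 2) ?_ h2)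
    · convert h4 using 1
      abel
    · have := mul_mayM_sub_lt (p := p) h
      omega
  · rw [kill_bPrev_of_lt_add hkn (by omega), map_zero]
    convert Submodule.zero_mem _ using 1
    abel

lemma comul_tt_sub_mem' (hkn : k ≤ n) (l : Ix n k) :
    comul p n k (tt p l) - (tX p n k l.2 l.1 + tY p n k l.2 l.1) ∈
      SSF p n k (hDeg p n l.1 l.2) ((mayM p n k l.1 : ℤ) - 1) := by
  have h1 := ev_mem (deltaRest_mem (p := p) hkn l.1) l.2
  rw [← hDeg_eq, Nat.cast_one] at h1
  convert h1 using 1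
  rw [comul_tt, kill_deltaPoly l.1.2, map_add, map_add, ev_xVar_tX, ev_yVar_tY]
  exact add_sub_cancel_left _ _

variable (p) in
/-- The product of the `(t_l ⊗ 1 + 1 ⊗ t_l)^{q_l}`. -/
def primProd (q : Ix n k →₀ ℕ) : SS p n k :=
  q.prod fun l m => (tX p n k l.2 l.1 + tY p n k l.2 l.1) ^ m

lemma primProd_add (q q' : Ix n k →₀ ℕ) : primProd p (q + q') = primProd p q * primProd p q' :=
  Finsupp.prod_add_index' (by simp) (by intros; rw [pow_add])

lemma primProd_single (l : Ix n k) (m : ℕ) : primProd p (Finsupp.single l m) =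
    (tX p n k l.2 l.1 + tY p n k l.2 l.1) ^ m := Finsupp.prod_single_index (by simp)

lemma tX_eq (l : Ix n k) : tX p n k l.2 l.1 = tt p l ⊗ₜ 1 := by
  rw [tX, tj_of_le l.1.2]

lemma tY_eq (l : Ix n k) : tY p n k l.2 l.1 = 1 ⊗ₜ tt p l := by
  rw [tY, tj_of_le l.1.2]

lemma isMono_tt (l : Ix n k) : IsMono p (tt p l) (hDeg p n l.1 l.2) (mayM p n k l.1) :=
  ⟨Finsupp.single l 1, by rw [tp_single, pow_one], by rw [qdeg_single, one_smul],
    by rw [qwt_single, one_mul]⟩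

lemma tX_add_tY_mem (l : Ix n k) : tX p n k l.2 l.1 + tY p n k l.2 l.1 ∈
    SSF p n k (hDeg p n l.1 l.2) (mayM p n k l.1) := by
  rw [tX_eq, tY_eq]
  have h1 := tmul_mem_SSF (isMono_tt (p := p) l) IsMono.one
  have h2 := tmul_mem_SSF IsMono.one (isMono_tt (p := p) l)
  rw [add_zero, Nat.cast_zero, add_zero] at h1
  rw [zero_add, Nat.cast_zero, zero_add] at h2
  exact add_mem h1 h2

lemma primProd_mem (q : Ix n k →₀ ℕ) : primProd p q ∈ SSF p n k (qdeg p q) (qwt p q) := by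
  induction q using Finsupp.induction_linear with
  | zero => simpa [primProd] using one_mem_SSF
  | add q q' h h' =>
    rw [primProd_add, qdeg_add, qwt_add, Nat.cast_add]; exact SSF_mul h h'
  | single l m =>
    rw [primProd_single, qdeg_single, qwt_single, Nat.cast_mul]
    exact SSF_pow (tX_add_tY_mem l) m

lemma mul_sub_mul_mem {γ γ' : Deg p n} {M M' : ℤ} {a b a' b' : SS p n k}
    (ha : a - a' ∈ SSF p n k γ (M - 1)) (hb : b - b' ∈ SSF p n k γ' (M' - 1))
    (ha' : a' ∈ SSF p n k γ M) (hb' : b' ∈ SSF p n k γ' M') :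
    a * b - a' * b' ∈ SSF p n k (γ + γ') (M + M' - 1) := by
  have hb2 : b ∈ SSF p n k γ' M' := by
    rw [← sub_add_cancel b b']; exact add_mem (SSF_mono (by omega) hb) hb'
  have e : a * b - a' * b' = (a - a') * b + a' * (b - b') := by ring
  rw [e]
  exact add_mem (SSF_mono (by omega) (SSF_mul ha hb2)) (SSF_mono (by omega) (SSF_mul ha' hb))

/-- The monomials are primitive modulo lower filtration. -/
lemma comul_tp_sub_mem (hkn : k ≤ n) (q : Ix n k →₀ ℕ) :
    comul p n k (tp p q) - primProd p q ∈ SSF p n k (qdeg p q) ((qwt p q : ℤ) - 1) := by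
  induction q using Finsupp.induction_linear with
  | zero => simp [primProd]
  | add q q' h h' =>
    rw [primProd_add, tp_add, map_mul, qdeg_add, qwt_add, Nat.cast_add]
    exact mul_sub_mul_mem h h' (primProd_mem q) (primProd_mem q')
  | single l m =>
    induction m with
    | zero => simp [primProd]
    | succ m ih =>
      rw [Finsupp.single_add, primProd_add, tp_add, map_mul, qdeg_add, qwt_add, Nat.cast_add]
      refine mul_sub_mul_mem ih ?_ (primProd_mem _) (primProd_mem _)
      rw [primProd_single, tp_single, pow_one, pow_one, qdeg_single, qwt_single, one_smul, one_mul]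
      exact comul_tt_sub_mem' hkn l

lemma add_pow_sub_mem {γ : Deg p n} {M : ℤ} {a r : SS p n k} (ha : a ∈ SSF p n k γ M)
    (hr : r ∈ SSF p n k γ (M - 1)) (m : ℕ) :
    (a + r) ^ (m + 1) - a ^ (m + 1) - (m + 1 : ℕ) * (a ^ m * r) ∈
      SSF p n k ((m + 1) • γ) ((m + 1 : ℕ) * M - 2) := by
  induction m with
  | zero =>
    convert Submodule.zero_mem _ using 1
    simp
  | succ m ih =>
    have e : (a + r) ^ (m + 1 + 1) - a ^ (m + 1 + 1) - (m + 1 + 1 : ℕ) * (a ^ (m + 1) * r) =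
        ((a + r) ^ (m + 1) - a ^ (m + 1) - (m + 1 : ℕ) * (a ^ m * r)) * (a + r) +
          (m + 1 : ℕ) • (a ^ m * r * r) := by
      rw [nsmul_eq_mul]; push_cast; ring
    rw [e]
    refine add_mem ?_ ?_
    · rw [succ_nsmul γ (m + 1)]
      refine SSF_mono ?_ (SSF_mul ih (add_mem ha (SSF_mono (by omega) hr)))
      push_cast; linarith
    · refine nsmul_mem ?_ _
      have := SSF_mul (SSF_mul (SSF_pow ha m) hr) hr
      rw [← succ_nsmul, ← succ_nsmul] at this
      refine SSF_mono ?_ this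
      push_cast; linarith

/-- The coproduct of `t_l^{m+1}` up to terms of filtration two less than the maximal one. -/
lemma comul_tt_pow_sub_mem (hkn : k ≤ n) (l : Ix n k) (m : ℕ) :
    comul p n k (tt p l ^ (m + 1)) - (tX p n k l.2 l.1 + tY p n k l.2 l.1) ^ (m + 1) -
      (m + 1 : ℕ) * ((tX p n k l.2 l.1 + tY p n k l.2 l.1) ^ m * sub1 p n k l.1 l.2) ∈
      SSF p n k ((m + 1) • hDeg p n l.1 l.2) ((m + 1 : ℕ) * (mayM p n k l.1 : ℤ) - 2) := by
  set P := tX p n k l.2 l.1 + tY p n k l.2 l.1 with hP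
  have h1 := comul_tt_sub_mem' (p := p) hkn l
  have h2 := comul_tt_sub_mem (p := p) hkn l
  rw [← hP] at h1 h2
  have hPm : P ∈ SSF p n k (hDeg p n l.1 l.2) (mayM p n k l.1) := tX_add_tY_mem l
  have h3 := add_pow_sub_mem hPm h1 m
  rw [add_sub_cancel] at h3
  have h4 : ((m + 1 : ℕ) : SS p n k) * (P ^ m * (comul p n k (tt p l) - P - sub1 p n k l.1 l.2)) ∈
      SSF p n k ((m + 1) • hDeg p n l.1 l.2) ((m + 1 : ℕ) * (mayM p n k l.1 : ℤ) - 2) := by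
    have := SSF_mul (SSF_pow hPm m) h2
    rw [← succ_nsmul] at this
    have h6 : (m : ℤ) * (mayM p n k l.1 : ℤ) + ((mayM p n k l.1 : ℤ) - 2) ≤
        (m + 1 : ℕ) * (mayM p n k l.1 : ℤ) - 2 := by
      push_cast; linarith
    have h5 := nsmul_mem (SSF_mono h6 this) (m + 1)
    rwa [nsmul_eq_mul (m + 1) (P ^ m * _)] at h5
  have h5 := add_mem h3 h4
  have e : ∀ x y z w c : SS p n k, x - y - c * (z * (w - P)) +
      c * (z * (w - P - sub1 p n k l.1 l.2)) = x - y - c * (z * sub1 p n k l.1 l.2) := by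
    intros; ring
  rw [e] at h5
  rw [map_pow]
  exact h5

end ComulWeight

end

/-! ### Coassociativity of `S(n,k)` -/

section

section SCoassoc

variable {p n k : ℕ} [Fact p.Prime] [NeZero n] [NeZero k]

lemma deltaT_eq_dl (s : ℕ) : deltaT p n k s =
    dl p n (fun a => t p n k a ⊗ₜ[ZMod p] 1) (fun a => 1 ⊗ₜ[ZMod p] t p n k a) s := rfl

lemma t_zero : t p n k 0 = 1 := if_pos rfl

lemma comul_t (hkn : k ≤ n) (s : ℕ) : comul p n k (t p n k s) = deltaT p n k s := by
  by_cases h0 : s = 0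
  · subst h0
    rw [t_zero, map_one, deltaT_eq, deltaPoly_zero (NeZero.pos n), map_one]
  by_cases h : k ≤ s
  · rw [t, if_neg h0, dif_pos h, comul_toS_X]
  · rw [t, if_neg h0, dif_neg h, map_zero, deltaT_eq, ← ev_kill, deltaPoly_eq, map_sub,
      kill_diagSum_of_lt (by omega) h0, kill_bPrev_of_lt (by omega), sub_zero, map_zero]

lemma map_dl {R R' : Type} [CommRing R] [CommRing R'] (φ : R →+* R') (x y : ℕ → R) (s : ℕ) :
    φ (dl p n x y s) = dl p n (fun a => φ (x a)) (fun a => φ (y a)) s := by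
  change φ.toIntAlgHom (ev x y _) = ev _ _ _
  rw [MvPolynomial.comp_aeval_apply]
  congr 2
  funext v
  rcases v with a | a <;> rfl

variable (p n k) in
/-- The threefold tensor product. -/
abbrev SSS : Type := S p n k ⊗[ZMod p] SS p n k

lemma SSS_pow (z : SSS p n k) : z ^ p ^ n = z := by
  induction z using TensorProduct.induction_on with
  | zero => exact zero_pow (p_pow_ne_zero _)
  | tmul x y => rw [Algebra.TensorProduct.tmul_pow, S_pow, SS_pow]
  | add x y hx hy => rw [add_pow_pp p n x y, hx, hy]

lemma charP_SSS : CharP (SSS p n k) p := by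
  let ε : SSS p n k →ₐ[ZMod p] ZMod p := (Algebra.TensorProduct.lift (counit p n k)
    (Algebra.TensorProduct.lift (counit p n k) (counit p n k) fun _ _ => Commute.all _ _)
    fun _ _ => Commute.all _ _)
  have : Nontrivial (SSS p n k) := ε.toRingHom.domain_nontrivial
  exact charP_of_injective_algebraMap (algebraMap (ZMod p) (SSS p n k)).injective p

lemma S_hom_ext {R : Type} [CommRing R] [Algebra (ZMod p) R] {f g : S p n k →ₐ[ZMod p] R}
    (h : ∀ s, k ≤ s → f (t p n k s) = g (t p n k s)) : f = g := by
  refine Ideal.Quotient.algHom_ext (ZMod p) (MvPolynomial.algHom_ext fun s => ?_)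
  have := h s s.2
  have hk := NeZero.pos k
  have h2 := s.2
  rw [t, if_neg (by omega), dif_pos s.2] at this
  exact this

/-- The coproduct of `S(n,k)` is coassociative. -/
lemma comul_coassoc (hkn : k ≤ n) (x : S p n k) :
    Algebra.TensorProduct.assoc (ZMod p) (ZMod p) (ZMod p) (S p n k) (S p n k) (S p n k)
      (Algebra.TensorProduct.map (comul p n k) (AlgHom.id (ZMod p) (S p n k)) (comul p n k x)) =
    Algebra.TensorProduct.map (AlgHom.id (ZMod p) (S p n k)) (comul p n k) (comul p n k x) := by
  let f : SS p n k →ₐ[ZMod p] SSS p n k :=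
    (Algebra.TensorProduct.assoc (ZMod p) (ZMod p) (ZMod p) (S p n k) (S p n k)
      (S p n k)).toAlgHom.comp (Algebra.TensorProduct.map (comul p n k) (AlgHom.id (ZMod p) (S p n k)))
  let g : SS p n k →ₐ[ZMod p] SSS p n k :=
    Algebra.TensorProduct.map (AlgHom.id (ZMod p) (S p n k)) (comul p n k)
  suffices h : f.comp (comul p n k) = g.comp (comul p n k) from DFunLike.congr_fun h x
  let X : ℕ → SSS p n k := fun a => t p n k a ⊗ₜ (1 ⊗ₜ 1)
  let Y : ℕ → SSS p n k := fun a => 1 ⊗ₜ (t p n k a ⊗ₜ 1)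
  let W : ℕ → SSS p n k := fun a => 1 ⊗ₜ (1 ⊗ₜ t p n k a)
  refine S_hom_ext fun s _ => ?_
  change f (comul p n k _) = g (comul p n k _)
  rw [comul_t hkn, deltaT_eq_dl]
  have h1 : f (dl p n (fun a => t p n k a ⊗ₜ[ZMod p] 1) (fun a => 1 ⊗ₜ[ZMod p] t p n k a) s) =
      dl p n (dl p n X Y) W s := by
    refine (map_dl f.toRingHom _ _ s).trans ?_
    congr 1
    · funext a
      change Algebra.TensorProduct.assoc (ZMod p) (ZMod p) (ZMod p) (S p n k) (S p n k) (S p n k)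
        (comul p n k (t p n k a) ⊗ₜ 1) = _
      rw [comul_t hkn, deltaT_eq_dl]
      let i : SS p n k →ₐ[ZMod p] SSS p n k :=
        (Algebra.TensorProduct.assoc (ZMod p) (ZMod p) (ZMod p) (S p n k) (S p n k)
          (S p n k)).toAlgHom.comp Algebra.TensorProduct.includeLeft
      exact map_dl i.toRingHom _ _ a
    · funext a
      change Algebra.TensorProduct.assoc (ZMod p) (ZMod p) (ZMod p) (S p n k) (S p n k) (S p n k)
        (comul p n k 1 ⊗ₜ t p n k a) = _
      rw [map_one]; rfl
  have h2 : g (dl p n (fun a => t p n k a ⊗ₜ[ZMod p] 1) (fun a => 1 ⊗ₜ[ZMod p] t p n k a) s) =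
      dl p n X (dl p n Y W) s := by
    refine (map_dl g.toRingHom _ _ s).trans ?_
    congr 1
    · funext a
      change t p n k a ⊗ₜ comul p n k 1 = _
      rw [map_one]; rfl
    · funext a
      change 1 ⊗ₜ comul p n k (t p n k a) = _
      rw [comul_t hkn, deltaT_eq_dl]
      let i : SS p n k →ₐ[ZMod p] SSS p n k := Algebra.TensorProduct.includeRight
      exact map_dl i.toRingHom _ _ a
  have := charP_SSS (p := p) (n := n) (k := k)
  rw [h1, h2]
  refine dl_coassoc (NeZero.pos n) SSS_pow ?_ ?_ ?_ s
  all_goals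
    simp only [X, Y, W, t_zero]
    rfl

end SCoassoc

/-! ### The cobar differential on words -/

section WordDiff

variable {p n k : ℕ} [Fact p.Prime] [NeZero n] [NeZero k]

variable (p n k) in
/-- The element `[x]`, written in terms of words. -/
def brw : S p n k →ₗ[ZMod p] Om p (Ix n k) := (theta p n k).symm.toLinearMap ∘ₗ br p n k

lemma theta_brw (x : S p n k) : theta p n k (brw p n k x) = br p n k x :=
  (theta p n k).apply_symm_apply _

lemma brw_eq_of_theta {x : S p n k} {y : Om p (Ix n k)} (h : theta p n k y = br p n k x) :
    brw p n k x = y := by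
  rw [brw, LinearMap.comp_apply, ← h]
  exact (theta p n k).symm_apply_apply _

lemma brw_one : brw p n k 1 = 0 := by
  rw [brw, LinearMap.comp_apply, br, LinearMap.comp_apply, pr_one, map_zero, map_zero]

lemma brw_tp {q : Ix n k →₀ ℕ} (hq : Trunc p q) :
    brw p n k (tp p q) = qfact p q • lt p q := by
  refine brw_eq_of_theta ?_
  rw [br_tp hq, map_smul]

lemma brw_mem {x : S p n k} {g : Deg p n} {w : ℕ} (hx : IsMono p x g w) :
    brw p n k x ∈ FO p n k 1 g w := by
  obtain ⟨y, hy, h⟩ := br_mem hx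
  rwa [brw_eq_of_theta h]

variable (p n k) in
/-- The map `x ⊗ y ↦ [x|y]`. -/
def Lw : SS p n k →ₗ[ZMod p] Om p (Ix n k) :=
  LinearMap.mul' (ZMod p) (Om p (Ix n k)) ∘ₗ TensorProduct.map (brw p n k) (brw p n k)

lemma Lw_tmul (x y : S p n k) : Lw p n k (x ⊗ₜ y) = brw p n k x * brw p n k y := by
  rw [Lw, LinearMap.comp_apply, TensorProduct.map_tmul, LinearMap.mul'_apply]

lemma Lw_mem {γ : Deg p n} {M : ℤ} {z : SS p n k} (hz : z ∈ SSF p n k γ M) :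
    Lw p n k z ∈ FO p n k 2 γ M := by
  suffices SSF p n k γ M ≤ (FO p n k 2 γ M).comap (Lw p n k) from this hz
  refine Submodule.span_le.2 ?_
  rintro _ ⟨x, y, g, g', w, w', h1, h2, rfl, h4, rfl⟩
  change Lw p n k _ ∈ FO p n k 2 _ M
  rw [Lw_tmul]
  have h5 := FO_mul (brw_mem h1) (brw_mem h2)
  rw [one_add_one_eq_two] at h5
  exact FO_mono h4 h5

lemma theta_Lw (z : SS p n k) : theta p n k (Lw p n k z) =
    LinearMap.mul' (ZMod p) (Cobar p n k) (TensorProduct.map (br p n k) (br p n k) z) := by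
  induction z using TensorProduct.induction_on with
  | zero => simp only [map_zero]
  | tmul x y =>
    rw [Lw_tmul, map_mul, theta_brw, theta_brw, TensorProduct.map_tmul, LinearMap.mul'_apply]
  | add x y hx hy => simp only [map_add, hx, hy]

/-- The value of the cobar differential on a letter. -/
def delw (a : Letter p (Ix n k)) : Om p (Ix n k) :=
  -((qfact p a.1)⁻¹ • Lw p n k (comul p n k (tp p a.1)))

variable (p n k) in
/-- The cobar differential on words. -/
def dw : Om p (Ix n k) →ₗ[ZMod p] Om p (Ix n k) := der delw

lemma theta_delw (a : Letter p (Ix n k)) : theta p n k (delw a) = -redComul p n k (gam a) := by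
  have h : ((gam a : Sbar p n k) : S p n k) = (qfact p a.1)⁻¹ • tp p a.1 := by
    change (qfact p a.1)⁻¹ • (pr p n k (tp p a.1) : S p n k) = _
    rw [coe_pr_tp a.2.1]
  rw [delw, map_neg, map_smul, theta_Lw, redComul]
  change _ = -(LinearMap.mul' (ZMod p) (Cobar p n k) (TensorProduct.map (br p n k) (br p n k)
    (comul p n k ((gam a : Sbar p n k) : S p n k))))
  rw [h, map_smul, map_smul, map_smul]

lemma theta_dw (x : Om p (Ix n k)) : theta p n k (dw p n k x) = cobarD p n k (theta p n k x) := by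
  suffices (theta p n k).toLinearMap ∘ₗ dw p n k = cobarD p n k ∘ₗ (theta p n k).toLinearMap from
    LinearMap.congr_fun this x
  refine word_hom_ext fun l => ?_
  induction l with
  | nil =>
    change theta p n k (der delw 1) = cobarD p n k (theta p n k 1)
    rw [der_one, map_zero, map_one, cobarD_one]
  | cons a l ih =>
    change theta p n k (der delw _) = cobarD p n k (theta p n k _)
    change theta p n k (der delw _) = cobarD p n k (theta p n k _) at ih
    rw [word_cons, der_ι_mul, map_sub, map_mul, map_mul, map_mul, ih, theta_ι, theta_delw,
      cobarD_ι_mul]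

lemma FO_length {s : ℕ} {u : Deg p n} {M : ℤ} {x : Om p (Ix n k)} (hx : x ∈ FO p n k s u M) :
    x ∈ wspan (ZMod p) fun l : List (Letter p (Ix n k)) => l.length = s := by
  refine wspan_mono (fun l hl => ?_) hx
  have h : ∀ l : List (Letter p (Ix n k)), ((triWt p n k).wdeg l).1 = l.length := by
    intro l
    induction l with
    | nil => rfl
    | cons a l ih =>
      rw [WordWt.wdeg_cons, Prod.fst_add, ih, triWt_ldeg]
      simp [add_comm]
  have := hl.1
  rw [h] at this
  exact_mod_cast this

lemma IsMono_mem_top (x : S p n k) :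
    x ∈ Submodule.span (ZMod p) {y : S p n k | ∃ g w, IsMono p y g w} := by
  refine Submodule.span_mono ?_ (mem_span_tp x)
  rintro _ ⟨q, -, rfl⟩
  exact ⟨_, _, q, rfl, rfl, le_rfl⟩

lemma brw_length (x : S p n k) :
    brw p n k x ∈ wspan (ZMod p) fun l : List (Letter p (Ix n k)) => l.length = 1 := by
  suffices (⊤ : Submodule (ZMod p) (S p n k)) ≤ (wspan (ZMod p) fun l : List (Letter p (Ix n k)) =>
      l.length = 1).comap (brw p n k) from this trivial
  intro y _
  refine (Submodule.span_le.2 ?_) (IsMono_mem_top y)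
  rintro _ ⟨g, w, h⟩
  exact FO_length (s := 1) (brw_mem h)

lemma Lw_length (z : SS p n k) :
    Lw p n k z ∈ wspan (ZMod p) fun l : List (Letter p (Ix n k)) => l.length = 2 := by
  induction z using TensorProduct.induction_on with
  | zero => rw [map_zero]; exact zero_mem _
  | tmul x y =>
    rw [Lw_tmul]
    exact wspan_mul (fun l l' h h' => by rw [List.length_append, h, h']) (brw_length x)
      (brw_length y)
  | add x y hx hy => rw [map_add]; exact add_mem hx hy

lemma delw_length (a : Letter p (Ix n k)) :
    delw a ∈ wspan (ZMod p) fun l : List (Letter p (Ix n k)) => l.length = 2 :=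
  neg_mem (Submodule.smul_mem _ _ (Lw_length _))

lemma dw_brw (x : S p n k) : dw p n k (brw p n k x) = -Lw p n k (comul p n k x) := by
  suffices dw p n k ∘ₗ brw p n k = -(Lw p n k ∘ₗ (comul p n k).toLinearMap) from
    LinearMap.congr_fun this x
  refine LinearMap.ext fun x => ?_
  suffices Submodule.span (ZMod p) {y | ∃ q : Ix n k →₀ ℕ, Trunc p q ∧ y = tp p q} ≤
      LinearMap.eqLocus (dw p n k ∘ₗ brw p n k) (-(Lw p n k ∘ₗ (comul p n k).toLinearMap)) from
    this (mem_span_tp x)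
  refine Submodule.span_le.2 ?_
  rintro _ ⟨q, hq, rfl⟩
  change dw p n k (brw p n k (tp p q)) = -Lw p n k (comul p n k (tp p q))
  by_cases h0 : q = 0
  · rw [h0, tp_zero, brw_one, map_zero, map_one, Algebra.TensorProduct.one_def, Lw_tmul, brw_one,
      zero_mul, neg_zero]
  · rw [brw_tp hq, lt, dif_pos ⟨h0, hq⟩, map_smul, dw, der_ι, delw, smul_neg, smul_smul,
      mul_inv_cancel₀ (qfact_ne_zero hq), one_smul]

variable (p n k) in
/-- The map `x ⊗ y ⊗ z ↦ [x|y|z]`. -/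
def Lw3 : SSS p n k →ₗ[ZMod p] Om p (Ix n k) :=
  LinearMap.mul' (ZMod p) (Om p (Ix n k)) ∘ₗ TensorProduct.map (brw p n k) (Lw p n k)

lemma Lw3_tmul (x : S p n k) (z : SS p n k) : Lw3 p n k (x ⊗ₜ z) = brw p n k x * Lw p n k z := by
  rw [Lw3, LinearMap.comp_apply, TensorProduct.map_tmul, LinearMap.mul'_apply]

lemma Lw3_assoc (z : SS p n k) (y : S p n k) : Lw3 p n k
    (Algebra.TensorProduct.assoc (ZMod p) (ZMod p) (ZMod p) (S p n k) (S p n k) (S p n k)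
      (z ⊗ₜ y)) = Lw p n k z * brw p n k y := by
  induction z using TensorProduct.induction_on with
  | zero => rw [TensorProduct.zero_tmul, map_zero, map_zero, map_zero, zero_mul]
  | tmul x x' =>
    rw [Algebra.TensorProduct.assoc_tmul, Lw3_tmul, Lw_tmul, Lw_tmul, mul_assoc]
  | add x x' hx hy => rw [TensorProduct.add_tmul, map_add, map_add, map_add, add_mul, hx, hy]

lemma dw_Lw (z : SS p n k) : dw p n k (Lw p n k z) = Lw3 p n k
      (Algebra.TensorProduct.map (AlgHom.id (ZMod p) (S p n k)) (comul p n k) z) - Lw3 p n k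
    (Algebra.TensorProduct.assoc (ZMod p) (ZMod p) (ZMod p) (S p n k) (S p n k) (S p n k)
      (Algebra.TensorProduct.map (comul p n k) (AlgHom.id (ZMod p) (S p n k)) z)) := by
  induction z using TensorProduct.induction_on with
  | zero => simp only [map_zero, sub_zero]
  | tmul x y =>
    rw [Algebra.TensorProduct.map_tmul, Algebra.TensorProduct.map_tmul, Lw3_assoc, Lw3_tmul,
      Lw_tmul, dw, der_mul_of_length _ (brw_length x)]
    change dw p n k _ * _ + _ * (_ * dw p n k _) = _
    rw [dw_brw, dw_brw, pow_one]
    simp only [AlgHom.id_apply]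
    noncomm_ring
  | add x y hx hy => simp only [map_add, hx, hy]; abel

lemma der_der {R X : Type} [CommRing R] {δ : X → FreeAlgebra R X}
    (h2 : ∀ a, δ a ∈ wspan R fun l : List X => l.length = 2) (h : ∀ a, der δ (δ a) = 0)
    (x : FreeAlgebra R X) : der δ (der δ x) = 0 := by
  suffices der δ ∘ₗ der δ = 0 from LinearMap.congr_fun this x
  refine word_hom_ext fun l => ?_
  induction l with
  | nil => simp
  | cons a l ih =>
    simp only [LinearMap.comp_apply, LinearMap.zero_apply] at ih ⊢
    rw [word_cons, der_ι_mul, map_sub, der_mul_of_length _ (h2 a), der_ι_mul, h, ih]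
    simp

/-- The cobar differential is a differential. -/
lemma dw_dw (hkn : k ≤ n) (x : Om p (Ix n k)) : dw p n k (dw p n k x) = 0 := by
  refine der_der delw_length (fun a => ?_) x
  rw [delw, map_neg, map_smul]
  change -(_ • dw p n k _) = 0
  rw [dw_Lw, comul_coassoc hkn, sub_self, smul_zero, neg_zero]

end WordDiff

end

/-! ### The leading part of the cobar differential -/

section

section Antidiagonal

lemma sum_antidiagonal_single_add {I N : Type} [DecidableEq I] [AddCommMonoid N] {a : I}
    {f : I →₀ ℕ} (ha : a ∉ f.support) (m : ℕ) (F : (I →₀ ℕ) × (I →₀ ℕ) → N) :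
    ∑ x ∈ Finset.HasAntidiagonal.antidiagonal (Finsupp.single a m + f), F x =
      ∑ u ∈ Finset.HasAntidiagonal.antidiagonal m, ∑ x ∈ Finset.HasAntidiagonal.antidiagonal f,
        F (Finsupp.single a u.1 + x.1, Finsupp.single a u.2 + x.2) := by
  have hfa : f a = 0 := Finsupp.notMem_support_iff.1 ha
  have herase : ∀ g : I →₀ ℕ, Finsupp.single a (g a) + g.erase a = g :=
    fun g => Finsupp.single_add_erase a g
  rw [← Finset.sum_product']
  refine Finset.sum_bij' (fun x _ => ((x.1 a, x.2 a), (x.1.erase a, x.2.erase a)))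
    (fun y _ => (Finsupp.single a y.1.1 + y.2.1, Finsupp.single a y.1.2 + y.2.2)) ?_ ?_ ?_ ?_ ?_
  · rintro ⟨x, y⟩ h
    rw [Finset.HasAntidiagonal.mem_antidiagonal] at h
    rw [Finset.mem_product, Finset.HasAntidiagonal.mem_antidiagonal,
      Finset.HasAntidiagonal.mem_antidiagonal]
    simp only at h ⊢
    constructor
    · rw [← Finsupp.add_apply, h, Finsupp.add_apply, Finsupp.single_eq_same, hfa, add_zero]
    · rw [← Finsupp.erase_add, h, Finsupp.erase_add, Finsupp.erase_single, zero_add,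
        Finsupp.erase_of_notMem_support ha]
  · rintro ⟨u, x⟩ h
    rw [Finset.mem_product, Finset.HasAntidiagonal.mem_antidiagonal,
      Finset.HasAntidiagonal.mem_antidiagonal] at h
    rw [Finset.HasAntidiagonal.mem_antidiagonal]
    simp only at h ⊢
    rw [← h.1, ← h.2, Finsupp.single_add]; abel
  · rintro ⟨x, y⟩ h
    simp only [herase]
  · rintro ⟨⟨u, v⟩, ⟨x, y⟩⟩ h
    rw [Finset.mem_product, Finset.HasAntidiagonal.mem_antidiagonal,
      Finset.HasAntidiagonal.mem_antidiagonal] at h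
    simp only at h ⊢
    have h1 : x a + y a = 0 := by rw [← Finsupp.add_apply, h.2, hfa]
    have hx : x a = 0 := by omega
    have hy : y a = 0 := by omega
    simp only [Finsupp.add_apply, Finsupp.single_eq_same, hx, hy, add_zero, Finsupp.erase_add,
      Finsupp.erase_single, zero_add,
      Finsupp.erase_of_notMem_support (Finsupp.notMem_support_iff.2 hx),
      Finsupp.erase_of_notMem_support (Finsupp.notMem_support_iff.2 hy)]
  · rintro ⟨x, y⟩ h
    simp only [herase]

end Antidiagonal

section Leading

variable {p n k : ℕ} [Fact p.Prime] [NeZero n] [NeZero k]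

lemma qfact_single {I : Type} (i : I) (m : ℕ) :
    qfact p (Finsupp.single i m) = (m.factorial : ZMod p) :=
  Finsupp.prod_single_index (by simp)

lemma qfact_single_add {I : Type} [DecidableEq I] {a : I} {f : I →₀ ℕ} (ha : f a = 0) (m : ℕ) :
    qfact p (Finsupp.single a m + f) = (m.factorial : ZMod p) * qfact p f := by
  rw [qfact, Finsupp.prod_add_index_of_disjoint]
  · rw [Finsupp.prod_single_index (by simp)]; rfl
  · refine Finset.disjoint_of_subset_left Finsupp.support_single_subset ?_
    simpa using ha

lemma primProd_eq {q : Ix n k →₀ ℕ} (hq : Trunc p q) : primProd p q =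
    ∑ x ∈ Finset.HasAntidiagonal.antidiagonal q,
      (qfact p q * ((qfact p x.1)⁻¹ * (qfact p x.2)⁻¹)) • (tp p x.1 ⊗ₜ[ZMod p] tp p x.2) := by
  induction q using Finsupp.induction with
  | zero => simp [primProd, qfact, Algebra.TensorProduct.one_def]
  | single_add a m f ha _ ih =>
    have hfa : f a = 0 := Finsupp.notMem_support_iff.1 ha
    have hm : m < p := by
      have := hq a
      rwa [Finsupp.add_apply, Finsupp.single_eq_same, hfa, add_zero] at this
    rw [primProd_add, ih (hq.mono (by simp)), primProd_single, sum_antidiagonal_single_add ha,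
      (Commute.all _ _).add_pow', Finset.sum_mul_sum]
    refine Finset.sum_congr rfl fun u hu => Finset.sum_congr rfl fun x hx => ?_
    rw [Finset.HasAntidiagonal.mem_antidiagonal] at hu hx
    have h1 : x.1 a + x.2 a = 0 := by rw [← Finsupp.add_apply, hx, hfa]
    have e1 : tX p n k a.2 a.1 ^ u.1 * tY p n k a.2 a.1 ^ u.2 =
        (tt p a ^ u.1) ⊗ₜ[ZMod p] (tt p a ^ u.2) := by
      rw [tX_pow, tY_pow, Algebra.TensorProduct.tmul_mul_tmul, mul_one, one_mul, tj_of_le a.1.2]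
    have e2 : ((m.choose u.1 : ℕ) : ZMod p) =
        m.factorial * ((u.1.factorial : ZMod p)⁻¹ * (u.2.factorial : ZMod p)⁻¹) := by
      have h3 : (u.1.factorial : ZMod p) ≠ 0 := factorial_ne_zero (by omega)
      have h4 : (u.2.factorial : ZMod p) ≠ 0 := factorial_ne_zero (by omega)
      have h5 := Nat.choose_mul_factorial_mul_factorial (show u.1 ≤ m by omega)
      rw [show m - u.1 = u.2 by omega] at h5
      rw [← h5, Nat.cast_mul, Nat.cast_mul]
      field_simp
    rw [e1, ← Nat.cast_smul_eq_nsmul (ZMod p), smul_mul_smul_comm,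
      Algebra.TensorProduct.tmul_mul_tmul, qfact_single_add hfa, qfact_single_add (by omega),
      qfact_single_add (by omega), tp_add, tp_add, tp_single, tp_single, e2]
    congr 1
    rw [mul_inv, mul_inv]
    ring

lemma Lw_primProd {q : Ix n k →₀ ℕ} (hq : Trunc p q) : Lw p n k (primProd p q) =
    qfact p q • ∑ x ∈ Finset.HasAntidiagonal.antidiagonal q, lt p x.1 * lt p x.2 := by
  rw [primProd_eq hq, map_sum, Finset.smul_sum]
  refine Finset.sum_congr rfl fun x hx => ?_
  rw [Finset.HasAntidiagonal.mem_antidiagonal] at hx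
  have h1 : Trunc p x.1 := hq.mono (by rw [← hx]; exact le_self_add)
  have h2 : Trunc p x.2 := hq.mono (by rw [← hx]; exact le_add_self)
  rw [map_smul, Lw_tmul, brw_tp h1, brw_tp h2, smul_mul_smul_comm, smul_smul]
  congr 1
  have := qfact_ne_zero h1
  have := qfact_ne_zero h2
  field_simp

lemma delw_sub_del0_mem (hkn : k ≤ n) (a : Letter p (Ix n k)) :
    delw a - del0 a ∈ FO p n k 2 (qdeg p a.1) ((qwt p a.1 : ℤ) - 1) := by
  have h1 := Lw_mem (comul_tp_sub_mem (p := p) hkn a.1)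
  rw [map_sub, Lw_primProd a.2.2] at h1
  have h2 := neg_mem (Submodule.smul_mem _ (qfact p a.1)⁻¹ h1)
  rw [smul_sub, smul_smul, inv_mul_cancel₀ (qfact_ne_zero a.2.2), one_smul, neg_sub] at h2
  rw [delw, del0]
  convert h2 using 1
  abel

variable (p n k) in
/-- The span of the words of tridegree `γ`. -/
def GO (γ : ℤ × Deg p n × ℤ) : Submodule (ZMod p) (Om p (Ix n k)) :=
  wspan (ZMod p) fun l => (triWt p n k).wdeg l = γ

variable (p n k) in
/-- The component of tridegree `γ`. -/
def comp (γ : ℤ × Deg p n × ℤ) : Om p (Ix n k) →ₗ[ZMod p] Om p (Ix n k) :=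
  wproj fun l => (triWt p n k).wdeg l = γ

lemma comp_mem (γ : ℤ × Deg p n × ℤ) (x : Om p (Ix n k)) : comp p n k γ x ∈ GO p n k γ :=
  wproj_mem _ x

lemma comp_of_mem {γ : ℤ × Deg p n × ℤ} {x : Om p (Ix n k)} (hx : x ∈ GO p n k γ) :
    comp p n k γ x = x := wproj_of_mem hx

lemma comp_of_ne {γ γ' : ℤ × Deg p n × ℤ} {x : Om p (Ix n k)} (h : γ ≠ γ')
    (hx : x ∈ GO p n k γ) : comp p n k γ' x = 0 :=
  wproj_of_disjoint (fun _ hl hl' => h (hl.symm.trans hl')) hx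

lemma comp_of_lt {s : ℤ} {u : Deg p n} {M M' : ℤ} {x : Om p (Ix n k)} (h : M < M')
    (hx : x ∈ FO p n k s u M) : comp p n k (s, u, M') x = 0 :=
  wproj_of_disjoint (fun l hl hl' => by
    have := hl.2.2
    rw [hl'] at this
    exact absurd this (not_le.2 h)) hx

lemma GO_le_FO (s : ℤ) (u : Deg p n) (M : ℤ) : GO p n k (s, u, M) ≤ FO p n k s u M :=
  fun _ hx => mem_FO_of_wdeg hx

lemma sub_comp_mem {s : ℤ} {u : Deg p n} {M : ℤ} {x : Om p (Ix n k)} (hx : x ∈ FO p n k s u M) :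
    x - comp p n k (s, u, M) x ∈ FO p n k s u (M - 1) := by
  suffices FO p n k s u M ≤ (FO p n k s u (M - 1)).comap (LinearMap.id - comp p n k (s, u, M)) from
    this hx
  refine wspan_le fun l hl => ?_
  rw [Submodule.mem_comap, LinearMap.sub_apply, LinearMap.id_apply]
  by_cases h : (triWt p n k).wdeg l = (s, u, M)
  · rw [comp, wproj_word_pos h, sub_self]; exact zero_mem _
  · rw [comp, wproj_word_neg h, sub_zero]
    refine word_mem_wspan ⟨hl.1, hl.2.1, ?_⟩
    have : ((triWt p n k).wdeg l).2.2 ≠ M := fun h' => h (by rw [← hl.1, ← hl.2.1, ← h'])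
    have := hl.2.2
    omega

lemma GO_mul {γ γ' : ℤ × Deg p n × ℤ} {x y : Om p (Ix n k)} (hx : x ∈ GO p n k γ)
    (hy : y ∈ GO p n k γ') : x * y ∈ GO p n k (γ + γ') := mul_mem_wdeg _ hx hy

lemma lt_mem_GO (q : Ix n k →₀ ℕ) : lt p q ∈ GO p n k (1, qdeg p q, qwt p q) := by
  have := lt_mem_wdeg (p := p) (triWt p n k) q
  rwa [triWt_ldeg] at this

lemma del0_mem_GO (a : Letter p (Ix n k)) : del0 a ∈ GO p n k (2, qdeg p a.1, qwt p a.1) := by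
  have h := d0_mem (triWt p n k) (lt_mem_wdeg (p := p) (triWt p n k) a.1)
  rw [lt_letter, d0, der_ι, triWt_ldeg] at h
  refine wspan_mono (fun l hl => ?_) h
  rw [hl]
  exact Prod.ext rfl (Prod.ext (zero_add _) (zero_add _))

lemma wdeg_letter (a : Letter p (Ix n k)) (l : List (Letter p (Ix n k))) :
    (triWt p n k).wdeg (a :: l) = (1, qdeg p a.1, (qwt p a.1 : ℤ)) + (triWt p n k).wdeg l := by
  rw [WordWt.wdeg_cons, triWt_ldeg]

lemma ι_mem_GO (a : Letter p (Ix n k)) :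
    FreeAlgebra.ι (ZMod p) a ∈ GO p n k (1, qdeg p a.1, qwt p a.1) := by
  rw [← lt_letter]; exact lt_mem_GO _

lemma der_word_mem_GO {δ : Letter p (Ix n k) → Om p (Ix n k)} {c : ℤ}
    (h : ∀ a, δ a ∈ GO p n k (2, qdeg p a.1, (qwt p a.1 : ℤ) - c)) (l : List (Letter p (Ix n k))) :
    der δ (word _ l) ∈ GO p n k ((triWt p n k).wdeg l + (1, 0, -c)) := by
  induction l with
  | nil => rw [word_nil, der_one]; exact zero_mem _
  | cons a l ih =>
    rw [word_cons, der_ι_mul]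
    refine sub_mem ?_ ?_
    · have := GO_mul (h a) (word_mem_wspan (rfl : (triWt p n k).wdeg l = _))
      convert this using 2
      rw [wdeg_letter]
      refine Prod.ext ?_ (Prod.ext ?_ ?_) <;> simp <;> ring
    · have := GO_mul (ι_mem_GO a) ih
      rwa [← add_assoc, ← wdeg_letter] at this

lemma der_mem_GO {δ : Letter p (Ix n k) → Om p (Ix n k)} {c : ℤ}
    (h : ∀ a, δ a ∈ GO p n k (2, qdeg p a.1, (qwt p a.1 : ℤ) - c)) {γ : ℤ × Deg p n × ℤ}
    {x : Om p (Ix n k)} (hx : x ∈ GO p n k γ) : der δ x ∈ GO p n k (γ + (1, 0, -c)) :=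
  wspan_map (fun l hl => hl ▸ der_word_mem_GO h l) hx

lemma der_mem_FO {δ : Letter p (Ix n k) → Om p (Ix n k)} {c : ℤ}
    (h : ∀ a, δ a ∈ FO p n k 2 (qdeg p a.1) ((qwt p a.1 : ℤ) - c)) {s : ℤ} {u : Deg p n} {M : ℤ}
    {x : Om p (Ix n k)} (hx : x ∈ FO p n k s u M) : der δ x ∈ FO p n k (s + 1) u (M - c) := by
  refine wspan_map (fun l hl => ?_) hx
  have key : ∀ l : List (Letter p (Ix n k)), der δ (word _ l) ∈ FO p n k
      (((triWt p n k).wdeg l).1 + 1) ((triWt p n k).wdeg l).2.1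
      (((triWt p n k).wdeg l).2.2 - c) := by
    intro l
    induction l with
    | nil => rw [word_nil, der_one]; exact zero_mem _
    | cons a l ih =>
      rw [word_cons, der_ι_mul, wdeg_letter]
      refine sub_mem ?_ ?_
      · have := FO_mul (h a) (word_mem_wspan (⟨rfl, rfl, le_rfl⟩ : FPred p n k _ _ _ l))
        convert this using 1
        simp only [Prod.fst_add, Prod.snd_add]
        congr 1 <;> ring
      · have := FO_mul (GO_le_FO _ _ _ (ι_mem_GO a)) ih
        convert this using 1
        simp only [Prod.fst_add, Prod.snd_add]
        congr 1 <;> ring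
  have := key l
  rw [hl.1, hl.2.1] at this
  exact FO_mono (by linarith [hl.2.2]) this

/-- The part of the cobar differential of a letter that lowers the filtration by `c`. -/
def delc (c : ℤ) (a : Letter p (Ix n k)) : Om p (Ix n k) :=
  comp p n k (2, qdeg p a.1, (qwt p a.1 : ℤ) - c) (delw a)

lemma delc_mem (c : ℤ) (a : Letter p (Ix n k)) :
    delc c a ∈ GO p n k (2, qdeg p a.1, (qwt p a.1 : ℤ) - c) := comp_mem _ _

lemma delw_sub_one_mem (hkn : k ≤ n) (a : Letter p (Ix n k)) :
    delw a - del0 a - delc 1 a ∈ FO p n k 2 (qdeg p a.1) ((qwt p a.1 : ℤ) - 2) := by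
  have h := sub_comp_mem (delw_sub_del0_mem hkn a)
  rw [map_sub, comp_of_ne _ (del0_mem_GO a), sub_zero] at h
  · refine FO_mono ?_ h
    linarith
  · intro h; simp at h; omega

lemma delw_sub_two_mem (hkn : k ≤ n) (a : Letter p (Ix n k)) :
    delw a - del0 a - delc 1 a - delc 2 a ∈
      FO p n k 2 (qdeg p a.1) ((qwt p a.1 : ℤ) - 3) := by
  have h := sub_comp_mem (delw_sub_one_mem hkn a)
  rw [map_sub, map_sub, comp_of_ne _ (del0_mem_GO a), comp_of_ne _ (delc_mem 1 a), sub_zero,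
    sub_zero] at h
  · refine FO_mono ?_ h
    linarith
  · intro h; simp at h
  · intro h; simp at h; omega

variable (p n k) in
/-- The part of the cobar differential that lowers the filtration by `1`. -/
def d1 : Om p (Ix n k) →ₗ[ZMod p] Om p (Ix n k) := der (delc 1)

variable (p n k) in
/-- The part of the cobar differential that lowers the filtration by `2`. -/
def d2 : Om p (Ix n k) →ₗ[ZMod p] Om p (Ix n k) := der (delc 2)

lemma d1_mem {γ : ℤ × Deg p n × ℤ} {x : Om p (Ix n k)} (hx : x ∈ GO p n k γ) :
    d1 p n k x ∈ GO p n k (γ + (1, 0, -1)) := der_mem_GO (delc_mem 1) hx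

lemma d2_mem {γ : ℤ × Deg p n × ℤ} {x : Om p (Ix n k)} (hx : x ∈ GO p n k γ) :
    d2 p n k x ∈ GO p n k (γ + (1, 0, -2)) := der_mem_GO (delc_mem 2) hx

lemma d0_mem_GO {γ : ℤ × Deg p n × ℤ} {x : Om p (Ix n k)} (hx : x ∈ GO p n k γ) :
    d0 p (Ix n k) x ∈ GO p n k (γ + (1, 0, 0)) := by
  have := d0_mem (triWt p n k) hx
  rwa [add_comm] at this

lemma dw_mem {s : ℤ} {u : Deg p n} {M : ℤ} {x : Om p (Ix n k)} (hkn : k ≤ n)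
    (hx : x ∈ FO p n k s u M) : dw p n k x ∈ FO p n k (s + 1) u M := by
  have := der_mem_FO (δ := delw) (c := 0) (fun a => ?_) hx
  · rwa [sub_zero] at this
  · rw [sub_zero, ← sub_add_cancel (delw a) (del0 a)]
    exact add_mem (FO_mono (by linarith) (delw_sub_del0_mem hkn a)) (GO_le_FO _ _ _ (del0_mem_GO a))

lemma dw_eq (x : Om p (Ix n k)) : dw p n k x = d0 p (Ix n k) x + d1 p n k x +
    der (fun a => delw a - del0 a - delc 1 a) x := by
  rw [dw, d0, d1, ← LinearMap.add_apply, ← LinearMap.add_apply, ← der_add, ← der_add]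
  congr 2
  funext a
  simp only [Pi.add_apply]
  abel

lemma dw_sub_mem {s : ℤ} {u : Deg p n} {M : ℤ} {x : Om p (Ix n k)} (hkn : k ≤ n)
    (hx : x ∈ FO p n k s u M) :
    dw p n k x - d0 p (Ix n k) x - d1 p n k x ∈ FO p n k (s + 1) u (M - 2) := by
  have := der_mem_FO (delw_sub_one_mem hkn) hx
  rw [dw_eq]
  convert this using 1
  abel

lemma dw_eq' (x : Om p (Ix n k)) : dw p n k x = d0 p (Ix n k) x + d1 p n k x + d2 p n k x +
    der (fun a => delw a - del0 a - delc 1 a - delc 2 a) x := by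
  rw [dw, d0, d1, d2, ← LinearMap.add_apply, ← LinearMap.add_apply, ← LinearMap.add_apply,
    ← der_add, ← der_add, ← der_add]
  congr 2
  funext a
  simp only [Pi.add_apply]
  abel

/-- The components of the relation `d² = 0`. -/
lemma dw_components (hkn : k ≤ n) (x : Om p (Ix n k)) :
    d0 p (Ix n k) (d1 p n k x) + d1 p n k (d0 p (Ix n k) x) = 0 ∧
    d0 p (Ix n k) (d2 p n k x) + d1 p n k (d1 p n k x) + d2 p n k (d0 p (Ix n k) x) = 0 := by
  suffices d0 p (Ix n k) ∘ₗ d1 p n k + d1 p n k ∘ₗ d0 p (Ix n k) = 0 ∧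
      d0 p (Ix n k) ∘ₗ d2 p n k + d1 p n k ∘ₗ d1 p n k + d2 p n k ∘ₗ d0 p (Ix n k) = 0 from
    ⟨LinearMap.congr_fun this.1 x, LinearMap.congr_fun this.2 x⟩
  suffices ∀ l, (d0 p (Ix n k) ∘ₗ d1 p n k + d1 p n k ∘ₗ d0 p (Ix n k)) (word _ l) = 0 ∧
      (d0 p (Ix n k) ∘ₗ d2 p n k + d1 p n k ∘ₗ d1 p n k + d2 p n k ∘ₗ d0 p (Ix n k)) (word _ l) = 0
    from ⟨word_hom_ext fun l => (this l).1, word_hom_ext fun l => (this l).2⟩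
  intro l
  obtain ⟨⟨s, u, M⟩, hγ⟩ : ∃ γ, (triWt p n k).wdeg l = γ := ⟨_, rfl⟩
  have hx : word (ZMod p) l ∈ GO p n k (s, u, M) := word_mem_wspan hγ
  generalize word (ZMod p) l = x at hx
  simp only [LinearMap.add_apply, LinearMap.comp_apply]
  set r := der (fun a : Letter p (Ix n k) => delw a - del0 a - delc 1 a - delc 2 a) x with hr
  have h0 := d0_mem_GO hx
  have h1 := d1_mem hx
  have h2 := d2_mem hx
  have h3 : r ∈ FO p n k (s + 1) u (M - 3) :=
    der_mem_FO (delw_sub_two_mem hkn) (GO_le_FO _ _ _ hx)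
  simp only [Prod.mk_add_mk, add_zero] at h0 h1 h2
  have h00 := d0_d0 x
  have h01 := d1_mem h0
  have h02 := d2_mem h0
  have h10 := d0_mem_GO h1
  have h11 := d1_mem h1
  have h20 := d0_mem_GO h2
  simp only [Prod.mk_add_mk, add_zero] at h01 h02 h10 h11 h20
  have e0 := dw_dw hkn x
  -- the terms of filtration at most `M - 3`
  have hrest : dw p n k (dw p n k x) - (d0 p (Ix n k) (d1 p n k x) + d1 p n k (d0 p (Ix n k) x)) -
      (d0 p (Ix n k) (d2 p n k x) + d1 p n k (d1 p n k x) + d2 p n k (d0 p (Ix n k) x)) ∈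
      FO p n k (s + 1 + 1) u (M - 3) := by
    have a0 : der (fun a : Letter p (Ix n k) => delw a - del0 a - delc 1 a - delc 2 a)
      (d0 p (Ix n k) x) ∈ FO p n k (s + 1 + 1) u (M - 3) :=
      der_mem_FO (delw_sub_two_mem hkn) (GO_le_FO _ _ _ h0)
    have a1 := dw_sub_mem hkn (GO_le_FO _ _ _ h1)
    have a2 := dw_sub_mem hkn (GO_le_FO _ _ _ h2)
    have a2' := d1_mem h2
    simp only [Prod.mk_add_mk, add_zero] at a2'
    have a3 := dw_mem hkn h3
    have e : dw p n k (dw p n k x) - (d0 p (Ix n k) (d1 p n k x) + d1 p n k (d0 p (Ix n k) x)) -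
      (d0 p (Ix n k) (d2 p n k x) + d1 p n k (d1 p n k x) + d2 p n k (d0 p (Ix n k) x)) =
      der (fun a : Letter p (Ix n k) => delw a - del0 a - delc 1 a - delc 2 a) (d0 p (Ix n k) x) +
      (dw p n k (d1 p n k x) - d0 p (Ix n k) (d1 p n k x) - d1 p n k (d1 p n k x)) +
      (dw p n k (d2 p n k x) - d0 p (Ix n k) (d2 p n k x) - d1 p n k (d2 p n k x)) +
      d1 p n k (d2 p n k x) + dw p n k r := by
      have b0 := dw_eq' (d0 p (Ix n k) x)
      rw [h00, zero_add] at b0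
      rw [dw_eq' x, map_add, map_add, map_add, b0, ← hr]
      abel
    rw [e]
    exact add_mem (add_mem (add_mem (add_mem a0 (FO_mono (by linarith) a1))
      (FO_mono (by linarith) a2)) (FO_mono (by linarith) (GO_le_FO _ _ _ a2'))) a3
  rw [e0, zero_sub] at hrest
  have hA := add_mem h10 h01
  have e3 : M + -1 + -1 = M + -2 := by ring
  rw [e3] at h11
  have hB := add_mem (add_mem h20 h11) h02
  generalize d0 p (Ix n k) (d1 p n k x) + d1 p n k (d0 p (Ix n k) x) = A at *
  generalize d0 p (Ix n k) (d2 p n k x) + d1 p n k (d1 p n k x) + d2 p n k (d0 p (Ix n k) x) = C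
    at *
  constructor
  · have := comp_of_lt (M' := M + -1) (by linarith) hrest
    rw [map_sub, map_neg, comp_of_mem hA, comp_of_ne _ hB, sub_zero, neg_eq_zero] at this
    · exact this
    · intro h; simp at h
  · have := comp_of_lt (M' := M + -2) (by linarith) hrest
    rw [map_sub, map_neg, comp_of_mem hB, comp_of_ne _ hA, neg_zero, zero_sub, neg_eq_zero] at this
    · exact this
    · intro h; simp at h

end Leading

end

/-! ### The first May differential on the generators -/

section

section Generators

variable {p n k : ℕ} [Fact p.Prime] [NeZero n] [NeZero k]

variable (p n k) in
/-- The word `[t_a^{p^j}]`, zero for `a < k`. -/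
def hW (a : ℕ) (j : ZMod n) : Om p (Ix n k) :=
  if h : k ≤ a then lt p (Finsupp.single ((⟨a, h⟩, j) : Ix n k) 1) else 0

variable (p n k) in
/-- The cocycle that represents `b_{a,j}`, zero for `a < k`. -/
def bW (a : ℕ) (j : ZMod n) : Om p (Ix n k) :=
  if h : k ≤ a then bw p ((⟨a, h⟩, j) : Ix n k) else 0

variable (p n k) in
/-- The value of `d_1` on `h_{i,j}`. -/
def x1 (i : ℕ) (j : ZMod n) : Om p (Ix n k) :=
  -(∑ a ∈ Finset.Icc k (i - k), if mayM p n k a + mayM p n k (i - a) + 1 = mayM p n k i then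
      hW p n k a j * hW p n k (i - a) ((a : ZMod n) + j) else 0) +
    if n + k ≤ i ∧ p * mayM p n k (i - n) + 1 = mayM p n k i then
      bW p n k (i - n) (j + ((n - 1 : ℕ) : ZMod n)) else 0

lemma brw_tt_pow (l : Ix n k) {m : ℕ} (hm : m < p) : brw p n k (tt p l ^ m) =
    (m.factorial : ZMod p) • lt p (Finsupp.single l m) := by
  rw [← tp_single, brw_tp (trunc_single.2 hm), qfact_single]

lemma brw_tj {a : ℕ} (h : k ≤ a) (j : ZMod n) : brw p n k (tj p n k a j) = hW p n k a j := by
  have := brw_tt_pow ((⟨a, h⟩, j) : Ix n k) (Fact.out : p.Prime).one_lt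
  rw [pow_one, Nat.factorial_one, Nat.cast_one, one_smul] at this
  rw [tj_of_le h, this, hW, dif_pos h]

lemma choose_div_mul (u : ℕ) (h0 : 0 < u) (h1 : u < p) :
    ((p.choose u / p : ℕ) : ZMod p) * (u.factorial * (p - u).factorial) = -1 := by
  have hp : p.Prime := Fact.out
  have h2 := Nat.choose_mul_factorial_mul_factorial h1.le
  obtain ⟨c, hc⟩ := hp.dvd_choose_self h0.ne' h1
  rw [hc, Nat.mul_div_cancel_left _ hp.pos]
  rw [hc, ← Nat.mul_factorial_pred hp.ne_zero, mul_assoc, mul_assoc] at h2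
  have h3 := Nat.eq_of_mul_eq_mul_left hp.pos h2
  rw [← ZMod.wilsons_lemma p, ← h3]
  push_cast
  ring

lemma Lw_wpoly (l : Ix n k) :
    Lw p n k (wpoly p (tX p n k l.2 l.1) (tY p n k l.2 l.1)) = bw p l := by
  rw [wpoly, map_sum, bw, ← Finset.sum_neg_distrib]
  refine Finset.sum_congr rfl fun u hu => ?_
  rw [Finset.mem_Ioo] at hu
  have e : tX p n k l.2 l.1 ^ u * tY p n k l.2 l.1 ^ (p - u) =
      (tt p l ^ u) ⊗ₜ[ZMod p] (tt p l ^ (p - u)) := by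
    rw [tX_pow, tY_pow, Algebra.TensorProduct.tmul_mul_tmul, mul_one, one_mul, tj_of_le l.1.2]
  rw [e, mul_comm, ← nsmul_eq_mul, ← Nat.cast_smul_eq_nsmul (ZMod p), map_smul, Lw_tmul,
    brw_tt_pow l hu.2, brw_tt_pow l (by omega), smul_mul_smul_comm, smul_smul,
    choose_div_mul u hu.1 hu.2, neg_smul, one_smul]

lemma Lw_sub1 (i : ℕ) (j : ZMod n) : Lw p n k (sub1 p n k i j) =
    ∑ a ∈ Finset.Icc k (i - k), hW p n k a j * hW p n k (i - a) ((a : ZMod n) + j) -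
    if n + k ≤ i then bW p n k (i - n) (j + ((n - 1 : ℕ) : ZMod n)) else 0 := by
  have hk := NeZero.pos k
  rw [sub1, map_sub, map_sum]
  congr 1
  · refine Finset.sum_congr rfl fun a ha => ?_
    rw [Finset.mem_Icc] at ha
    rw [Lw_tmul, brw_tj (by omega), brw_tj (by omega)]
  · split_ifs with h
    · have h' : k ≤ i - n := by omega
      rw [bW, dif_pos h']
      exact Lw_wpoly ((⟨i - n, h'⟩, j + ((n - 1 : ℕ) : ZMod n)) : Ix n k)
    · exact map_zero _

lemma hW_mem (a : ℕ) (j : ZMod n) : hW p n k a j ∈ GO p n k (1, hDeg p n a j, mayM p n k a) := by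
  rw [hW]
  split_ifs with h
  · have := lt_mem_GO (p := p) (Finsupp.single ((⟨a, h⟩, j) : Ix n k) 1)
    rwa [qdeg_single, qwt_single, one_smul, one_mul] at this
  · exact zero_mem _

lemma bW_mem (a : ℕ) (j : ZMod n) :
    bW p n k a j ∈ GO p n k (2, p • hDeg p n a j, (p * mayM p n k a : ℕ)) := by
  rw [bW]
  split_ifs with h
  · refine wspan_mono (fun l hl => ?_) (bw_mem_wdeg (p := p) (triWt p n k) ((⟨a, h⟩, j) : Ix n k))
    rw [hl]
    simp [WordWt.gen, triWt]
  · exact zero_mem _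

variable (p) in
lemma hDeg_natCast_add (b c : ℕ) (j : ZMod n) :
    hDeg p n b ((c : ZMod n) + j) = p ^ c • hDeg p n b j := by
  induction c generalizing j with
  | zero => simp
  | succ c ih =>
    rw [Nat.cast_succ, add_assoc, add_comm (1 : ZMod n), ih, hDeg_add_one, smul_smul, pow_succ]

variable (p) in
lemma hDeg_add (a b : ℕ) (j : ZMod n) :
    hDeg p n a j + hDeg p n b ((a : ZMod n) + j) = hDeg p n (a + b) j := by
  rw [hDeg_natCast_add, hDeg_eq a j, hDeg_eq b j, hDeg_eq (a + b) j, ← hDeg_zero_add, smul_add,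
    smul_comm]

variable (p) in
lemma hDeg_prev' {i : ℕ} (h : n ≤ i) (j : ZMod n) :
    p • hDeg p n (i - n) (j + ((n - 1 : ℕ) : ZMod n)) = hDeg p n i j := by
  have hn := NeZero.pos n
  have h1 := hDeg_natCast_add p (i - n) n j
  rw [ZMod.natCast_self, zero_add] at h1
  rw [← hDeg_add_one, add_assoc, ← Nat.cast_add_one, Nat.sub_add_cancel hn, ZMod.natCast_self,
    add_zero, h1, hDeg_eq, hDeg_eq i j, ← hDeg_prev p n h, smul_comm]

lemma hW_mul_hW_mem {i a : ℕ} (h : a ≤ i) (j : ZMod n) :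
    hW p n k a j * hW p n k (i - a) ((a : ZMod n) + j) ∈
      GO p n k (2, hDeg p n i j, (mayM p n k a + mayM p n k (i - a) : ℕ)) := by
  have := GO_mul (hW_mem (p := p) (k := k) a j) (hW_mem (i - a) ((a : ZMod n) + j))
  rw [Prod.mk_add_mk, Prod.mk_add_mk, hDeg_add, Nat.add_sub_cancel' h, one_add_one_eq_two] at this
  rwa [Nat.cast_add]

lemma bW_mem' {i : ℕ} (h : n ≤ i) (j : ZMod n) :
    bW p n k (i - n) (j + ((n - 1 : ℕ) : ZMod n)) ∈
      GO p n k (2, hDeg p n i j, (p * mayM p n k (i - n) : ℕ)) := by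
  have := bW_mem (p := p) (k := k) (i - n) (j + ((n - 1 : ℕ) : ZMod n))
  rwa [hDeg_prev' p h] at this

lemma x1_mem (i : ℕ) (j : ZMod n) :
    x1 p n k i j ∈ GO p n k (2, hDeg p n i j, (mayM p n k i : ℤ) - 1) := by
  have hk := NeZero.pos k
  refine add_mem (neg_mem (sum_mem fun a ha => ?_)) ?_
  · rw [Finset.mem_Icc] at ha
    split_ifs with h
    · have := hW_mul_hW_mem (p := p) (n := n) (k := k) (i := i) (a := a) (by omega) j
      rwa [show ((mayM p n k a + mayM p n k (i - a) : ℕ) : ℤ) = (mayM p n k i : ℤ) - 1 by omega]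
        at this
    · exact zero_mem _
  · split_ifs with h
    · have := bW_mem' (p := p) (n := n) (k := k) (i := i) (by omega) j
      rwa [show ((p * mayM p n k (i - n) : ℕ) : ℤ) = (mayM p n k i : ℤ) - 1 by omega] at this
    · exact zero_mem _

lemma x1_add_Lw_sub1_mem (i : ℕ) (j : ZMod n) : x1 p n k i j + Lw p n k (sub1 p n k i j) ∈
    FO p n k 2 (hDeg p n i j) ((mayM p n k i : ℤ) - 2) := by
  have hk := NeZero.pos k
  have e : ∀ a b c d : Om p (Ix n k), -a + b + (c - d) = c - a - (d - b) := by
    intros; abel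
  rw [Lw_sub1, x1, e, ← Finset.sum_sub_distrib]
  refine sub_mem (sum_mem fun a ha => ?_) ?_
  · rw [Finset.mem_Icc] at ha
    split_ifs with h
    · rw [sub_self]; exact zero_mem _
    · rw [sub_zero]
      have h1 := mayM_add_lt p n k (a := a) (b := i - a) (by omega) (by omega)
      rw [Nat.add_sub_cancel' (by omega)] at h1
      exact FO_mono (by omega) (GO_le_FO _ _ _
        (hW_mul_hW_mem (p := p) (n := n) (k := k) (i := i) (a := a) (by omega) j))
  · by_cases h : n + k ≤ i
    · have h1 := mul_mayM_sub_lt (p := p) h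
      by_cases h2 : p * mayM p n k (i - n) + 1 = mayM p n k i
      · rw [if_pos h, if_pos ⟨h, h2⟩, sub_self]; exact zero_mem _
      · rw [if_pos h, if_neg (fun h' => h2 h'.2), sub_zero]
        exact FO_mono (by omega) (GO_le_FO _ _ _ (bW_mem' (p := p) (by omega) j))
    · rw [if_neg h, if_neg (fun h' => h h'.1), sub_zero]; exact zero_mem _

/-- The letter `t_l^m/m!`. -/
def sletter (l : Ix n k) (m : ℕ) (h0 : m ≠ 0) (h : m < p) : Letter p (Ix n k) :=
  ⟨Finsupp.single l m, by simpa using h0, trunc_single.2 h⟩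

lemma Lw_tX (l : Ix n k) : Lw p n k (tX p n k l.2 l.1 + tY p n k l.2 l.1) = 0 := by
  rw [map_add, tX, tY, Lw_tmul, Lw_tmul, brw_one, mul_zero, zero_mul, add_zero]

/-- The first May differential of `h_{i,j}`, as a cobar differential of lower filtration. -/
lemma delc_one_single (hkn : k ≤ n) (l : Ix n k) :
    delc 1 (sletter l 1 one_ne_zero (Fact.out : p.Prime).one_lt) = x1 p n k l.1 l.2 := by
  have h1 := Lw_mem (comul_tt_sub_mem (p := p) hkn l)
  rw [map_sub, map_sub, Lw_tX, sub_zero] at h1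
  have h2 := neg_mem (add_mem h1 (x1_add_Lw_sub1_mem (p := p) l.1 l.2))
  have e : ∀ a b c : Om p (Ix n k), -(a - b + (c + b)) = -a - c := by intros; abel
  rw [e] at h2
  have h3 := comp_of_lt (M' := (mayM p n k l.1 : ℤ) - 1) (by linarith) h2
  have h4 : delw (sletter l 1 one_ne_zero (Fact.out : p.Prime).one_lt) =
      -Lw p n k (comul p n k (tt p l)) := by
    rw [delw]
    change -((qfact p (Finsupp.single l 1))⁻¹ •
      Lw p n k (comul p n k (tp p (Finsupp.single l 1)))) = _
    rw [qfact_single, tp_single, pow_one, Nat.factorial_one, Nat.cast_one, inv_one, one_smul]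
  rw [delc, h4]
  change comp p n k (2, qdeg p (Finsupp.single l 1), (qwt p (Finsupp.single l 1) : ℤ) - 1) _ = _
  rw [qdeg_single, qwt_single, one_smul, one_mul]
  rw [map_sub, comp_of_mem (x1_mem _ _), sub_eq_zero] at h3
  exact h3

variable (p n k) in
/-- The span of the words with a letter that involves at least two of the `t_l`. -/
def MixedSpan : Submodule (ZMod p) (Om p (Ix n k)) :=
  wspan (ZMod p) fun l => ∃ a ∈ l, 1 < a.1.support.card

lemma mul_mem_mixed_left {x y : Om p (Ix n k)} (hx : x ∈ MixedSpan p n k) :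
    x * y ∈ MixedSpan p n k :=
  wspan_mul (Q := fun _ => True) (fun l l' h _ => by
    obtain ⟨a, ha, h⟩ := h
    exact ⟨a, List.mem_append_left _ ha, h⟩) hx (mem_wspan_true y)

lemma mul_mem_mixed_right {x y : Om p (Ix n k)} (hy : y ∈ MixedSpan p n k) :
    x * y ∈ MixedSpan p n k :=
  wspan_mul (P := fun _ => True) (fun l l' _ h => by
    obtain ⟨a, ha, h⟩ := h
    exact ⟨a, List.mem_append_right _ ha, h⟩) (mem_wspan_true x) hy

lemma brw_mixed {l l' : Ix n k} (h : l ≠ l') {u v : ℕ} (hu : u < p) (hv : v < p) (hu0 : u ≠ 0)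
    (hv0 : v ≠ 0) : brw p n k (tt p l ^ u * tt p l' ^ v) ∈ MixedSpan p n k := by
  have hq : Trunc p (Finsupp.single l u + Finsupp.single l' v) := by
    intro i
    rw [Finsupp.add_apply, Finsupp.single_apply, Finsupp.single_apply]
    split_ifs with h1 h2
    · exact absurd (h1.trans h2.symm) h
    all_goals omega
  have hs : (Finsupp.single l u + Finsupp.single l' v).support = {l, l'} := by
    rw [Finsupp.support_add_eq, Finsupp.support_single _ hu0, Finsupp.support_single _ hv0]
    · rfl
    · rw [Finsupp.support_single _ hu0, Finsupp.support_single _ hv0]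
      simpa using h
  rw [← tp_single, ← tp_single, ← tp_add, brw_tp hq]
  refine Submodule.smul_mem _ _ ?_
  rw [lt]
  split_ifs with h1
  · rw [← word_singleton]
    refine word_mem_wspan ⟨_, List.mem_singleton_self _, ?_⟩
    simp only [hs]
    rw [Finset.card_pair h]
    norm_num
  · exact zero_mem _

lemma Lw_mixed {l a b : Ix n k} (ha : l ≠ a) (hb : l ≠ b) {u u' v v' : ℕ} (hu : u + u' < p)
    (hu0 : u + u' ≠ 0) (hv : v < p) (hv' : v' < p) (hv0 : v ≠ 0) (hv0' : v' ≠ 0) :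
    Lw p n k ((tt p l ^ u * tt p a ^ v) ⊗ₜ (tt p l ^ u' * tt p b ^ v')) ∈ MixedSpan p n k := by
  rw [Lw_tmul]
  by_cases h : u = 0
  · exact mul_mem_mixed_right (brw_mixed hb (by omega) hv' (by omega) hv0')
  · exact mul_mem_mixed_left (brw_mixed ha (by omega) hv (by omega) hv0)

/-- The terms of the coproduct of `t_l^{m+1}` of next to highest filtration consist of mixed words:
no factor of a term of `sub1` is a power of `t_l`, and each of these terms is multiplied with a
positive power of `t_l ⊗ 1` or `1 ⊗ t_l`. -/
lemma Lw_pow_mul_sub1_mem (l : Ix n k) {m : ℕ} (h0 : m ≠ 0) (hm : m < p) :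
    Lw p n k ((tX p n k l.2 l.1 + tY p n k l.2 l.1) ^ m * sub1 p n k l.1 l.2) ∈
      MixedSpan p n k := by
  have hk := NeZero.pos k
  have hn := NeZero.pos n
  have hl := l.1.2
  rw [(Commute.all _ _).add_pow', Finset.sum_mul, map_sum]
  refine sum_mem fun u hu => ?_
  rw [Finset.HasAntidiagonal.mem_antidiagonal] at hu
  rw [smul_mul_assoc, map_nsmul]
  refine nsmul_mem ?_ _
  have e1 : tX p n k l.2 l.1 ^ u.1 * tY p n k l.2 l.1 ^ u.2 =
      (tt p l ^ u.1) ⊗ₜ[ZMod p] (tt p l ^ u.2) := by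
    rw [tX_pow, tY_pow, Algebra.TensorProduct.tmul_mul_tmul, mul_one, one_mul, tj_of_le l.1.2]
  rw [e1, sub1, mul_sub, map_sub]
  refine sub_mem ?_ ?_
  · rw [Finset.mul_sum, map_sum]
    refine sum_mem fun a ha => ?_
    rw [Finset.mem_Icc] at ha
    have ha' : k ≤ l.1 - a := by omega
    rw [Algebra.TensorProduct.tmul_mul_tmul, tj_of_le ha.1, tj_of_le ha']
    have := Lw_mixed (p := p) (l := l) (a := (⟨a, ha.1⟩, l.2))
      (b := (⟨l.1 - a, ha'⟩, (a : ZMod n) + l.2)) (u := u.1) (u' := u.2) (v := 1) (v' := 1) ?_ ?_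
      (by omega) (by omega) (Fact.out : p.Prime).one_lt (Fact.out : p.Prime).one_lt one_ne_zero
      one_ne_zero
    · rwa [pow_one, pow_one] at this
    · intro h
      have := congrArg (fun x : Ix n k => (x.1 : ℕ)) h
      simp only at this
      omega
    · intro h
      have := congrArg (fun x : Ix n k => (x.1 : ℕ)) h
      simp only at this
      omega
  · split_ifs with h
    · have h' : k ≤ l.1 - n := by omega
      rw [wpoly, Finset.mul_sum, map_sum]
      refine sum_mem fun v hv => ?_
      rw [Finset.mem_Ioo] at hv
      rw [← mul_assoc, mul_comm, ← nsmul_eq_mul, map_nsmul]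
      refine nsmul_mem ?_ _
      rw [tX_pow, tY_pow, Algebra.TensorProduct.tmul_mul_tmul, mul_one, one_mul,
        Algebra.TensorProduct.tmul_mul_tmul, tj_of_le h']
      refine Lw_mixed ?_ ?_ (by omega) (by omega) hv.2 (by omega) (by omega) (by omega)
      all_goals
        intro h
        have := congrArg (fun x : Ix n k => (x.1 : ℕ)) h
        simp only at this
        omega
    · rw [mul_zero, map_zero]; exact zero_mem _

lemma wproj_mem_wspan {R X : Type} [CommRing R] {P Q : List X → Prop} {x : FreeAlgebra R X}
    (hx : x ∈ wspan R P) : wproj Q x ∈ wspan R P :=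
  wspan_map (fun l hl => by
    by_cases h : Q l
    · rw [wproj_word_pos h]; exact word_mem_wspan hl
    · rw [wproj_word_neg h]; exact zero_mem _) hx

lemma delc_one_mem_mixed (hkn : k ≤ n) (l : Ix n k) {m : ℕ} (h0 : m ≠ 0) (hm : m + 1 < p) :
    delc 1 (sletter l (m + 1) (Nat.succ_ne_zero m) hm) ∈ MixedSpan p n k := by
  have h1 := Lw_mem (comul_tt_pow_sub_mem (p := p) hkn l m)
  have hq : Trunc p (Finsupp.single l (m + 1)) := trunc_single.2 hm
  have h2 : Lw p n k ((tX p n k l.2 l.1 + tY p n k l.2 l.1) ^ (m + 1)) ∈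
      GO p n k (2, (m + 1) • hDeg p n l.1 l.2, ((m + 1) * mayM p n k l.1 : ℕ)) := by
    have h3 := del0_mem_GO (sletter l (m + 1) (Nat.succ_ne_zero m) hm)
    change -_ ∈ GO p n k (2, qdeg p (Finsupp.single l (m + 1)),
      (qwt p (Finsupp.single l (m + 1)) : ℤ)) at h3
    rw [qdeg_single, qwt_single, Submodule.neg_mem_iff] at h3
    rw [← primProd_single, Lw_primProd hq]
    exact Submodule.smul_mem _ _ h3
  have h3 := Lw_pow_mul_sub1_mem l h0 (by omega : m < p)
  have h4 := comp_of_lt (M' := (m + 1 : ℕ) * (mayM p n k l.1 : ℤ) - 1) (by linarith) h1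
  have h5 : delw (sletter l (m + 1) (Nat.succ_ne_zero m) hm) =
      -((qfact p (Finsupp.single l (m + 1)))⁻¹ •
        Lw p n k (comul p n k (tt p l ^ (m + 1)))) := by
    rw [← tp_single]; rfl
  rw [delc, h5]
  change comp p n k (2, qdeg p (Finsupp.single l (m + 1)),
    (qwt p (Finsupp.single l (m + 1)) : ℤ) - 1) _ ∈ _
  rw [qdeg_single, qwt_single, map_neg, map_smul]
  refine neg_mem (Submodule.smul_mem _ _ ?_)
  rw [map_sub, map_sub, map_sub, map_sub, comp_of_ne _ h2, sub_zero, sub_eq_zero] at h4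
  · rw [Nat.cast_mul, h4, ← nsmul_eq_mul (m + 1) (_ ^ m * _), map_nsmul, map_nsmul]
    exact nsmul_mem (wproj_mem_wspan h3) _
  · intro h
    simp only [Prod.mk.injEq, true_and] at h
    push_cast at h
    linarith

variable {B : Type} [Ring B] [Algebra (ZMod p) B] (Q : AntiOps p (Ix n k) B)

/-- A letter that involves at least two of the `t_l` acts by zero. -/
lemma rho_mixed {x : Om p (Ix n k)} (hx : x ∈ MixedSpan p n k) : Q.rho x = 0 := by
  suffices MixedSpan p n k ≤ LinearMap.ker Q.rho.toLinearMap from this hx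
  refine wspan_le fun l hl => ?_
  obtain ⟨a, ha, h⟩ := hl
  change Q.rho (word _ l) = 0
  induction l with
  | nil => simp at ha
  | cons b l ih =>
    rw [word_cons, map_mul]
    rcases List.mem_cons.1 ha with rfl | ha
    · rw [Q.rho_ι]
      rcases Q.tau_cases a.1 with h1 | ⟨i, m, hm, h1⟩
      · rw [h1, zero_mul]
      · rw [h1, Finsupp.support_single _ hm, Finset.card_singleton] at h
        exact absurd h (lt_irrefl 1)
    · rw [ih ha, mul_zero]

lemma rho_single (l : Ix n k) {m : ℕ} (h0 : m ≠ 0) (h : m < p) :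
    Q.rho (lt p (Finsupp.single l m)) = Q.op l m := by
  rw [Q.rho_lt (trunc_single.2 h), Q.tau_single l h0]

lemma commute_mul_of_anti {B : Type} [Ring B] {a b c : B} (h1 : a * c = -(c * a))
    (h2 : b * c = -(c * b)) : Commute (a * b) c := by
  rw [Commute, SemiconjBy, mul_assoc, h2, mul_neg, ← mul_assoc, h1, neg_mul, neg_neg, mul_assoc]

lemma rho_hW_anti {l : Ix n k} {a : ℕ} (h : a ≠ l.1) (j : ZMod n) (m : ℕ) :
    Q.rho (hW p n k a j) * Q.op l m = -(Q.op l m * Q.rho (hW p n k a j)) := by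
  rw [hW]
  split_ifs with ha
  · rw [rho_single Q _ one_ne_zero (Fact.out : p.Prime).one_lt]
    refine Q.op_anti ?_ _ _
    rintro rfl
    exact h rfl
  · rw [map_zero]; simp

/-- All terms of `d_1(h_l)` are products of two elements that belong to indices other than `l`. -/
lemma rho_x1_commute (l : Ix n k) (m : ℕ) :
    Commute (Q.rho (x1 p n k l.1 l.2)) (Q.op l m) := by
  have hk := NeZero.pos k
  have hn := NeZero.pos n
  have hl := l.1.2
  rw [x1, map_add, map_neg, map_sum]
  refine (Commute.neg_left (Commute.sum_left _ _ _ fun a ha => ?_)).add_left ?_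
  · rw [Finset.mem_Icc] at ha
    split_ifs with h
    · rw [map_mul]
      exact commute_mul_of_anti (rho_hW_anti Q (by omega) _ _) (rho_hW_anti Q (by omega) _ _)
    · rw [map_zero]; exact Commute.zero_left _
  · split_ifs with h
    · have h' : k ≤ l.1 - n := by omega
      rw [bW, dif_pos h', bw, map_neg, map_sum]
      refine Commute.neg_left (Commute.sum_left _ _ _ fun u hu => ?_)
      rw [Finset.mem_Ioo] at hu
      rw [map_mul, rho_single Q _ hu.1.ne' hu.2, rho_single Q _ (by omega) (by omega)]
      refine commute_mul_of_anti (Q.op_anti ?_ _ _) (Q.op_anti ?_ _ _)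
      all_goals
        intro h
        have := congrArg (fun x : Ix n k => (x.1 : ℕ)) h
        simp only at this
        omega
    · rw [map_zero]; exact Commute.zero_left _

lemma d1_lt_mul (l : Ix n k) {m : ℕ} (h0 : m ≠ 0) (h : m < p) (x : Om p (Ix n k)) :
    d1 p n k (lt p (Finsupp.single l m) * x) =
      delc 1 (sletter l m h0 h) * x - lt p (Finsupp.single l m) * d1 p n k x := by
  have : lt p (Finsupp.single l m) = FreeAlgebra.ι (ZMod p) (sletter l m h0 h) :=
    lt_letter (sletter l m h0 h)
  rw [this, d1, der_ι_mul]

lemma d1_lt (l : Ix n k) {m : ℕ} (h0 : m ≠ 0) (h : m < p) :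
    d1 p n k (lt p (Finsupp.single l m)) = delc 1 (sletter l m h0 h) := by
  have := d1_lt_mul l h0 h (1 : Om p (Ix n k))
  rwa [mul_one, mul_one, d1, der_one, mul_zero, sub_zero] at this

lemma rho_delc_one (hkn : k ≤ n) (l : Ix n k) {m : ℕ} (h0 : m ≠ 0) (h : m < p) :
    Q.rho (delc 1 (sletter l m h0 h)) = if m = 1 then Q.rho (x1 p n k l.1 l.2) else 0 := by
  split_ifs with h1
  · subst h1; rw [delc_one_single hkn]
  · obtain ⟨u, rfl⟩ : ∃ u, m = u + 1 := ⟨m - 1, by omega⟩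
    exact rho_mixed Q (delc_one_mem_mixed hkn l (by omega) h)

/-- The classes `b_{i,j}` are cycles of the first May differential: the words `[t^m|t^{p-m}]` with
`m = 1` and with `m = p - 1` contribute `d_1(h_{i,j})` times the action of `t^{p-1}`, in either order,
and the others contribute nothing. -/
lemma rho_d1_bw (hkn : k ≤ n) (l : Ix n k) : Q.rho (d1 p n k (bw p l)) = 0 := by
  have hp := (Fact.out : p.Prime).two_le
  have h1 : ∀ m ∈ Finset.Ioo 0 p,
      Q.rho (d1 p n k (lt p (Finsupp.single l m) * lt p (Finsupp.single l (p - m)))) =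
      (if m = 1 then Q.rho (x1 p n k l.1 l.2) * Q.op l (p - 1) else 0) -
        if m = p - 1 then Q.op l (p - 1) * Q.rho (x1 p n k l.1 l.2) else 0 := by
    intro m hm
    rw [Finset.mem_Ioo] at hm
    rw [d1_lt_mul l hm.1.ne' hm.2, d1_lt l (by omega : p - m ≠ 0) (by omega), map_sub, map_mul,
      map_mul, rho_delc_one Q hkn, rho_delc_one Q hkn, rho_single Q l hm.1.ne' hm.2,
      rho_single Q l (by omega) (by omega)]
    congr 1
    · split_ifs with h
      · rw [h]
      · rw [zero_mul]
    · by_cases h : m = p - 1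
      · rw [if_pos h, if_pos (by omega), h]
      · rw [if_neg h, if_neg (by omega), mul_zero]
  rw [bw, map_neg, map_neg, map_sum, map_sum, Finset.sum_congr rfl h1, Finset.sum_sub_distrib,
    Finset.sum_ite_eq', Finset.sum_ite_eq', if_pos (Finset.mem_Ioo.2 ⟨one_pos, by omega⟩),
    if_pos (Finset.mem_Ioo.2 ⟨by omega, by omega⟩), (rho_x1_commute Q l (p - 1)).eq, sub_self,
    neg_zero]

end Generators

end

/-! ### The May filtration of the generators below and above `s_0` -/

section

section Numerics

variable {p n k : ℕ} [Fact p.Prime] [NeZero n] [NeZero k]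

lemma le_s0 : n + k - 1 ≤ s0 p n k := le_max_right _ _

lemma two_mul_le_mayM (s : ℕ) : 2 * s - 1 ≤ mayM p n k s := by
  rw [mayM]; split_ifs
  · exact le_max_left _ _
  · exact le_rfl

lemma le_s0_iff {i : ℕ} (hi : n + k ≤ i) :
    i ≤ s0 p n k ↔ 2 * p * i + 2 ≤ 2 * p * n + p + 2 * i := by
  have hk := NeZero.pos k
  obtain ⟨q, rfl⟩ : ∃ q, p = q + 2 := ⟨p - 2, by have := (Fact.out : p.Prime).two_le; omega⟩
  rw [s0, le_max_iff, or_iff_left (by omega), Nat.le_div_iff_mul_le (by omega),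
    show q + 2 - 1 = q + 1 by omega]
  constructor
  · intro h
    have : i * (2 * (q + 1)) + 2 ≤ 2 * (q + 2) * n + (q + 2) := by omega
    nlinarith
  · intro h
    refine Nat.le_sub_of_add_le ?_
    nlinarith

/-- Above `s_0` the filtration of `t_i` is that of `b_{i-n}` plus one. -/
lemma mayM_of_s0_lt {i : ℕ} (hi : s0 p n k < i) :
    n + k ≤ i ∧ p * mayM p n k (i - n) + 1 = mayM p n k i ∧ 2 * i - 1 < mayM p n k i := by
  have hk := NeZero.pos k
  have h1 : n + k ≤ i := by have := le_s0 (p := p) (n := n) (k := k); omega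
  have h2 := (le_s0_iff (p := p) h1).not.1 hi.not_ge
  have h3 := two_mul_le_mayM (p := p) (n := n) (k := k) (i - n)
  have h4 : 2 * i - 1 < p * mayM p n k (i - n) + 1 := by
    obtain ⟨a, rfl⟩ : ∃ a, i = n + 1 + a := ⟨i - n - 1, by omega⟩
    rw [show n + 1 + a - n = a + 1 by omega] at h3 ⊢
    have h5 : p * (2 * a + 1) ≤ p * mayM p n k (a + 1) := Nat.mul_le_mul_left _ (by omega)
    have : 2 * (n + 1 + a) ≤ p * mayM p n k (a + 1) + 1 := by nlinarith
    omega
  have h5 := mayM_of_le p n k h1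
  rw [max_eq_right h4.le] at h5
  exact ⟨h1, h5.symm, by omega⟩

/-- Up to `s_0` the maximum in the recursion of `M(t_i)` is attained by its first term. -/
lemma mayM_of_le_s0 {i : ℕ} (hi : i ≤ s0 p n k) :
    mayM p n k i = 2 * i - 1 := by
  have hn := NeZero.pos n
  have hk := NeZero.pos k
  induction i using Nat.strong_induction_on with
  | _ i ih =>
    by_cases h : n + k ≤ i
    · rw [mayM_of_le p n k h, ih (i - n) (by omega) (by omega), max_eq_left]
      have h2 := (le_s0_iff h).1 hi
      obtain ⟨a, rfl⟩ : ∃ a, i = n + 1 + a := ⟨i - n - 1, by omega⟩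
      rw [show 2 * (n + 1 + a - n) - 1 = 2 * a + 1 by omega]
      have : p * (2 * a + 1) + 2 ≤ 2 * (n + 1 + a) := by nlinarith
      omega
    · exact mayM_of_lt p n k (by omega)

/-- In the range of the reduced complex the class `b_{i-n}` contributes to `d_1(h_i)` only if `p = 2`
and `i = 2n`; for odd `p` this is excluded by parity. -/
lemma extra_iff (hkn : k ≤ n) {i : ℕ} (hi : i ≤ s0 p n k) :
    (n + k ≤ i ∧ p * mayM p n k (i - n) + 1 = mayM p n k i) ↔ p = 2 ∧ i = 2 * n := by
  have hp := (Fact.out : p.Prime)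
  have hn := NeZero.pos n
  have hk := NeZero.pos k
  rw [mayM_of_le_s0 hi, mayM_of_le_s0 (by omega : i - n ≤ s0 p n k)]
  constructor
  · rintro ⟨h1, h2⟩
    obtain ⟨a, rfl⟩ : ∃ a, i = n + 1 + a := ⟨i - n - 1, by omega⟩
    rw [show 2 * (n + 1 + a - n) - 1 = 2 * a + 1 by omega] at h2
    have h3 : p * (2 * a + 1) = 2 * (n + a) := by omega
    rcases hp.eq_two_or_odd' with rfl | h
    · exact ⟨rfl, by omega⟩
    · have := h.mul (odd_two_mul_add_one a)
      rw [h3] at this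
      exact absurd this (Nat.not_odd_iff_even.2 (even_two_mul _))
  · rintro ⟨rfl, rfl⟩
    exact ⟨by omega, by omega⟩

lemma s0_two (hkn : k ≤ n) : s0 2 n k = 2 * n := by
  have hk := NeZero.pos k
  rw [s0, show (2 * 2 * n + 2 - 2) / (2 * (2 - 1)) = 2 * n by omega]
  exact max_eq_left (by omega)

end Numerics

end

/-! ### The cohomology of the associated graded complex and its first differential -/

section

section LengthProjection

variable {R X Y : Type} [CommRing R]

variable (R X Y) in
open Classical in
/-- The projection of the Fock space onto the part of cohomological degree `s`, where `h_x` has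
degree `1` and `b_y` has degree `2`. -/
def lenProj (s : ℕ) : Module.End R (Fock R X Y) :=
  ∑ ab ∈ Finset.HasAntidiagonal.antidiagonal s,
    tmap R (GradedAlgebra.proj (fun i : ℕ => ⋀[R]^i (X →₀ R)) ab.1)
      ((MvPolynomial.basisMonomials Y R).constr R fun c =>
        if (c.sum fun _ m => 2 * m) = ab.2 then MvPolynomial.monomial c 1 else 0)

lemma lenProj_mon (s : ℕ) (L : List X) (c : Y →₀ ℕ) : lenProj R X Y s (mon R L c) =
    if L.length + (c.sum fun _ m => 2 * m) = s then mon R L c else 0 := by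
  classical
  have hL : (L.map (ex (R := R))).prod ∈ ⋀[R]^L.length (X →₀ R) := by
    induction L with
    | nil => simp
    | cons x L ih =>
      rw [List.map_cons, List.prod_cons, List.length_cons]
      change _ ∈ LinearMap.range (ExteriorAlgebra.ι R (M := X →₀ R)) ^ (L.length + 1)
      rw [pow_succ']
      exact Submodule.mul_mem_mul ⟨_, rfl⟩ ih
  have h1 : ∀ ab : ℕ × ℕ, tmap R (GradedAlgebra.proj (fun i : ℕ => ⋀[R]^i (X →₀ R)) ab.1)
      ((MvPolynomial.basisMonomials Y R).constr R fun c =>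
        if (c.sum fun _ m => 2 * m) = ab.2 then MvPolynomial.monomial c 1 else 0) (mon R L c) =
      if ab = (L.length, c.sum fun _ m => 2 * m) then mon R L c else 0 := by
    intro ab
    have h2 := (MvPolynomial.basisMonomials Y R).constr_basis R
      (fun c => if (c.sum fun _ m => 2 * m) = ab.2 then MvPolynomial.monomial c (1 : R) else 0) c
    rw [MvPolynomial.coe_basisMonomials] at h2
    rw [mon, tmap_tm, h2, GradedAlgebra.proj_apply]
    by_cases h3 : L.length = ab.1
    · rw [← h3, DirectSum.decompose_of_mem_same (fun i : ℕ => ⋀[R]^i (X →₀ R)) hL]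
      by_cases h4 : (c.sum fun _ m => 2 * m) = ab.2
      · rw [if_pos h4, if_pos (Prod.ext h3.symm h4.symm)]
      · rw [if_neg h4, if_neg (fun h => h4 (by rw [h])), tm_zero]
    · rw [DirectSum.decompose_of_mem_ne (fun i : ℕ => ⋀[R]^i (X →₀ R)) hL h3,
        if_neg (fun h => h3 (congrArg Prod.fst h).symm), zero_tm]
  rw [lenProj, LinearMap.sum_apply, Finset.sum_congr rfl fun ab _ => h1 ab, Finset.sum_ite_eq']
  simp only [Finset.HasAntidiagonal.mem_antidiagonal]

end LengthProjection

section Descent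

variable {p : ℕ} [Fact p.Prime] {I : Type} [DecidableEq I]

lemma lenProj_fspan {m : ℤ} (s : ℕ) {a : Fk p I} (ha : a ∈ fspan p (lenWt I) m) :
    lenProj _ I I s a = if m = s then a else 0 := by
  suffices fspan p (lenWt I) m ≤
      LinearMap.ker (lenProj _ I I s - (if m = s then LinearMap.id else 0)) by
    have := this ha
    rw [LinearMap.mem_ker, LinearMap.sub_apply, sub_eq_zero] at this
    rw [this]; split_ifs <;> rfl
  refine Submodule.span_le.2 ?_
  rintro _ ⟨L, c, rfl, -, rfl⟩
  have h : ((lenWt I).gen p).deg L c = (L.length + (c.sum fun _ m => 2 * m) : ℕ) := by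
    simp [GenWt.deg, WordWt.gen, lenWt, Finsupp.sum, mul_comm]
  change _ = _
  rw [LinearMap.sub_apply, lenProj_mon, h, sub_eq_zero]
  simp only [Nat.cast_inj]
  split_ifs <;> rfl

lemma vac_wproj_length (s : ℕ) (x : Om p I) :
    vac p I (wproj (fun l => (lenWt I).wdeg l = s) x) = lenProj _ I I s (vac p I x) := by
  suffices vac p I ∘ₗ wproj (fun l => (lenWt I).wdeg l = s) = lenProj _ I I s ∘ₗ vac p I from
    LinearMap.congr_fun this x
  refine word_hom_ext fun l => ?_
  rw [LinearMap.comp_apply, LinearMap.comp_apply, lenProj_fspan s (vac_word_mem (lenWt I) l)]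
  split_ifs with h
  · rw [wproj_word_pos h]
  · rw [wproj_word_neg h, map_zero]

lemma eq_sum_wproj (x : Om p I) : ∃ N : ℕ,
    x = ∑ s ∈ Finset.range N, wproj (fun l => (lenWt I).wdeg l = (s : ℕ)) x := by
  suffices ∃ N : ℕ, ∀ N' ≥ N,
      x = ∑ s ∈ Finset.range N', wproj (fun l => (lenWt I).wdeg l = (s : ℕ)) x from
    this.imp fun N h => h N le_rfl
  induction mem_wspan_true x using Submodule.span_induction with
  | mem x h =>
    obtain ⟨l, -, rfl⟩ := h
    refine ⟨l.length + 1, fun N' hN => ?_⟩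
    rw [Finset.sum_eq_single_of_mem l.length (Finset.mem_range.2 hN),
      wproj_word_pos (lenWt_wdeg l)]
    intro s _ hs
    refine wproj_word_neg fun h => hs ?_
    rw [lenWt_wdeg] at h
    exact_mod_cast h.symm
  | zero => exact ⟨0, fun N' _ => by simp⟩
  | add x y _ _ hx hy =>
    obtain ⟨N, h⟩ := hx
    obtain ⟨N₂, h₂⟩ := hy
    refine ⟨max N N₂, fun N' hN => ?_⟩
    simp only [map_add, Finset.sum_add_distrib]
    rw [← h N' (le_of_max_le_left hN), ← h₂ N' (le_of_max_le_right hN)]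
  | smul r x _ hx =>
    obtain ⟨N, h⟩ := hx
    refine ⟨N, fun N' hN => ?_⟩
    simp only [map_smul, ← Finset.smul_sum]
    rw [← h N' hN]

/-- The Fock space is the cohomology of the associated graded complex. -/
theorem d0_exact {x : Om p I} (hd : d0 p I x = 0) (hv : vac p I x = 0) : ∃ y, d0 p I y = x := by
  have h : ∀ s : ℕ, ∃ y, d0 p I y = wproj (fun l => (lenWt I).wdeg l = (s : ℕ)) x := by
    intro s
    have h1 : d0 p I (wproj (fun l => (lenWt I).wdeg l = (s : ℕ)) x) = 0 := by
      rw [← wproj_comm (deg := fun l : List (Letter p I) => (lenWt I).wdeg l)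
        (φ := fun g => (lenWt I).ℓ + g) (add_right_injective _) (d0_word_mem _), hd, map_zero]
    obtain ⟨y, -, hy⟩ := d0_exact_of_length s (wproj_mem _ x) h1
      (by rw [vac_wproj_length, hv, map_zero])
    exact ⟨y, hy⟩
  choose y hy using h
  obtain ⟨N, hN⟩ := eq_sum_wproj x
  refine ⟨∑ s ∈ Finset.range N, y s, ?_⟩
  rw [map_sum]
  exact (Finset.sum_congr rfl fun s _ => hy s).trans hN.symm

variable (p I) in
/-- Representing cocycles can be chosen linearly. -/
lemma exists_cocycle_section : ∃ f : Fk p I →ₗ[ZMod p] LinearMap.ker (d0 p I),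
    (vac p I ∘ₗ (LinearMap.ker (d0 p I)).subtype) ∘ₗ f = LinearMap.id := by
  refine LinearMap.exists_rightInverse_of_surjective _ (LinearMap.range_eq_top.2 fun a => ?_)
  suffices (⊤ : Submodule (ZMod p) (Fk p I)) ≤
      LinearMap.range (vac p I ∘ₗ (LinearMap.ker (d0 p I)).subtype) from this trivial
  rw [← span_mon]
  refine Submodule.span_le.2 ?_
  rintro _ ⟨L, c, rfl⟩
  obtain ⟨z, -, h, h'⟩ := exists_vac_eq (p := p) (lenWt I)
    (mon_mem_gspan (D := (lenWt I).gen p) (W := ⟨0, 0⟩) (w := 0) (L := L) (c := c) rfl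
      (by rw [zero_deg]))
  exact ⟨⟨z, h⟩, h'⟩

/-- A map that vanishes on coboundaries, as a map out of the cohomology. -/
def descend {N : Type} [AddCommGroup N] [Module (ZMod p) N] (F : Om p I →ₗ[ZMod p] N) :
    Fk p I →ₗ[ZMod p] N :=
  F ∘ₗ (LinearMap.ker (d0 p I)).subtype ∘ₗ (exists_cocycle_section p I).choose

lemma descend_vac {N : Type} [AddCommGroup N] [Module (ZMod p) N] {F : Om p I →ₗ[ZMod p] N}
    (hF : ∀ y, F (d0 p I y) = 0) {z : Om p I} (hz : d0 p I z = 0) :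
    descend F (vac p I z) = F z := by
  have h := LinearMap.congr_fun (exists_cocycle_section p I).choose_spec (vac p I z)
  have h' := ((exists_cocycle_section p I).choose (vac p I z)).2
  rw [LinearMap.mem_ker] at h'
  change F ((exists_cocycle_section p I).choose (vac p I z) : Om p I) = F z
  change vac p I ((exists_cocycle_section p I).choose (vac p I z) : Om p I) = vac p I z at h
  generalize (((exists_cocycle_section p I).choose (vac p I z)) : Om p I) = y at h h'
  obtain ⟨w, hw⟩ := d0_exact (x := y - z) (by rw [map_sub, h', hz, sub_zero])
    (by rw [map_sub, h, sub_self])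
  rw [← sub_eq_zero, ← map_sub, ← hw, hF]

lemma exists_cocycle (a : Fk p I) : ∃ z, d0 p I z = 0 ∧ vac p I z = a :=
  ⟨_, ((exists_cocycle_section p I).choose a).2,
    LinearMap.congr_fun (exists_cocycle_section p I).choose_spec a⟩

lemma d0_exact_of_wdeg {G : Type} [AddCommGroup G] (D : WordWt I G) {γ : G} {x : Om p I}
    (hx : x ∈ wspan _ fun l => D.wdeg l = γ) (hd : d0 p I x = 0) (hv : vac p I x = 0) :
    ∃ y ∈ wspan (ZMod p) fun l : List (Letter p I) => D.wdeg l = γ - D.ℓ, d0 p I y = x := by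
  obtain ⟨y, rfl⟩ := d0_exact hd hv
  exact d0_project D y hx

lemma d0_lt_one_mul (l : I) (z : Om p I) (hz : d0 p I z = 0) :
    d0 p I (lt p (Finsupp.single l 1) * z) = 0 := by
  rw [d0_lt_mul, hz, d0_lt (trunc_single.2 (Fact.out : p.Prime).one_lt),
    Finsupp.antidiagonal_single, Finset.sum_map]
  simp [Finset.Nat.antidiagonal_succ]

lemma d0_bw_mul_eq_zero (l : I) (z : Om p I) (hz : d0 p I z = 0) : d0 p I (bw p l * z) = 0 := by
  rw [d0_bw_mul, hz, mul_zero]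

lemma vac_lt_one_mul (l : I) (z : Om p I) :
    vac p I (lt p (Finsupp.single l 1) * z) = (fockOps p I).op l 1 (vac p I z) := by
  rw [vac_lt_mul (trunc_single.2 (Fact.out : p.Prime).one_lt), AntiOps.tau_single _ _ one_ne_zero]

lemma op_one_apply (l : I) {a : Fk p I} (h : dop _ l a = 0) :
    (fockOps p I).op l 1 a = hop _ l a := by
  rw [AntiOps.op, if_pos rfl, LinearMap.sub_apply]
  have : (if 1 = p - 1 then (fockOps p I).C l else 0) a = 0 := by
    split_ifs
    · change bop _ l (dop _ l a) = 0
      rw [h, map_zero]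
    · rfl
  rw [this, sub_zero]; rfl

lemma op_one_mon (l : I) {L : List I} (hl : l ∉ L) (c : I →₀ ℕ) :
    (fockOps p I).op l 1 (mon _ L c) = mon _ (l :: L) c := by
  rw [op_one_apply l (dop_mon_of_not_mem l L c hl), hop_mon]

/-- Induction over the monomials without repeated exterior factors. -/
lemma mon_induction {X Y : Type} {P : List X → (Y →₀ ℕ) → Prop} (h0 : P [] 0)
    (hb : ∀ c y, P [] c → P [] (c + Finsupp.single y 1))
    (hh : ∀ l L c, l ∉ L → L.Nodup → P L c → P (l :: L) c) (L : List X)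
    (c : Y →₀ ℕ) (hL : L.Nodup) : P L c := by
  induction L with
  | nil =>
    induction c using Finsupp.induction with
    | zero => exact h0
    | single_add y m c _ _ ih =>
      rw [add_comm]
      rename_i hm
      clear hL hm
      induction m with
      | zero => simpa using ih
      | succ m ihm => rw [Finsupp.single_add, ← add_assoc]; exact hb _ _ ihm
  | cons l L ih =>
    rw [List.nodup_cons] at hL
    exact hh l L c hL.1 hL.2 (ih hL.2)

end Descent

section FirstDifferential

variable {p n k : ℕ} [Fact p.Prime] [NeZero n] [NeZero k]

variable (p n k) in
/-- The first May differential, on the cohomology of the associated graded complex. -/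
def dA : Module.End (ZMod p) (Fk p (Ix n k)) := descend (vac p (Ix n k) ∘ₗ d1 p n k)

variable (hkn : k ≤ n)
include hkn

lemma dA_vac {z : Om p (Ix n k)} (hz : d0 p (Ix n k) z = 0) :
    dA p n k (vac p _ z) = vac p _ (d1 p n k z) := by
  refine descend_vac (fun y => ?_) hz
  rw [LinearMap.comp_apply, eq_neg_of_add_eq_zero_right (dw_components hkn y).1, map_neg, vac_d0,
    neg_zero]

lemma d0_d1 {z : Om p (Ix n k)} (hz : d0 p (Ix n k) z = 0) : d0 p _ (d1 p n k z) = 0 := by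
  have := (dw_components hkn z).1
  rwa [hz, map_zero, add_zero] at this

lemma dA_dA (a : Fk p (Ix n k)) : dA p n k (dA p n k a) = 0 := by
  obtain ⟨z, hz, rfl⟩ := exists_cocycle a
  have := (dw_components hkn z).2
  rw [hz, map_zero, add_zero] at this
  rw [dA_vac hkn hz, dA_vac hkn (d0_d1 hkn hz), eq_neg_of_add_eq_zero_right this, map_neg, vac_d0,
    neg_zero]

lemma dA_mem {γ : ℤ × Deg p n × ℤ} {a : Fk p (Ix n k)} (ha : a ∈ fspan p (triWt p n k) γ) :
    dA p n k a ∈ fspan p (triWt p n k) (γ + (1, 0, -1)) := by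
  obtain ⟨z, h1, h2, rfl⟩ := exists_vac_eq _ ha
  rw [dA_vac hkn h2]
  exact vac_mem _ (d1_mem h1)

lemma dA_one : dA p n k 1 = 0 := by
  rw [← vac_one, dA_vac hkn (by simp [d0]), d1, der_one, map_zero]

lemma d1_lt_one_mul (l : Ix n k) (z : Om p (Ix n k)) :
    d1 p n k (lt p (Finsupp.single l 1) * z) =
      x1 p n k l.1 l.2 * z - lt p (Finsupp.single l 1) * d1 p n k z := by
  rw [d1_lt_mul l one_ne_zero (Fact.out : p.Prime).one_lt, delc_one_single hkn]

lemma d1_bw_mul (l : Ix n k) (z : Om p (Ix n k)) :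
    d1 p n k (bw p l * z) = d1 p n k (bw p l) * z + bw p l * d1 p n k z := by
  have h : bw p l ∈ wspan (ZMod p) fun l : List (Letter p (Ix n k)) => l.length = 2 :=
    neg_mem (sum_mem fun _ _ => lt_mul_mem _ _)
  rw [d1, der_mul_of_length _ h]; simp

lemma dA_op (l : Ix n k) (a : Fk p (Ix n k)) : dA p n k ((fockOps p _).op l 1 a) =
    (fockOps p _).rho (x1 p n k l.1 l.2) a - (fockOps p _).op l 1 (dA p n k a) := by
  obtain ⟨z, hz, rfl⟩ := exists_cocycle a
  rw [← vac_lt_one_mul, dA_vac hkn (d0_lt_one_mul l z hz), dA_vac hkn hz, d1_lt_one_mul hkn,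
    map_sub, vac_mul, vac_lt_one_mul]

lemma dA_bop (l : Ix n k) (a : Fk p (Ix n k)) :
    dA p n k (bop _ l a) = bop _ l (dA p n k a) := by
  obtain ⟨z, hz, rfl⟩ := exists_cocycle a
  rw [← vac_bw_mul, dA_vac hkn (d0_bw_mul_eq_zero l z hz), dA_vac hkn hz, d1_bw_mul hkn, map_add,
    vac_mul, rho_d1_bw _ hkn, LinearMap.zero_apply, zero_add, vac_bw_mul]

lemma dA_mon_nil (c : Ix n k →₀ ℕ) : dA p n k (mon _ [] c) = 0 := by
  refine mon_induction (P := fun L c => L = [] → dA p n k (mon _ L c) = 0) (fun _ => ?_)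
    (fun c y h _ => ?_) (fun l L c _ _ _ h => ?_) [] c List.nodup_nil rfl
  · rw [← one_eq_mon, dA_one hkn]
  · rw [← bop_mon, dA_bop hkn, h rfl, map_zero]
  · simp at h

end FirstDifferential

end

/-! ### Reductions of the first term of the May spectral sequence -/

section

section Action

variable {p : ℕ} [Fact p.Prime] {I : Type} [DecidableEq I] {A : Type} [Ring A] [Algebra (ZMod p) A]
  (Q : AntiOps p I (Module.End (ZMod p) A))

/-- The map to `A` that is induced on cohomology by an action of the cobar construction on `A`. -/
def piA : Fk p I →ₗ[ZMod p] A :=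
  descend (LinearMap.applyₗ (1 : A) ∘ₗ Q.rho.toLinearMap)

lemma piA_vac {z : Om p I} (hz : d0 p I z = 0) : piA Q (vac p I z) = Q.rho z 1 := by
  refine descend_vac (fun y => ?_) hz
  change Q.rho (d0 p I y) 1 = 0
  rw [Q.rho_d0]; rfl

lemma piA_rho {w : Om p I} (hw : ∀ z, d0 p I z = 0 → d0 p I (w * z) = 0) (a : Fk p I) :
    piA Q ((fockOps p I).rho w a) = Q.rho w (piA Q a) := by
  obtain ⟨z, hz, rfl⟩ := exists_cocycle a
  rw [← vac_mul, piA_vac Q (hw z hz), map_mul, piA_vac Q hz]; rfl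

lemma rho_lt_one (l : I) : Q.rho (lt p (Finsupp.single l 1)) = Q.op l 1 := by
  rw [Q.rho_lt (trunc_single.2 (Fact.out : p.Prime).one_lt), Q.tau_single l one_ne_zero]

lemma piA_op (l : I) (a : Fk p I) :
    piA Q ((fockOps p I).op l 1 a) = Q.op l 1 (piA Q a) := by
  rw [← rho_lt_one, piA_rho Q (d0_lt_one_mul l), rho_lt_one]

lemma piA_bop (l : I) (a : Fk p I) : piA Q (bop _ l a) = Q.rho (bw p l) (piA Q a) := by
  rw [← fock_rho_bw, piA_rho Q (d0_bw_mul_eq_zero l)]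

lemma piA_one : piA Q 1 = 1 := by
  rw [← vac_one, piA_vac Q (by simp [d0]), map_one Q.rho, Module.End.one_apply]

/-- If the generators act by left multiplications, then so does every cocycle. -/
lemma rho_eq_mulLeft {h b : I → A} (hh : ∀ l, Q.op l 1 = LinearMap.mulLeft _ (h l))
    (hb : ∀ l, Q.rho (bw p l) = LinearMap.mulLeft _ (b l)) {z : Om p I} (hz : d0 p I z = 0) :
    Q.rho z = LinearMap.mulLeft _ (Q.rho z 1) := by
  -- the difference of the two sides vanishes on coboundaries; so it suffices to consider the
  -- representatives of the monomials, on which it is multiplicative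
  let F : Om p I →ₗ[ZMod p] Module.End (ZMod p) A := Q.rho.toLinearMap -
    LinearMap.mul (ZMod p) A ∘ₗ LinearMap.applyₗ (1 : A) ∘ₗ Q.rho.toLinearMap
  have hF : ∀ z, F z = Q.rho z - LinearMap.mulLeft _ (Q.rho z 1) := fun z => rfl
  have hF0 : ∀ y, F (d0 p I y) = 0 := fun y => by
    rw [hF, Q.rho_d0, LinearMap.zero_apply, LinearMap.mulLeft_zero_eq_zero, sub_zero]
  have hstep : ∀ (w z : Om p I) (x : A), Q.rho w = LinearMap.mulLeft _ x →
      F (w * z) = LinearMap.mulLeft _ x * F z := by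
    intro w z x hw
    rw [hF, hF, map_mul, hw, mul_sub]
    congr 1
    rw [Module.End.mul_apply, LinearMap.mulLeft_apply, LinearMap.mulLeft_mul]; rfl
  rw [← sub_eq_zero, ← hF, ← descend_vac hF0 hz]
  suffices descend F = 0 by rw [this]; rfl
  refine fock_hom_ext (mon_induction ?_ (fun c y ih => ?_) fun l L c hl _ ih => ?_)
  · rw [← one_eq_mon, ← vac_one, descend_vac hF0 (by simp [d0]), hF, map_one]
    change (1 : Module.End (ZMod p) A) - LinearMap.mulLeft _ 1 = 0
    rw [LinearMap.mulLeft_one]; exact sub_self _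
  · rw [← bop_mon]
    obtain ⟨z, hz, hz'⟩ := exists_cocycle (mon (ZMod p) ([] : List I) c)
    rw [← hz', descend_vac hF0 hz] at ih
    rw [← hz', ← vac_bw_mul, descend_vac hF0 (d0_bw_mul_eq_zero y z hz), hstep _ _ _ (hb y), ih]
    exact mul_zero _
  · rw [← op_one_mon l hl]
    obtain ⟨z, hz, hz'⟩ := exists_cocycle (mon (ZMod p) L c)
    rw [← hz', descend_vac hF0 hz] at ih
    rw [← hz', ← vac_lt_one_mul, descend_vac hF0 (d0_lt_one_mul l z hz),
      hstep _ _ _ ((rho_lt_one Q l).trans (hh l)), ih]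
    exact mul_zero _

end Action

variable {p n k : ℕ} [Fact p.Prime] [NeZero n] [NeZero k]

lemma d0_hW_mul (i : ℕ) (j : ZMod n) {z : Om p (Ix n k)} (hz : d0 p _ z = 0) :
    d0 p _ (hW p n k i j * z) = 0 := by
  rw [hW]; split_ifs
  · exact d0_lt_one_mul _ z hz
  · rw [zero_mul, map_zero]

lemma d0_bW_mul (i : ℕ) (j : ZMod n) {z : Om p (Ix n k)} (hz : d0 p _ z = 0) :
    d0 p _ (bW p n k i j * z) = 0 := by
  rw [bW]; split_ifs
  · exact d0_bw_mul_eq_zero _ z hz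
  · rw [zero_mul, map_zero]

lemma d0_x1_mul (i : ℕ) (j : ZMod n) {z : Om p (Ix n k)} (hz : d0 p _ z = 0) :
    d0 p _ (x1 p n k i j * z) = 0 := by
  rw [x1, add_mul, neg_mul, Finset.sum_mul, map_add, map_neg, map_sum, Finset.sum_eq_zero,
    neg_zero, zero_add]
  · split_ifs
    · exact d0_bW_mul _ _ hz
    · rw [zero_mul, map_zero]
  · intro a _
    split_ifs
    · rw [mul_assoc]; exact d0_hW_mul _ _ (d0_hW_mul _ _ hz)
    · rw [zero_mul, map_zero]

/-- The monomials that survive in the reduced complex. -/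
def Good (p n k : ℕ) (L : List (Ix n k)) (c : Ix n k →₀ ℕ) : Prop :=
  (∀ l ∈ L, (l.1 : ℕ) ≤ s0 p n k) ∧ ∀ y, c y ≠ 0 → (y.1 : ℕ) + n ≤ s0 p n k

variable (p n k) in
/-- An algebra `A` with generators `h_{i,j}` for `k ≤ i ≤ s_0` and `b_{i,j}` for `k ≤ i ≤ s_0 - n`,
on which the cobar construction acts through the multiplications by the generators, such that the
monomials in the generators that survive form a basis. -/
structure Target (A : Type) [Ring A] [Algebra (ZMod p) A] where
  /-- the generators `h_{i,j}` -/
  h : ℕ → ZMod n → A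
  /-- the generators `b_{i,j}` -/
  b : ℕ → ZMod n → A
  /-- the action of the cobar construction -/
  Q : AntiOps p (Ix n k) (Module.End (ZMod p) A)
  op_eq : ∀ l : Ix n k, Q.op l 1 = LinearMap.mulLeft _ (h l.1 l.2)
  rho_bw : ∀ l : Ix n k, Q.rho (bw p l) = LinearMap.mulLeft _ (b l.1 l.2)
  h_lt : ∀ {i}, i < k → ∀ j, h i j = 0
  b_lt : ∀ {i}, i < k → ∀ j, b i j = 0
  h_gt : ∀ {i}, s0 p n k < i → ∀ j, h i j = 0
  b_gt : ∀ {i}, s0 p n k < i + n → ∀ j, b i j = 0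
  b_two : p = 2 → ∀ i j, b i j = h i j ^ 2
  /-- the section that sends monomials to monomials -/
  lift : A →ₗ[ZMod p] Fk p (Ix n k)
  piA_lift : ∀ a, piA Q (lift a) = a
  mon_mem : ∀ L c, L.Nodup → Good p n k L c → mon _ L c ∈ LinearMap.range lift

namespace Target

variable {A : Type} [Ring A] [Algebra (ZMod p) A] (T : Target p n k A)

/-- The reduction map. -/
abbrev pi : Fk p (Ix n k) →ₗ[ZMod p] A := piA T.Q

lemma pi_op (l : Ix n k) (a : Fk p (Ix n k)) :
    T.pi ((fockOps p _).op l 1 a) = T.h l.1 l.2 * T.pi a := by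
  rw [pi, piA_op, T.op_eq, LinearMap.mulLeft_apply]

lemma pi_bop (l : Ix n k) (a : Fk p (Ix n k)) : T.pi (bop _ l a) = T.b l.1 l.2 * T.pi a := by
  rw [pi, piA_bop, T.rho_bw, LinearMap.mulLeft_apply]

lemma rho_hW (i : ℕ) (j : ZMod n) : T.Q.rho (hW p n k i j) = LinearMap.mulLeft _ (T.h i j) := by
  rw [hW]; split_ifs with h
  · rw [rho_lt_one, T.op_eq]
  · rw [map_zero, T.h_lt (by omega), LinearMap.mulLeft_zero_eq_zero]

lemma rho_bW (i : ℕ) (j : ZMod n) : T.Q.rho (bW p n k i j) = LinearMap.mulLeft _ (T.b i j) := by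
  rw [bW]; split_ifs with h
  · rw [T.rho_bw]
  · rw [map_zero, T.b_lt (by omega), LinearMap.mulLeft_zero_eq_zero]

lemma pi_vac_mul {z z' : Om p (Ix n k)} (hz : d0 p _ z = 0) (hz' : d0 p _ z' = 0)
    (h : d0 p _ (z * z') = 0) : T.pi (vac p _ (z * z')) = T.pi (vac p _ z) * T.pi (vac p _ z') := by
  rw [pi, piA_vac _ hz, piA_vac _ hz', piA_vac _ h, map_mul, Module.End.mul_apply,
    rho_eq_mulLeft T.Q T.op_eq T.rho_bw hz, LinearMap.mulLeft_apply, LinearMap.mulLeft_apply,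
    mul_one]

/-- The formula for the first differential of `h_{i,j}` vanishes in `A` if `i > s_0`. -/
lemma rho_x1_of_s0_lt {i : ℕ} (hi : s0 p n k < i) (j : ZMod n) :
    T.Q.rho (x1 p n k i j) = 0 := by
  have hk := NeZero.pos k
  obtain ⟨h1, h2, h3⟩ := mayM_of_s0_lt hi
  rw [x1, map_add, map_neg, map_sum, if_pos ⟨h1, h2⟩, T.rho_bW, T.b_gt (by omega),
    LinearMap.mulLeft_zero_eq_zero, add_zero, Finset.sum_eq_zero, neg_zero]
  intro a ha
  rw [Finset.mem_Icc] at ha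
  split_ifs with h
  · rw [map_mul, T.rho_hW, T.rho_hW]
    by_cases ha0 : s0 p n k < a
    · rw [T.h_gt ha0, LinearMap.mulLeft_zero_eq_zero]; exact zero_mul _
    by_cases hb0 : s0 p n k < i - a
    · rw [T.h_gt hb0, LinearMap.mulLeft_zero_eq_zero]; exact mul_zero _
    rw [mayM_of_le_s0 (not_lt.1 ha0), mayM_of_le_s0 (not_lt.1 hb0)] at h
    omega
  · rw [map_zero]

variable (hkn : k ≤ n)
include hkn

lemma pi_dA_op (l : Ix n k) (a : Fk p (Ix n k)) : T.pi (dA p n k ((fockOps p _).op l 1 a)) =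
    T.Q.rho (x1 p n k l.1 l.2) (T.pi a) - T.h l.1 l.2 * T.pi (dA p n k a) := by
  rw [dA_op hkn, map_sub, T.pi_op, pi, piA_rho T.Q fun z hz => d0_x1_mul _ _ hz]

/-- The monomials that contain one of the missing generators are in the kernel of the reduction, as
are their differentials. -/
lemma pi_bad (L : List (Ix n k)) (c : Ix n k →₀ ℕ) (hL : L.Nodup) (hg : ¬ Good p n k L c) :
    T.pi (mon _ L c) = 0 ∧ T.pi (dA p n k (mon _ L c)) = 0 := by
  refine mon_induction (P := fun L c => ¬ Good p n k L c →
    T.pi (mon _ L c) = 0 ∧ T.pi (dA p n k (mon _ L c)) = 0) (fun h => ?_) (fun c y ih h => ?_)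
    (fun l L c hl _ ih h => ?_) L c hL hg
  · exact absurd ⟨by simp, by simp⟩ h
  · rw [← bop_mon, dA_bop hkn, T.pi_bop, T.pi_bop]
    by_cases hy : s0 p n k < y.1 + n
    · rw [T.b_gt hy, zero_mul, zero_mul]; exact ⟨rfl, rfl⟩
    · obtain ⟨h1, h2⟩ := ih fun h' => h ⟨by simp, fun y' hy' => by
        by_cases he : y' = y
        · rw [he]; exact not_lt.1 hy
        · exact h'.2 y' (by simpa [Finsupp.single_apply, Ne.symm he] using hy')⟩
      rw [h1, h2, mul_zero]; exact ⟨rfl, rfl⟩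
  · rw [← op_one_mon l hl, T.pi_op, T.pi_dA_op hkn]
    by_cases hy : s0 p n k < l.1
    · rw [T.h_gt hy, zero_mul, zero_mul, T.rho_x1_of_s0_lt hy]; exact ⟨rfl, sub_zero _⟩
    · obtain ⟨h1, h2⟩ := ih fun h' => h ⟨by
        intro l' hl'
        rcases List.mem_cons.1 hl' with rfl | hl'
        · exact not_lt.1 hy
        · exact h'.1 l' hl', h'.2⟩
      rw [h1, h2, mul_zero, map_zero]; exact ⟨rfl, sub_zero _⟩

open Classical in
lemma lift_pi_mon (L : List (Ix n k)) (c : Ix n k →₀ ℕ) (hL : L.Nodup) :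
    T.lift (T.pi (mon _ L c)) = if Good p n k L c then mon _ L c else 0 := by
  split_ifs with h
  · obtain ⟨a, ha⟩ := T.mon_mem L c hL h
    rw [← ha, pi, T.piA_lift]
  · rw [(T.pi_bad hkn L c hL h).1, map_zero]

omit hkn in
/-- The differential of the reduced complex. -/
def d : A →ₗ[ZMod p] A := T.pi ∘ₗ dA p n k ∘ₗ T.lift

lemma d_pi (a : Fk p (Ix n k)) : T.d (T.pi a) = T.pi (dA p n k a) := by
  suffices T.d ∘ₗ T.pi = T.pi ∘ₗ dA p n k from LinearMap.congr_fun this a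
  refine fock_hom_ext fun L c hL => ?_
  change T.pi (dA p n k (T.lift (T.pi _))) = T.pi (dA p n k _)
  rw [T.lift_pi_mon hkn L c hL]
  split_ifs with h
  · rfl
  · rw [(T.pi_bad hkn L c hL h).2, map_zero, map_zero]

end Target

end

/-! ### Acyclicity of the kernel of the reduction -/

section

section Generic

variable {B : Type*} [Ring B]

/-- The contraction of `E[h] ⊗ P[b]` with the differential `h ↦ b`, where `d` is the derivative by `h`
and `v` the division by `b`. -/
lemma homotopy_identity {b d v h : B} (hvb : v * b = 1) (hdh : d * h = 1 - h * d)
    (h1 : Commute h b) (h2 : Commute d v) :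
    (b * d) * (v * h) + (v * h) * (b * d) = 1 - (1 - b * v) * (d * h) := by
  have e1 : (b * d) * (v * h) = b * v * (d * h) := by
    rw [mul_assoc, ← mul_assoc d, h2.eq]; simp only [mul_assoc]
  have e2 : (v * h) * (b * d) = h * d := by
    rw [mul_assoc, ← mul_assoc h, h1.eq, mul_assoc b, ← mul_assoc v, hvb, one_mul]
  rw [e1, e2, sub_mul, one_mul, hdh]
  abel

end Generic

variable {p n k : ℕ} [Fact p.Prime] [NeZero n] [NeZero k]

variable (p n k) in
/-- The auxiliary weight: `h_i` and the classes `b_{i-n}` that are not generators of the reduced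
complex have weight `2i-1`.  So the products `h_r h_{i-r}` in `d_1(h_i)` have weight `2i-2`, and for
`i > s_0` the term `b_{i-n}` is the only one of weight `2i-1`. -/
def auxWt : GenWt (Ix n k) (Ix n k) ℤ where
  h l := 2 * (l.1 : ℕ) - 1
  b l := if s0 p n k < l.1 + n then 2 * ((l.1 : ℕ) + n) - 1 else 0

variable (p n k) in
/-- The part of tridegree `γ` and auxiliary weight at most `w`. -/
abbrev WS (γ : ℤ × Deg p n × ℤ) (w : ℤ) : Submodule (ZMod p) (Fk p (Ix n k)) :=
  gspan (ZMod p) ((triWt p n k).gen p) (auxWt p n k) γ w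

lemma gen_h (l : Ix n k) :
    ((triWt p n k).gen p).h l = (1, hDeg p n l.1 l.2, (mayM p n k l.1 : ℤ)) := by
  simp [WordWt.gen, triWt]

lemma gen_b (l : Ix n k) : ((triWt p n k).gen p).b l =
    (2, p • hDeg p n l.1 l.2, ((p * mayM p n k l.1 : ℕ) : ℤ)) := by
  simp [WordWt.gen, triWt]

/-- The index of the class `b_{i-n,j+n-1}` that occurs in `d_1(h_{i,j})`, for `i ≥ n + k`. -/
def prev (l : Ix n k) : Ix n k :=
  if h : k ≤ l.1 - n then (⟨l.1 - n, h⟩, l.2 + ((n - 1 : ℕ) : ZMod n)) else l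

/-- The index is that of a class `h_{i,j}` with `i > s_0`. -/
def Bad (p : ℕ) (l : Ix n k) : Prop := s0 p n k < l.1

section Prev

variable {l : Ix n k}

lemma bad_le (hl : Bad p l) : n + k ≤ l.1 := by
  have := le_s0 (p := p) (n := n) (k := k)
  have := NeZero.pos k
  rw [Bad] at hl; omega

lemma prev_eq (h : n + k ≤ l.1) : prev l =
    (⟨l.1 - n, Nat.le_sub_of_add_le' h⟩, l.2 + ((n - 1 : ℕ) : ZMod n)) := dif_pos _

lemma bW_prev (h : n + k ≤ l.1) :
    bW p n k (l.1 - n) (l.2 + ((n - 1 : ℕ) : ZMod n)) = bw p (prev l) := by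
  rw [bW, dif_pos (Nat.le_sub_of_add_le' h), prev_eq h]

lemma prev_fst_add (h : n + k ≤ l.1) : ((prev l).1 : ℕ) + n = l.1 := by
  rw [prev_eq h]; exact Nat.sub_add_cancel (by omega)

lemma prev_inj {l' : Ix n k} (hl : Bad p l) (hl' : Bad p l') (h : prev l = prev l') : l = l' := by
  have h1 := prev_fst_add (bad_le hl)
  rw [h, prev_fst_add (bad_le hl')] at h1
  rw [prev_eq (bad_le hl), prev_eq (bad_le hl'), Prod.mk.injEq] at h
  exact Prod.ext (Subtype.ext h1.symm) (add_right_cancel h.2)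

lemma auxWt_prev (hl : Bad p l) : (auxWt p n k).b (prev l) = (auxWt p n k).h l := by
  have h1 := prev_fst_add (bad_le hl)
  change (if s0 p n k < (prev l).1 + n then 2 * (((prev l).1 : ℕ) + (n : ℤ)) - 1 else 0) =
    2 * ((l.1 : ℕ) : ℤ) - 1
  rw [if_pos (h1.symm ▸ hl), ← Nat.cast_add, h1]

lemma gen_prev (hl : n + k ≤ l.1 ∧ p * mayM p n k (l.1 - n) + 1 = mayM p n k l.1) :
    ((triWt p n k).gen p).b (prev l) = ((triWt p n k).gen p).h l + (1, 0, -1) := by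
  rw [gen_b, gen_h, prev_eq hl.1, hDeg_prev' p (by omega)]
  refine Prod.ext rfl (Prod.ext (add_zero _).symm ?_)
  change ((p * mayM p n k (l.1 - n) : ℕ) : ℤ) = (mayM p n k l.1 : ℤ) + -1
  rw [← hl.2]
  push_cast
  ring

/-- Every polynomial generator that is killed by the reduction is of the form `prev l`. -/
lemma exists_prev {y : Ix n k} (hy : s0 p n k < y.1 + n) : ∃ l, Bad p l ∧ prev l = y := by
  have hk := y.1.2
  have hn := NeZero.pos n
  refine ⟨(⟨y.1 + n, by omega⟩, y.2 + 1), hy, ?_⟩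
  rw [prev_eq (by simp; omega)]
  refine Prod.ext (Subtype.ext (Nat.add_sub_cancel _ _)) ?_
  change y.2 + 1 + ((n - 1 : ℕ) : ZMod n) = y.2
  rw [add_assoc, ← Nat.cast_one, ← Nat.cast_add, Nat.add_sub_cancel' hn, ZMod.natCast_self,
    add_zero]

end Prev

variable (p) in
/-- The leading part of `d_1` for a single index. -/
def lead (l : Ix n k) : Module.End (ZMod p) (Fk p (Ix n k)) := bop _ (prev l) * dop _ l

variable (p) in
/-- The contracting homotopy of `lead`. -/
def htp (l : Ix n k) : Module.End (ZMod p) (Fk p (Ix n k)) := binv _ (prev l) * hop _ l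

variable (p) in
/-- The projection onto the monomials that do not contain `h_l` and `b_{prev l}`. -/
abbrev rest (l : Ix n k) : Module.End (ZMod p) (Fk p (Ix n k)) := eop _ l (prev l)

lemma lead_htp_self (l : Ix n k) : lead p l * htp p l + htp p l * lead p l = 1 - rest p l :=
  homotopy_identity (binv_bop_self _) (dop_hop_self l) (hop_bop _ _) (dop_binv _ _)

lemma lead_htp {l l' : Ix n k} (hl : Bad p l) (hl' : Bad p l') (h : l' ≠ l) :
    lead p l' * htp p l + htp p l * lead p l' = 0 := by
  have h1 : prev l ≠ prev l' := fun e => h (prev_inj hl hl' e).symm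
  have : lead p l' * htp p l = -(htp p l * lead p l') :=
    mul_mul_anticomm (dop_hop_of_ne h) (binv_bop_of_ne h1).symm (hop_bop _ _).symm
      (dop_binv _ _).symm
  rw [this, neg_add_cancel]

lemma htp_mem {l : Ix n k} (hl : Bad p l) {γ : ℤ × Deg p n × ℤ} {w : ℤ} {a : Fk p (Ix n k)}
    (ha : a ∈ WS p n k γ w) : htp p l a ∈ WS p n k (γ - (1, 0, -1)) w := by
  have := binv_gspan (prev l) (hop_gspan l ha)
  have h := mayM_of_s0_lt hl
  rw [gen_prev ⟨h.1, h.2.1⟩, auxWt_prev hl, add_sub_cancel_right] at this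
  have e : γ - (1, 0, -1) = γ + ((triWt p n k).gen p).h l -
      (((triWt p n k).gen p).h l + (1, 0, -1)) := by abel
  rw [e]
  exact this

lemma rest_mem (l : Ix n k) {γ : ℤ × Deg p n × ℤ} {w : ℤ} {a : Fk p (Ix n k)}
    (ha : a ∈ WS p n k γ w) : rest p l a ∈ WS p n k γ w := by
  classical
  refine gspan_induction (fun L c _ h1 h2 => ?_) ha
  rw [eop_mon]
  split_ifs
  · exact zero_mem _
  · exact mon_mem_gspan h1 h2

variable (hkn : k ≤ n)
include hkn

lemma op_WS (l : Ix n k) {γ : ℤ × Deg p n × ℤ} {w : ℤ} {a : Fk p (Ix n k)}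
    (ha : a ∈ WS p n k γ w) : (fockOps p _).op l 1 a ∈
      WS p n k (γ + ((triWt p n k).gen p).h l) (w + (auxWt p n k).h l) := by
  rw [AntiOps.op, if_pos rfl, LinearMap.sub_apply]
  refine sub_mem (hop_gspan l ha) ?_
  split_ifs with h
  · have hp : p = 2 := by have := (Fact.out : p.Prime).two_le; omega
    have hs : s0 p n k = 2 * n := by rw [hp]; exact s0_two hkn
    have h1 := bop_gspan l (dop_gspan l ha)
    have h2 : γ - ((triWt p n k).gen p).h l + ((triWt p n k).gen p).b l =
        γ + ((triWt p n k).gen p).h l := by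
      have : p • (triWt p n k).e l = (2 : ℕ) • (triWt p n k).e l := by congr 1
      simp only [WordWt.gen, this, two_smul]; abel
    rw [h2] at h1
    refine gspan_mono ?_ h1
    have hl := l.1.2
    have := NeZero.pos k
    simp only [auxWt]
    split_ifs with h3
    · rw [hs] at h3; omega
    · omega
  · exact zero_mem _

lemma hW_WS (i : ℕ) (j : ZMod n) {γ : ℤ × Deg p n × ℤ} {w : ℤ} {a : Fk p (Ix n k)}
    (ha : a ∈ WS p n k γ w) : (fockOps p _).rho (hW p n k i j) a ∈
      WS p n k (γ + (1, hDeg p n i j, (mayM p n k i : ℤ))) (w + (2 * i - 1)) := by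
  rw [hW]; split_ifs with h
  · rw [rho_lt_one]
    have := op_WS hkn (⟨i, h⟩, j) ha
    rwa [gen_h] at this
  · rw [map_zero]; exact zero_mem _

open Classical in
/-- The first differential of `h_l` is `b_{prev l}`, up to terms of lower auxiliary weight, if `l`
is bad, and it consists of terms of lower weight otherwise. -/
lemma x1_WS (l : Ix n k) {γ : ℤ × Deg p n × ℤ} {w : ℤ} {a : Fk p (Ix n k)}
    (ha : a ∈ WS p n k γ w) :
    (fockOps p _).rho (x1 p n k l.1 l.2) a - (if Bad p l then bop _ (prev l) a else 0) ∈
      WS p n k (γ + ((triWt p n k).gen p).h l + (1, 0, -1)) (w + (auxWt p n k).h l - 1) := by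
  have hl := l.1.2
  have hk := NeZero.pos k
  have e : ∀ x y z : Fk p (Ix n k), x + y - z = x + (y - z) := add_sub_assoc
  rw [x1, map_add, LinearMap.add_apply, e, map_neg, map_sum, LinearMap.neg_apply,
    LinearMap.sum_apply]
  refine add_mem (neg_mem (sum_mem fun r hr => ?_)) ?_
  · rw [Finset.mem_Icc] at hr
    split_ifs with h
    · rw [map_mul]
      have h1 := hW_WS hkn r l.2 (hW_WS hkn (l.1 - r) ((r : ZMod n) + l.2) ha)
      have e : γ + (1, hDeg p n (l.1 - r) ((r : ZMod n) + l.2), (mayM p n k (l.1 - r) : ℤ)) +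
          (1, hDeg p n r l.2, (mayM p n k r : ℤ)) =
          γ + ((triWt p n k).gen p).h l + (1, 0, -1) := by
        have h2 := hDeg_add p r (l.1 - r) l.2
        rw [Nat.add_sub_cancel' (by omega)] at h2
        rw [gen_h, add_assoc, add_assoc, ← h2, ← h]
        congr 1
        refine Prod.ext rfl (Prod.ext ?_ ?_)
        · simp [add_comm]
        · simp; ring
      rw [e] at h1
      refine gspan_mono (le_of_eq ?_) h1
      rw [Nat.cast_sub (by omega)]
      simp only [auxWt]; ring
    · rw [map_zero]; exact zero_mem _
  · by_cases hb : Bad p l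
    · have h := mayM_of_s0_lt hb
      rw [if_pos ⟨h.1, h.2.1⟩, if_pos hb, bW_prev h.1, fock_rho_bw, sub_self]
      exact zero_mem _
    · rw [if_neg hb, sub_zero]
      split_ifs with h
      · rw [bW_prev h.1, fock_rho_bw]
        have h1 := bop_gspan (prev l) ha
        rw [gen_prev h, ← add_assoc] at h1
        refine gspan_mono ?_ h1
        have h2 := prev_fst_add h.1
        have h3 : (auxWt p n k).b (prev l) = 0 := by
          change (if _ then _ else _) = _
          rw [if_neg]; rw [h2]; exact hb
        rw [h3]
        simp only [auxWt]
        omega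
      · rw [map_zero]; exact zero_mem _

/-- The leading part of the first differential, with respect to the auxiliary weight. -/
lemma dA_sub_lead_mem (Λ : Finset (Ix n k)) (hΛ : ∀ l ∈ Λ, Bad p l) (L : List (Ix n k))
    (c : Ix n k →₀ ℕ) (hL : ∀ l ∈ L, Bad p l → l ∈ Λ) :
    dA p n k (mon _ L c) - ∑ l ∈ Λ, lead p l (mon _ L c) ∈
      WS p n k (((triWt p n k).gen p).deg L c + (1, 0, -1)) ((auxWt p n k).deg L c - 1) := by
  classical
  induction L with
  | nil =>
    rw [dA_mon_nil hkn, Finset.sum_eq_zero, sub_zero]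
    · exact zero_mem _
    · intro l _
      rw [lead, Module.End.mul_apply, dop_mon_nil, map_zero]
  | cons l L ih =>
    by_cases hl : l ∈ L
    · rw [mon_of_not_nodup _ c (fun h => (List.nodup_cons.1 h).1 hl)]
      simp only [map_zero, Finset.sum_const_zero, sub_zero]
      exact zero_mem _
    have h1 := ih fun l' hl' => hL l' (List.mem_cons_of_mem _ hl')
    set S := ∑ l ∈ Λ, lead p l (mon _ L c) with hS
    have h2 : ∑ l' ∈ Λ, lead p l' (mon _ (l :: L) c) =
        (if Bad p l then bop _ (prev l) (mon _ L c) else 0) - hop _ l S := by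
      have h3 : ∀ l' ∈ Λ, lead p l' (mon _ (l :: L) c) =
          (if l' = l then bop _ (prev l) (mon _ L c) else 0) - hop _ l (lead p l' (mon _ L c)) := by
        intro l' _
        rw [lead, Module.End.mul_apply, Module.End.mul_apply, dop_mon_cons, map_sub]
        congr 1
        split_ifs with h
        · rw [h]
        · rw [map_zero]
      rw [Finset.sum_congr rfl h3, Finset.sum_sub_distrib, Finset.sum_ite_eq', hS, map_sum]
      simp only [show l ∈ Λ ↔ Bad p l from ⟨hΛ l, hL l List.mem_cons_self⟩]
    have h4 : (fockOps p _).op l 1 S = hop _ l S := by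
      refine op_one_apply l ?_
      rw [hS, map_sum]
      refine Finset.sum_eq_zero fun l' _ => ?_
      rw [lead, Module.End.mul_apply, ← Module.End.mul_apply (dop _ l), (dop_bop l (prev l')).eq,
        Module.End.mul_apply, ← Module.End.mul_apply (dop _ l), dop_dop, LinearMap.neg_apply,
        Module.End.mul_apply, dop_mon_of_not_mem l L c hl]
      simp
    have h5 := x1_WS hkn l (mon_mem_gspan (R := ZMod p) (D := (triWt p n k).gen p)
      (W := auxWt p n k) (L := L) (c := c) rfl le_rfl)
    have h6 := op_WS hkn l h1
    rw [map_sub, h4] at h6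
    rw [GenWt.deg_cons, GenWt.deg_cons, h2, ← op_one_mon l hl, dA_op hkn]
    rw [add_right_comm] at h6
    have h7 := sub_mem h5 (gspan_mono (w' := (auxWt p n k).deg L c + (auxWt p n k).h l - 1)
      (by linarith) h6)
    rw [add_comm (GenWt.h _ l), add_comm ((auxWt p n k).h l)]
    convert h7 using 1
    abel

/-- The homotopy contracts the differential, up to terms of lower auxiliary weight. -/
lemma dA_htp_mem {l : Ix n k} (hl : Bad p l) {γ : ℤ × Deg p n × ℤ} {w : ℤ} {a : Fk p (Ix n k)}
    (ha : a ∈ WS p n k γ w) :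
    dA p n k (htp p l a) + htp p l (dA p n k a) - (a - rest p l a) ∈ WS p n k γ (w - 1) := by
  classical
  change (dA p n k * htp p l + htp p l * dA p n k - (1 - rest p l)) a ∈ _
  refine gspan_induction (fun L c hL h1 h2 => ?_) ha
  -- the bad indices that occur; `l` may come in through the homotopy
  let Λ : Finset (Ix n k) := insert l (L.toFinset.filter (Bad p))
  have hΛ : ∀ l ∈ Λ, Bad p l := by
    intro l' hl'
    rcases Finset.mem_insert.1 hl' with rfl | h
    · exact hl
    · exact (Finset.mem_filter.1 h).2
  have hΛ' : ∀ l' ∈ L, Bad p l' → l' ∈ Λ := fun l' h h' =>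
    Finset.mem_insert_of_mem (Finset.mem_filter.2 ⟨List.mem_toFinset.2 h, h'⟩)
  have e : ∑ l' ∈ Λ, (lead p l' * htp p l + htp p l * lead p l') = 1 - rest p l := by
    rw [Finset.sum_eq_single_of_mem l (Finset.mem_insert_self _ _), lead_htp_self]
    intro l' hl' hne
    exact lead_htp hl (hΛ l' hl') hne
  have h3 : dA p n k (htp p l (mon _ L c)) - ∑ l' ∈ Λ, lead p l' (htp p l (mon _ L c)) ∈
      WS p n k γ (w - 1) := by
    by_cases hc : c (prev l) = 0
    · have : htp p l (mon _ L c) = 0 := by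
        rw [htp, Module.End.mul_apply, hop_mon, binv_mon, if_pos hc]
      rw [this]; simp
    · have : htp p l (mon _ L c) = mon _ (l :: L) (c - Finsupp.single (prev l) 1) := by
        rw [htp, Module.End.mul_apply, hop_mon, binv_mon, if_neg hc]
      have h4 := dA_sub_lead_mem hkn Λ hΛ (l :: L) (c - Finsupp.single (prev l) 1) (by
        intro l' h h'
        rcases List.mem_cons.1 h with rfl | h
        · exact Finset.mem_insert_self _ _
        · exact hΛ' l' h h')
      have hM := mayM_of_s0_lt hl
      rw [GenWt.deg_cons, GenWt.deg_cons, GenWt.deg_sub _ _ _ _ hc, GenWt.deg_sub _ _ _ _ hc,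
        auxWt_prev hl, gen_prev ⟨hM.1, hM.2.1⟩] at h4
      rw [this]
      refine gspan_mono ?_ (?_ : _ ∈ WS p n k γ ((auxWt p n k).deg L c - 1))
      · linarith
      · convert h4 using 2
        · rw [← h1]; abel
        · ring
  have h4 := htp_mem hl (dA_sub_lead_mem hkn Λ hΛ L c hΛ')
  rw [add_sub_cancel_right, h1] at h4
  have h5 := add_mem h3 (gspan_mono (by linarith : _ ≤ w - 1) h4)
  rw [← e]
  convert h5 using 1
  simp only [LinearMap.sub_apply, LinearMap.add_apply, Module.End.mul_apply, LinearMap.sum_apply,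
    map_sub, map_sum, Finset.sum_add_distrib]
  abel

end

section

variable {p n k : ℕ} [Fact p.Prime] [NeZero n] [NeZero k]

variable (p) in
/-- The composite of the projections `rest` over a list of indices. -/
def restAll : List (Ix n k) → Module.End (ZMod p) (Fk p (Ix n k))
  | [] => 1
  | l :: ls => restAll ls * rest p l

lemma restAll_mem (ls : List (Ix n k)) {γ : ℤ × Deg p n × ℤ} {w : ℤ} {a : Fk p (Ix n k)}
    (ha : a ∈ WS p n k γ w) : restAll p ls a ∈ WS p n k γ w := by
  induction ls generalizing a with
  | nil => exact ha
  | cons l ls ih => exact ih (rest_mem l ha)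

lemma restAll_mon (ls : List (Ix n k)) (L : List (Ix n k)) (c : Ix n k →₀ ℕ)
    (h : ∃ l ∈ ls, l ∈ L ∨ c (prev l) ≠ 0) : restAll p ls (mon _ L c) = 0 := by
  classical
  induction ls with
  | nil => simp at h
  | cons l ls ih =>
    rw [restAll, Module.End.mul_apply, eop_mon]
    by_cases hl : l ∈ L ∨ c (prev l) ≠ 0
    · rw [if_pos hl, map_zero]
    · rw [if_neg hl]
      refine ih ?_
      obtain ⟨l', h1, h2⟩ := h
      rcases List.mem_cons.1 h1 with rfl | h1
      · exact absurd h2 hl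
      · exact ⟨l', h1, h2⟩

/-- The auxiliary weight of an element is bounded; the bound is written so that it is negative for
`N = 0`. -/
lemma exists_WS {γ : ℤ × Deg p n × ℤ} {a : Fk p (Ix n k)} (ha : a ∈ fspan p (triWt p n k) γ) :
    ∃ N : ℕ, a ∈ WS p n k γ ((N : ℤ) - 1) := by
  induction ha using Submodule.span_induction with
  | mem x h =>
    obtain ⟨L, c, h1, -, rfl⟩ := h
    exact ⟨((auxWt p n k).deg L c + 1).toNat, mon_mem_gspan h1 (by omega)⟩
  | zero => exact ⟨0, zero_mem _⟩
  | add x y _ _ hx hy =>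
    obtain ⟨N, h⟩ := hx
    obtain ⟨N', h'⟩ := hy
    exact ⟨max N N', add_mem (gspan_mono (by simp) h) (gspan_mono (by simp) h')⟩
  | smul r x _ hx => exact hx.imp fun N h => Submodule.smul_mem _ _ h

lemma WS_le (γ : ℤ × Deg p n × ℤ) (w : ℤ) : WS p n k γ w ≤ fspan p (triWt p n k) γ := by
  refine Submodule.span_mono ?_
  rintro _ ⟨L, c, h1, -, rfl⟩
  exact ⟨L, c, h1, by rw [zero_deg], rfl⟩

lemma WS_neg {γ : ℤ × Deg p n × ℤ} {w : ℤ} (hw : w < 0) {a : Fk p (Ix n k)}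
    (ha : a ∈ WS p n k γ w) : a = 0 := by
  have hk := NeZero.pos k
  refine (Submodule.mem_bot (ZMod p)).1 (gspan_induction (f := LinearMap.id)
    (fun L c _ _ h => absurd hw (not_lt.2 (le_trans (add_nonneg ?_ ?_) h))) ha)
  · refine List.sum_nonneg fun x hx => ?_
    obtain ⟨l, -, rfl⟩ := List.mem_map.1 hx
    have := l.1.2
    simp only [auxWt]
    omega
  · refine Finset.sum_nonneg fun y _ => smul_nonneg (Nat.zero_le _) ?_
    have := y.1.2
    simp only [auxWt]
    split_ifs <;> omega

namespace Target

variable {A : Type} [Ring A] [Algebra (ZMod p) A] (T : Target p n k A) (hkn : k ≤ n)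
include hkn

lemma pi_htp {l : Ix n k} (hl : Bad p l) (a : Fk p (Ix n k)) : T.pi (htp p l a) = 0 := by
  suffices T.pi ∘ₗ hop _ l = 0 by
    rw [htp, ← (hop_binv l (prev l)).eq]
    exact LinearMap.congr_fun this (binv _ _ a)
  refine fock_hom_ext fun L c _ => ?_
  rw [LinearMap.comp_apply, hop_mon]
  by_cases h : (l :: L).Nodup
  · exact (T.pi_bad hkn _ c h fun hg => absurd hl (not_lt.2 (hg.1 l List.mem_cons_self))).1
  · rw [mon_of_not_nodup _ c h, map_zero]; rfl

/-- An element of the kernel of the reduction is killed by enough of the projections. -/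
lemma exists_restAll (a : Fk p (Ix n k)) : ∃ Λ : List (Ix n k), (∀ l ∈ Λ, Bad p l) ∧
    ∀ ls, Λ ⊆ ls → restAll p ls (a - T.lift (T.pi a)) = 0 := by
  have ha : a ∈ Submodule.span (ZMod p)
      {a | ∃ (L : List (Ix n k)) (c : Ix n k →₀ ℕ), a = mon (ZMod p) L c} := by
    rw [span_mon]; trivial
  induction ha using Submodule.span_induction with
  | mem x h =>
    obtain ⟨L, c, rfl⟩ := h
    by_cases hL : L.Nodup
    swap
    · exact ⟨[], by simp, fun ls _ => by rw [mon_of_not_nodup L c hL]; simp⟩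
    rw [T.lift_pi_mon hkn L c hL]
    split_ifs with hg
    · exact ⟨[], by simp, fun ls _ => by rw [sub_self, map_zero]⟩
    rw [sub_zero]
    suffices ∃ l, Bad p l ∧ (l ∈ L ∨ c (prev l) ≠ 0) by
      obtain ⟨l, h1, h2⟩ := this
      exact ⟨[l], by simpa using h1, fun ls hls => restAll_mon ls L c ⟨l, hls (by simp), h2⟩⟩
    by_contra! h
    refine hg ⟨fun l hl => not_lt.1 fun hb => (h l hb).1 hl, fun y hy => not_lt.1 fun hb => ?_⟩
    obtain ⟨l, hl, rfl⟩ := exists_prev hb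
    exact hy (h l hl).2
  | zero => exact ⟨[], by simp, fun ls _ => by simp⟩
  | add x y _ _ hx hy =>
    obtain ⟨Λ, h1, h2⟩ := hx
    obtain ⟨Λ', h1', h2'⟩ := hy
    refine ⟨Λ ++ Λ', fun l hl => (List.mem_append.1 hl).elim (h1 l) (h1' l), fun ls hls => ?_⟩
    rw [map_add, map_add, add_sub_add_comm, map_add,
      h2 ls fun _ h => hls (List.mem_append_left _ h),
      h2' ls fun _ h => hls (List.mem_append_right _ h), add_zero]
  | smul r x _ hx =>
    obtain ⟨Λ, h1, h2⟩ := hx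
    exact ⟨Λ, h1, fun ls hls => by rw [map_smul, map_smul, ← smul_sub, map_smul, h2 ls hls,
      smul_zero]⟩

/-- The homotopies of the indices in `ls`, applied one after the other, change a cycle by boundaries
into its projection `restAll p ls a`, up to terms of lower auxiliary weight. -/
lemma exists_sub_restAll_mem (ls : List (Ix n k)) (hls : ∀ l ∈ ls, Bad p l)
    {γ : ℤ × Deg p n × ℤ} {w : ℤ} {a : Fk p (Ix n k)} (ha : a ∈ WS p n k γ w)
    (hd : dA p n k a = 0) : ∃ y ∈ fspan p (triWt p n k) (γ - (1, 0, -1)), T.pi y = 0 ∧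
      a - dA p n k y ∈ WS p n k γ w ∧ a - dA p n k y - restAll p ls a ∈ WS p n k γ (w - 1) := by
  induction ls generalizing a with
  | nil => exact ⟨0, zero_mem _, map_zero _, by simpa using ha, by simp [restAll]⟩
  | cons l ls ih =>
    have h0 := dA_htp_mem hkn (hls l List.mem_cons_self) ha
    rw [hd, map_zero, add_zero] at h0
    have h2 : a - dA p n k (htp p l a) ∈ WS p n k γ w := by
      have := sub_mem (rest_mem l ha) (gspan_mono (by linarith : w - 1 ≤ w) h0)
      convert this using 1
      abel
    obtain ⟨y, hy1, hy2, hy3, hy4⟩ := ih (fun l' h => hls l' (List.mem_cons_of_mem _ h)) h2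
      (by rw [map_sub, hd, dA_dA hkn, sub_zero])
    refine ⟨htp p l a + y, add_mem (WS_le _ _ (htp_mem (hls l List.mem_cons_self) ha)) hy1, ?_, ?_,
      ?_⟩
    · rw [map_add, T.pi_htp hkn (hls l List.mem_cons_self), hy2, add_zero]
    · rwa [map_add, ← sub_sub]
    · have h3 := sub_mem hy4 (restAll_mem ls h0)
      rw [map_add, ← sub_sub]
      convert h3 using 1
      simp only [restAll, Module.End.mul_apply, map_sub]
      abel

/-- The kernel of the reduction is acyclic: as enough of the projections annihilate a given element,
a cycle in the kernel can be changed by boundaries into elements of lower and lower auxiliary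
weight. -/
theorem acyclic {γ : ℤ × Deg p n × ℤ} {a : Fk p (Ix n k)} (ha : a ∈ fspan p (triWt p n k) γ)
    (hp : T.pi a = 0) (hd : dA p n k a = 0) :
    ∃ y ∈ fspan p (triWt p n k) (γ - (1, 0, -1)), T.pi y = 0 ∧ dA p n k y = a := by
  obtain ⟨N, hN⟩ := exists_WS ha
  clear ha
  induction N generalizing a with
  | zero => exact ⟨0, zero_mem _, map_zero _, by rw [WS_neg (by simp) hN, map_zero]⟩
  | succ N ih =>
    obtain ⟨Λ, h1, h2⟩ := T.exists_restAll hkn a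
    have h3 := h2 Λ (List.Subset.refl _)
    rw [hp, map_zero, sub_zero] at h3
    obtain ⟨y, hy1, hy2, hy3, hy4⟩ := T.exists_sub_restAll_mem hkn Λ h1 hN hd
    rw [h3, sub_zero] at hy4
    obtain ⟨y', h4, h5, h6⟩ := ih (a := a - dA p n k y)
      (by rw [map_sub, hp, ← T.d_pi hkn, hy2, map_zero, sub_zero])
      (by rw [map_sub, hd, dA_dA hkn, sub_zero])
      (by push_cast at hy4; rwa [add_sub_cancel_right] at hy4)
    exact ⟨y + y', add_mem hy1 h4, by rw [map_add, hy2, h5, add_zero], by rw [map_add, h6]; abel⟩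

end Target

end

/-! ### The differential of the reduced complex -/

section

section Leibniz

variable {p n k : ℕ} [Fact p.Prime] [NeZero n] [NeZero k]

lemma der_mul_of_mem_FO (δ : Letter p (Ix n k) → Om p (Ix n k)) {s : ℤ} {u : Deg p n} {M : ℤ}
    {x : Om p (Ix n k)} (hx : x ∈ FO p n k s u M) (y : Om p (Ix n k)) :
    der δ (x * y) = der δ x * y + Int.negOnePow s • (x * der δ y) := by
  have hsm : ∀ (N : ℕ) (a : Om p (Ix n k)), Int.negOnePow N • a = (-1) ^ N * a := by
    intro N a
    rcases Nat.even_or_odd N with h | h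
    · rw [Int.negOnePow_even _ (by exact_mod_cast h), one_smul, h.neg_one_pow, one_mul]
    · rw [Int.negOnePow_odd _ (by exact_mod_cast h), h.neg_one_pow, Units.neg_smul, one_smul,
        neg_one_mul]
  rcases le_or_gt 0 s with hs | hs
  · obtain ⟨N, rfl⟩ := Int.eq_ofNat_of_zero_le hs
    rw [der_mul_of_length δ (FO_length hx), hsm]
  · have : x = 0 := by
      refine (Submodule.mem_bot (ZMod p)).1 (wspan_le (fun l hl => ?_) hx)
      have h := FO_length (word_mem_wspan (P := FPred p n k l.length ((triWt p n k).wdeg l).2.1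
        ((triWt p n k).wdeg l).2.2) (l := l) ?_)
      all_goals
        have h1 : ∀ l : List (Letter p (Ix n k)), ((triWt p n k).wdeg l).1 = l.length := by
          intro l
          induction l with
          | nil => rfl
          | cons a l ih =>
            rw [wdeg_letter, Prod.fst_add, ih, List.length_cons]; push_cast; ring
      · have := hl.1
        rw [h1] at this
        omega
      · exact ⟨h1 l, rfl, le_rfl⟩
    rw [this]; simp

end Leibniz

section X1

variable {p n k : ℕ} [Fact p.Prime] [NeZero n] [NeZero k]

/-- In the range of the generators of the reduced complex, all products contribute to `d_1`. -/
lemma x1_of_le (hkn : k ≤ n) {i : ℕ} (hi : i ≤ s0 p n k) (j : ZMod n) : x1 p n k i j =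
    -(∑ r ∈ Finset.Icc k (i - k), hW p n k r j * hW p n k (i - r) ((r : ZMod n) + j)) +
    (if p = 2 ∧ i = 2 * n then bW p n k n (j + ((n - 1 : ℕ) : ZMod n)) else 0) := by
  have hk := NeZero.pos k
  rw [x1]
  congr 1
  · congr 1
    refine Finset.sum_congr rfl fun r hr => if_pos ?_
    rw [Finset.mem_Icc] at hr
    rw [mayM_of_le_s0 hi, mayM_of_le_s0 (by omega : r ≤ _), mayM_of_le_s0 (by omega : i - r ≤ _)]
    omega
  · by_cases h : p = 2 ∧ i = 2 * n
    · rw [if_pos h, if_pos ((extra_iff hkn hi).2 h), h.2, show 2 * n - n = n by omega]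
    · rw [if_neg h, if_neg (fun h' => h ((extra_iff hkn hi).1 h'))]

lemma d1_hW (hkn : k ≤ n) {i : ℕ} (hi : k ≤ i) (j : ZMod n) :
    d1 p n k (hW p n k i j) = x1 p n k i j := by
  rw [hW, dif_pos hi, d1_lt _ one_ne_zero (Fact.out : p.Prime).one_lt, delc_one_single hkn]

lemma d0_hW (i : ℕ) (j : ZMod n) : d0 p _ (hW p n k i j) = 0 := by
  rw [← mul_one (hW p n k i j)]; exact d0_hW_mul _ _ (by simp [d0])

lemma d0_bW (i : ℕ) (j : ZMod n) : d0 p _ (bW p n k i j) = 0 := by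
  rw [← mul_one (bW p n k i j)]; exact d0_bW_mul _ _ (by simp [d0])

lemma d0_x1 (i : ℕ) (j : ZMod n) : d0 p _ (x1 p n k i j) = 0 := by
  rw [← mul_one (x1 p n k i j)]; exact d0_x1_mul _ _ (by simp [d0])

lemma rho_d1_bW {B : Type} [Ring B] [Algebra (ZMod p) B] (Q : AntiOps p (Ix n k) B) (hkn : k ≤ n)
    (i : ℕ) (j : ZMod n) : Q.rho (d1 p n k (bW p n k i j)) = 0 := by
  rw [bW]; split_ifs
  · exact rho_d1_bw Q hkn _
  · rw [map_zero, map_zero]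

lemma bW_mem_genDeg (i : ℕ) (j : ZMod n) :
    bW p n k i j ∈ GO p n k (2, bDeg p n i j, (p : ℤ) * (mayM p n k i : ℤ)) := by
  have := bW_mem (p := p) (k := k) i j
  rwa [← bDeg_eq, Nat.cast_mul] at this

end X1

namespace Target

variable {p n k : ℕ} [Fact p.Prime] [NeZero n] [NeZero k]
variable {A : Type} [Ring A] [Algebra (ZMod p) A] (T : Target p n k A)

lemma pi_vac {z : Om p (Ix n k)} (hz : d0 p _ z = 0) : T.pi (vac p _ z) = T.Q.rho z 1 :=
  piA_vac T.Q hz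

lemma rho_mul {z : Om p (Ix n k)} (hz : d0 p _ z = 0) (z' : Om p (Ix n k)) :
    T.Q.rho (z * z') 1 = T.Q.rho z 1 * T.Q.rho z' 1 := by
  rw [map_mul, Module.End.mul_apply, rho_eq_mulLeft T.Q T.op_eq T.rho_bw hz,
    LinearMap.mulLeft_apply, LinearMap.mulLeft_apply, mul_one]

/-- The homogeneous elements of the reduced complex are the images of the homogeneous cocycles of the
associated graded complex. -/
lemma mem_homog {s : ℤ} {u : Deg p n} {M : ℤ} {x : A} : x ∈ homog p n k T.h T.b s u M ↔
    ∃ z ∈ GO p n k (s, u, M), d0 p _ z = 0 ∧ T.pi (vac p _ z) = x := by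
  constructor
  · intro hx
    let N : Submodule (ZMod p) (Om p (Ix n k)) := GO p n k (s, u, M) ⊓ LinearMap.ker (d0 p _)
    suffices homog p n k T.h T.b s u M ≤ N.map (T.pi ∘ₗ vac p _) by
      obtain ⟨z, hz, h⟩ := this hx
      exact ⟨z, hz.1, hz.2, h⟩
    refine Submodule.span_le.2 ?_
    rintro _ ⟨L, hL, rfl⟩
    suffices ∃ z ∈ GO p n k (L.map (genDeg p n k)).sum, d0 p _ z = 0 ∧ T.pi (vac p _ z) =
        (L.map (Sum.elim (fun q => T.h q.1 q.2) (fun q => T.b q.1 q.2))).prod by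
      obtain ⟨z, h1, h2, h3⟩ := this
      exact ⟨z, ⟨hL ▸ h1, h2⟩, h3⟩
    clear hL N
    induction L with
    | nil => exact ⟨1, one_mem_wdeg _, by simp [d0], by rw [vac_one]; exact piA_one _⟩
    | cons g L ih =>
      obtain ⟨z, h1, h2, h3⟩ := ih
      rw [T.pi_vac h2] at h3
      rcases g with ⟨i, j⟩ | ⟨i, j⟩
      · have h4 := d0_hW_mul i j h2
        refine ⟨hW p n k i j * z, GO_mul (hW_mem i j) h1, h4, ?_⟩
        rw [T.pi_vac h4, T.rho_mul (d0_hW i j), h3, T.rho_hW]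
        simp
      · have h4 := d0_bW_mul i j h2
        refine ⟨bW p n k i j * z, GO_mul (bW_mem_genDeg i j) h1, h4, ?_⟩
        rw [T.pi_vac h4, T.rho_mul (d0_bW i j), h3, T.rho_bW]
        simp
  · rintro ⟨z, h1, -, rfl⟩
    have h2 := vac_mem (triWt p n k) h1
    refine gspan_induction (fun L c hL h3 _ => Submodule.subset_span ?_) h2
    rw [← h3]
    refine mon_induction (P := fun L c => ∃ G : List ((ℕ × ZMod n) ⊕ (ℕ × ZMod n)),
      (G.map (genDeg p n k)).sum = ((triWt p n k).gen p).deg L c ∧ T.pi (mon _ L c) =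
        (G.map (Sum.elim (fun q => T.h q.1 q.2) (fun q => T.b q.1 q.2))).prod)
      ⟨[], by simp [GenWt.deg], by rw [← one_eq_mon]; exact piA_one _⟩ ?_ ?_ L c hL
    · rintro c y ⟨G, h4, h5⟩
      refine ⟨Sum.inr (y.1, y.2) :: G, ?_, by rw [← bop_mon, T.pi_bop, h5]; simp⟩
      rw [List.map_cons, List.sum_cons, h4, GenWt.deg_add, add_comm, gen_b, ← bDeg_eq,
        Nat.cast_mul]
      rfl
    · rintro l L c hl _ ⟨G, h4, h5⟩
      refine ⟨Sum.inl (l.1, l.2) :: G, ?_, by rw [← op_one_mon l hl, T.pi_op, h5]; simp⟩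
      rw [List.map_cons, List.sum_cons, h4, GenWt.deg_cons, gen_h]
      rfl

lemma pi_surjective : Function.Surjective T.pi := fun a => ⟨T.lift a, T.piA_lift a⟩

lemma exists_pi_vac (a : A) : ∃ z, d0 p _ z = 0 ∧ T.pi (vac p _ z) = a := by
  obtain ⟨x, rfl⟩ := T.pi_surjective a
  obtain ⟨z, hz, rfl⟩ := exists_cocycle x
  exact ⟨z, hz, rfl⟩

lemma rho_hW_one (i : ℕ) (j : ZMod n) : T.Q.rho (hW p n k i j) 1 = T.h i j := by
  rw [T.rho_hW, LinearMap.mulLeft_apply, mul_one]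

lemma rho_bW_one (i : ℕ) (j : ZMod n) : T.Q.rho (bW p n k i j) 1 = T.b i j := by
  rw [T.rho_bW, LinearMap.mulLeft_apply, mul_one]

lemma rho_x1 (hkn : k ≤ n) {i : ℕ} (hi : i ≤ s0 p n k) (j : ZMod n) :
    T.Q.rho (x1 p n k i j) 1 = d1h p n k T.h i j := by
  rw [x1_of_le hkn hi, d1h, map_add, map_neg, map_sum, LinearMap.add_apply, LinearMap.neg_apply,
    LinearMap.sum_apply]
  congr 1
  · congr 1
    refine Finset.sum_congr rfl fun r _ => ?_
    rw [T.rho_mul (d0_hW _ _), T.rho_hW_one, T.rho_hW_one]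
  · split_ifs with h
    · rw [T.rho_bW_one, T.b_two h.1]
    · rw [map_zero]; rfl

variable (hkn : k ≤ n)
include hkn

lemma d_vac {z : Om p (Ix n k)} (hz : d0 p _ z = 0) :
    T.d (T.pi (vac p _ z)) = T.Q.rho (d1 p n k z) 1 := by
  rw [T.d_pi hkn, dA_vac hkn hz, T.pi_vac (d0_d1 hkn hz)]

lemma d_rho {z : Om p (Ix n k)} (hz : d0 p _ z = 0) :
    T.d (T.Q.rho z 1) = T.Q.rho (d1 p n k z) 1 := by
  rw [← T.pi_vac hz, T.d_vac hkn hz]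

lemma isReducedD : IsReducedD p n k T.h T.b T.d where
  degree s u M x hx := by
    obtain ⟨z, h1, h2, rfl⟩ := T.mem_homog.1 hx
    refine T.mem_homog.2 ⟨d1 p n k z, ?_, d0_d1 hkn h2, ?_⟩
    · have := d1_mem h1
      rwa [Prod.mk_add_mk, Prod.mk_add_mk, add_zero] at this
    · rw [T.d_vac hkn h2, T.pi_vac (d0_d1 hkn h2)]
  leibniz s u M x hx y := by
    obtain ⟨z, h1, h2, rfl⟩ := T.mem_homog.1 hx
    obtain ⟨z', h2', rfl⟩ := T.exists_pi_vac y
    have h1' := GO_le_FO _ _ _ h1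
    have h3 : d0 p (Ix n k) (z * z') = 0 := by
      rw [d0, der_mul_of_mem_FO _ h1', ← d0, h2, h2']; simp
    have h4 : T.pi (vac p _ z) * T.pi (vac p _ z') = T.pi (vac p _ (z * z')) :=
      (T.pi_vac_mul h2 h2' h3).symm
    rw [h4, T.d_vac hkn h3, T.d_vac hkn h2, T.d_vac hkn h2', T.pi_vac h2, T.pi_vac h2', d1,
      der_mul_of_mem_FO _ h1', map_add, LinearMap.add_apply, ← d1, T.rho_mul (d0_d1 hkn h2)]
    congr 1
    rcases Int.even_or_odd s with h | h
    · rw [Int.negOnePow_even _ h, one_smul, one_smul, T.rho_mul h2]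
    · rw [Int.negOnePow_odd _ h, Units.neg_smul, one_smul, Units.neg_smul, one_smul, map_neg,
        LinearMap.neg_apply, T.rho_mul h2]
  on_h i hi hi' j := by
    rw [← T.rho_hW_one, T.d_rho hkn (d0_hW i j), d1_hW hkn hi, T.rho_x1 hkn hi']
  on_b i _ _ j := by
    rw [← T.rho_bW_one, T.d_rho hkn (d0_bW i j), rho_d1_bW T.Q hkn]; rfl
  sq x := by
    obtain ⟨a, rfl⟩ := T.pi_surjective x
    rw [T.d_pi hkn, T.d_pi hkn, dA_dA hkn, map_zero]

end Target

end

/-! ### The first terms of the May spectral sequence -/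

section

section Cobar

variable {p n k : ℕ} [Fact p.Prime] [NeZero n] [NeZero k]

lemma theta_mem_FC {s : ℤ} {u : Deg p n} {M : ℤ} {w : Om p (Ix n k)} :
    theta p n k w ∈ FC p n k s u M ↔ w ∈ FO p n k s u M := by
  rw [FC_eq]
  constructor
  · rintro ⟨w', h, h'⟩
    rwa [← (theta p n k).injective h']
  · exact fun h => ⟨w, h, rfl⟩

lemma theta_mem_Z {r s : ℤ} {u : Deg p n} {M : ℤ} {w : Om p (Ix n k)} :
    theta p n k w ∈ Z p n k r s u M ↔
      w ∈ FO p n k s u M ∧ dw p n k w ∈ FO p n k (s + 1) u (M - r) := by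
  rw [Z, Submodule.mem_inf, Submodule.mem_comap, ← theta_dw, theta_mem_FC, theta_mem_FC]

lemma exists_theta (x : Cobar p n k) : ∃ w, theta p n k w = x := (theta p n k).surjective x

lemma theta_hW {i : ℕ} (h : k ≤ i) (j : ZMod n) : theta p n k (hW p n k i j) = hCob p n k i j := by
  rw [← brw_tj h, theta_brw]; rfl

lemma theta_bW {i : ℕ} (h : k ≤ i) (j : ZMod n) : theta p n k (bW p n k i j) = bCob p n k i j := by
  have h1 := Lw_wpoly (p := p) ((⟨i, h⟩, j) : Ix n k)
  rw [bW, dif_pos h, ← h1, wpoly, map_sum, map_sum, bCob]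
  refine Finset.sum_congr rfl fun m _ => ?_
  have e : tX p n k j i ^ m * tY p n k j i ^ (p - m) =
      (tj p n k i j ^ m) ⊗ₜ[ZMod p] (tj p n k i j ^ (p - m)) := by
    rw [tX_pow, tY_pow, Algebra.TensorProduct.tmul_mul_tmul, mul_one, one_mul]
  change theta p n k (Lw p n k (tX p n k j i ^ m * tY p n k j i ^ (p - m) *
    ((p.choose m / p : ℕ) : SS p n k))) = _
  rw [e, mul_comm, ← nsmul_eq_mul, ← Nat.cast_smul_eq_nsmul (ZMod p), map_smul, Lw_tmul, map_smul,
    map_mul, theta_brw, theta_brw, tj, ← pow_mul, ← pow_mul, mul_comm m, mul_comm (p - m)]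

variable (hkn : k ≤ n)
include hkn

lemma dw_sub_d0_mem {s : ℤ} {u : Deg p n} {M : ℤ} {w : Om p (Ix n k)} (hw : w ∈ FO p n k s u M) :
    dw p n k w - d0 p _ (comp p n k (s, u, M) w) ∈ FO p n k (s + 1) u (M - 1) := by
  have h1 := dw_mem hkn (sub_comp_mem hw)
  have h2 := comp_mem (s, u, M) w
  have h3 := dw_sub_mem hkn (GO_le_FO _ _ _ h2)
  have h4 := d1_mem h2
  rw [Prod.mk_add_mk, Prod.mk_add_mk, add_zero] at h4
  have h5 := add_mem (add_mem h1 (FO_mono (by linarith) h3)) (GO_le_FO _ _ _ h4)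
  rw [map_sub] at h5
  convert h5 using 1
  abel

lemma comp_dw {s : ℤ} {u : Deg p n} {M : ℤ} {w : Om p (Ix n k)} (hw : w ∈ FO p n k s u M) :
    comp p n k (s + 1, u, M) (dw p n k w) = d0 p _ (comp p n k (s, u, M) w) := by
  have h1 := comp_of_lt (by linarith : M - 1 < M) (dw_sub_d0_mem hkn hw)
  have h2 := d0_mem_GO (comp_mem (s, u, M) w)
  rw [Prod.mk_add_mk, Prod.mk_add_mk, add_zero, add_zero] at h2
  rwa [map_sub, comp_of_mem h2, sub_eq_zero] at h1

lemma d0_comp {s : ℤ} {u : Deg p n} {M : ℤ} {w : Om p (Ix n k)} (hw : w ∈ FO p n k s u M)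
    (hdw : dw p n k w ∈ FO p n k (s + 1) u (M - 1)) : d0 p _ (comp p n k (s, u, M) w) = 0 := by
  rw [← comp_dw hkn hw, comp_of_lt (by linarith) hdw]

/-- The component of `d w` of filtration `M - 1` is the first differential of the leading component
of `w`, up to a coboundary. -/
lemma comp_dw_sub_one {s : ℤ} {u : Deg p n} {M : ℤ} {w : Om p (Ix n k)} (hw : w ∈ FO p n k s u M)
    (hdw : dw p n k w ∈ FO p n k (s + 1) u (M - 1)) :
    comp p n k (s + 1, u, M - 1) (dw p n k w) = d1 p n k (comp p n k (s, u, M) w) +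
      d0 p _ (comp p n k (s, u, M - 1) (w - comp p n k (s, u, M) w)) := by
  have h1 := dw_sub_mem hkn (GO_le_FO _ _ _ (comp_mem (s, u, M) w))
  rw [d0_comp hkn hw hdw, sub_zero] at h1
  have h2 := comp_of_lt (by linarith : M - 2 < M - 1) h1
  have h3 := d1_mem (comp_mem (s, u, M) w)
  rw [Prod.mk_add_mk, Prod.mk_add_mk, add_zero, ← sub_eq_add_neg] at h3
  rw [map_sub, comp_of_mem h3, sub_eq_zero] at h2
  have h4 := comp_dw hkn (sub_comp_mem hw)
  rw [← h2, ← h4, map_sub, map_sub]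
  abel

lemma theta_mem_Z_one {s : ℤ} {u : Deg p n} {M : ℤ} {z : Om p (Ix n k)}
    (hz : z ∈ GO p n k (s, u, M)) (hd : d0 p _ z = 0) : theta p n k z ∈ Z p n k 1 s u M := by
  refine theta_mem_Z.2 ⟨GO_le_FO _ _ _ hz, ?_⟩
  have := dw_sub_d0_mem hkn (GO_le_FO _ _ _ hz)
  rwa [comp_of_mem hz, hd, sub_zero] at this

lemma theta_dw_mem_Z_one {s : ℤ} {u : Deg p n} {M : ℤ} {w : Om p (Ix n k)}
    (hdw : dw p n k w ∈ FO p n k (s + 1) u M) : theta p n k (dw p n k w) ∈ Z p n k 1 (s + 1) u M := by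
  refine theta_mem_Z.2 ⟨hdw, ?_⟩
  rw [dw_dw hkn]; exact zero_mem _

/-- The first May differential can be computed in the associated graded complex. -/
lemma d1Eq_of {s : ℤ} {u : Deg p n} {M : ℤ} {w v q : Om p (Ix n k)} (hw : w ∈ GO p n k (s, u, M))
    (hw0 : d0 p _ w = 0) (hv : v ∈ GO p n k (s + 1, u, M - 1)) (hv0 : d0 p _ v = 0)
    (hq : q ∈ GO p n k (s, u, M - 1)) (h : d1 p n k w - v = d0 p _ q) :
    D1Eq p n k s u M (theta p n k w) (theta p n k v) := by
  have hx := theta_mem_Z_one hkn hw hw0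
  refine ⟨hx, theta_mem_Z_one hkn hv hv0, theta p n k w, hx, ?_, rfl, ?_⟩
  · rw [← theta_dw]
    exact theta_dw_mem_Z_one hkn (theta_mem_Z.1 hx).2
  · refine (Submodule.Quotient.eq _).2 ?_
    change cobarD p n k (theta p n k w) - theta p n k v ∈ B p n k 1 (s + 1) u (M - 1)
    have e : cobarD p n k (theta p n k w) - theta p n k v =
        theta p n k (dw p n k w - d0 p _ w - d1 p n k w - (dw p n k q - d0 p _ q)) +
          cobarD p n k (theta p n k q) := by
      rw [hw0, sub_zero, ← h, ← theta_dw, ← theta_dw, ← map_sub, ← map_add]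
      congr 1
      abel
    rw [e]
    have hq' := GO_le_FO _ _ _ hq
    have h1 := dw_sub_d0_mem hkn hq'
    rw [comp_of_mem hq] at h1
    refine add_mem (Submodule.mem_sup_left (theta_mem_Z.2 ?_))
      (Submodule.mem_sup_right ⟨_, (theta_mem_Z (w := q)).2 ?_, rfl⟩)
    · have h2 := sub_mem (FO_mono (by linarith : M - 2 ≤ M - 1 - 1)
        (dw_sub_mem hkn (GO_le_FO _ _ _ hw))) h1
      refine ⟨h2, ?_⟩
      rw [sub_self, sub_zero]
      exact dw_mem hkn h2
    · rw [add_sub_cancel_right, sub_add_cancel, sub_self, sub_zero]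
      exact ⟨hq', dw_mem hkn hq'⟩

lemma d1Eq_h {i : ℕ} (hi : k ≤ i) (hi' : i ≤ s0 p n k) (j : ZMod n) :
    D1Eq p n k 1 (hDeg p n i j) (mayM p n k i : ℤ) (hCob p n k i j)
      (d1h p n k (hCob p n k) i j) := by
  have h1 := d1Eq_of hkn (hW_mem (p := p) i j) (d0_hW i j)
    (x1_mem (p := p) (n := n) (k := k) i j) (d0_x1 i j) (zero_mem _)
    (by rw [d1_hW hkn hi, sub_self, map_zero])
  convert h1 using 1
  · exact (theta_hW hi j).symm
  · rw [x1_of_le hkn hi', map_add, map_neg, map_sum, d1h]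
    congr 1
    · congr 1
      refine Finset.sum_congr rfl fun r hr => ?_
      rw [Finset.mem_Icc] at hr
      have := NeZero.pos k
      rw [map_mul, theta_hW (by omega), theta_hW (by omega)]
    · split_ifs with h
      · rw [theta_bW hkn, pow_two]
        obtain ⟨rfl, -⟩ := h
        simp [bCob, hCob, show Finset.Ioo 0 2 = {1} from rfl]
      · rw [map_zero]

lemma d1Eq_b {i : ℕ} (hi : k ≤ i) (j : ZMod n) :
    D1Eq p n k 2 (bDeg p n i j) ((p : ℤ) * (mayM p n k i : ℤ)) (bCob p n k i j) 0 := by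
  have h1 := bW_mem_genDeg (p := p) (k := k) i j
  have h2 := d1_mem h1
  obtain ⟨q, hq, hq'⟩ := d0_exact_of_wdeg (triWt p n k) h2 (d0_d1 hkn (d0_bW i j))
    (by rw [vac_apply, rho_d1_bW _ hkn]; rfl)
  have e : (2, bDeg p n i j, (p : ℤ) * (mayM p n k i : ℤ)) + (1, 0, -1) - (triWt p n k).ℓ =
      (2, bDeg p n i j, (p : ℤ) * (mayM p n k i : ℤ) - 1) := by
    refine Prod.ext ?_ (Prod.ext ?_ ?_) <;> simp [triWt]
    ring
  have := d1Eq_of hkn h1 (d0_bW i j) (zero_mem _) (map_zero _) (q := q)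
    (by rw [e] at hq; exact hq)
    (by rw [sub_zero, hq'])
  rwa [theta_bW hi, map_zero] at this

end Cobar

end

section

variable {p n k : ℕ} [Fact p.Prime] [NeZero n] [NeZero k]

lemma comp_mul {s s' : ℤ} {u u' : Deg p n} {M M' : ℤ} {x y : Om p (Ix n k)}
    (hx : x ∈ FO p n k s u M) (hy : y ∈ FO p n k s' u' M') :
    comp p n k (s + s', u + u', M + M') (x * y) =
      comp p n k (s, u, M) x * comp p n k (s', u', M') y := by
  have hcx := comp_mem (s, u, M) x
  have h1 := FO_mul (sub_comp_mem hx) hy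
  have h2 := FO_mul (GO_le_FO _ _ _ hcx) (sub_comp_mem hy)
  have h3 := add_mem (FO_mono (by linarith : _ ≤ M + M' - 1) h1)
    (FO_mono (by linarith : _ ≤ M + M' - 1) h2)
  have h4 := comp_of_lt (by linarith : M + M' - 1 < M + M') h3
  have h5 := GO_mul hcx (comp_mem (s', u', M') y)
  rw [Prod.mk_add_mk, Prod.mk_add_mk] at h5
  rw [← comp_of_mem h5, ← sub_eq_zero, ← map_sub, ← h4]
  congr 1
  rw [sub_mul, mul_sub]; abel

namespace Target

variable {A : Type} [Ring A] [Algebra (ZMod p) A] (T : Target p n k A)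

/-- The image in `A` of the leading component of an element of the cobar complex. -/
def symbol (s : ℤ) (u : Deg p n) (M : ℤ) : Cobar p n k →ₗ[ZMod p] A :=
  LinearMap.applyₗ (1 : A) ∘ₗ T.Q.rho.toLinearMap ∘ₗ comp p n k (s, u, M) ∘ₗ
    (theta p n k).symm.toLinearMap

lemma symbol_theta (s : ℤ) (u : Deg p n) (M : ℤ) (w : Om p (Ix n k)) :
    T.symbol s u M (theta p n k w) = T.Q.rho (comp p n k (s, u, M) w) 1 := by
  change T.Q.rho (comp p n k (s, u, M) ((theta p n k).symm (theta p n k w))) 1 = _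
  rw [AlgEquiv.symm_apply_apply]

lemma symbol_of_lt {s : ℤ} {u : Deg p n} {M M' : ℤ} (h : M' < M) {x : Cobar p n k}
    (hx : x ∈ FC p n k s u M') : T.symbol s u M x = 0 := by
  obtain ⟨w, rfl⟩ := exists_theta x
  rw [symbol_theta, comp_of_lt h (theta_mem_FC.1 hx), map_zero]; rfl

lemma symbol_of_mem {s : ℤ} {u : Deg p n} {M : ℤ} {z : Om p (Ix n k)}
    (hz : z ∈ GO p n k (s, u, M)) : T.symbol s u M (theta p n k z) = T.Q.rho z 1 := by
  rw [symbol_theta, comp_of_mem hz]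

variable (hkn : k ≤ n)
include hkn

lemma symbol_d_of_mem {s : ℤ} {u : Deg p n} {M : ℤ} {x : Cobar p n k}
    (hx : x ∈ FC p n k s u M) : T.symbol (s + 1) u M (cobarD p n k x) = 0 := by
  obtain ⟨w, rfl⟩ := exists_theta x
  rw [← theta_dw, symbol_theta, comp_dw hkn (theta_mem_FC.1 hx), T.Q.rho_d0]; rfl

lemma symbol_d {s : ℤ} {u : Deg p n} {M : ℤ} {x : Cobar p n k} (hx : x ∈ Z p n k 1 s u M) :
    T.symbol (s + 1) u (M - 1) (cobarD p n k x) = T.d (T.symbol s u M x) := by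
  obtain ⟨w, rfl⟩ := exists_theta x
  obtain ⟨h1, h2⟩ := theta_mem_Z.1 hx
  rw [← theta_dw, symbol_theta, symbol_theta, comp_dw_sub_one hkn h1 h2,
    T.d_rho hkn (d0_comp hkn h1 h2), map_add, T.Q.rho_d0, add_zero]

lemma symbol_mem_homog {s : ℤ} {u : Deg p n} {M : ℤ} {x : Cobar p n k} (hx : x ∈ Z p n k 1 s u M) :
    T.symbol s u M x ∈ homog p n k T.h T.b s u M := by
  obtain ⟨w, rfl⟩ := exists_theta x
  obtain ⟨h1, h2⟩ := theta_mem_Z.1 hx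
  have h3 := d0_comp hkn h1 h2
  exact T.mem_homog.2 ⟨_, comp_mem _ w, h3, by rw [T.pi_vac h3, symbol_theta]⟩

lemma symbol_B (s : ℤ) (u : Deg p n) (M : ℤ) {x : Cobar p n k} (hx : x ∈ B p n k 1 s u M) :
    T.symbol s u M x = 0 := by
  obtain ⟨y, hy, _, ⟨z, hz, rfl⟩, rfl⟩ := Submodule.mem_sup.1 hx
  have h := T.symbol_d_of_mem hkn hz.1
  rw [sub_add_cancel, add_sub_cancel_right] at h
  rw [map_add, T.symbol_of_lt (sub_one_lt M) hy.1, h, add_zero]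

/-- The reduction of the first term of the May spectral sequence. -/
def piE (s : ℤ) (u : Deg p n) (M : ℤ) : E p n k 1 s u M →ₗ[ZMod p] A :=
  Submodule.liftQ _ (T.symbol s u M ∘ₗ (Z p n k 1 s u M).subtype)
    fun _ hx => T.symbol_B hkn s u M hx

lemma piE_cls {s : ℤ} {u : Deg p n} {M : ℤ} (x : Z p n k 1 s u M) :
    T.piE hkn s u M (cls p n k 1 s u M x) = T.symbol s u M x := rfl

lemma isReduction : IsReduction p n k T.h T.b T.d (T.piE hkn) where
  range s u M := by
    apply le_antisymm
    · rintro _ ⟨ξ, rfl⟩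
      obtain ⟨x, rfl⟩ := Submodule.mkQ_surjective _ ξ
      exact T.symbol_mem_homog hkn x.2
    · intro a ha
      obtain ⟨z, h1, h2, rfl⟩ := T.mem_homog.1 ha
      refine ⟨cls p n k 1 s u M ⟨_, theta_mem_Z_one hkn h1 h2⟩, ?_⟩
      rw [piE_cls, T.pi_vac h2]
      exact T.symbol_of_mem h1
  map_one := by
    have h : (1 : Om p (Ix n k)) ∈ GO p n k (0, 0, 0) := one_mem_wdeg (triWt p n k)
    have h1 := theta_mem_Z_one hkn h (by simp [d0])
    rw [map_one] at h1
    refine ⟨h1, ?_⟩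
    have h2 := T.symbol_of_mem h
    rw [map_one (theta p n k), map_one T.Q.rho] at h2
    exact h2
  map_mul s u M s' u' M' x y := by
    obtain ⟨x, hx⟩ := x
    obtain ⟨y, hy⟩ := y
    obtain ⟨w, rfl⟩ := exists_theta x
    obtain ⟨w', rfl⟩ := exists_theta y
    obtain ⟨h1, h2⟩ := theta_mem_Z.1 hx
    obtain ⟨h1', h2'⟩ := theta_mem_Z.1 hy
    have h : theta p n k w * theta p n k w' ∈ Z p n k 1 (s + s') (u + u') (M + M') := by
      rw [← map_mul]
      refine theta_mem_Z.2 ⟨FO_mul h1 h1', ?_⟩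
      rw [dw, der_mul_of_mem_FO _ h1]
      have hsm : ∀ (a : ℤˣ) {N : Submodule (ZMod p) (Om p (Ix n k))} {v : Om p (Ix n k)}, v ∈ N →
          a • v ∈ N := by
        intro a N v hv
        rcases Int.units_eq_one_or a with rfl | rfl
        · rwa [one_smul]
        · rw [Units.neg_smul, one_smul]; exact neg_mem hv
      refine add_mem ?_ (hsm _ ?_)
      · have := FO_mul h2 h1'
        rwa [add_right_comm, sub_add_eq_add_sub] at this
      · have := FO_mul h1 h2'
        rwa [← add_assoc, ← add_sub_assoc] at this
    refine ⟨h, ?_⟩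
    rw [piE_cls, piE_cls, piE_cls]
    change T.symbol _ _ _ (theta p n k w * theta p n k w') =
      T.symbol _ _ _ (theta p n k w) * T.symbol _ _ _ (theta p n k w')
    rw [← map_mul, symbol_theta, symbol_theta, symbol_theta, comp_mul h1 h1',
      T.rho_mul (d0_comp hkn h1 h2)]
  map_h i hi j := by
    have h1 := theta_mem_Z_one hkn (hW_mem (p := p) (k := k) i j) (d0_hW i j)
    have h2 := T.symbol_of_mem (hW_mem (p := p) (k := k) i j)
    rw [theta_hW hi] at h1 h2
    exact ⟨h1, by rw [piE_cls, ← T.rho_hW_one]; exact h2⟩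
  map_b i hi j := by
    have h1 := theta_mem_Z_one hkn (bW_mem_genDeg (p := p) (k := k) i j) (d0_bW i j)
    have h2 := T.symbol_of_mem (bW_mem_genDeg (p := p) (k := k) i j)
    rw [theta_bW hi] at h1 h2
    exact ⟨h1, by rw [piE_cls, ← T.rho_bW_one]; exact h2⟩
  map_d s u M ξ := by
    obtain ⟨⟨x, hx⟩, rfl⟩ := Submodule.mkQ_surjective _ ξ
    obtain ⟨w, rfl⟩ := exists_theta x
    have h := theta_dw_mem_Z_one hkn (theta_mem_Z.1 hx).2
    rw [theta_dw] at h
    exact ⟨cls p n k 1 (s + 1) u (M - 1) ⟨_, h⟩, ⟨_, hx, h, rfl, rfl⟩, T.symbol_d hkn hx⟩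

lemma Z_two_le {s : ℤ} {u : Deg p n} {M : ℤ} : Z p n k 2 s u M ≤ Z p n k 1 s u M := by
  intro x hx
  obtain ⟨w, rfl⟩ := exists_theta x
  obtain ⟨h1, h2⟩ := theta_mem_Z.1 hx
  exact theta_mem_Z.2 ⟨h1, FO_mono (by linarith) h2⟩

lemma symbol_mem_redCocycles {s : ℤ} {u : Deg p n} {M : ℤ} {x : Cobar p n k}
    (hx : x ∈ Z p n k 2 s u M) : T.symbol s u M x ∈ redCocycles p n k T.h T.b T.d s u M := by
  have hx' := Z_two_le hkn hx
  refine ⟨T.symbol_mem_homog hkn hx', ?_⟩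
  change T.d _ = 0
  rw [← T.symbol_d hkn hx']
  exact T.symbol_of_lt (by linarith) hx.2

/-- The map from `Z_2` to the cohomology of the reduced complex. -/
def toRedH (s : ℤ) (u : Deg p n) (M : ℤ) :
    Z p n k 2 s u M →ₗ[ZMod p] redH p n k T.h T.b T.d s u M :=
  Submodule.mkQ _ ∘ₗ LinearMap.codRestrict _ (T.symbol s u M ∘ₗ (Z p n k 2 s u M).subtype)
    fun x => T.symbol_mem_redCocycles hkn x.2

lemma toRedH_eq_zero {s : ℤ} {u : Deg p n} {M : ℤ} {x : Z p n k 2 s u M} :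
    T.toRedH hkn s u M x = 0 ↔
      T.symbol s u M x ∈ (homog p n k T.h T.b (s - 1) u (M + 1)).map T.d :=
  Submodule.Quotient.mk_eq_zero _

/-- An element of `Z_2` whose class in the cohomology of the reduced complex vanishes is a boundary:
the obstruction to lifting a primitive is a cocycle in the kernel of the reduction. -/
lemma mem_B_two {s : ℤ} {u : Deg p n} {M : ℤ} {x : Cobar p n k} (hx : x ∈ Z p n k 2 s u M)
    (h : T.symbol s u M x ∈ (homog p n k T.h T.b (s - 1) u (M + 1)).map T.d) :
    x ∈ B p n k 2 s u M := by
  obtain ⟨w, rfl⟩ := exists_theta x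
  obtain ⟨c, hc, hc'⟩ := h
  obtain ⟨z, hz1, hz2, rfl⟩ := T.mem_homog.1 hc
  obtain ⟨h1, h2⟩ := theta_mem_Z.1 hx
  have h2' := FO_mono (by linarith : M - 2 ≤ M - 1) h2
  have hcw := comp_mem (s, u, M) w
  have h0 := d0_comp hkn h1 h2'
  have e1 : ((s, u, M) : ℤ × Deg p n × ℤ) - (1, 0, -1) = (s - 1, u, M + 1) := by
    simp
  have e2 : ((s - 1, u, M + 1) : ℤ × Deg p n × ℤ) + (1, 0, -1) = (s, u, M) := by
    simp
  have e3 : ((s, u, M) : ℤ × Deg p n × ℤ) - (triWt p n k).ℓ = (s - 1, u, M) := by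
    simp [triWt]
  have h3 : vac p _ (d1 p n k (comp p n k (s, u, M) w)) = 0 := by
    have := comp_dw_sub_one hkn h1 h2'
    rw [comp_of_lt (by linarith) h2] at this
    rw [eq_neg_of_add_eq_zero_left this.symm, map_neg, vac_d0, neg_zero]
  -- the difference of the leading component and the lifted primitive
  have hker : T.pi (vac p _ (comp p n k (s, u, M) w - d1 p n k z)) = 0 := by
    rw [map_sub, map_sub, T.pi_vac h0, T.pi_vac (d0_d1 hkn hz2), ← symbol_theta, ← hc',
      T.d_vac hkn hz2, sub_self]
  have hd1z := d1_mem hz1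
  rw [e2] at hd1z
  obtain ⟨a, ha1, -, ha3⟩ := T.acyclic hkn (vac_mem _ (sub_mem hcw hd1z)) hker (by
    rw [map_sub, map_sub, ← dA_vac hkn hz2, dA_dA hkn, dA_vac hkn h0, h3, sub_zero])
  obtain ⟨z', hz1', hz2', rfl⟩ := exists_vac_eq _ ha1
  rw [e1] at hz1'
  have hd1z' := d1_mem hz1'
  rw [e2] at hd1z'
  rw [dA_vac hkn hz2'] at ha3
  -- now the leading component is `d_1` of a cocycle, up to a coboundary
  obtain ⟨v, hv1, hv2⟩ := d0_exact_of_wdeg (triWt p n k)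
    (sub_mem (sub_mem hcw hd1z) hd1z')
    (by rw [map_sub, map_sub, h0, d0_d1 hkn hz2, d0_d1 hkn hz2', sub_zero, sub_zero])
    (by rw [map_sub, ha3, sub_self])
  rw [e3] at hv1
  have hzz := GO_le_FO _ _ _ (add_mem hz1 hz1')
  have hv := GO_le_FO _ _ _ hv1
  have f1 := dw_sub_mem hkn hzz
  have f2 := dw_sub_d0_mem hkn hv
  rw [comp_of_mem hv1, sub_add_cancel] at f2
  rw [sub_add_cancel] at f1
  have f3 : w - dw p n k (z + z' + v) ∈ FO p n k s u (M - 1) := by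
    have := sub_mem (sub_mem (sub_comp_mem h1) (FO_mono (by linarith) f1)) f2
    convert this using 1
    rw [hv2, map_add (dw p n k) (z + z') v, map_add (d0 p _) z z', hz2, hz2',
      map_add (d1 p n k) z z']
    abel
  have f4 : theta p n k w = theta p n k (w - dw p n k (z + z' + v)) +
      cobarD p n k (theta p n k (z + z' + v)) := by
    rw [← theta_dw, ← map_add, sub_add_cancel]
  rw [f4]
  refine add_mem (Submodule.mem_sup_left (theta_mem_Z.2 ⟨f3, ?_⟩))
    (Submodule.mem_sup_right ⟨_, (theta_mem_Z (w := z + z' + v)).2 ⟨?_, ?_⟩, rfl⟩)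
  · rw [map_sub, dw_dw hkn, sub_zero]
    exact FO_mono (by linarith) h2
  · exact add_mem (FO_mono (by linarith) hzz) (FO_mono (by linarith) hv)
  · have := sub_mem h1 (FO_mono (by linarith : M - 1 ≤ M) f3)
    rw [sub_sub_cancel] at this
    rw [sub_add_cancel]
    exact FO_mono (by linarith) this

lemma toRedH_ker (s : ℤ) (u : Deg p n) (M : ℤ) : LinearMap.ker (T.toRedH hkn s u M) =
    (B p n k 2 s u M).comap (Z p n k 2 s u M).subtype := by
  ext x
  rw [LinearMap.mem_ker, toRedH_eq_zero, Submodule.mem_comap]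
  refine ⟨T.mem_B_two hkn x.2, fun hx => ?_⟩
  obtain ⟨y, hy, _, ⟨z, hz, rfl⟩, h⟩ := Submodule.mem_sup.1 hx
  rw [show (2 : ℤ) - 1 = 1 by norm_num, show M + 2 - 1 = M + 1 by ring] at hz
  refine ⟨T.symbol (s - 1) u (M + 1) z, T.symbol_mem_homog hkn hz, ?_⟩
  have h1 := T.symbol_d hkn hz
  rw [sub_add_cancel, add_sub_cancel_right] at h1
  rw [← h1]
  change _ = T.symbol s u M ((Z p n k 2 s u M).subtype x)
  rw [← h, map_add, T.symbol_of_lt (sub_one_lt M) hy.1, zero_add]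

/-- A cocycle of the reduced complex lifts to a cocycle for `d_1`, since the differential of any lift
is in the acyclic kernel of the reduction; then the cocycle in the associated graded complex is
corrected by an element of filtration `M - 1`. -/
lemma toRedH_surjective (s : ℤ) (u : Deg p n) (M : ℤ) :
    Function.Surjective (T.toRedH hkn s u M) := by
  intro ξ
  obtain ⟨⟨a, ha, had⟩, rfl⟩ := Submodule.mkQ_surjective _ ξ
  obtain ⟨z, hz1, hz2, rfl⟩ := T.mem_homog.1 ha
  replace had : T.d (T.pi (vac p _ z)) = 0 := had
  rw [T.d_pi hkn] at had
  have e1 : ((s, u, M) : ℤ × Deg p n × ℤ) + (1, 0, -1) - (1, 0, -1) = (s, u, M) := by simp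
  have e2 : ((s, u, M) : ℤ × Deg p n × ℤ) + (1, 0, -1) - (triWt p n k).ℓ = (s, u, M - 1) := by
    simp [triWt]; ring
  obtain ⟨a, ha1, ha2, ha3⟩ := T.acyclic hkn (dA_mem hkn (vac_mem _ hz1)) had (dA_dA hkn _)
  rw [e1] at ha1
  obtain ⟨z', hz1', hz2', rfl⟩ := exists_vac_eq _ ha1
  have hzz := sub_mem hz1 hz1'
  have hzz0 : d0 p _ (z - z') = 0 := by rw [map_sub, hz2, hz2', sub_zero]
  obtain ⟨v, hv1, hv2⟩ := d0_exact_of_wdeg (triWt p n k) (d1_mem hzz) (d0_d1 hkn hzz0) (by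
    rw [← dA_vac hkn hzz0, map_sub, map_sub, ha3, sub_self])
  rw [e2] at hv1
  have hv := GO_le_FO _ _ _ hv1
  have hx : theta p n k (z - z' - v) ∈ Z p n k 2 s u M := by
    refine theta_mem_Z.2 ⟨sub_mem (GO_le_FO _ _ _ hzz) (FO_mono (by linarith) hv), ?_⟩
    have f1 := dw_sub_mem hkn (GO_le_FO _ _ _ hzz)
    have f2 := dw_sub_d0_mem hkn hv
    rw [comp_of_mem hv1, hv2] at f2
    rw [hzz0, sub_zero] at f1
    have := sub_mem f1 (FO_mono (by linarith) f2)
    rw [map_sub (dw p n k) (z - z') v]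
    convert this using 1
    abel
  refine ⟨⟨_, hx⟩, congrArg (Submodule.mkQ _) (Subtype.ext ?_)⟩
  change T.symbol s u M (theta p n k (z - z' - v)) = _
  rw [symbol_theta, map_sub, comp_of_mem hzz, comp_of_lt (sub_one_lt M) hv, sub_zero,
    ← T.pi_vac hzz0, map_sub, map_sub, ha2, sub_zero]

/-- The second term of the May spectral sequence is the cohomology of the reduced complex. -/
theorem computesE2 : ComputesE2 p n k T.h T.b :=
  ⟨T.d, T.isReducedD hkn, T.piE hkn, T.isReduction hkn,
    fun s u M => (Submodule.quotEquivOfEq _ _ (T.toRedH_ker hkn s u M).symm).trans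
      ((T.toRedH hkn s u M).quotKerEquivOfSurjective (T.toRedH_surjective hkn s u M)),
    fun _ _ _ _ hx => ⟨Z_two_le hkn hx, T.symbol_mem_redCocycles hkn hx, rfl⟩⟩

end Target

end

/-! ### The reduced complex at odd primes -/

section

section Inclusions

variable {R X Y X' Y' : Type} [CommRing R]

lemma map_ex_prod (f : X → X') (L : List X) :
    ExteriorAlgebra.map (Finsupp.lmapDomain R R f) (L.map ex).prod = ((L.map f).map ex).prod := by
  rw [map_list_prod, List.map_map, List.map_map]
  congr 2
  funext x
  simp [ex, ExteriorAlgebra.map_apply_ι, Finsupp.lmapDomain_apply, Finsupp.mapDomain_single]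

variable (R) in
/-- The map of Fock spaces that is induced by maps of the index sets. -/
def fockMap (f : X → X') (g : Y → Y') : Fock R X Y →ₗ[R] Fock R X' Y' :=
  (TensorProduct.map (ExteriorAlgebra.map (Finsupp.lmapDomain R R f)).toLinearMap
    (MvPolynomial.rename g).toLinearMap : _ ⊗[R] _ →ₗ[R] _ ⊗[R] _)

lemma fockMap_mon (f : X → X') (g : Y → Y') (L : List X) (c : Y →₀ ℕ) :
    fockMap R f g (mon R L c) = mon R (L.map f) (c.mapDomain g) := by
  rw [mon, mon, ← map_ex_prod, ← MvPolynomial.rename_monomial]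
  exact TensorProduct.map_tmul _ _ _ _

end Inclusions

variable {p n k : ℕ}

/-- The inclusion of an index set of generators. -/
def incl {a b : ℕ} (ha : k ≤ a) (x : Idx n a b) : Ix n k := (⟨x.1.1, ha.trans x.1.2.1⟩, x.2)

lemma incl_injective {a b : ℕ} (ha : k ≤ a) :
    Function.Injective (incl (n := n) (b := b) ha) := fun x y h => by
  have h1 := congrArg (fun l : Ix n k => (l.1 : ℕ)) h
  exact Prod.ext (Subtype.ext h1) (congrArg (fun l : Ix n k => l.2) h)

/-- The index, as an element of the index set of generators. -/
abbrev idx (l : Ix n k) {a b : ℕ} (h : a ≤ l.1 ∧ l.1 ≤ b) : Idx n a b := (⟨l.1, h⟩, l.2)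

lemma idx_ne {l l' : Ix n k} (hl : l ≠ l') {a b : ℕ} (h : a ≤ l.1 ∧ (l.1 : ℕ) ≤ b)
    (h' : a ≤ l'.1 ∧ (l'.1 : ℕ) ≤ b) : idx l h ≠ idx l' h' := fun e => by
  refine hl (Prod.ext (Subtype.ext ?_) (congrArg (fun x : Idx n a b => x.2) e))
  exact congrArg (fun x : Idx n a b => (x.1 : ℕ)) e

lemma exists_list_incl {a b : ℕ} (ha : k ≤ a) {L : List (Ix n k)}
    (hL : ∀ l ∈ L, a ≤ l.1 ∧ (l.1 : ℕ) ≤ b) : ∃ L' : List (Idx n a b), L'.map (incl ha) = L := by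
  have : L ∈ Set.range (List.map (incl (n := n) (b := b) ha)) := by
    rw [Set.range_list_map]
    exact fun l hl => ⟨idx l (hL l hl), rfl⟩
  exact this

lemma exists_finsupp_incl {a b : ℕ} (ha : k ≤ a) {c : Ix n k →₀ ℕ}
    (hc : ∀ l, c l ≠ 0 → a ≤ l.1 ∧ (l.1 : ℕ) ≤ b) :
    ∃ c' : Idx n a b →₀ ℕ, c'.mapDomain (incl ha) = c :=
  ⟨_, Finsupp.mapDomain_comapDomain _ (incl_injective ha) c fun l hl =>
    ⟨idx l (hc l (Finsupp.mem_support_iff.1 hl)), rfl⟩⟩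

lemma mulLeft_hgen {R X Y : Type} [CommRing R] (x : X) :
    LinearMap.mulLeft R (hgen R (Y := Y) x) = hop R x :=
  LinearMap.ext fun a => (hop_apply x a).symm

lemma mulLeft_bgen {R X Y : Type} [CommRing R] (y : Y) :
    LinearMap.mulLeft R (bgen R (X := X) y) = bop R y :=
  LinearMap.ext fun a => (bop_apply y a).symm

variable [Fact p.Prime] [NeZero n] [NeZero k]

variable (p n k) in
/-- The reduced complex at an odd prime. -/
abbrev OddFock : Type := Fock (ZMod p) (Idx n k (s0 p n k)) (Idx n k (s0 p n k - n))

lemma idx_le {l : Ix n k} (h : k ≤ l.1 ∧ (l.1 : ℕ) ≤ s0 p n k - n) :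
    k ≤ l.1 ∧ (l.1 : ℕ) ≤ s0 p n k := ⟨h.1, h.2.trans (Nat.sub_le _ _)⟩

variable (p n k) in
/-- The action of the cobar construction on the reduced complex: as on the full Fock space, with the
operators of the missing generators replaced by zero. -/
def oddOps : AntiOps p (Ix n k) (Module.End (ZMod p) (OddFock p n k)) where
  H l := if h : k ≤ l.1 ∧ (l.1 : ℕ) ≤ s0 p n k then hop _ (idx l h) else 0
  C l := if h : k ≤ l.1 ∧ (l.1 : ℕ) ≤ s0 p n k - n then bop _ (idx l h) * dop _ (idx l (idx_le h))
    else 0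
  HH {i j} _ := by
    split_ifs
    · exact hop_hop _ _
    all_goals simp only [zero_mul, mul_zero, neg_zero]
  CC {i j} _ := by
    split_ifs
    · exact mul_mul_anticomm (dop_dop _ _) (bop_bop _ _) (dop_bop _ _).symm (dop_bop _ _).symm
    all_goals simp only [zero_mul, mul_zero, neg_zero]
  HC {i j} hij := by
    split_ifs
    · exact mul_mul_anticomm' (dop_hop_of_ne (idx_ne hij.symm _ _)) (hop_bop _ _)
    all_goals simp only [zero_mul, mul_zero, neg_zero]
  sq _ l := by
    split_ifs
    · exact hop_hop_self _
    · exact zero_mul _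

variable (p n k) in
/-- `h_{i,j}` in the reduced complex at an odd prime. -/
def hOddFock (i : ℕ) (j : ZMod n) : OddFock p n k :=
  if h : k ≤ i ∧ i ≤ s0 p n k then hgen _ (⟨i, h⟩, j) else 0

variable (p n k) in
/-- `b_{i,j}` in the reduced complex at an odd prime. -/
def bOddFock (i : ℕ) (j : ZMod n) : OddFock p n k :=
  if h : k ≤ i ∧ i ≤ s0 p n k - n then bgen _ (⟨i, h⟩, j) else 0

lemma oddOps_op (hp : p ≠ 2) (l : Ix n k) :
    (oddOps p n k).op l 1 = LinearMap.mulLeft _ (hOddFock p n k l.1 l.2) := by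
  have h1 := (Fact.out : p.Prime).two_le
  rw [AntiOps.op, if_pos rfl, if_neg (by omega), sub_zero, hOddFock, oddOps]
  by_cases h : k ≤ l.1 ∧ (l.1 : ℕ) ≤ s0 p n k
  · simp only [dif_pos h]
    exact (mulLeft_hgen (R := ZMod p) _).symm
  · simp only [dif_neg h, LinearMap.mulLeft_zero_eq_zero]

lemma oddOps_bw (hp : p ≠ 2) (l : Ix n k) :
    (oddOps p n k).rho (bw p l) = LinearMap.mulLeft _ (bOddFock p n k l.1 l.2) := by
  rw [AntiOps.rho_bw, if_neg hp, bOddFock, oddOps]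
  by_cases h : k ≤ l.1 ∧ (l.1 : ℕ) ≤ s0 p n k - n
  · simp only [dif_pos h, dif_pos (idx_le h)]
    rw [mulLeft_bgen]
    exact add_of_anticomm (dop_hop_self _) (hop_bop _ _)
  · simp only [dif_neg h, mul_zero, zero_mul, add_zero, LinearMap.mulLeft_zero_eq_zero]

lemma odd_piA_mon (hp : p ≠ 2) (L : List (Idx n k (s0 p n k))) (c : Idx n k (s0 p n k - n) →₀ ℕ)
    (hL : L.Nodup) : piA (oddOps p n k) (mon _ (L.map (incl le_rfl))
      (c.mapDomain (incl le_rfl))) = mon _ L c := by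
  refine mon_induction (P := fun L c => piA (oddOps p n k) (mon _ (L.map (incl le_rfl))
    (c.mapDomain (incl le_rfl))) = mon _ L c) ?_ (fun c y ih => ?_) (fun l L c hl _ ih => ?_) L c hL
  · rw [List.map_nil, Finsupp.mapDomain_zero, ← one_eq_mon, ← one_eq_mon, piA_one]
  · rw [Finsupp.mapDomain_add, Finsupp.mapDomain_single, ← bop_mon, ← bop_mon, piA_bop, ih,
      oddOps_bw hp, bOddFock, dif_pos (show k ≤ ((incl le_rfl y : Ix n k).1 : ℕ) ∧
        ((incl le_rfl y : Ix n k).1 : ℕ) ≤ s0 p n k - n from y.1.2), mulLeft_bgen]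
    rfl
  · have h : incl le_rfl l ∉ L.map (incl (n := n) (k := k) le_rfl) := by
      rwa [List.mem_map_of_injective (incl_injective le_rfl)]
    rw [List.map_cons, ← op_one_mon _ h, piA_op, ih, oddOps_op hp, hOddFock,
      dif_pos (show k ≤ ((incl le_rfl l : Ix n k).1 : ℕ) ∧
        ((incl le_rfl l : Ix n k).1 : ℕ) ≤ s0 p n k from l.1.2), mulLeft_hgen, ← hop_mon]
    rfl

variable (p n k) in
/-- The reduction at an odd prime. -/
def oddTarget (hp : p ≠ 2) : Target p n k (OddFock p n k) where
  h := hOddFock p n k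
  b := bOddFock p n k
  Q := oddOps p n k
  op_eq := oddOps_op hp
  rho_bw := oddOps_bw hp
  h_lt hi _ := dif_neg (by omega)
  b_lt hi _ := dif_neg (by omega)
  h_gt hi _ := dif_neg (by omega)
  b_gt hi _ := dif_neg (by have := NeZero.pos k; omega)
  b_two h := absurd h hp
  lift := fockMap _ (incl le_rfl) (incl le_rfl)
  piA_lift a := by
    suffices piA (oddOps p n k) ∘ₗ fockMap _ (incl le_rfl) (incl le_rfl) = LinearMap.id from
      LinearMap.congr_fun this a
    refine fock_hom_ext fun L c hL => ?_
    rw [LinearMap.comp_apply, fockMap_mon, odd_piA_mon hp L c hL]; rfl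
  mon_mem L c _ hg := by
    obtain ⟨L, rfl⟩ := exists_list_incl le_rfl (b := s0 p n k) fun l hl => ⟨l.1.2, hg.1 l hl⟩
    obtain ⟨c, rfl⟩ := exists_finsupp_incl le_rfl (b := s0 p n k - n) fun l hl =>
      ⟨l.1.2, Nat.le_sub_of_add_le (hg.2 l hl)⟩
    exact ⟨mon _ L c, fockMap_mon _ _ L c⟩

lemma computesE2_odd (hkn : k ≤ n) (hp : p ≠ 2) :
    ComputesE2 p n k (hOdd p n k) (bOdd p n k) := (oddTarget p n k hp).computesE2 hkn

end

/-! ### The reduced complex at the prime 2 -/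

section

section CharTwo

lemma neg_eq_of_two {V : Type} [AddCommGroup V] [Module (ZMod 2) V] (v : V) : -v = v := by
  rw [← neg_one_smul (ZMod 2), show (-1 : ZMod 2) = 1 by decide, one_smul]

lemma mon_perm {X Y : Type} {L L' : List X} (h : L.Perm L') (c : Y →₀ ℕ) :
    mon (ZMod 2) L c = mon (ZMod 2) L' c := by
  induction h with
  | nil => rfl
  | cons x _ ih => rw [← hop_mon, ih, hop_mon]
  | swap x y L =>
    rw [← hop_mon, ← hop_mon, ← hop_mon, ← hop_mon, ← Module.End.mul_apply, hop_hop,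
      LinearMap.neg_apply, neg_eq_of_two]; rfl
  | trans _ _ ih ih' => rw [ih, ih']

variable {Y : Type}

/-- The factors that occur to an odd power. -/
def oddPart (c : Y →₀ ℕ) : List Y := {y ∈ c.support | Odd (c y)}.toList

/-- The square root of a monomial, up to the factors that occur to an odd power. -/
def halfPart (c : Y →₀ ℕ) : Y →₀ ℕ := c.mapRange (· / 2) rfl

lemma nodup_oddPart (c : Y →₀ ℕ) : (oddPart c).Nodup := Finset.nodup_toList _

lemma mem_oddPart {c : Y →₀ ℕ} {y : Y} : y ∈ oddPart c ↔ Odd (c y) := by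
  rw [oddPart, Finset.mem_toList, Finset.mem_filter, Finsupp.mem_support_iff]
  exact ⟨And.right, fun h => ⟨fun h0 => by simp [h0] at h, h⟩⟩

variable [DecidableEq Y]

/-- The exponents of the monomial `∏_{y ∈ S} y · ∏_y y^{2 c_y}`. -/
def oddAdd (S : List Y) (c : Y →₀ ℕ) : Y →₀ ℕ := Multiset.toFinsupp (S : Multiset Y) + 2 • c

lemma oddAdd_apply {S : List Y} (hS : S.Nodup) (c : Y →₀ ℕ) (y : Y) :
    oddAdd S c y = (if y ∈ S then 1 else 0) + 2 * c y := by
  rw [oddAdd, Finsupp.add_apply, Multiset.toFinsupp_apply, Multiset.coe_count, hS.count,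
    Finsupp.smul_apply, smul_eq_mul]

lemma oddAdd_cons (y : Y) (S : List Y) (c : Y →₀ ℕ) :
    oddAdd (y :: S) c = oddAdd S c + Finsupp.single y 1 := by
  rw [oddAdd, oddAdd, ← Multiset.cons_coe, ← Multiset.singleton_add, Multiset.toFinsupp_add,
    Multiset.toFinsupp_singleton]
  abel

lemma oddAdd_add_single (S : List Y) (c : Y →₀ ℕ) (y : Y) :
    oddAdd S (c + Finsupp.single y 1) = oddAdd S c + Finsupp.single y 1 + Finsupp.single y 1 := by
  rw [oddAdd, oddAdd, smul_add, two_smul ℕ (Finsupp.single y 1)]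
  abel

lemma oddAdd_oddPart (c : Y →₀ ℕ) : oddAdd (oddPart c) (halfPart c) = c := by
  ext y
  rw [oddAdd_apply (nodup_oddPart c), halfPart, Finsupp.mapRange_apply]
  simp only [mem_oddPart, Nat.odd_iff]
  split_ifs <;> omega

lemma oddPart_oddAdd {S : List Y} (hS : S.Nodup) (c : Y →₀ ℕ) : (oddPart (oddAdd S c)).Perm S := by
  rw [List.perm_ext_iff_of_nodup (nodup_oddPart _) hS]
  intro y
  rw [mem_oddPart, oddAdd_apply hS, Nat.odd_iff]
  split_ifs with h <;> simp only [h, iff_true, iff_false] <;> omega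

lemma halfPart_oddAdd {S : List Y} (hS : S.Nodup) (c : Y →₀ ℕ) : halfPart (oddAdd S c) = c := by
  ext y
  rw [halfPart, Finsupp.mapRange_apply, oddAdd_apply hS]
  split_ifs <;> omega

end CharTwo

section SquareRoots

variable {X Y I : Type} (f : X → I) (g : Y → I)

/-- The linear map that sends `∏ x · ∏ y^{c_y}` to `∏ x · ∏_{c_y odd} y · ∏ (y^2)^{⌊c_y/2⌋}`, where
the squares are the polynomial generators of the target. -/
def sqrtMap : Fock (ZMod 2) X Y →ₗ[ZMod 2] Fock (ZMod 2) I I :=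
  (TensorProduct.lift ((LinearMap.mul (ZMod 2) (Fock (ZMod 2) I I)).compl₁₂
    ((Algebra.TensorProduct.includeLeft (S := ZMod 2)).toLinearMap ∘ₗ
      (ExteriorAlgebra.map (Finsupp.lmapDomain (ZMod 2) (ZMod 2) f)).toLinearMap)
    ((MvPolynomial.basisMonomials Y (ZMod 2)).constr (ZMod 2) fun c =>
      mon (ZMod 2) ((oddPart c).map g) ((halfPart c).mapDomain g))) :
      _ ⊗[ZMod 2] _ →ₗ[ZMod 2] _)

lemma sqrtMap_mon (L : List X) (c : Y →₀ ℕ) : sqrtMap f g (mon _ L c) =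
    mon _ (L.map f ++ (oddPart c).map g) ((halfPart c).mapDomain g) := by
  have h : (MvPolynomial.basisMonomials Y (ZMod 2)).constr (ZMod 2) (fun c =>
      mon (ZMod 2) ((oddPart c).map g) ((halfPart c).mapDomain g)) (MvPolynomial.monomial c 1) =
      mon (ZMod 2) ((oddPart c).map g) ((halfPart c).mapDomain g) := by
    exact (congrArg _ (congrFun (MvPolynomial.coe_basisMonomials Y (ZMod 2)) c).symm).trans
      (Module.Basis.constr_basis _ _ _ _)
  rw [sqrtMap, mon, tm]
  erw [TensorProduct.lift.tmul]
  rw [LinearMap.compl₁₂_apply, h, LinearMap.mul_apply', mon, mon, List.map_append, List.prod_append,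
    ← map_ex_prod f]
  exact (tm_mul_tm _ _ _ _).trans (by rw [one_mul]; rfl)

end SquareRoots

variable {n k : ℕ} [NeZero n] [NeZero k]

variable (n k) in
/-- The reduced complex at the prime 2. -/
abbrev TwoFock : Type := Fock (ZMod 2) (Idx n (n + 1) (2 * n)) (Idx n k n)

variable (n k) in
/-- `h_{i,j}` in the reduced complex at the prime 2. -/
def hTwoFock (i : ℕ) (j : ZMod n) : TwoFock n k :=
  if i ≤ n then (if h : k ≤ i ∧ i ≤ n then bgen _ (⟨i, h⟩, j) else 0)
  else (if h : n + 1 ≤ i ∧ i ≤ 2 * n then hgen _ (⟨i, h⟩, j) else 0)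

/-- A generator of the reduced complex at the prime 2 acts by an exterior or by a polynomial
generator, or by zero. -/
lemma hTwoFock_cases (i : ℕ) (j : ZMod n) :
    (∃ x, LinearMap.mulLeft (ZMod 2) (hTwoFock n k i j) = hop _ x) ∨
    (∃ y, LinearMap.mulLeft (ZMod 2) (hTwoFock n k i j) = bop _ y) ∨
    LinearMap.mulLeft (ZMod 2) (hTwoFock n k i j) = 0 := by
  rw [hTwoFock]
  split_ifs with h1 h2 h3
  · exact Or.inr (Or.inl ⟨_, mulLeft_bgen _⟩)
  · exact Or.inr (Or.inr (LinearMap.mulLeft_zero_eq_zero _ _))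
  · exact Or.inl ⟨_, mulLeft_hgen _⟩
  · exact Or.inr (Or.inr (LinearMap.mulLeft_zero_eq_zero _ _))

lemma hTwoFock_of_le (y : Idx n k n) :
    LinearMap.mulLeft (ZMod 2) (hTwoFock n k y.1 y.2) = bop _ y := by
  rw [hTwoFock, if_pos y.1.2.2, dif_pos y.1.2, mulLeft_bgen]

lemma hTwoFock_of_lt (x : Idx n (n + 1) (2 * n)) :
    LinearMap.mulLeft (ZMod 2) (hTwoFock n k x.1 x.2) = hop _ x := by
  rw [hTwoFock, if_neg (not_le.2 x.1.2.1), dif_pos x.1.2, mulLeft_hgen]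

lemma hTwoFock_sq {i : ℕ} (hi : i < k ∨ n < i) (j : ZMod n) : hTwoFock n k i j ^ 2 = 0 := by
  rw [hTwoFock]
  split_ifs with h1 h2 h3
  · omega
  · exact zero_pow two_ne_zero
  · rw [sq, ← LinearMap.mulLeft_apply (ZMod 2), mulLeft_hgen]
    have := LinearMap.congr_fun (hop_hop_self (R := ZMod 2) (Y := Idx n k n)
      ((⟨i, h3⟩, j) : Idx n (n + 1) (2 * n))) 1
    rw [Module.End.mul_apply, hop_apply _ 1, mul_one] at this
    exact this
  · exact zero_pow two_ne_zero

variable (n k) in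
/-- The action of the cobar construction on the reduced complex at the prime 2. -/
def twoOps : AntiOps 2 (Ix n k) (Module.End (ZMod 2) (TwoFock n k)) where
  H l := LinearMap.mulLeft _ (hTwoFock n k l.1 l.2)
  C _ := 0
  HH {l l'} _ := by
    rw [neg_eq_of_two]
    obtain ⟨x, hx⟩ | ⟨y, hy⟩ | h0 := hTwoFock_cases (k := k) (l.1 : ℕ) l.2 <;>
    obtain ⟨x', hx'⟩ | ⟨y', hy'⟩ | h0' := hTwoFock_cases (k := k) (l'.1 : ℕ) l'.2
    · rw [hx, hx', hop_hop, neg_eq_of_two]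
    · rw [hx, hy', hop_bop]
    · rw [h0', mul_zero, zero_mul]
    · rw [hy, hx', hop_bop]
    · rw [hy, hy', bop_bop]
    · rw [h0', mul_zero, zero_mul]
    all_goals rw [h0, mul_zero, zero_mul]
  CC _ := by rw [mul_zero, neg_zero]
  HC _ := by rw [mul_zero, zero_mul, neg_zero]
  sq h := absurd rfl h

lemma twoOps_op (l : Ix n k) :
    (twoOps n k).op l 1 = LinearMap.mulLeft _ (hTwoFock n k l.1 l.2) := by
  rw [AntiOps.op, if_pos rfl, if_pos rfl]
  exact sub_zero _

lemma twoOps_bw (l : Ix n k) :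
    (twoOps n k).rho (bw 2 l) = LinearMap.mulLeft _ (hTwoFock n k l.1 l.2 ^ 2) := by
  rw [AntiOps.rho_bw, if_pos rfl, neg_eq_of_two, sq (hTwoFock n k l.1 l.2), LinearMap.mulLeft_mul]
  change (LinearMap.mulLeft _ _ - 0) * (LinearMap.mulLeft _ _ - 0) = _
  rw [sub_zero]; rfl

lemma two_piA_mon {L : List (Idx n (n + 1) (2 * n))} {S : List (Idx n k n)} (hL : L.Nodup)
    (hS : S.Nodup) (hkn : k ≤ n) (c : Idx n k n →₀ ℕ) :
    piA (twoOps n k) (mon _ (L.map (incl (hkn.trans n.le_succ)) ++ S.map (incl le_rfl))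
      (c.mapDomain (incl le_rfl))) = mon _ L (oddAdd S c) := by
  induction L with
  | nil =>
    rw [List.map_nil, List.nil_append]
    refine mon_induction (P := fun S c => piA (twoOps n k) (mon _ (S.map (incl le_rfl))
      (c.mapDomain (incl le_rfl))) = mon _ [] (oddAdd S c)) ?_ (fun c y ih => ?_)
      (fun l L c hl _ ih => ?_) S c hS
    · rw [List.map_nil, Finsupp.mapDomain_zero, ← one_eq_mon, piA_one, oddAdd, Multiset.coe_nil,
        map_zero, smul_zero, zero_add, one_eq_mon]
    · rw [Finsupp.mapDomain_add, Finsupp.mapDomain_single, List.map_nil, ← bop_mon, piA_bop,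
        ← List.map_nil, ih, twoOps_bw, sq, LinearMap.mulLeft_mul, LinearMap.comp_apply,
        oddAdd_add_single, ← bop_mon, ← bop_mon, ← hTwoFock_of_le]
      rfl
    · have h : incl le_rfl l ∉ L.map (incl (n := n) (k := k) le_rfl) := by
        rwa [List.mem_map_of_injective (incl_injective le_rfl)]
      rw [List.map_cons, ← op_one_mon _ h, piA_op, ih, twoOps_op, oddAdd_cons, ← bop_mon,
        ← hTwoFock_of_le]
      rfl
  | cons l L ih =>
    rw [List.nodup_cons] at hL
    have h : incl (hkn.trans n.le_succ) l ∉
        L.map (incl (n := n) (k := k) (hkn.trans n.le_succ)) ++ S.map (incl le_rfl) := by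
      rw [List.mem_append, List.mem_map_of_injective (incl_injective _), List.mem_map]
      rintro (h | ⟨y, -, hy⟩)
      · exact hL.1 h
      · have h1 : (y.1 : ℕ) = l.1 := congrArg (fun l : Ix n k => (l.1 : ℕ)) hy
        have h2 := y.1.2.2
        have h3 := l.1.2.1
        omega
    rw [List.map_cons, List.cons_append, ← op_one_mon _ h, piA_op, ih hL.2, twoOps_op, ← hop_mon,
      ← hTwoFock_of_lt (k := k)]
    rfl

variable (n k) in
/-- The reduction at the prime 2. -/
def twoTarget (hkn : k ≤ n) : Target 2 n k (TwoFock n k) where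
  h := hTwoFock n k
  b i j := hTwoFock n k i j ^ 2
  Q := twoOps n k
  op_eq := twoOps_op
  rho_bw := twoOps_bw
  h_lt hi _ := by rw [hTwoFock, if_pos (by omega), dif_neg (by omega)]
  b_lt hi _ := hTwoFock_sq (Or.inl hi) _
  h_gt hi _ := by
    rw [s0_two hkn] at hi
    rw [hTwoFock, if_neg (by omega), dif_neg (by omega)]
  b_gt hi _ := by
    rw [s0_two hkn] at hi
    exact hTwoFock_sq (Or.inr (by omega)) _
  b_two _ _ _ := rfl
  lift := sqrtMap (incl (hkn.trans n.le_succ)) (incl le_rfl)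
  piA_lift a := by
    suffices piA (twoOps n k) ∘ₗ sqrtMap (incl (hkn.trans n.le_succ)) (incl le_rfl) =
      LinearMap.id from LinearMap.congr_fun this a
    refine fock_hom_ext fun L c hL => ?_
    rw [LinearMap.comp_apply, sqrtMap_mon, two_piA_mon hL (nodup_oddPart c) hkn, oddAdd_oddPart]
    rfl
  mon_mem L c hL hg := by
    rw [Good, s0_two hkn] at hg
    have hf := List.filter_append_perm (fun l : Ix n k => decide (n < l.1)) L
    obtain ⟨L₁, h1⟩ := exists_list_incl (hkn.trans n.le_succ) (b := 2 * n)
      (L := L.filter fun l : Ix n k => decide (n < l.1)) fun l hl => by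
        rw [List.mem_filter, decide_eq_true_eq] at hl
        exact ⟨hl.2, hg.1 l hl.1⟩
    obtain ⟨L₂, h2⟩ := exists_list_incl le_rfl (b := n)
      (L := L.filter fun l : Ix n k => !decide (n < l.1)) fun l hl => by
        rw [List.mem_filter, Bool.not_eq_true', decide_eq_false_iff_not] at hl
        exact ⟨l.1.2, not_lt.1 hl.2⟩
    obtain ⟨c, rfl⟩ := exists_finsupp_incl le_rfl (b := n) fun l hl =>
      ⟨l.1.2, by have := hg.2 l hl; omega⟩
    have hS : L₂.Nodup := List.Nodup.of_map (incl le_rfl) (by rw [h2]; exact hL.filter _)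
    refine ⟨mon _ L₁ (oddAdd L₂ c), ?_⟩
    rw [sqrtMap_mon, halfPart_oddAdd hS]
    refine mon_perm (List.Perm.trans ?_ hf) _
    rw [← h1, ← h2]
    exact ((oddPart_oddAdd hS c).map _).append_left _

lemma computesE2_two (hkn : k ≤ n) : ComputesE2 2 n k (hTwo n k) (bTwo n k) :=
  (twoTarget n k hkn).computesE2 hkn

end

end MaySS

end

theorem theorem3p3 (p n k : ℕ) [Fact p.Prime] (hk : 1 ≤ k) (hkn : k ≤ n) :
    -- the first differentials of the May spectral sequence
    (∀ i, k ≤ i → i ≤ MaySS.s0 p n k → ∀ j : ZMod n,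
      MaySS.D1Eq p n k 1 (MaySS.hDeg p n i j) (MaySS.mayM p n k i : ℤ)
        (MaySS.hCob p n k i j) (MaySS.d1h p n k (MaySS.hCob p n k) i j)) ∧
    (∀ i, k ≤ i → i ≤ MaySS.s0 p n k - n → ∀ j : ZMod n,
      MaySS.D1Eq p n k 2 (MaySS.bDeg p n i j) ((p : ℤ) * (MaySS.mayM p n k i : ℤ))
        (MaySS.bCob p n k i j) 0) ∧
    -- the `E_2`-term at odd primes
    (p ≠ 2 → MaySS.ComputesE2 p n k (MaySS.hOdd p n k) (MaySS.bOdd p n k)) ∧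
    -- the `E_2`-term at the prime 2
    (p = 2 → MaySS.s0 p n k = 2 * n ∧
      MaySS.ComputesE2 2 n k (MaySS.hTwo n k) (MaySS.bTwo n k)) := by
  have : NeZero k := ⟨by omega⟩
  have : NeZero n := ⟨by omega⟩
  refine ⟨fun i hi hi' j => MaySS.d1Eq_h hkn hi hi' j, fun i hi _ j => MaySS.d1Eq_b hkn hi j,
    fun hp => MaySS.computesE2_odd hkn hp, fun hp => ?_⟩
  subst hp
  exact ⟨MaySS.s0_two hkn, MaySS.computesE2_two hkn⟩
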